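/- Let $M$ be a $C^\infty$ manifold of dimension $n$ (Hausdorff, second countable), let $m\in\mathbf R$, and let $P\in\Psi^m_{cl}(M)$ be an $N\times N$ system of classical pseudodifferential operators: in local coordinates it is the Weyl quantization of a symbol with an asymptotic expansion $P_m+P_{m-1}+\cdots$, where $P_j(x,\xi)$ is homogeneous of degree $j$ in $\xi$. Let $P_m=\sigma(P)$ be its principal symbol, a function on $T^*M\setminus 0$ with values in the $N\times N$ matrices, and let $w_0=(x_0,\xi_0)\in T^*M\setminus 0$. Assume that near $w_0$: (i) $P$ is of principal type: for every $w$ near $w_0$ there is a tangent vector $\nu\in T_w(T^*M)$ such that the map $\ker P_m(w)\to \mathbf C^N/\operatorname{Ran}P_m(w)$ induced by $\partial_\nu P_m(w)$ is bijective; (ii) $P$ has constant characteristics: there are $\varepsilon>0$ and a neighbourhood $U$ of $w_0$ such that any section of eigenvalues $\lambda$ of $P_m$ with $|\lambda|<\varepsilon$ (a continuous function on a subset of $U$ with $\det(P_m(w)-\lambda(w)\operatorname{Id}_N)=0$) has constant algebraic and constant geometric multiplicity. Then there exist properly supported $N\times N$ systems $A^w, B^w\in\Psi^0_{cl}(M)$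 which are elliptic (their principal symbols are invertible on $T^*M\setminus 0$), and, with $K=\dim\ker P_m(w_0)$, a $K\times K$ system $Q_{11}^w\in\Psi^m_{cl}(M)$ and an $(N-K)\times(N-K)$ system $Q_{22}^w\in\Psi^m_{cl}(M)$ such that $$A^wP^wB^w=Q^w=\begin{pmatrix}Q_{11}^w&0\\0&Q_{22}^w\end{pmatrix}\quad\text{microlocally near }w_0,$$ that is, $w_0\notin\operatorname{WF}(A^wP^wB^w-Q^w)$ (the symbol of the difference is of order $-\infty$ in a conic neighbourhood of $w_0$). Moreover there are an open conic neighbourhood $\Gamma\subset T^*M\setminus0$ of $w_0$ and a function $\lambda\in C^\infty(\Gamma)$ such that on $\Gamma$: $\sigma(Q_{11})=\lambda\operatorname{Id}_K$; $\lambda$ is of principal type, i.e. $d\lambda\neq0$ where $\lambda=0$; $\sigma(Q_{22})$ is invertible, i.e. $Q_{22}^w$ is elliptic; and, if $K>0$, $\lambda$ is a section of eigenvalues of $P_m$ with $\lambda(w_0)=0$. (If $K=0$, the block $Q_{11}^w$ is empty.) -/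

import Mathlib

open scoped Manifold ContDiff Topology

noncomputable section

namespace PsiDO

/-- The model space `ℝⁿ` with its Euclidean norm and Lebesgue measure. -/
abbrev Rn (n : ℕ) : Type := EuclideanSpace ℝ (Fin n)

/-! ### Symbols and Weyl quantization on `ℝⁿ` -/

/-- The symbol estimates of order `μ` on a set `s ⊆ ℝⁿ × ℝⁿ`:
`‖∂_ξ^k ∂_x^j a(x,ξ)‖ ≤ C_{jk} (1 + |ξ|)^{μ - k}` for `(x,ξ) ∈ s` and all `j`, `k`, where
`∂_x^j` and `∂_ξ^k` are the full `j`-th and `k`-th derivatives (as multilinear forms). -/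
def SymbolBoundOn {n : ℕ} (s : Set (Rn n × Rn n)) (μ : ℝ) (a : Rn n × Rn n → ℂ) : Prop :=
  ∀ j k : ℕ, ∃ C : ℝ, ∀ z ∈ s,
    ‖iteratedFDeriv ℝ k
        (fun ξ : Rn n => iteratedFDeriv ℝ j (fun x : Rn n => a (x, ξ)) z.1) z.2‖
      ≤ C * (1 + ‖z.2‖) ^ (μ - (k : ℝ))

/-- The symbol class `S^μ_{1,0}(ℝⁿ × ℝⁿ)`. -/
def IsSymbol {n : ℕ} (μ : ℝ) (a : Rn n × Rn n → ℂ) : Prop :=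
  ContDiff ℝ ∞ a ∧ SymbolBoundOn Set.univ μ a

/-- `a ∈ S^m_cl(ℝⁿ × ℝⁿ)` has the asymptotic expansion `a ~ b₀ + b₁ + b₂ + ⋯`, where `b_j` is
smooth and homogeneous of degree `m - j` in `ξ ≠ 0`. -/
structure IsClassicalSymbol {n : ℕ} (m : ℝ) (a : Rn n × Rn n → ℂ)
    (b : ℕ → Rn n × Rn n → ℂ) : Prop where
  isSymbol : IsSymbol m a
  smooth : ∀ j, ContDiffOn ℝ ∞ (b j) {z | z.2 ≠ 0}
  homogeneous : ∀ (j : ℕ) (x ξ : Rn n) (t : ℝ), ξ ≠ 0 → 0 < t →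
    b j (x, t • ξ) = ((t ^ (m - (j : ℝ)) : ℝ) : ℂ) * b j (x, ξ)
  expansion : ∀ k : ℕ, SymbolBoundOn {z | 1 ≤ ‖z.2‖} (m - (k : ℝ))
    (fun z => a z - ∑ j ∈ Finset.range k, b j z)

/-- The Weyl quantization
`a^w u (x) = (2π)^{-n} ∫ (∫ e^{i⟨x-y,ξ⟩} a((x+y)/2, ξ) u(y) dy) dξ`.
For `a` in a symbol class and `u` a Schwartz function the inner integral is rapidly
decreasing in `ξ`, so both integrals converge absolutely. -/
def weylOp {n : ℕ} (a : Rn n × Rn n → ℂ) (u : SchwartzMap (Rn n) ℂ) (x : Rn n) : ℂ :=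
  (((2 * Real.pi) ^ n : ℝ) : ℂ)⁻¹ *
    ∫ ξ : Rn n, ∫ y : Rn n,
      Complex.exp (Complex.I * ((inner ℝ (x - y) ξ : ℝ) : ℂ)) *
        a ((2 : ℝ)⁻¹ • (x + y), ξ) * u y

section Manifold

variable (n : ℕ) (M : Type*) [TopologicalSpace M] [ChartedSpace (Rn n) M]

/-- `C^∞(M)`, complex valued. -/
def SmoothFun : Submodule ℂ (M → ℂ) where
  carrier := {u | ContMDiff 𝓘(ℝ, Rn n) 𝓘(ℝ, ℂ) ∞ u}
  add_mem' hu hv := ContMDiff.add hu hv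
  zero_mem' := contMDiff_const
  smul_mem' c _ hu := by
    have h : ContMDiff 𝓘(ℝ, ℂ) 𝓘(ℝ, ℂ) ∞ (fun z : ℂ => c * z) :=
      ContDiff.contMDiff (contDiff_const.mul contDiff_id)
    exact h.comp hu

/-- `C_c^∞(M)`, complex valued. -/
def TestFun : Submodule ℂ (M → ℂ) where
  carrier := {u | u ∈ SmoothFun n M ∧ HasCompactSupport u}
  add_mem' hu hv := ⟨(SmoothFun n M).add_mem hu.1 hv.1, hu.2.add hv.2⟩
  zero_mem' := ⟨(SmoothFun n M).zero_mem, HasCompactSupport.zero⟩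
  smul_mem' c _ hu := ⟨(SmoothFun n M).smul_mem c hu.1,
    hu.2.comp_left (g := fun z : ℂ => c • z) (smul_zero c)⟩

theorem testFun_le_smoothFun : TestFun n M ≤ SmoothFun n M := fun _ hu => hu.1

/-- Linear operators `C_c^∞(M) → C^∞(M)`. -/
abbrev Op : Type _ := TestFun n M →ₗ[ℂ] SmoothFun n M

/-- A properly supported operator: a linear map `C^∞(M) → C^∞(M)` such that the support of
`A u` stays in a fixed compact set when that of `u` does, and such that `A u` on a compact set
only depends on `u` on some compact set. -/
structure ProperOp where
  toLin : SmoothFun n M →ₗ[ℂ] SmoothFun n M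
  support_subset : ∀ S : Set M, IsCompact S → ∃ S' : Set M, IsCompact S' ∧
    ∀ u : SmoothFun n M, tsupport (u : M → ℂ) ⊆ S → tsupport (toLin u : M → ℂ) ⊆ S'
  local_dependence : ∀ S : Set M, IsCompact S → ∃ S' : Set M, IsCompact S' ∧
    ∀ u : SmoothFun n M, (∀ x ∈ S', (u : M → ℂ) x = 0) → ∀ x ∈ S, (toLin u : M → ℂ) x = 0

variable {n M}

/-- A properly supported operator as an operator `C_c^∞(M) → C^∞(M)`. -/
def ProperOp.toOp (A : ProperOp n M) : Op n M :=
  A.toLin ∘ₗ Submodule.inclusion (testFun_le_smoothFun n M)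

/-- A properly supported operator on a Hausdorff manifold maps `C_c^∞(M)` to itself. -/
def ProperOp.onTest [T2Space M] (A : ProperOp n M) : TestFun n M →ₗ[ℂ] TestFun n M where
  toFun u := ⟨(A.toOp u : M → ℂ), (A.toOp u).2, by
    obtain ⟨S', hS', h⟩ := A.support_subset (tsupport (u : M → ℂ)) u.2.2
    exact hS'.of_isClosed_subset (isClosed_tsupport _) (h _ subset_rfl)⟩
  map_add' u v := by
    apply Subtype.ext
    exact congrArg (fun f : SmoothFun n M => (f : M → ℂ)) (A.toOp.map_add u v)
  map_smul' c u := by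
    apply Subtype.ext
    exact congrArg (fun f : SmoothFun n M => (f : M → ℂ)) (A.toOp.map_smul c u)

/-- The composition `A P B` of `N × N` systems; a system is a matrix of scalar operators. -/
def sysComp [T2Space M] {ι : Type*} [Fintype ι] (A : Matrix ι ι (ProperOp n M))
    (P : Matrix ι ι (Op n M)) (B : Matrix ι ι (ProperOp n M)) : Matrix ι ι (Op n M) :=
  fun i j => ∑ k, ∑ l, (A i k).toLin ∘ₗ P k l ∘ₗ (B l j).onTest

variable [IsManifold 𝓘(ℝ, Rn n) ∞ M]

/-! ### Pseudodifferential operators on a manifold -/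

/-- For `ψ ∈ C_c^∞(M)` supported in the domain of a chart `κ` and `u` on `ℝⁿ`, the test function
`ψ · (u ∘ κ)` on `M`. -/
def liftCutoff (κ : OpenPartialHomeomorph M (Rn n))
    (hκ : κ ∈ IsManifold.maximalAtlas 𝓘(ℝ, Rn n) ∞ M)
    (ψ : TestFun n M) (hψ : tsupport (ψ : M → ℂ) ⊆ κ.source)
    (u : SchwartzMap (Rn n) ℂ) : TestFun n M :=
  ⟨fun x => (ψ : M → ℂ) x * u (κ x), by
    refine ⟨contMDiff_of_tsupport (I := 𝓘(ℝ, Rn n)) (I' := 𝓘(ℝ, ℂ)) fun x hx => ?_,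
      HasCompactSupport.mul_right ψ.2.2⟩
    have hxs : x ∈ κ.source := hψ (tsupport_mul_subset_left hx)
    have h1 : ContMDiffAt 𝓘(ℝ, Rn n) 𝓘(ℝ, Rn n) ∞ κ x :=
      (contMDiffOn_of_mem_maximalAtlas hκ).contMDiffAt (κ.open_source.mem_nhds hxs)
    have h2 : ContMDiffAt 𝓘(ℝ, Rn n) 𝓘(ℝ, ℂ) ∞ (fun y => u (κ y)) x :=
      ((u.smooth ⊤).contMDiff.contMDiffAt).comp x h1
    have h3 : ContMDiffAt 𝓘(ℝ, Rn n) 𝓘(ℝ, ℂ) ∞ (ψ : M → ℂ) x := ψ.2.1 x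
    exact (contDiff_fst.mul contDiff_snd : ContDiff ℝ ∞
      (fun z : ℂ × ℂ => z.1 * z.2)).contMDiff.contMDiffAt.comp x (h3.prodMk_space h2)⟩

/-- In the coordinates `κ` the localized operator `φ R ψ` is the Weyl operator `a^w` on `ℝⁿ`:
`(κ⁻¹)^* φ R ψ κ^* u = a^w u` for all Schwartz functions `u`, the left-hand side being extended
by zero outside the range of `κ`. -/
def LocallyWeyl (R : Op n M) (κ : OpenPartialHomeomorph M (Rn n))
    (hκ : κ ∈ IsManifold.maximalAtlas 𝓘(ℝ, Rn n) ∞ M)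
    (φ ψ : TestFun n M) (hψ : tsupport (ψ : M → ℂ) ⊆ κ.source)
    (a : Rn n × Rn n → ℂ) : Prop :=
  ∀ (u : SchwartzMap (Rn n) ℂ) (z : Rn n),
    κ.target.indicator
        (fun z' => (φ : M → ℂ) (κ.symm z') * (R (liftCutoff κ hκ ψ hψ u) : M → ℂ) (κ.symm z')) z
      = weylOp a u z

variable (n M) in
/-- The cotangent bundle `T^*M`, with Mathlib's smooth structure. -/
abbrev Cotangent : Type _ :=
  Bundle.TotalSpace (Rn n →L[ℝ] ℝ)
    (fun x : M => TangentSpace 𝓘(ℝ, Rn n) x →L[ℝ] Bundle.Trivial M ℝ x)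

/-- The covector at `x` with coordinates `η` in the chart `κ`, i.e. `∑ η_j dκ_j(x)`. -/
def covector (κ : OpenPartialHomeomorph M (Rn n)) (x : M) (η : Rn n) : Cotangent n M :=
  ⟨x, (innerSL ℝ η).comp (mfderiv 𝓘(ℝ, Rn n) 𝓘(ℝ, Rn n) κ x)⟩

/-- The system `P` belongs to `Ψ^m_cl(M)` and has principal symbol `p` (a matrix valued function
on `T^*M`, of which only the values outside the zero section matter).

Any two points `x₁`, `x₂` of `M` lie in the domain of a (not necessarily connected) chart `κ` of
the smooth structure such that, for all cutoff functions `φ`, `ψ` supported in that domain, the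
operator `φ P ψ` in the coordinates `κ` is a Weyl operator with classical symbol of order `m`,
with leading term `φ ψ p`. The case `x₁ = x₂` is the usual local condition and the case `x₁ ≠ x₂`
contains the smoothness of the kernel off the diagonal. By the invariance of pseudodifferential
operators under changes of coordinates, all charts then have this property. -/
def IsClassicalPsiDO {ι : Type*} (m : ℝ) (P : Matrix ι ι (Op n M))
    (p : Cotangent n M → Matrix ι ι ℂ) : Prop :=
  ∀ x₁ x₂ : M, ∃ (κ : OpenPartialHomeomorph M (Rn n))
    (hκ : κ ∈ IsManifold.maximalAtlas 𝓘(ℝ, Rn n) ∞ M),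
    x₁ ∈ κ.source ∧ x₂ ∈ κ.source ∧
    ∀ (i j : ι) (φ ψ : TestFun n M), tsupport (φ : M → ℂ) ⊆ κ.source →
      ∀ hψ : tsupport (ψ : M → ℂ) ⊆ κ.source,
      ∃ (a : Rn n × Rn n → ℂ) (b : ℕ → Rn n × Rn n → ℂ),
        IsClassicalSymbol m a b ∧ LocallyWeyl (P i j) κ hκ φ ψ hψ a ∧
        ∀ x ∈ κ.source, ∀ η : Rn n, η ≠ 0 →
          b 0 (κ x, η) = (φ : M → ℂ) x * (ψ : M → ℂ) x * p (covector κ x η) i j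

/-- Ellipticity over a set `s` of covectors, in terms of the principal symbol: it is invertible
at all nonzero covectors in `s`. -/
def IsEllipticOn {ι : Type*} [Fintype ι] [DecidableEq ι] (p : Cotangent n M → Matrix ι ι ℂ)
    (s : Set (Cotangent n M)) : Prop :=
  ∀ w ∈ s, w.2 ≠ 0 → (p w).det ≠ 0

/-- `w₀ ∉ WF(R)` for a scalar pseudodifferential operator `R`: near the base point of `w₀`, in
local coordinates, the symbol of `R` is of order `-∞` in a conic neighbourhood of `w₀`. -/
def NotMemWF (R : Op n M) (w₀ : Cotangent n M) : Prop :=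
  ∃ (κ : OpenPartialHomeomorph M (Rn n))
    (hκ : κ ∈ IsManifold.maximalAtlas 𝓘(ℝ, Rn n) ∞ M)
    (φ ψ : TestFun n M) (hψ : tsupport (ψ : M → ℂ) ⊆ κ.source)
    (μ : ℝ) (a : Rn n × Rn n → ℂ) (η₀ : Rn n) (V C : Set (Rn n)),
    w₀.1 ∈ κ.source ∧ tsupport (φ : M → ℂ) ⊆ κ.source ∧
    (∀ᶠ x in 𝓝 w₀.1, (φ : M → ℂ) x = 1 ∧ (ψ : M → ℂ) x = 1) ∧
    IsSymbol μ a ∧ LocallyWeyl R κ hκ φ ψ hψ a ∧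
    covector κ w₀.1 η₀ = w₀ ∧
    IsOpen V ∧ κ w₀.1 ∈ V ∧
    IsOpen C ∧ η₀ ∈ C ∧ (∀ η ∈ C, ∀ t : ℝ, 0 < t → t • η ∈ C) ∧
    ∀ ν : ℝ, SymbolBoundOn {z | z.1 ∈ V ∧ z.2 ∈ C ∧ 1 ≤ ‖z.2‖} ν a

/-- `R₁ = R₂` microlocally near `w₀`: `w₀ ∉ WF(R₁ - R₂)`, for systems entry by entry. -/
def MicrolocallyEq {ι : Type*} (R₁ R₂ : Matrix ι ι (Op n M)) (w₀ : Cotangent n M) : Prop :=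
  ∀ i j : ι, NotMemWF (R₁ i j - R₂ i j) w₀

/-- An open conic subset of `T^*M ∖ 0`. -/
structure IsOpenConic (Γ : Set (Cotangent n M)) : Prop where
  isOpen : IsOpen Γ
  ne_zero : ∀ w ∈ Γ, w.2 ≠ 0
  conic : ∀ w ∈ Γ, ∀ t : ℝ, 0 < t → (⟨w.1, t • w.2⟩ : Cotangent n M) ∈ Γ

/-! ### Principal type and constant characteristics -/

/-- The model with corners of the manifold `T^*M`. -/
abbrev cotModel (n : ℕ) :
    ModelWithCorners ℝ (Rn n × (Rn n →L[ℝ] ℝ)) (ModelProd (Rn n) (Rn n →L[ℝ] ℝ)) :=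
  𝓘(ℝ, Rn n).prod 𝓘(ℝ, Rn n →L[ℝ] ℝ)

/-- The derivative `∂_ν p(w)` of a matrix valued function in the direction `ν ∈ T_w(T^*M)`,
entry by entry. -/
def dirDeriv {ι : Type*} (p : Cotangent n M → Matrix ι ι ℂ) (w : Cotangent n M)
    (ν : TangentSpace (cotModel n) w) : Matrix ι ι ℂ :=
  Matrix.of fun i j => (mfderiv (cotModel n) 𝓘(ℝ, ℂ) (fun w' => p w' i j) w ν : ℂ)

/-- `p` is of principal type at `w`: for some direction `ν` the map
`ker p(w) → Coker p(w) = ℂ^N / Ran p(w)` induced by `∂_ν p(w)` is bijective. -/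
def IsPrincipalTypeAt {ι : Type*} [Fintype ι] [DecidableEq ι]
    (p : Cotangent n M → Matrix ι ι ℂ) (w : Cotangent n M) : Prop :=
  ∃ ν : TangentSpace (cotModel n) w,
    Function.Bijective
      ((LinearMap.range (Matrix.toLin' (p w))).mkQ ∘ₗ
        Matrix.toLin' (dirDeriv p w ν) ∘ₗ (LinearMap.ker (Matrix.toLin' (p w))).subtype)

/-- `l` is a section of eigenvalues of `p` over the set `s`: a continuous function on `s` whose
value at each `w ∈ s` solves the characteristic equation of `p(w)`. -/
def IsEigenvalueSection {ι : Type*} [Fintype ι] [DecidableEq ι]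
    (p : Cotangent n M → Matrix ι ι ℂ) (l : Cotangent n M → ℂ) (s : Set (Cotangent n M)) : Prop :=
  ContinuousOn l s ∧ ∀ w ∈ s, (p w - Matrix.scalar ι (l w)).det = 0

/-- The algebraic multiplicity of `μ` as an eigenvalue of `A`. -/
def algMult {ι : Type*} [Fintype ι] [DecidableEq ι] (A : Matrix ι ι ℂ) (μ : ℂ) : ℕ :=
  A.charpoly.rootMultiplicity μ

/-- The geometric multiplicity `dim ker (A - μ Id)` of `μ` as an eigenvalue of `A`. -/
def geomMult {ι : Type*} [Fintype ι] [DecidableEq ι] (A : Matrix ι ι ℂ) (μ : ℂ) : ℕ :=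
  Module.finrank ℂ (LinearMap.ker (Matrix.toLin' (A - Matrix.scalar ι μ)))

/-- `p` has constant characteristics near `w₀`: for some `ε > 0` and some neighbourhood `U` of
`w₀`, every section of eigenvalues `l` of `p` with `|l| < ε`, over any set `s ⊆ U`, has
constant algebraic and constant geometric multiplicity. -/
def HasConstantCharacteristicsNear {ι : Type*} [Fintype ι] [DecidableEq ι]
    (p : Cotangent n M → Matrix ι ι ℂ) (w₀ : Cotangent n M) : Prop :=
  ∃ ε : ℝ, 0 < ε ∧ ∃ U ∈ 𝓝 w₀, ∀ (s : Set (Cotangent n M)) (l : Cotangent n M → ℂ),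
    s ⊆ U → IsEigenvalueSection p l s → (∀ w ∈ s, ‖l w‖ < ε) →
    ∀ w ∈ s, ∀ w' ∈ s,
      algMult (p w) (l w) = algMult (p w') (l w') ∧
      geomMult (p w) (l w) = geomMult (p w') (l w')

end Manifold

end PsiDO

end

open scoped Manifold ContDiff Topology
noncomputable section
set_option linter.unusedSectionVars false
namespace PsiDO
open Filter MeasureTheory
open Finset (sum_congr range mul_sum sum_mul sum_const sum_nonneg sum_le_sum mem_range
  single_le_sum sum_range_succ' sum_sub_distrib sum_eq_zero sum_comm mem_univ)
open Set (EqOn univ indicator_of_mem indicator_of_notMem Icc)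
open Metric (ball closedBall mem_ball_self)
open Matrix (fromBlocks scalar toLin' mul_apply of_apply reindex_apply reindex)
open LinearMap (ker)
open Module (finrank)
open Filter.Eventually (of_forall)
open ContinuousLinearMap (fst snd inl inr)

/-! ### Weighted derivative estimates along a frame of directions -/

theorem exists_upper_bound {ι : Type*} [Finite ι] (C : ℝ) (K : ι → ℝ) : ∃ D, C ≤ D ∧ ∀ i, K i ≤ D :=
  let ⟨D, hD⟩ := (Set.finite_range K).bddAbove
  ⟨max C D, le_max_left _ _, fun i => (hD ⟨i, rfl⟩).trans (le_max_right _ _)⟩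

section Frames

variable {𝒳 : Type*} [NormedAddCommGroup 𝒳] [NormedSpace ℝ 𝒳]
variable {G : Type*} [NormedAddCommGroup G] [NormedSpace ℝ G]
variable {G' : Type*} [NormedAddCommGroup G'] [NormedSpace ℝ G']

/-- A weight function with finitely many directions of differentiation, each of which lowers the
order by a given amount. -/
structure Frame (𝒳 : Type*) where
  ι : Type
  ρ : 𝒳 → ℝ
  one_le : ∀ y, 1 ≤ ρ y
  dir : ι → 𝒳
  loss : ι → ℝ

theorem Frame.ρ_pos (F : Frame 𝒳) (y : 𝒳) : 0 < F.ρ y := lt_of_lt_of_le one_pos (F.one_le y)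

/-- The derivative in the constant direction `v`. -/
def dd (v : 𝒳) (a : 𝒳 → G) : 𝒳 → G := fun y => fderiv ℝ a y v

/-- `|∂_{i₁} ⋯ ∂_{iₖ} a| ≤ w ρ^{μ - loss}` on `s`, for at most `N` directions of the frame. -/
def SB (F : Frame 𝒳) (s : Set 𝒳) (w : 𝒳 → ℝ) : ℕ → ℝ → (𝒳 → G) → Prop
  | 0, μ, a => ∀ y ∈ s, ‖a y‖ ≤ w y * F.ρ y ^ μ
  | N + 1, μ, a => (∀ y ∈ s, ‖a y‖ ≤ w y * F.ρ y ^ μ) ∧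
      ∀ i, SB F s w N (μ - F.loss i) (dd (F.dir i) a)

variable {F : Frame 𝒳} {s t U : Set 𝒳} {w w' : 𝒳 → ℝ} {N : ℕ} {μ μ' : ℝ} {a b : 𝒳 → G}

theorem SB.bound (h : SB F s w N μ a) : ∀ y ∈ s, ‖a y‖ ≤ w y * F.ρ y ^ μ := by
  cases N with
  | zero => exact h
  | succ N => exact h.1

theorem SB.of_succ (h : SB F s w (N + 1) μ a) : SB F s w N μ a := by
  induction N generalizing μ a with
  | zero => exact h.1
  | succ N ih => exact ⟨h.1, fun i => ih (h.2 i)⟩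

theorem SB.of_le {N' : ℕ} (h : SB F s w N' μ a) (hN : N ≤ N') : SB F s w N μ a := by
  induction N' with
  | zero => obtain rfl : N = 0 := by omega
            exact h
  | succ k ih =>
    rcases Nat.lt_or_ge k N with h' | h'
    · obtain rfl : N = k + 1 := by omega
      exact h
    · exact ih h.of_succ h'

theorem SB.mono_weight (h : SB F s w N μ a) (hw : ∀ y ∈ s, w y ≤ w' y) : SB F s w' N μ a := by
  have key : ∀ (μ : ℝ) (a : 𝒳 → G), (∀ y ∈ s, ‖a y‖ ≤ w y * F.ρ y ^ μ) →
      ∀ y ∈ s, ‖a y‖ ≤ w' y * F.ρ y ^ μ := fun μ a h y hy =>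
    (h y hy).trans (mul_le_mul_of_nonneg_right (hw y hy) (Real.rpow_nonneg (F.ρ_pos y).le _))
  induction N generalizing μ a with
  | zero => exact key _ _ h
  | succ N ih => exact ⟨key _ _ h.1, fun i => ih (h.2 i)⟩

theorem SB.mono_set (h : SB F s w N μ a) (hst : t ⊆ s) : SB F t w N μ a := by
  induction N generalizing μ a with
  | zero => exact fun y hy => h y (hst hy)
  | succ N ih => exact ⟨fun y hy => h.1 y (hst hy), fun i => ih (h.2 i)⟩

theorem SB.of_singletons (h : ∀ y ∈ s, SB F {y} w N μ a) : SB F s w N μ a := by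
  induction N generalizing μ a with
  | zero => exact fun y hy => h y hy y rfl
  | succ N ih => exact ⟨fun y hy => (h y hy).1 y rfl, fun i => ih fun y hy => (h y hy).2 i⟩

theorem SB.weight_nonneg (h : SB F s w N μ a) : ∀ y ∈ s, 0 ≤ w y := by
  intro y hy
  have h1 := (norm_nonneg _).trans (h.bound y hy)
  exact nonneg_of_mul_nonneg_left h1 (Real.rpow_pos_of_pos (F.ρ_pos y) _)

theorem SB.mono_order (h : SB F s w N μ a) (hμ : μ ≤ μ') : SB F s w N μ' a := by
  have hw := h.weight_nonneg
  have key : ∀ (μ μ' : ℝ) (a : 𝒳 → G), μ ≤ μ' → (∀ y ∈ s, ‖a y‖ ≤ w y * F.ρ y ^ μ) →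
      ∀ y ∈ s, ‖a y‖ ≤ w y * F.ρ y ^ μ' := fun μ μ' a hμ h' y hy =>
    (h' y hy).trans (mul_le_mul_of_nonneg_left
      (Real.rpow_le_rpow_of_exponent_le (F.one_le y) hμ) (hw y hy))
  induction N generalizing μ μ' a with
  | zero => exact key _ _ _ hμ h
  | succ N ih => exact ⟨key _ _ _ hμ h.1, fun i => ih (h.2 i) (sub_le_sub_right hμ _)⟩

theorem dd_congr {v y : 𝒳} (hab : a =ᶠ[𝓝 y] b) : dd v a =ᶠ[𝓝 y] dd v b := by
  filter_upwards [hab.fderiv (𝕜 := ℝ)] with z hz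
  simp only [dd, hz]

theorem SB.congr (h : SB F s w N μ a) (hab : ∀ y ∈ s, a =ᶠ[𝓝 y] b) : SB F s w N μ b := by
  induction N generalizing μ a b with
  | zero => exact fun y hy => by rw [← (hab y hy).self_of_nhds]; exact h y hy
  | succ N ih =>
    exact ⟨fun y hy => by rw [← (hab y hy).self_of_nhds]; exact h.1 y hy,
      fun i => ih (h.2 i) fun y hy => dd_congr (hab y hy)⟩

theorem SB.congr_open (h : SB F s w N μ a) (hU : IsOpen U) (hs : s ⊆ U) (hab : EqOn a b U) :
    SB F s w N μ b :=
  h.congr fun _ hy => Filter.eventuallyEq_of_mem (hU.mem_nhds (hs hy)) hab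

theorem ContDiffOn.dd (ha : ContDiffOn ℝ ∞ a U) (hU : IsOpen U) (v : 𝒳) :
    ContDiffOn ℝ ∞ (dd v a) U :=
  (ha.fderiv_of_isOpen hU (m := ∞) (by simp)).clm_apply contDiffOn_const

theorem ContDiff.dd (ha : ContDiff ℝ ∞ a) (v : 𝒳) : ContDiff ℝ ∞ (dd v a) :=
  (ha.fderiv_right (m := ∞) (by simp)).clm_apply contDiff_const

theorem ContDiffOn.diffAt (ha : ContDiffOn ℝ ∞ a U) (hU : IsOpen U) {y : 𝒳} (hy : y ∈ U) :
    DifferentiableAt ℝ a y :=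
  (ha.contDiffAt (hU.mem_nhds hy)).differentiableAt (by simp)

theorem dd_add_on (ha : ContDiffOn ℝ ∞ a U) (hb : ContDiffOn ℝ ∞ b U) (hU : IsOpen U) (v : 𝒳) :
    EqOn (dd v (fun y => a y + b y)) (fun y => dd v a y + dd v b y) U := fun y hy => by
  simp only [dd]
  rw [fderiv_fun_add (ContDiffOn.diffAt ha hU hy) (ContDiffOn.diffAt hb hU hy)]; rfl

theorem SB.add (h : SB F s w N μ a) (h' : SB F s w' N μ b) (hU : IsOpen U) (hs : s ⊆ U)
    (ha : ContDiffOn ℝ ∞ a U) (hb : ContDiffOn ℝ ∞ b U) :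
    SB F s (fun y => w y + w' y) N μ (fun y => a y + b y) := by
  have key : ∀ (μ : ℝ) (a b : 𝒳 → G), (∀ y ∈ s, ‖a y‖ ≤ w y * F.ρ y ^ μ) →
      (∀ y ∈ s, ‖b y‖ ≤ w' y * F.ρ y ^ μ) →
      ∀ y ∈ s, ‖a y + b y‖ ≤ (w y + w' y) * F.ρ y ^ μ := fun μ a b h h' y hy => by
    rw [add_mul]
    exact norm_add_le_of_le (h y hy) (h' y hy)
  induction N generalizing μ a b with
  | zero => exact key _ _ _ h h'
  | succ N ih =>
    refine ⟨key _ _ _ h.1 h'.1, fun i => ?_⟩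
    exact (ih (h.2 i) (h'.2 i) (ContDiffOn.dd ha hU _) (ContDiffOn.dd hb hU _)).congr_open hU hs
      (dd_add_on ha hb hU _).symm

theorem dd_clm_on (L : G →L[ℝ] G') (ha : ContDiffOn ℝ ∞ a U) (hU : IsOpen U) (v : 𝒳) :
    EqOn (dd v (fun y => L (a y))) (fun y => L (dd v a y)) U := fun y hy => by
  have := (L.hasFDerivAt.comp y (ContDiffOn.diffAt ha hU hy).hasFDerivAt).fderiv
  simp only [dd]
  change fderiv ℝ (L ∘ a) y v = _
  rw [this]; rfl

theorem SB.clm (L : G →L[ℝ] G') (h : SB F s w N μ a) (hU : IsOpen U) (hs : s ⊆ U)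
    (ha : ContDiffOn ℝ ∞ a U) : SB F s (fun y => ‖L‖ * w y) N μ (fun y => L (a y)) := by
  have key : ∀ (μ : ℝ) (a : 𝒳 → G), (∀ y ∈ s, ‖a y‖ ≤ w y * F.ρ y ^ μ) →
      ∀ y ∈ s, ‖L (a y)‖ ≤ (‖L‖ * w y) * F.ρ y ^ μ := fun μ a h y hy => by
    rw [mul_assoc]
    exact L.le_opNorm_of_le (h y hy)
  induction N generalizing μ a with
  | zero => exact key _ _ h
  | succ N ih =>
    refine ⟨key _ _ h.1, fun i => ?_⟩
    exact (ih (h.2 i) (ContDiffOn.dd ha hU _)).congr_open hU hs (dd_clm_on L ha hU _).symm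

theorem SB.const_mul {f : 𝒳 → ℂ} (c : ℂ) (h : SB F s w N μ f) (hU : IsOpen U) (hs : s ⊆ U)
    (hf : ContDiffOn ℝ ∞ f U) : SB F s (fun y => ‖c‖ * w y) N μ (fun y => c * f y) := by
  have h1 := SB.clm (ContinuousLinearMap.mul ℝ ℂ c) h hU hs hf
  refine h1.mono_weight fun y hy => ?_
  exact mul_le_mul_of_nonneg_right (ContinuousLinearMap.opNorm_mul_apply_le ℝ ℂ c)
    (h.weight_nonneg y hy)

theorem dd_mul_on {f g : 𝒳 → ℂ} (hf : ContDiffOn ℝ ∞ f U) (hg : ContDiffOn ℝ ∞ g U)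
    (hU : IsOpen U) (v : 𝒳) :
    EqOn (dd v (fun y => f y * g y)) (fun y => dd v f y * g y + f y * dd v g y) U :=
  fun y hy => by
  simp only [dd]
  rw [fderiv_fun_mul (ContDiffOn.diffAt hf hU hy) (ContDiffOn.diffAt hg hU hy)]
  simp only [add_apply, smul_apply, smul_eq_mul]
  ring

theorem SB.mul {f g : 𝒳 → ℂ} (h : SB F s w N μ f) (h' : SB F s w' N μ' g) (hU : IsOpen U)
    (hs : s ⊆ U) (hf : ContDiffOn ℝ ∞ f U) (hg : ContDiffOn ℝ ∞ g U) :
    SB F s (fun y => 2 ^ N * (w y * w' y)) N (μ + μ') (fun y => f y * g y) := by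
  have key : ∀ (μ μ' : ℝ) (f g : 𝒳 → ℂ), (∀ y ∈ s, ‖f y‖ ≤ w y * F.ρ y ^ μ) →
      (∀ y ∈ s, ‖g y‖ ≤ w' y * F.ρ y ^ μ') →
      ∀ y ∈ s, ‖f y * g y‖ ≤ (w y * w' y) * F.ρ y ^ (μ + μ') := fun μ μ' f g h h' y hy => by
    rw [norm_mul, Real.rpow_add (F.ρ_pos y), mul_mul_mul_comm]
    exact mul_le_mul (h y hy) (h' y hy) (norm_nonneg _) ((norm_nonneg _).trans (h y hy))
  induction N generalizing μ μ' f g with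
  | zero => simpa [SB] using key _ _ _ _ h h'
  | succ N ih =>
    refine ⟨fun y hy => ?_, fun i => ?_⟩
    · refine (key _ _ _ _ h.1 h'.1 y hy).trans
        (mul_le_mul_of_nonneg_right ?_ (Real.rpow_nonneg (F.ρ_pos y).le _))
      have h2 : 0 ≤ w y * w' y := mul_nonneg (h.weight_nonneg y hy) (h'.weight_nonneg y hy)
      nlinarith [one_le_pow₀ (n := N + 1) (one_le_two : (1 : ℝ) ≤ 2)]
    · have h1 := ih (h.2 i) h'.of_succ (ContDiffOn.dd hf hU _) hg
      have h2 := ih h.of_succ (h'.2 i) hf (ContDiffOn.dd hg hU _)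
      rw [show μ - F.loss i + μ' = μ + μ' - F.loss i by ring] at h1
      rw [show μ + (μ' - F.loss i) = μ + μ' - F.loss i by ring] at h2
      refine ((h1.add h2 hU hs ((ContDiffOn.dd hf hU _).mul hg)
        (hf.mul (ContDiffOn.dd hg hU _))).congr_open hU hs
        (dd_mul_on hf hg hU _).symm).mono_weight fun y hy => ?_
      exact le_of_eq (by ring)

theorem SB.zero : SB F s (fun _ => 0) N μ (fun _ => (0 : G)) := by
  induction N generalizing μ with
  | zero => intro y _; simp
  | succ N ih =>
    refine ⟨fun y _ => by simp, fun i => ?_⟩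
    have : dd (F.dir i) (fun _ : 𝒳 => (0 : G)) = fun _ => 0 := by funext y; simp [dd]
    rw [this]; exact ih

theorem SB.sum {κ : Type*} (T : Finset κ) {w : κ → 𝒳 → ℝ} {f : κ → 𝒳 → G}
    (h : ∀ k ∈ T, SB F s (w k) N μ (f k)) (hU : IsOpen U) (hs : s ⊆ U)
    (hf : ∀ k ∈ T, ContDiffOn ℝ ∞ (f k) U) :
    SB F s (fun y => ∑ k ∈ T, w k y) N μ (fun y => ∑ k ∈ T, f k y) := by
  classical
  induction T using Finset.induction_on with
  | empty => simpa using SB.zero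
  | insert k T hk ih =>
    simp only [Finset.sum_insert hk]
    refine (h k (by simp)).add (ih (fun j hj => h j (by simp [hj])) fun j hj => hf j (by simp [hj]))
      hU hs (hf k (by simp)) (ContDiffOn.sum fun j hj => hf j (by simp [hj]))

/-- The same directions, with parameters in `E`. -/
abbrev Frame.param (F : Frame 𝒳) (E : Type*) [Zero E] : Frame (𝒳 × E) where
  ι := F.ι
  ρ y := F.ρ y.1
  one_le y := F.one_le y.1
  dir i := (F.dir i, 0)
  loss := F.loss

/-- Composition with a smooth map carrying the frame into the frame of the target. -/
theorem SB.comp_affine {𝒴 : Type*} [NormedAddCommGroup 𝒴] [NormedSpace ℝ 𝒴] {F' : Frame 𝒴}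
    {s' : Set 𝒴} (T : 𝒴 →L[ℝ] 𝒳) (c : 𝒳) (h : SB F s w N μ a) (hU : IsOpen U)
    (hs : s ⊆ U) (ha : ContDiffOn ℝ ∞ a U) (hT : ∀ y ∈ s', T y + c ∈ s)
    (hw : ∀ y ∈ s', 0 ≤ w (T y + c))
    (hρ : ∀ y, F.ρ (T y + c) = F'.ρ y)
    (hdir : ∀ j, (T (F'.dir j) = 0) ∨ ∃ i, ∃ r : ℝ, |r| ≤ 1 ∧ T (F'.dir j) = r • F.dir i ∧
      F'.loss j = F.loss i) :
    SB F' s' (fun y => w (T y + c)) N μ (fun y => a (T y + c)) := by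
  have key : ∀ (μ : ℝ) (a : 𝒳 → G), (∀ y ∈ s, ‖a y‖ ≤ w y * F.ρ y ^ μ) →
      ∀ y ∈ s', ‖a (T y + c)‖ ≤ w (T y + c) * F'.ρ y ^ μ := fun μ a h y hy => by
    rw [← hρ]; exact h _ (hT y hy)
  have hU' : IsOpen ((fun y => T y + c) ⁻¹' U) := hU.preimage (by fun_prop)
  have hs' : s' ⊆ (fun y => T y + c) ⁻¹' U := fun y hy => hs (hT y hy)
  have hTd : ∀ y, HasFDerivAt (fun y => T y + c) T y := fun y => T.hasFDerivAt.add_const c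
  induction N generalizing μ a with
  | zero => exact key _ _ h
  | succ N ih =>
    refine ⟨key _ _ h.1, fun j => ?_⟩
    have hcomp : ∀ y ∈ (fun y => T y + c) ⁻¹' U,
        dd (F'.dir j) (fun y => a (T y + c)) y = fderiv ℝ a (T y + c) (T (F'.dir j)) := by
      intro y hy
      have := ((ContDiffOn.diffAt ha hU hy).hasFDerivAt.comp y (hTd y)).fderiv
      simp only [dd]
      change fderiv ℝ (a ∘ fun y => T y + c) y _ = _
      rw [this]; rfl
    rcases hdir j with h0 | ⟨i, r, hr, hTi, hl⟩
    · have h1 : SB F' s' (fun y => w (T y + c)) N (μ - F'.loss j) (fun _ : 𝒴 => (0 : G)) :=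
        SB.zero.mono_weight hw
      refine h1.congr_open hU' hs' fun y hy => ?_
      simp only [hcomp y hy, h0, map_zero]
    · have h1 := (ih (h.2 i) (ContDiffOn.dd ha hU _))
      have hsm : ContDiffOn ℝ ∞ (fun y => dd (F.dir i) a (T y + c)) ((fun y => T y + c) ⁻¹' U) :=
        (ContDiffOn.dd ha hU _).comp (by fun_prop) fun y hy => hy
      have h2 := (h1.clm (r • ContinuousLinearMap.id ℝ G) hU' hs' hsm)
      rw [hl]
      refine (h2.congr_open hU' hs' fun y hy => ?_).mono_weight fun y hy => ?_
      · simp only [hcomp y hy, hTi, map_smul]; rfl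
      · have h3 : ‖r • ContinuousLinearMap.id ℝ G‖ ≤ 1 := by
          rw [norm_smul]
          exact mul_le_one₀ hr (norm_nonneg _) ContinuousLinearMap.norm_id_le
        exact mul_le_of_le_one_left (hw y hy) h3

end Frames

/-! ### The symbol estimates in terms of directional derivatives -/

section MixedDerivatives

/-- Continuous linear maps, as a normed space. -/
def Hm (E G : Type) [NormedAddCommGroup E] [NormedSpace ℝ E] [NormedAddCommGroup G]
    [NormedSpace ℝ G] : Type := E →L[ℝ] G
variable {E G G' : Type} [NormedAddCommGroup E] [NormedSpace ℝ E] [NormedAddCommGroup G]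
    [NormedSpace ℝ G] [NormedAddCommGroup G'] [NormedSpace ℝ G']
instance : NormedAddCommGroup (Hm E G) := inferInstanceAs (NormedAddCommGroup (E →L[ℝ] G))
instance : NormedSpace ℝ (Hm E G) := inferInstanceAs (NormedSpace ℝ (E →L[ℝ] G))

/-- Evaluation. -/
def Hm.ap (f : Hm E G) (v : E) : G := (show E →L[ℝ] G from f) v
theorem Hm.ext {f g : Hm E G} (h : ∀ v, f.ap v = g.ap v) : f = g := ContinuousLinearMap.ext h
theorem Hm.le (f : Hm E G) (v : E) : ‖f.ap v‖ ≤ ‖f‖ * ‖v‖ := ContinuousLinearMap.le_opNorm f v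
/-- A continuous linear map as an element of `Hm E G`. -/
def Hm.mk (f : E →L[ℝ] G) : Hm E G := f
theorem Hm.norm_mk_le (f : E →L[ℝ] G) (C : ℝ) (hC : 0 ≤ C) (h : ∀ v, ‖f v‖ ≤ C * ‖v‖) : ‖Hm.mk f‖ ≤ C := f.opNorm_le_bound hC h

/-- Composition with a linear map on the left. -/
def postCLM (L : G →L[ℝ] G') : Hm E G →L[ℝ] Hm E G' :=
  LinearMap.mkContinuous
    { toFun := fun f => Hm.mk (L.comp (show E →L[ℝ] G from f))
      map_add' := fun f g => Hm.ext fun v => L.map_add _ _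
      map_smul' := fun c f => Hm.ext fun v => L.map_smul _ _ } ‖L‖ fun f => L.opNorm_comp_le _

theorem norm_postCLM_le (L : G →L[ℝ] G') : ‖(postCLM L : Hm E G →L[ℝ] _)‖ ≤ ‖L‖ :=
  LinearMap.mkContinuous_norm_le _ (norm_nonneg _) _

/-- Evaluation at a vector. -/
def apCLM (v : E) : Hm E G →L[ℝ] G :=
  LinearMap.mkContinuous
    { toFun := fun f => f.ap v
      map_add' := fun f g => rfl
      map_smul' := fun c f => rfl } ‖v‖ fun f => (f.le v).trans_eq (mul_comm _ _)

/-- Exchanging the arguments of a bilinear map. -/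
def flipCLM (E G : Type) [NormedAddCommGroup E] [NormedSpace ℝ E] [NormedAddCommGroup G]
    [NormedSpace ℝ G]  : Hm E (Hm E G) →L[ℝ] Hm E (Hm E G) :=
  LinearMap.mkContinuous
    { toFun := fun f => Hm.mk (LinearMap.mkContinuous
        { toFun := fun v => Hm.mk ((apCLM v).comp (show E →L[ℝ] Hm E G from f))
          map_add' := fun v w => Hm.ext fun u => ContinuousLinearMap.map_add (show E →L[ℝ] G from f.ap u) v w
          map_smul' := fun c v => Hm.ext fun u => ContinuousLinearMap.map_smul (show E →L[ℝ] G from f.ap u) c v } ‖f‖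
         fun v => Hm.norm_mk_le _ _ (by positivity) fun u => ((f.ap u).le v).trans (by
           nlinarith [f.le u, norm_nonneg v]))
      map_add' := fun f g => rfl
      map_smul' := fun c f => rfl } 1 fun f => Hm.norm_mk_le _ _ (by positivity) fun v => by
        rw [one_mul]
        exact Hm.norm_mk_le _ _ (by positivity) fun u => ((f.ap u).le v).trans (by
           nlinarith [f.le u, norm_nonneg v])

theorem norm_flipCLM_le : ‖flipCLM E G‖ ≤ 1 := LinearMap.mkContinuous_norm_le _ zero_le_one _

variable {U s : Set (E × E)} {a b : E × E → G}

/-- The mixed derivative norms which occur in the symbol estimates. -/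
def mixNorm (j k : ℕ) (a : E × E → G) (z : E × E) : ℝ :=
  ‖iteratedFDeriv ℝ k (fun ξ : E => iteratedFDeriv ℝ j (fun x : E => a (x, ξ)) z.1) z.2‖

/-- The derivative along the image of `J`. -/
def PD {E' : Type} [NormedAddCommGroup E'] [NormedSpace ℝ E'] (J : E →L[ℝ] E') (a : E' → G)
    (z : E') : Hm E G := Hm.mk ((fderiv ℝ a z).comp J)

theorem mixNorm_zero_left (k : ℕ) (a : E × E → G) (z : E × E) :
    mixNorm 0 k a z = ‖iteratedFDeriv ℝ k (fun ξ => a (z.1, ξ)) z.2‖ := by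
  unfold mixNorm
  simp only [iteratedFDeriv_zero_eq_comp]
  exact LinearIsometryEquiv.norm_iteratedFDeriv_comp_left
    (continuousMultilinearCurryFin0 ℝ E G).symm (fun ξ => a (z.1, ξ)) z.2 k

theorem mixNorm_zero (a : E × E → G) (z : E × E) : mixNorm 0 0 a z = ‖a z‖ := by
  rw [mixNorm_zero_left, norm_iteratedFDeriv_zero]

theorem norm_iteratedFDeriv_isometry {A B : Type*} [NormedAddCommGroup A] [NormedSpace ℝ A]
    [NormedAddCommGroup B] [NormedSpace ℝ B] (I : A ≃ₗᵢ[ℝ] B) (f : E → A) (g : E → B)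
    (h : ∀ x, g x = I (f x)) (x : E) (k : ℕ) :
    ‖iteratedFDeriv ℝ k g x‖ = ‖iteratedFDeriv ℝ k f x‖ := by
  obtain rfl : g = I ∘ f := funext h
  exact I.norm_iteratedFDeriv_comp_left f x k

theorem mixNorm_congr (j k : ℕ) {z : E × E} (h : a =ᶠ[𝓝 z] b) :
    mixNorm j k a z = mixNorm j k b z := by
  unfold mixNorm
  have h1 : ∀ᶠ ξ in 𝓝 z.2, ∀ᶠ x in 𝓝 z.1, a (x, ξ) = b (x, ξ) := by
    have : ∀ᶠ p in 𝓝 z.1 ×ˢ 𝓝 z.2, a p = b p := by rw [← nhds_prod_eq]; exact h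
    exact (Filter.eventually_swap_iff.mp this).curry
  have h2 : (fun ξ : E => iteratedFDeriv ℝ j (fun x : E => a (x, ξ)) z.1) =ᶠ[𝓝 z.2]
      fun ξ => iteratedFDeriv ℝ j (fun x : E => b (x, ξ)) z.1 := by
    filter_upwards [h1] with ξ hξ
    exact (Filter.EventuallyEq.iteratedFDeriv ℝ hξ j).self_of_nhds
  rw [(Filter.EventuallyEq.iteratedFDeriv ℝ h2 k).self_of_nhds]

theorem mixNorm_succ_left (j k : ℕ) (ha : ContDiffOn ℝ ∞ a U) (hU : IsOpen U) {z : E × E}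
    (hz : z ∈ U) : mixNorm (j + 1) k a z = mixNorm j k (PD (inl ℝ E E) a) z := by
  have h : ∀ ξ, iteratedFDeriv ℝ (j + 1) (fun x : E => a (x, ξ)) z.1 =
      (continuousMultilinearCurryRightEquiv' ℝ j E G).symm
        (iteratedFDeriv ℝ j (fun x : E => Hm.mk (fderiv ℝ (fun x => a (x, ξ)) x)) z.1) := by
    intro ξ
    rw [iteratedFDeriv_succ_eq_comp_right]
    rfl
  refine (norm_iteratedFDeriv_isometry (E := E)
    (A := ContinuousMultilinearMap ℝ (fun _ : Fin j => E) (E →L[ℝ] G))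
    (B := ContinuousMultilinearMap ℝ (fun _ : Fin (j + 1) => E) G)
    (continuousMultilinearCurryRightEquiv' ℝ j E G).symm _ _ h z.2 k).trans (mixNorm_congr j k
      (a := fun z : E × E => Hm.mk (fderiv ℝ (fun x => a (x, z.2)) z.1)) ?_)
  filter_upwards [hU.mem_nhds hz] with y hy
  exact (HasFDerivAt.comp (f := fun x : E => (x, y.2)) y.1
    (ContDiffOn.diffAt ha hU hy).hasFDerivAt (hasFDerivAt_prodMk_left y.1 y.2)).fderiv

theorem mixNorm_zero_succ (k : ℕ) (ha : ContDiffOn ℝ ∞ a U) (hU : IsOpen U) {z : E × E}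
    (hz : z ∈ U) : mixNorm 0 (k + 1) a z = mixNorm 0 k (PD (inr ℝ E E) a) z := by
  rw [mixNorm_zero_left, ← norm_iteratedFDeriv_fderiv]
  refine (mixNorm_zero_left k (fun z : E × E => Hm.mk (fderiv ℝ (fun ξ => a (z.1, ξ)) z.2))
    z).symm.trans (mixNorm_congr 0 k ?_)
  filter_upwards [hU.mem_nhds hz] with y hy
  exact (HasFDerivAt.comp (f := fun ξ : E => (y.1, ξ)) y.2
    (ContDiffOn.diffAt ha hU hy).hasFDerivAt (hasFDerivAt_prodMk_right y.1 y.2)).fderiv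

variable {J J' : E →L[ℝ] E × E}

/-- Restriction of linear forms along `J`. -/
def preCLM (J : E →L[ℝ] E × E) : (E × E →L[ℝ] G) →L[ℝ] Hm E G :=
  LinearMap.mkContinuous
    { toFun := fun f => Hm.mk (f.comp J)
      map_add' := fun f g => rfl
      map_smul' := fun c f => rfl } ‖J‖ fun f => (f.opNorm_comp_le J).trans_eq (mul_comm _ _)

theorem contDiffOn_PD (ha : ContDiffOn ℝ ∞ a U) (hU : IsOpen U) : ContDiffOn ℝ ∞ (PD J a) U :=
  ContDiffOn.congr (f := fun z => preCLM J (fderiv ℝ a z)) ((preCLM (G := G) J).contDiff.comp_contDiffOn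
    (ha.fderiv_of_isOpen hU (m := ∞) (by simp))) fun _ _ => rfl

theorem PD_clm (L : G →L[ℝ] G') (ha : ContDiffOn ℝ ∞ a U) (hU : IsOpen U) :
    EqOn (PD J fun y => L (a y)) (fun y => postCLM L (PD J a y)) U := fun z hz =>
  Hm.ext fun v => DFunLike.congr_fun
    (L.hasFDerivAt.comp z (ContDiffOn.diffAt ha hU hz).hasFDerivAt).fderiv (J v)

theorem mixNorm_clm_le (L : G →L[ℝ] G') (j k : ℕ) (ha : ContDiffOn ℝ ∞ a U) (hU : IsOpen U)
    {z : E × E} (hz : z ∈ U) : mixNorm j k (fun y => L (a y)) z ≤ ‖L‖ * mixNorm j k a z := by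
  have hLa : ContDiffOn ℝ ∞ (fun y => L (a y)) U := L.contDiff.comp_contDiffOn ha
  induction j generalizing G G' with
  | zero =>
    induction k generalizing G G' with
    | zero => rw [mixNorm_zero, mixNorm_zero]; exact L.le_opNorm _
    | succ k ih =>
      rw [mixNorm_zero_succ k hLa hU hz, mixNorm_zero_succ k ha hU hz,
        mixNorm_congr 0 k (Filter.eventuallyEq_of_mem (hU.mem_nhds hz) (PD_clm L ha hU))]
      exact (ih (postCLM L) (contDiffOn_PD ha hU) ((postCLM L).contDiff.comp_contDiffOn
        (contDiffOn_PD ha hU))).trans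
          (mul_le_mul_of_nonneg_right (norm_postCLM_le L) (norm_nonneg _))
  | succ j ih =>
    rw [mixNorm_succ_left j k hLa hU hz, mixNorm_succ_left j k ha hU hz,
      mixNorm_congr j k (Filter.eventuallyEq_of_mem (hU.mem_nhds hz) (PD_clm L ha hU))]
    exact (ih (postCLM L) (contDiffOn_PD ha hU) ((postCLM L).contDiff.comp_contDiffOn
      (contDiffOn_PD ha hU))).trans (mul_le_mul_of_nonneg_right (norm_postCLM_le L) (norm_nonneg _))

theorem PD_comm (ha : ContDiffOn ℝ ∞ a U) (hU : IsOpen U) :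
    EqOn (PD J (PD J' a)) (fun z => flipCLM E G (PD J' (PD J a) z)) U := fun z hz => by
  have hd := ContDiffOn.diffAt (ha.fderiv_of_isOpen hU (m := ∞) (by simp)) hU hz
  have h : ∀ (J J' : E →L[ℝ] E × E) v w, ((PD J (PD J' a) z).ap v).ap w =
      fderiv ℝ (fderiv ℝ a) z (J v) (J' w) := fun J J' v w => by
    have := ((preCLM J').hasFDerivAt.comp z hd.hasFDerivAt).fderiv
    change Hm.ap (fderiv ℝ (preCLM J' ∘ fderiv ℝ a) z (J v)) w = _
    rw [this]; rfl
  have hs : IsSymmSndFDerivAt ℝ a z :=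
    (ha.contDiffAt (hU.mem_nhds hz)).isSymmSndFDerivAt (by simp; exact WithTop.coe_le_coe.2 le_top)
  refine Hm.ext fun v => Hm.ext fun w => ?_
  rw [h, hs.eq]
  exact (h J' J w v).symm

theorem mixNorm_PD_le (j k : ℕ) (ha : ContDiffOn ℝ ∞ a U) (hU : IsOpen U) {z : E × E}
    (hz : z ∈ U) : mixNorm j k (PD (inr ℝ E E) a) z ≤ mixNorm j (k + 1) a z := by
  induction j generalizing G with
  | zero => exact (mixNorm_zero_succ k ha hU hz).ge
  | succ j ih =>
    rw [mixNorm_succ_left j k (contDiffOn_PD ha hU) hU hz, mixNorm_succ_left j (k + 1) ha hU hz,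
      mixNorm_congr j k (Filter.eventuallyEq_of_mem (hU.mem_nhds hz) (PD_comm ha hU))]
    refine ((mixNorm_clm_le (flipCLM E G) j k ?_ hU hz).trans ?_).trans (ih (contDiffOn_PD ha hU))
    · exact contDiffOn_PD (contDiffOn_PD ha hU) hU
    · exact mul_le_of_le_one_left (norm_nonneg _) norm_flipCLM_le

end MixedDerivatives

section SymbolEstimates

variable {n : ℕ}

/-- The phase space `ℝⁿ × ℝⁿ`. -/
abbrev Ph (n : ℕ) : Type := Rn n × Rn n

/-- The standard basis vectors of `ℝⁿ`. -/
def eb (i : Fin n) : Rn n := EuclideanSpace.single i (1 : ℝ)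

/-- The frame of the symbol classes. -/
abbrev frX (n : ℕ) : Frame (Ph n) where
  ι := Fin n ⊕ Fin n
  ρ z := 1 + ‖z.2‖
  one_le z := by linarith [norm_nonneg z.2]
  dir := Sum.elim (fun i => (eb i, 0)) (fun i => (0, eb i))
  loss := Sum.elim (fun _ => 0) (fun _ => 1)

theorem sum_coord_smul_eb (v : Rn n) : ∑ i, v i • eb i = v := by
  ext j
  simp [eb, Finset.sum_apply, Pi.single_apply]

variable {G : Type} [NormedAddCommGroup G] [NormedSpace ℝ G]
variable {G' : Type} [NormedAddCommGroup G'] [NormedSpace ℝ G']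
variable {U s : Set (Ph n)} {a b : Ph n → G}

/-- The linear map `w ↦ (v ↦ vᵢ w)`. -/
def coordCLM (i : Fin n) : G →L[ℝ] Hm (Rn n) G :=
  LinearMap.mkContinuous
    { toFun := fun w => Hm.mk ((EuclideanSpace.proj i : Rn n →L[ℝ] ℝ).smulRight w)
      map_add' := fun w w' => Hm.ext fun v => smul_add _ _ _
      map_smul' := fun c w => Hm.ext fun v => smul_comm _ _ _ } 1 fun w =>
    Hm.norm_mk_le _ _ (by positivity) fun v => by
      change ‖v i • w‖ ≤ _
      rw [norm_smul, one_mul, mul_comm]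
      exact mul_le_mul_of_nonneg_left (PiLp.norm_apply_le v i) (norm_nonneg _)

theorem Hm.sum_ap {κ : Type*} (T : Finset κ) (f : κ → Hm (Rn n) G) (v : Rn n) :
    (∑ k ∈ T, f k).ap v = ∑ k ∈ T, (f k).ap v :=
  map_sum (apCLM v : Hm (Rn n) G →L[ℝ] G) f T

/-- Symbol estimates of all orders along the coordinate frame. -/
def SymOn (s : Set (Ph n)) (μ : ℝ) (a : Ph n → G) : Prop :=
  ∀ N : ℕ, ∃ C : ℝ, SB (frX n) s (fun _ => C) N μ a

theorem symOn_of_mixNorm (hU : IsOpen U) (hs : s ⊆ U) (ha : ContDiffOn ℝ ∞ a U) {μ : ℝ}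
    (h : ∀ j k : ℕ, ∃ C : ℝ, ∀ z ∈ s, mixNorm (E := Rn n) j k a z ≤ C * (1 + ‖z.2‖) ^ (μ - (k : ℝ))) :
    SymOn s μ a := by
  intro N
  induction N generalizing μ a with
  | zero =>
    obtain ⟨C, hC⟩ := h 0 0
    exact ⟨C, fun z hz => by simpa [mixNorm_zero, frX] using hC z hz⟩
  | succ N ih =>
    obtain ⟨C, hC⟩ := h 0 0
    have : Fintype (frX n).ι := inferInstanceAs (Fintype (Fin n ⊕ Fin n))
    set D := fun i : Fin n => ‖(apCLM (eb i : Rn n) : Hm (Rn n) G →L[ℝ] G)‖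
    have hap : ∀ (J : Rn n →L[ℝ] Ph n) i j k, ∀ z ∈ s, mixNorm (E := Rn n) j k (dd (J (eb i)) a) z ≤
        D i * mixNorm j k (PD J a) z :=
      fun J i j k z hz => mixNorm_clm_le (apCLM (eb i : Rn n)) j k (contDiffOn_PD ha hU) hU (hs hz)
    have key : ∀ i : (frX n).ι, ∃ C : ℝ,
        SB (frX n) s (fun _ => C) N (μ - (frX n).loss i) (dd ((frX n).dir i) a) := by
      rintro (i | i) <;> refine ih (ContDiffOn.dd ha hU _) fun j k => ?_
      · obtain ⟨C, hC⟩ := h (j + 1) k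
        refine ⟨D i * C, fun z hz => (hap (inl ℝ _ _) i j k z hz).trans ?_⟩
        rw [mul_assoc, ← mixNorm_succ_left j k ha hU (hs hz)]
        exact mul_le_mul_of_nonneg_left (by simpa [frX] using hC z hz) (norm_nonneg _)
      · obtain ⟨C, hC⟩ := h j (k + 1)
        refine ⟨D i * C, fun z hz => (hap (inr ℝ _ _) i j k z hz).trans ?_⟩
        rw [mul_assoc]
        refine mul_le_mul_of_nonneg_left ((mixNorm_PD_le j k ha hU (hs hz)).trans
          ((hC z hz).trans_eq ?_)) (norm_nonneg _)
        simp [frX, sub_sub, add_comm]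
    choose K hK using key
    refine ⟨max C (Finset.univ.sup' Finset.univ_nonempty
      (fun i : Option (frX n).ι => i.elim C K)), ⟨fun z hz => ?_, fun i => ?_⟩⟩
    · have := hC z hz
      simp only [mixNorm_zero, Nat.cast_zero, sub_zero] at this
      exact this.trans (mul_le_mul_of_nonneg_right (le_max_left _ _)
        (Real.rpow_nonneg (by positivity) _))
    · refine (hK i).mono_weight fun y _ => le_max_of_le_right ?_
      exact Finset.le_sup' (fun i : Option (frX n).ι => i.elim C K) (mem_univ (some i))

theorem SymOn.dir {μ : ℝ} (h : SymOn s μ a) (i : Fin n ⊕ Fin n) :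
    SymOn s (μ - (frX n).loss i) (dd ((frX n).dir i) a) := fun N =>
  (h (N + 1)).imp fun _ hC => hC.2 i

theorem SymOn.add {μ : ℝ} (h : SymOn s μ a) (h' : SymOn s μ b) (hU : IsOpen U) (hs : s ⊆ U)
    (ha : ContDiffOn ℝ ∞ a U) (hb : ContDiffOn ℝ ∞ b U) : SymOn s μ (fun y => a y + b y) :=
  fun N => by
  obtain ⟨C, hC⟩ := h N
  obtain ⟨C', hC'⟩ := h' N
  exact ⟨C + C', hC.add hC' hU hs ha hb⟩

theorem SymOn.sum {κ : Type*} (T : Finset κ) {μ : ℝ} {f : κ → Ph n → G}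
    (h : ∀ k ∈ T, SymOn s μ (f k)) (hU : IsOpen U) (hs : s ⊆ U)
    (hf : ∀ k ∈ T, ContDiffOn ℝ ∞ (f k) U) : SymOn s μ (fun y => ∑ k ∈ T, f k y) := fun N => by
  classical
  have h' : ∀ k : κ, ∃ C : ℝ, k ∈ T → SB (frX n) s (fun _ => C) N μ (f k) := fun k => by
    by_cases hk : k ∈ T
    · obtain ⟨C, hC⟩ := h k hk N
      exact ⟨C, fun _ => hC⟩
    · exact ⟨0, fun h => absurd h hk⟩
  choose C hC using h'
  exact ⟨∑ k ∈ T, C k, SB.sum T (w := fun k _ => C k) hC hU hs hf⟩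

theorem SymOn.clm {μ : ℝ} (L : G →L[ℝ] G') (h : SymOn s μ a) (hU : IsOpen U) (hs : s ⊆ U)
    (ha : ContDiffOn ℝ ∞ a U) : SymOn s μ (fun y => L (a y)) := fun N => by
  obtain ⟨C, hC⟩ := h N
  exact ⟨_, hC.clm L hU hs ha⟩

theorem SymOn.congr {μ : ℝ} (h : SymOn s μ a) (hU : IsOpen U) (hs : s ⊆ U)
    (hab : EqOn a b U) : SymOn s μ b := fun N =>
  (h N).imp fun _ hC => hC.congr_open hU hs hab

theorem SymOn.mixNorm_le {μ : ℝ} (h : SymOn s μ a) (hU : IsOpen U) (hs : s ⊆ U)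
    (ha : ContDiffOn ℝ ∞ a U) (j k : ℕ) :
    ∃ C : ℝ, ∀ z ∈ s, mixNorm (E := Rn n) j k a z ≤ C * (1 + ‖z.2‖) ^ (μ - (k : ℝ)) := by
  have key : ∀ {H : Type} [NormedAddCommGroup H] [NormedSpace ℝ H] {f : Ph n → H} {ν : ℝ}
      {J : Rn n →L[ℝ] Ph n}, ContDiffOn ℝ ∞ f U → (∀ i, SymOn s ν (dd (J (eb i)) f)) →
        SymOn s ν (PD J f) := fun {H _ _ f ν J} hf h => by
    have e : (fun z => ∑ i : Fin n, coordCLM i (dd (J (eb i)) f z)) = PD J f := by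
      funext z
      refine Hm.ext fun v => ?_
      change _ = fderiv ℝ f z (J v)
      conv_rhs => rw [← sum_coord_smul_eb v, map_sum, map_sum]
      rw [Hm.sum_ap]
      exact sum_congr rfl fun i _ => by rw [map_smul, map_smul]; rfl
    rw [← e]
    exact SymOn.sum Finset.univ (fun i _ => SymOn.clm _ (h i) hU hs (ContDiffOn.dd hf hU _)) hU hs
      fun i _ => (coordCLM i).contDiff.comp_contDiffOn (ContDiffOn.dd hf hU _)
  induction j generalizing G with
  | zero =>
    induction k generalizing G μ with
    | zero =>
      obtain ⟨C, hC⟩ := h 0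
      exact ⟨C, fun z hz => by simpa [mixNorm_zero, frX] using SB.bound hC z hz⟩
    | succ k ih =>
      obtain ⟨C, hC⟩ := ih (key (J := inr ℝ _ _) (ν := μ - 1) ha fun i =>
        h.dir (Sum.inr i)) (contDiffOn_PD ha hU)
      refine ⟨C, fun z hz => ?_⟩
      rw [mixNorm_zero_succ k ha hU (hs hz)]
      refine (hC z hz).trans_eq ?_
      push_cast
      rw [sub_sub, add_comm (k : ℝ)]
  | succ j ih =>
    obtain ⟨C, hC⟩ := ih (key (J := inl ℝ _ _) (ν := μ) ha fun i => by
      simpa using h.dir (Sum.inl i)) (contDiffOn_PD ha hU)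
    exact ⟨C, fun z hz => by rw [mixNorm_succ_left j k ha hU (hs hz)]; exact hC z hz⟩

theorem symbolBoundOn_iff {μ : ℝ} {a : Ph n → ℂ} (hU : IsOpen U) (hs : s ⊆ U)
    (ha : ContDiffOn ℝ ∞ a U) : SymbolBoundOn s μ a ↔ SymOn s μ a :=
  ⟨fun h => symOn_of_mixNorm hU hs ha h, fun h => h.mixNorm_le hU hs ha⟩

theorem isSymbol_iff {μ : ℝ} {a : Ph n → ℂ} : IsSymbol μ a ↔ ContDiff ℝ ∞ a ∧ SymOn univ μ a :=
  and_congr_right fun h => symbolBoundOn_iff isOpen_univ subset_rfl h.contDiffOn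

theorem SymOn.mul {f g : Ph n → ℂ} {μ μ' : ℝ} (h : SymOn s μ f) (h' : SymOn s μ' g)
    (hU : IsOpen U) (hs : s ⊆ U) (hf : ContDiffOn ℝ ∞ f U) (hg : ContDiffOn ℝ ∞ g U) :
    SymOn s (μ + μ') (fun y => f y * g y) := fun N => by
  obtain ⟨C, hC⟩ := h N
  obtain ⟨C', hC'⟩ := h' N
  exact ⟨_, hC.mul hC' hU hs hf hg⟩

theorem SymOn.const_mul {f : Ph n → ℂ} {μ : ℝ} (c : ℂ) (h : SymOn s μ f)
    (hU : IsOpen U) (hs : s ⊆ U) (hf : ContDiffOn ℝ ∞ f U) :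
    SymOn s μ (fun y => c * f y) := fun N => by
  obtain ⟨C, hC⟩ := h N
  exact ⟨_, hC.const_mul c hU hs hf⟩

theorem SymOn.mono_order {μ μ' : ℝ} (h : SymOn s μ a) (hμ : μ ≤ μ') : SymOn s μ' a := fun N =>
  (h N).imp fun _ hC => hC.mono_order hμ

theorem SymOn.mono_set {t : Set (Ph n)} {μ : ℝ} (h : SymOn s μ a) (ht : t ⊆ s) : SymOn t μ a :=
  fun N => (h N).imp fun _ hC => hC.mono_set ht

theorem SymOn.zero {μ : ℝ} : SymOn s μ (fun _ => (0 : G)) := fun _ => ⟨0, SB.zero⟩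

end SymbolEstimates

/-! ### Parameter integrals and expansions of weighted families -/

section ParamIntegral

variable {𝒳 : Type*} [NormedAddCommGroup 𝒳] [NormedSpace ℝ 𝒳]
variable {E : Type*} [NormedAddCommGroup E] [NormedSpace ℝ E]

theorem dd_eq_of_line {𝒴 G : Type*} [NormedAddCommGroup 𝒴] [NormedSpace ℝ 𝒴]
    [NormedAddCommGroup G] [NormedSpace ℝ G] {f : 𝒳 → G} {g : 𝒴 → G} {y v : 𝒳} {p w : 𝒴}
    (hf : DifferentiableAt ℝ f y) (hg : DifferentiableAt ℝ g p)
    (h : ∀ t : ℝ, f (y + t • v) = g (p + t • w)) : dd v f y = dd w g p := by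
  have h1 := hf.lineDeriv_eq_fderiv (v := v)
  have h2 := hg.lineDeriv_eq_fderiv (v := w)
  simp only [dd]
  rw [← h1, ← h2, lineDeriv, lineDeriv]
  exact congrArg (fun F : ℝ → G => deriv F 0) (funext h)

theorem dd_eq_zero_of_line {G : Type*} [NormedAddCommGroup G] [NormedSpace ℝ G] {f : 𝒳 → G}
    {y v : 𝒳} (hf : DifferentiableAt ℝ f y) (h : ∀ t : ℝ, f (y + t • v) = f y) :
    dd v f y = 0 := by
  rw [dd_eq_of_line (g := fun _ : ℝ => f y) (p := 0) (w := 0) hf (differentiableAt_const _) h]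
  simp [dd]

theorem dd_comm {G : Type*} [NormedAddCommGroup G] [NormedSpace ℝ G] {f : 𝒳 → G} {U : Set 𝒳}
    (hU : IsOpen U) (hf : ContDiffOn ℝ ∞ f U) (v w : 𝒳) :
    EqOn (dd v (dd w f)) (dd w (dd v f)) U := fun y hy => by
  have hd := ContDiffOn.diffAt (hf.fderiv_of_isOpen hU (m := ∞) (by simp)) hU hy
  have h1 : ∀ v w, dd v (dd w f) y = fderiv ℝ (fderiv ℝ f) y v w := fun v w => by
    have := (hd.hasFDerivAt.clm_apply (hasFDerivAt_const w y)).fderiv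
    change fderiv ℝ (fun y => fderiv ℝ f y w) y v = _
    rw [this]
    simp
  have hs : IsSymmSndFDerivAt ℝ f y := (hf.contDiffAt (hU.mem_nhds hy)).isSymmSndFDerivAt
    (by simp; exact WithTop.coe_le_coe.2 le_top)
  rw [h1, h1, hs.eq]

theorem SB.of_param_const {F : Frame 𝒳} {s : Set (𝒳 × E)} (c : E → ℂ) (N : ℕ) :
    SB (F.param E) s (fun y => ‖c y.2‖) N 0 (fun y => c y.2) := by
  cases N with
  | zero => intro y _; simp
  | succ N =>
    refine ⟨fun y _ => by simp, fun i => ?_⟩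
    have : dd ((F.param E).dir i) (fun y : 𝒳 × E => c y.2) = fun _ => 0 := by
      funext y
      by_cases hd : DifferentiableAt ℝ (fun y : 𝒳 × E => c y.2) y
      · exact dd_eq_zero_of_line hd fun t => by simp [Frame.param]
      · simp [dd, fderiv_zero_of_not_differentiableAt hd]
    rw [this]
    exact SB.zero.mono_weight fun y _ => norm_nonneg _

variable [FiniteDimensional ℝ 𝒳] [FiniteDimensional ℝ E] [MeasurableSpace E] [BorelSpace E]

/-- Families of weighted functions whose weights are integrable in the parameters. -/
structure IntClass (F : Frame 𝒳) (U : Set 𝒳) (ν : Measure E) (μ : ℝ) (H : 𝒳 × E → ℂ) : Prop where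
  smooth : ContDiff ℝ ∞ H
  bound : ∀ N : ℕ, ∃ w : E → ℝ, Integrable w ν ∧ SB (F.param E) (U ×ˢ univ) (fun y => w y.2) N μ H

/-- The directions of the frame span, by means of linear coordinates. -/
def Frame.Spans (F : Frame 𝒳) : Prop :=
  ∃ (T : Finset F.ι) (c : F.ι → 𝒳 →L[ℝ] ℝ), ∀ v, v = ∑ i ∈ T, c i v • F.dir i

variable {F : Frame 𝒳} {U : Set 𝒳} {ν : Measure E} {μ : ℝ} {H : 𝒳 × E → ℂ}

theorem IntClass.dd (h : IntClass F U ν μ H) (i : F.ι) :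
    IntClass F U ν (μ - F.loss i) (dd (F.dir i, 0) H) where
  smooth := ContDiff.dd h.smooth _
  bound N := (h.bound (N + 1)).imp fun _ hw => ⟨hw.1, hw.2.2 i⟩

theorem IntClass.integrable (h : IntClass F U ν μ H) {y : 𝒳} (hy : y ∈ U) :
    Integrable (fun ζ => H (y, ζ)) ν := by
  obtain ⟨w, hw, hb⟩ := h.bound 0
  refine (hw.mul_const (F.ρ y ^ μ)).mono'
    (h.smooth.continuous.comp (by fun_prop : Continuous fun ζ : E => (y, ζ))).aestronglyMeasurable
    (of_forall fun ζ => hb.bound (y, ζ) ⟨hy, trivial⟩)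

theorem IntClass.exists_bound (h : IntClass F U ν μ H) (hF : F.Spans) (hρ : Continuous F.ρ)
    (hU : IsOpen U) {y : 𝒳} (hy : y ∈ U) : ∃ B : E → ℝ, Integrable B ν ∧
    ∀ᶠ y' in 𝓝 y, ∀ ζ, ‖(fderiv ℝ H (y', ζ)).comp (inl ℝ 𝒳 E)‖ ≤ B ζ := by
  obtain ⟨T, c, hc⟩ := hF
  have hi : ∀ i, ∃ w : E → ℝ, Integrable w ν ∧ ∀ y ∈ U, ∀ ζ,
      ‖fderiv ℝ H (y, ζ) (F.dir i, 0)‖ ≤ w ζ * F.ρ y ^ (μ - F.loss i) := fun i => by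
    obtain ⟨w, hw, hb⟩ := (h.dd i).bound 0
    exact ⟨w, hw, fun y hy ζ => hb.bound (y, ζ) ⟨hy, trivial⟩⟩
  choose w hw hb using hi
  have hcont : ∀ i, ContinuousAt (fun y => F.ρ y ^ (μ - F.loss i)) y := fun i =>
    (hρ.continuousAt).rpow_const (Or.inl (F.ρ_pos y).ne')
  have hev : ∀ᶠ y' in 𝓝 y, y' ∈ U ∧ ∀ i : T, F.ρ y' ^ (μ - F.loss i) ≤ F.ρ y ^ (μ - F.loss i) + 1 :=
    (hU.eventually_mem hy).and (eventually_all.2 fun i =>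
      (hcont i).eventually (eventually_le_nhds (lt_add_one _)))
  refine ⟨fun ζ => ∑ i : T, ‖c i‖ * (w i ζ * (F.ρ y ^ (μ - F.loss i) + 1)),
    integrable_finset_sum _ fun i _ => ((hw i).mul_const _).const_mul _, ?_⟩
  filter_upwards [hev] with y' hy' ζ
  have hw0 : ∀ i, 0 ≤ w i ζ := fun i => by
    have h1 := (norm_nonneg _).trans (hb i y hy ζ)
    exact nonneg_of_mul_nonneg_left h1 (Real.rpow_pos_of_pos (F.ρ_pos y) _)
  refine ContinuousLinearMap.opNorm_le_bound _ (sum_nonneg fun i _ => ?_) fun v => ?_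
  · exact mul_nonneg (norm_nonneg _) (mul_nonneg (hw0 i)
      (add_nonneg (Real.rpow_nonneg (F.ρ_pos y).le _) zero_le_one))
  · have e : (fderiv ℝ H (y', ζ)).comp (inl ℝ 𝒳 E) v =
        ∑ i ∈ T, c i v • fderiv ℝ H (y', ζ) (F.dir i, 0) := by
      have e1 : ((fderiv ℝ H (y', ζ)).comp (inl ℝ 𝒳 E)) v =
          ((fderiv ℝ H (y', ζ)).comp (inl ℝ 𝒳 E)) (∑ i ∈ T, c i v • F.dir i) := by rw [← hc v]
      rw [e1, map_sum]
      refine sum_congr rfl fun i _ => ?_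
      rw [map_smul]; rfl
    rw [e, sum_mul, ← Finset.sum_coe_sort T]
    refine (norm_sum_le _ _).trans (sum_le_sum fun i _ => ?_)
    rw [norm_smul, mul_right_comm]
    exact mul_le_mul ((c i).le_opNorm v) ((hb i y' hy'.1 ζ).trans
      (mul_le_mul_of_nonneg_left (hy'.2 i) (hw0 i))) (norm_nonneg _) (by positivity)

theorem IntClass.continuous_fderiv (h : IntClass F U ν μ H) (y : 𝒳) :
    Continuous fun ζ : E => (fderiv ℝ H (y, ζ)).comp (inl ℝ 𝒳 E) :=
  ((h.smooth.continuous_fderiv (by simp)).comp (by fun_prop)).clm_comp continuous_const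

theorem IntClass.hasFDerivAt (h : IntClass F U ν μ H) (hF : F.Spans) (hρ : Continuous F.ρ)
    (hU : IsOpen U) {y : 𝒳} (hy : y ∈ U) :
    HasFDerivAt (fun y => ∫ ζ, H (y, ζ) ∂ν) (∫ ζ, (fderiv ℝ H (y, ζ)).comp (inl ℝ 𝒳 E) ∂ν) y := by
  obtain ⟨B, hB, hev⟩ := h.exists_bound hF hρ hU hy
  have hdiff : ∀ p, DifferentiableAt ℝ H p := fun p => h.smooth.contDiffAt.differentiableAt (by simp)
  have hmeas : ∀ y, AEStronglyMeasurable (fun ζ => H (y, ζ)) ν := fun y =>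
    (h.smooth.continuous.comp (by fun_prop : Continuous fun ζ : E => (y, ζ))).aestronglyMeasurable
  refine hasFDerivAt_integral_of_dominated_of_fderiv_le hev (of_forall hmeas)
    (h.integrable hy) (F' := fun y ζ => (fderiv ℝ H (y, ζ)).comp (inl ℝ 𝒳 E))
    (h.continuous_fderiv y).aestronglyMeasurable
    (of_forall fun ζ y' hy' => hy' ζ) hB (of_forall fun ζ y' _ => ?_)
  exact (hdiff (y', ζ)).hasFDerivAt.comp (f := fun y => (y, ζ)) y' (hasFDerivAt_prodMk_left y' ζ)

theorem IntClass.dd_integral (h : IntClass F U ν μ H) (hF : F.Spans) (hρ : Continuous F.ρ)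
    (hU : IsOpen U) (i : F.ι) :
    EqOn (PsiDO.dd (F.dir i) (fun y => ∫ ζ, H (y, ζ) ∂ν))
      (fun y => ∫ ζ, PsiDO.dd (F.dir i, 0) H (y, ζ) ∂ν) U := fun y hy => by
  have hd := h.hasFDerivAt hF hρ hU hy
  simp only [PsiDO.dd]
  rw [hd.fderiv]
  obtain ⟨B, hB, hev⟩ := h.exists_bound hF hρ hU hy
  have hint : Integrable (fun ζ => (fderiv ℝ H (y, ζ)).comp (inl ℝ 𝒳 E)) ν :=
    hB.mono' (h.continuous_fderiv y).aestronglyMeasurable (of_forall fun ζ => hev.self_of_nhds ζ)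
  exact ContinuousLinearMap.integral_apply hint (F.dir i)

theorem IntClass.contDiffOn (h : IntClass F U ν μ H) (hF : F.Spans) (hρ : Continuous F.ρ)
    (hU : IsOpen U) : ContDiffOn ℝ ∞ (fun y => ∫ ζ, H (y, ζ) ∂ν) U := by
  refine contDiffOn_infty.2 fun N => ?_
  induction N generalizing μ H with
  | zero =>
    exact contDiffOn_zero.2 fun y hy => (h.hasFDerivAt hF hρ hU hy).continuousAt.continuousWithinAt
  | succ N ih =>
    have hd : DifferentiableOn ℝ (fun y => ∫ ζ, H (y, ζ) ∂ν) U := fun y hy =>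
      (h.hasFDerivAt hF hρ hU hy).differentiableAt.differentiableWithinAt
    refine (contDiffOn_succ_iff_fderiv_of_isOpen hU).2 ⟨hd, fun h => (WithTop.natCast_ne_top N h).elim, ?_⟩
    obtain ⟨T, c, hc⟩ := id hF
    have e : ∀ y ∈ U, fderiv ℝ (fun y => ∫ ζ, H (y, ζ) ∂ν) y =
        ∑ i ∈ T, (c i).smulRight (∫ ζ, PsiDO.dd (F.dir i, 0) H (y, ζ) ∂ν) := fun y hy => by
      ext v
      conv_lhs => rw [hc v]
      rw [map_sum, sum_apply]
      refine sum_congr rfl fun i _ => ?_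
      rw [map_smul]
      exact congrArg (fun q => c i v • q) (h.dd_integral hF hρ hU i hy)
    refine ContDiffOn.congr ?_ e
    refine ContDiffOn.sum fun i _ => ?_
    exact contDiffOn_const.smulRight (ih (h.dd i))

theorem IntClass.sb (h : IntClass F U ν μ H) (hF : F.Spans) (hρ : Continuous F.ρ)
    (hU : IsOpen U) (N : ℕ) {w : E → ℝ} (hw : Integrable w ν)
    (hS : SB (F.param E) (U ×ˢ univ) (fun y => w y.2) N μ H) :
    SB F U (fun _ => ∫ ζ, w ζ ∂ν) N μ (fun y => ∫ ζ, H (y, ζ) ∂ν) := by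
  have key : ∀ (μ : ℝ) (H : 𝒳 × E → ℂ), (∀ y ∈ U ×ˢ (univ : Set E),
      ‖H y‖ ≤ w y.2 * (F.param E).ρ y ^ μ) →
      ∀ y ∈ U, ‖∫ ζ, H (y, ζ) ∂ν‖ ≤ (∫ ζ, w ζ ∂ν) * F.ρ y ^ μ := fun μ H hb y hy => by
    refine (norm_integral_le_of_norm_le (hw.mul_const (F.ρ y ^ μ))
      (of_forall fun ζ => hb (y, ζ) ⟨hy, trivial⟩)).trans_eq ?_
    rw [integral_mul_const]
  induction N generalizing μ H with
  | zero => exact key _ _ hS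
  | succ N ih =>
    exact ⟨key _ _ hS.1, fun i => (ih (h.dd i) (hS.2 i)).congr_open hU subset_rfl
      (h.dd_integral hF hρ hU i).symm⟩

end ParamIntegral

section Expansion

variable {n : ℕ}

/-- The frame of families of symbols depending on a parameter `s` of order `-1`. -/
abbrev frY (n : ℕ) : Frame (ℝ × Ph n) where
  ι := Option (Fin n ⊕ Fin n)
  ρ y := 1 + ‖y.2.2‖
  one_le y := by linarith [norm_nonneg y.2.2]
  dir i := i.elim (1, 0) fun j => (0, (frX n).dir j)
  loss i := i.elim 1 (frX n).loss

/-- The range of the parameter `s`. -/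
def slab (n : ℕ) : Set (ℝ × Ph n) := {y | |y.1| < 2}

theorem isOpen_slab : IsOpen (slab n) := isOpen_lt (by fun_prop) continuous_const

theorem frX_spans : (frX n).Spans := by
  refine ⟨(Finset.univ : Finset (Fin n ⊕ Fin n)), Sum.elim
    (fun i => (EuclideanSpace.proj i).comp (fst ℝ (Rn n) (Rn n)))
    (fun i => (EuclideanSpace.proj i).comp (snd ℝ (Rn n) (Rn n))), fun v => ?_⟩
  rw [Fintype.sum_sum_type]
  ext1
  · simp only [frX, Sum.elim_inl, Sum.elim_inr, Prod.fst_add, Prod.fst_sum, Prod.smul_fst, smul_zero,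
      Finset.sum_const_zero, add_zero]
    exact (sum_coord_smul_eb v.1).symm
  · simp only [frX, Sum.elim_inl, Sum.elim_inr, Prod.snd_add, Prod.snd_sum, Prod.smul_snd, smul_zero,
      Finset.sum_const_zero, zero_add]
    exact (sum_coord_smul_eb v.2).symm

theorem frY_spans : (frY n).Spans := by
  obtain ⟨T, c, hc⟩ := frX_spans (n := n)
  classical
  refine ⟨Finset.insertNone T, fun i => i.elim (fst ℝ ℝ (Ph n))
    fun j => (c j).comp (snd ℝ ℝ (Ph n)), fun v => ?_⟩
  rw [Finset.sum_insertNone]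
  have h := hc v.2
  ext1
  · simp [frY, Prod.fst_sum]
  · simp only [frY, Option.elim_none, Option.elim_some, Prod.snd_add, Prod.snd_sum,
      Prod.smul_snd, smul_zero, zero_add]
    exact h

theorem frY_continuous : Continuous (frY n).ρ := by
  change Continuous fun z : ℝ × Ph n => 1 + ‖z.2.2‖
  fun_prop

/-- Families `J(s, x, ξ)`, `|s| < 2`, of symbols for which `∂_s` lowers the order by one. -/
structure SymFam (μ : ℝ) (J : ℝ × Ph n → ℂ) : Prop where
  smooth : ContDiffOn ℝ ∞ J (slab n)
  bound : ∀ N : ℕ, ∃ C : ℝ, SB (frY n) (slab n) (fun _ => C) N μ J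

variable {μ : ℝ} {J : ℝ × Ph n → ℂ}

theorem SymFam.dir (h : SymFam μ J) (i : Option (Fin n ⊕ Fin n)) :
    SymFam (μ - (frY n).loss i) (dd ((frY n).dir i) J) where
  smooth := ContDiffOn.dd h.smooth isOpen_slab _
  bound N := (h.bound (N + 1)).imp fun _ hC => hC.2 i

theorem SymFam.contDiff_at (h : SymFam μ J) {t : ℝ} (ht : |t| < 2) :
    ContDiff ℝ ∞ (fun z => J (t, z)) := by
  rw [← contDiffOn_univ]
  exact h.smooth.comp (by fun_prop) fun z _ => ht

theorem SymFam.symOn_at (h : SymFam μ J) {t : ℝ} (ht : |t| < 2) :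
    SymOn univ μ (fun z => J (t, z)) := fun N => by
  obtain ⟨C, hC⟩ := h.bound N
  have := SB.comp_affine (F' := frX n) (s' := univ) (inr ℝ ℝ (Ph n))
    ((t, 0) : ℝ × Ph n) hC isOpen_slab subset_rfl h.smooth
    (fun y _ => by simpa [slab] using ht) (fun y _ => hC.weight_nonneg (t, y) ht)
    (fun y => by simp [frX, frY]) (fun j => Or.inr ⟨some j, 1, by simp, (one_smul ℝ _).symm, rfl⟩)
  exact ⟨C, by simpa using this⟩

theorem SymFam.dd_at (h : SymFam μ J) {t : ℝ} (ht : |t| < 2) (v : Ph n) (z : Ph n) :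
    dd v (fun z => J (t, z)) z = dd (0, v) J (t, z) :=
  dd_eq_of_line ((h.contDiff_at ht).contDiffAt.differentiableAt (by simp))
    (ContDiffOn.diffAt h.smooth isOpen_slab ht) fun r => by simp

/-- The derivatives in `s`. -/
def sder (J : ℝ × Ph n → ℂ) (r : ℕ) : ℝ × Ph n → ℂ := (dd (1, 0))^[r] J

theorem SymFam.sder (h : SymFam μ J) (r : ℕ) : SymFam (μ - r) (sder J r) := by
  induction r with
  | zero => simpa [PsiDO.sder] using h
  | succ r ih =>
    have := ih.dir none
    simp only [frY, Option.elim_none] at this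
    rw [PsiDO.sder, Function.iterate_succ_apply']
    change SymFam _ (dd (1, 0) (PsiDO.sder J r))
    rw [show μ - ((r + 1 : ℕ) : ℝ) = μ - r - 1 by push_cast; ring]
    exact this

theorem dd_sder (h : ContDiffOn ℝ ∞ J (slab n)) (v : ℝ × Ph n) (r : ℕ) :
    EqOn (dd v (sder J r)) (sder (dd v J) r) (slab n) := by
  have hsm : ∀ r, ContDiffOn ℝ ∞ (sder J r) (slab n) := fun r => by
    induction r with
    | zero => exact h
    | succ r ih =>
      rw [sder, Function.iterate_succ_apply']
      exact ContDiffOn.dd ih isOpen_slab _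
  induction r with
  | zero => exact fun _ _ => rfl
  | succ r ih =>
    intro y hy
    have e1 := dd_comm isOpen_slab (hsm r) v (1, 0) hy
    have e2 := (dd_congr (v := ((1 : ℝ), (0 : Ph n)))
      (eventuallyEq_of_mem (isOpen_slab.mem_nhds hy) ih)).self_of_nhds
    simp only [sder, Function.iterate_succ_apply'] at e1 e2 ⊢
    rw [e1, e2]

theorem norm_taylor_le {f : ℕ → ℝ → ℂ} {R : ℕ} {C : ℝ}
    (hf : ∀ r < R, ∀ t ∈ Icc (0 : ℝ) 1, HasDerivAt (f r) (f (r + 1) t) t)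
    (hC : ∀ t ∈ Icc (0 : ℝ) 1, ‖f R t‖ ≤ C) :
    ∀ t ∈ Icc (0 : ℝ) 1, ‖f 0 t - ∑ r ∈ range R, ((t ^ r / r.factorial : ℝ) : ℂ) * f r 0‖ ≤ C := by
  induction R generalizing f with
  | zero => simpa using hC
  | succ R ih =>
    have h1 := ih (f := fun r => f (r + 1)) (fun r hr => hf (r + 1) (by omega)) hC
    set g : ℝ → ℂ := fun t =>
      f 0 t - ∑ r ∈ range (R + 1), ((t ^ r / r.factorial : ℝ) : ℂ) * f r 0 with hg
    have hg0 : g 0 = 0 := by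
      simp only [hg]
      rw [sum_range_succ']
      simp
    have hd : ∀ t ∈ Icc (0 : ℝ) 1, HasDerivAt g
        (f 1 t - ∑ r ∈ range R, ((t ^ r / r.factorial : ℝ) : ℂ) * f (r + 1) 0) t := by
      intro t ht
      have hs : HasDerivAt
          (fun t : ℝ => ∑ r ∈ range (R + 1), ((t ^ r / r.factorial : ℝ) : ℂ) * f r 0)
          (∑ r ∈ range (R + 1), (((r : ℝ) * t ^ (r - 1) / r.factorial : ℝ) : ℂ) * f r 0)
          t := by
        refine HasDerivAt.fun_sum fun r _ => ?_
        exact (((hasDerivAt_pow r t).div_const _).ofReal_comp).mul_const _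
      refine ((hf 0 (by omega) t ht).sub hs).congr_deriv ?_
      congr 1
      rw [sum_range_succ']
      simp only [Nat.cast_zero, zero_mul, zero_div, Complex.ofReal_zero, add_zero]
      refine sum_congr rfl fun r _ => ?_
      congr 2
      rw [Nat.factorial_succ, Nat.add_sub_cancel]
      push_cast
      have : ((r : ℝ) + 1) ≠ 0 := by positivity
      have : (r.factorial : ℝ) ≠ 0 := by positivity
      field_simp
    have h2 := norm_image_sub_le_of_norm_deriv_le_segment'
      (fun t ht => (hd t ht).hasDerivWithinAt) fun t ht => h1 t (Set.Ico_subset_Icc_self ht)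
    intro t ht
    have h3 := h2 t ht
    rw [hg0, sub_zero, sub_zero] at h3
    have hC0 : 0 ≤ C := (norm_nonneg _).trans (h1 0 (by simp))
    exact h3.trans (mul_le_of_le_one_right hC0 ht.2)

/-- The remainder of the Taylor expansion of `J` at `s = 0`, evaluated at `s = 1`. -/
def taylorRem (R : ℕ) (J : ℝ × Ph n → ℂ) (z : Ph n) : ℂ :=
  J (1, z) - ∑ r ∈ range R, ((1 / r.factorial : ℝ) : ℂ) * sder J r (0, z)

theorem SymFam.norm_taylorRem_le (h : SymFam μ J) (R : ℕ) :
    ∃ C : ℝ, ∀ z, ‖taylorRem R J z‖ ≤ C * (frX n).ρ z ^ (μ - R) := by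
  obtain ⟨C, hC⟩ := (h.sder R).bound 0
  refine ⟨C, fun z => ?_⟩
  have := norm_taylor_le (f := fun r t => PsiDO.sder J r (t, z)) (R := R)
    (C := C * (frX n).ρ z ^ (μ - R)) (fun r _ t ht => ?_) (fun t ht => ?_) 1 (by simp)
  · simpa [taylorRem, PsiDO.sder] using this
  · have ht' : |t| < 2 := abs_lt.2 ⟨by linarith [ht.1], by linarith [ht.2]⟩
    have hd := (ContDiffOn.diffAt (h.sder r).smooth isOpen_slab
      (show (t, z) ∈ slab n from ht')).hasFDerivAt
    have hl : HasDerivAt (fun t : ℝ => (t, z)) ((1 : ℝ), (0 : Ph n)) t :=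
      (hasDerivAt_id t).prodMk (hasDerivAt_const t z)
    have := hd.comp_hasDerivAt t hl
    have e : PsiDO.sder J (r + 1) (t, z) = fderiv ℝ (PsiDO.sder J r) (t, z) (1, 0) := by
      rw [PsiDO.sder, Function.iterate_succ_apply']; rfl
    rw [e]
    exact this
  · have ht' : |t| < 2 := abs_lt.2 ⟨by linarith [ht.1], by linarith [ht.2]⟩
    exact hC.bound (t, z) ht'

theorem SymFam.contDiff_taylorRem (h : SymFam μ J) (R : ℕ) : ContDiff ℝ ∞ (taylorRem R J) :=
  (h.contDiff_at (by norm_num)).sub (ContDiff.sum fun r _ =>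
    contDiff_const.mul ((h.sder r).contDiff_at (by norm_num)))

theorem SymFam.dd_taylorRem (h : SymFam μ J) (R : ℕ) (v : Ph n) :
    dd v (taylorRem R J) = taylorRem R (dd (0, v) J) := by
  funext z
  have hd : ∀ {μ : ℝ} {J : ℝ × Ph n → ℂ} (_ : SymFam μ J) {t : ℝ}, |t| < 2 →
      DifferentiableAt ℝ (fun z => J (t, z)) z := fun h _ ht =>
    (h.contDiff_at ht).contDiffAt.differentiableAt (by simp)
  have h1 : |(1 : ℝ)| < 2 := by norm_num
  have h0 : |(0 : ℝ)| < 2 := by norm_num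
  have e : dd v (taylorRem R J) z = dd v (fun z => J (1, z)) z -
      ∑ r ∈ range R, ((1 / r.factorial : ℝ) : ℂ) * dd v (fun z => PsiDO.sder J r (0, z)) z := by
    have hF := (hd h h1).hasFDerivAt.fun_sub (HasFDerivAt.fun_sum
      (A := fun r (z : Ph n) => ((1 / r.factorial : ℝ) : ℂ) * PsiDO.sder J r (0, z))
      (u := range R) fun r _ => (hd (h.sder r) h0).hasFDerivAt.const_mul _)
    simp only [dd]
    have := hF.fderiv
    change fderiv ℝ (fun z => J (1, z) - ∑ r ∈ range R, _) z v = _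
    rw [this]
    simp
  rw [e, h.dd_at h1, taylorRem]
  congr 1
  refine sum_congr rfl fun r _ => ?_
  rw [(h.sder r).dd_at h0, dd_sder h.smooth _ r (show ((0 : ℝ), z) ∈ slab n from h0)]

theorem SymFam.symOn_taylorRem (h : SymFam μ J) (R : ℕ) : SymOn univ (μ - R) (taylorRem R J) := by
  refine fun N => ?_
  induction N generalizing μ J with
  | zero =>
    obtain ⟨C, hC⟩ := h.norm_taylorRem_le R
    exact ⟨C, fun z _ => hC z⟩
  | succ N ih =>
    obtain ⟨C, hC⟩ := h.norm_taylorRem_le R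
    have key : ∀ i : Fin n ⊕ Fin n, ∃ C : ℝ, SB (frX n) univ (fun _ => C) N
        (μ - R - (frX n).loss i) (dd ((frX n).dir i) (taylorRem R J)) := fun i => by
      obtain ⟨C, hC⟩ := ih (h.dir (some i))
      refine ⟨C, ?_⟩
      rw [h.dd_taylorRem, sub_right_comm]
      exact hC
    choose K hK using key
    obtain ⟨D, hCD, hD⟩ := exists_upper_bound C K
    exact ⟨D, fun z _ => (hC z).trans (mul_le_mul_of_nonneg_right hCD
      (Real.rpow_nonneg ((frX n).ρ_pos z).le _)), fun i => (hK i).mono_weight fun _ _ => hD i⟩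

end Expansion

/-! ### Oscillating exponentials and the Fourier transform -/

section Fourier

variable {n : ℕ}

/-- The exponential `e^{ir}`. -/
def cis (r : ℝ) : ℂ := Complex.exp (Complex.I * (r : ℂ))

theorem cis_add (r s : ℝ) : cis (r + s) = cis r * cis s := by
  simp only [cis, Complex.ofReal_add, mul_add, Complex.exp_add]

theorem cis_zero : cis 0 = 1 := by simp [cis]

theorem norm_cis (r : ℝ) : ‖cis r‖ = 1 := by rw [cis, mul_comm, Complex.norm_exp_ofReal_mul_I]

theorem contDiff_cis : ContDiff ℝ ∞ cis := by
  unfold cis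
  exact (contDiff_const.mul Complex.ofRealCLM.contDiff).cexp

theorem continuous_cis : Continuous cis := contDiff_cis.continuous

theorem hasDerivAt_cis (r : ℝ) : HasDerivAt cis (Complex.I * cis r) r := by
  have h : HasDerivAt (fun r : ℝ => Complex.I * (r : ℂ)) (Complex.I * 1) r :=
    (Complex.ofRealCLM.hasDerivAt).const_mul _
  refine h.cexp.congr_deriv ?_
  rw [cis]; ring

theorem dd_cis {𝒳 : Type*} [NormedAddCommGroup 𝒳] [NormedSpace ℝ 𝒳] {l : 𝒳 → ℝ} {y : 𝒳}
    (hl : DifferentiableAt ℝ l y) (v : 𝒳) :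
    dd v (fun y => cis (l y)) y = Complex.I * (dd v l y : ℝ) * cis (l y) := by
  have := ((hasDerivAt_cis (l y)).hasFDerivAt.comp y hl.hasFDerivAt).fderiv
  simp only [dd]
  change fderiv ℝ (cis ∘ l) y v = _
  rw [this]
  simp
  ring

/-- The Fourier transform. -/
def ft (f : Rn n → ℂ) (ξ : Rn n) : ℂ := ∫ y, cis (-(inner ℝ y ξ)) * f y

/-- The normalizing factor `(2π)^{-n}`. -/
def cpi (n : ℕ) : ℂ := (((2 * Real.pi) ^ n : ℝ) : ℂ)⁻¹

theorem cpi_mul : cpi n * (((2 * Real.pi) ^ n : ℝ) : ℂ) = 1 :=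
  inv_mul_cancel₀ (by exact_mod_cast (by positivity : (2 * Real.pi) ^ n ≠ 0))

theorem fourier_eq_ft (f : Rn n → ℂ) (w : Rn n) :
    FourierTransform.fourier f w = ft f ((2 * Real.pi) • w) := by
  rw [Real.fourier_eq', ft]
  congr 1; funext v
  rw [smul_eq_mul, cis, inner_smul_right, mul_comm Complex.I]
  congr 3; push_cast; ring

theorem ft_eq_fourier (f : Rn n → ℂ) (ξ : Rn n) :
    ft f ξ = FourierTransform.fourier f ((2 * Real.pi)⁻¹ • ξ) := by
  rw [fourier_eq_ft, smul_smul, mul_inv_cancel₀ (by positivity), one_smul]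

theorem ft_inversion {f : Rn n → ℂ} (hc : Continuous f) (hi : Integrable f)
    (hft : Integrable (ft f)) (x : Rn n) : f x = cpi n * ∫ ξ, cis (inner ℝ x ξ) * ft f ξ := by
  have h2 : (2 * Real.pi) ≠ 0 := by positivity
  have e : FourierTransform.fourier f = fun w => ft f ((2 * Real.pi) • w) :=
    funext fun w => fourier_eq_ft f w
  have hF : Integrable (FourierTransform.fourier f) := by rw [e]; exact hft.comp_smul h2
  have h1 := congrFun (hc.fourierInv_fourier_eq hi hF) x
  rw [← h1, Real.fourierInv_eq', e]
  have e2 : (fun v : Rn n => Complex.exp (((2 * Real.pi * inner ℝ v x : ℝ) : ℂ) * Complex.I) •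
      ft f ((2 * Real.pi) • v)) =
      fun v => (fun ξ => cis (inner ℝ x ξ) * ft f ξ) ((2 * Real.pi) • v) := by
    funext v
    simp only [smul_eq_mul, cis, inner_smul_right, real_inner_comm x v, mul_comm Complex.I]
  rw [e2, Measure.integral_comp_smul volume (fun ξ => cis (inner ℝ x ξ) * ft f ξ), finrank_euclideanSpace_fin, abs_of_pos (by positivity)]
  rw [Complex.real_smul, cpi, Complex.ofReal_inv]

theorem ft_eq_of_inverse {V v : Rn n → ℂ} (hc : Continuous V) (hi : Integrable V)
    (hv : Integrable v) (h : ∀ y, v y = cpi n * ∫ η, cis (inner ℝ y η) * V η) : ft v = V := by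
  have e : ∀ y, ft V (-y) = (((2 * Real.pi) ^ n : ℝ) : ℂ) * v y := fun y => by
    rw [h, ← mul_assoc, mul_comm _ (cpi n), cpi_mul, one_mul, ft]
    simp only [inner_neg_right, neg_neg, real_inner_comm y]
  have hint : Integrable (ft V) := by
    have : Integrable (fun y => ft V (-y)) := by simp only [e]; exact hv.const_mul _
    simpa using this.comp_neg
  funext η
  rw [ft_inversion hc hi hint η, ← integral_neg_eq_self, ← integral_const_mul, ft]
  congr 1; funext y
  rw [e, inner_neg_right, real_inner_comm y η]
  linear_combination -(cis (-inner ℝ y η) * v y) * cpi_mul (n := n)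

end Fourier

section Weights

variable {E : Type*} [NormedAddCommGroup E]

/-- The weight `(1 + |ζ|)^k`. -/
def jb (k : ℝ) (ζ : E) : ℝ := (1 + ‖ζ‖) ^ k

theorem jb_pos (k : ℝ) (ζ : E) : 0 < jb k ζ := Real.rpow_pos_of_pos (by positivity) _

theorem jb_add (k l : ℝ) (ζ : E) : jb (k + l) ζ = jb k ζ * jb l ζ :=
  Real.rpow_add (by positivity) _ _

theorem jb_mono {k l : ℝ} (h : k ≤ l) (ζ : E) : jb k ζ ≤ jb l ζ :=
  Real.rpow_le_rpow_of_exponent_le (by linarith [norm_nonneg ζ]) h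

theorem one_le_jb {k : ℝ} (h : 0 ≤ k) (ζ : E) : 1 ≤ jb k ζ := by simpa [jb] using jb_mono h ζ

theorem norm_le_jb (ζ : E) : ‖ζ‖ ≤ jb 1 ζ := by simp [jb]

end Weights

/-! ### Families with decay in a parameter -/

section Decay

variable {𝒳 : Type*} [NormedAddCommGroup 𝒳] [NormedSpace ℝ 𝒳]
variable {E E' : Type*} [NormedAddCommGroup E] [NormedSpace ℝ E] [NormedAddCommGroup E']
  [NormedSpace ℝ E']
variable {F : Frame 𝒳} {U : Set 𝒳} {μ μ' : ℝ}

theorem SB.exists_succ [Finite F.ι] {G : Type*} [NormedAddCommGroup G] [NormedSpace ℝ G]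
    {s : Set 𝒳} {w : 𝒳 → ℝ} {a : 𝒳 → G} {N : ℕ} (hw : ∀ y ∈ s, 0 ≤ w y)
    (h0 : ∃ C : ℝ, ∀ y ∈ s, ‖a y‖ ≤ C * w y * F.ρ y ^ μ)
    (h : ∀ i, ∃ C : ℝ, SB F s (fun y => C * w y) N (μ - F.loss i) (dd (F.dir i) a)) :
    ∃ C : ℝ, SB F s (fun y => C * w y) (N + 1) μ a := by
  cases nonempty_fintype F.ι
  obtain ⟨C, hC⟩ := h0
  choose K hK using h
  obtain ⟨D, hCD, hD⟩ := exists_upper_bound C K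
  exact ⟨D, fun y hy => (hC y hy).trans (mul_le_mul_of_nonneg_right
    (mul_le_mul_of_nonneg_right hCD (hw y hy)) (Real.rpow_nonneg (F.ρ_pos y).le _)),
    fun i => (hK i).mono_weight fun y hy => mul_le_mul_of_nonneg_right (hD i) (hw y hy)⟩

/-- Families which decrease rapidly in the parameter. -/
structure RD (F : Frame 𝒳) (U : Set 𝒳) (μ : ℝ) (H : 𝒳 × E → ℂ) : Prop where
  smooth : ContDiff ℝ ∞ H
  bound : ∀ N k : ℕ, ∃ C : ℝ, SB (F.param E) (U ×ˢ univ) (fun y => C * jb (-(k : ℝ)) y.2) N μ H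

theorem jb_neg_mul (k k' : ℕ) (ζ : E) :
    jb (-((k + k' : ℕ) : ℝ)) ζ * jb (k' : ℝ) ζ = jb (-(k : ℝ)) ζ := by
  rw [← jb_add]; congr 1; push_cast; ring

/-- Families which grow at most polynomially in the parameter. -/
structure PG (F : Frame 𝒳) (U : Set 𝒳) (μ : ℝ) (H : 𝒳 × E → ℂ) : Prop where
  smooth : ContDiff ℝ ∞ H
  bound : ∀ N : ℕ, ∃ (C : ℝ) (k : ℕ), SB (F.param E) (U ×ˢ univ) (fun y => C * jb (k : ℝ) y.2) N μ H

variable {H : 𝒳 × E → ℂ} {K : 𝒳 × E → ℂ}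

theorem RD.mul_pg (h : RD F U μ H) (h' : PG F U μ' K) (hU : IsOpen U) :
    RD F U (μ + μ') (fun y => H y * K y) :=
  ⟨h.smooth.mul h'.smooth, fun N k => by
    obtain ⟨C', k', hK⟩ := h'.bound N
    obtain ⟨C, hH⟩ := h.bound N (k + k')
    refine ⟨2 ^ N * (C * C'), (hH.mul hK (hU.prod isOpen_univ) subset_rfl h.smooth.contDiffOn
      h'.smooth.contDiffOn).mono_weight fun y _ => le_of_eq ?_⟩
    rw [← jb_neg_mul k k']; ring⟩

theorem SB.lift_param {w : E → ℝ} {N : ℕ} (T : E' →L[ℝ] E) (hU : IsOpen U)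
    (h : SB (F.param E) (U ×ˢ univ) (fun y => w y.2) N μ H) (hH : ContDiff ℝ ∞ H) :
    SB (F.param E') (U ×ˢ univ) (fun y => w (T y.2)) N μ (fun y => H (y.1, T y.2)) := by
  have := SB.comp_affine (F' := F.param E') (s' := U ×ˢ (univ : Set E'))
    ((fst ℝ 𝒳 E').prod (T.comp (snd ℝ 𝒳 E'))) 0 h
    (hU.prod isOpen_univ) subset_rfl hH.contDiffOn (fun y hy => by simpa using hy.1)
    (fun y hy => h.weight_nonneg _ (by simpa using hy.1)) (fun y => by simp)
    (fun j => Or.inr ⟨j, 1, by simp, by simp, rfl⟩)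
  simpa using this

theorem integrable_jb [FiniteDimensional ℝ E] [MeasurableSpace E] [BorelSpace E]
    (ν : Measure E) [ν.IsAddHaarMeasure] {k : ℝ} (hk : (finrank ℝ E : ℝ) < k) :
    Integrable (fun ζ : E => jb (-k) ζ) ν := integrable_one_add_norm hk

theorem RD.intClass [FiniteDimensional ℝ 𝒳] [FiniteDimensional ℝ E] [MeasurableSpace E]
    [BorelSpace E] (h : RD F U μ H) (ν : Measure E) [ν.IsAddHaarMeasure] :
    IntClass F U ν μ H where
  smooth := h.smooth
  bound N := by
    obtain ⟨C, hC⟩ := h.bound N (finrank ℝ E + 1)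
    exact ⟨_, (integrable_jb ν (by push_cast; linarith)).const_mul C, hC⟩

theorem pg_cis [Finite F.ι] (l : 𝒳 →L[ℝ] E →L[ℝ] ℝ) (hl : ∀ i, F.loss i = 0 ∨ l (F.dir i) = 0)
    : PG F U 0 (fun y : 𝒳 × E => cis (l y.1 y.2)) := by
  have hsm : ContDiff ℝ ∞ fun y : 𝒳 × E => l y.1 y.2 :=
    (l.contDiff.comp contDiff_fst).clm_apply contDiff_snd
  have hcs : ContDiff ℝ ∞ fun y : 𝒳 × E => cis (l y.1 y.2) := contDiff_cis.comp hsm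
  refine ⟨hcs, fun N => ?_⟩
  have key : ∃ C : ℝ, SB (F.param E) univ (fun y => C * jb (N : ℝ) y.2) N 0
      (fun y : 𝒳 × E => cis (l y.1 y.2)) := by
    induction N with
    | zero => exact ⟨1, fun y _ => by simp [norm_cis, jb]⟩
    | succ N ih =>
      obtain ⟨C, hC⟩ := ih
      haveI : Finite (F.param E).ι := inferInstanceAs (Finite F.ι)
      refine SB.exists_succ (fun y _ => (jb_pos _ _).le) ⟨1, fun y _ => ?_⟩ fun i => ?_
      · simp only [norm_cis, Real.rpow_zero, mul_one, one_mul]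
        exact one_le_jb (by positivity) _
      · have e : PsiDO.dd ((F.param E).dir i) (fun y : 𝒳 × E => cis (l y.1 y.2)) =
            fun y => (Complex.I * (l (F.dir i) y.2 : ℝ)) * cis (l y.1 y.2) := by
          funext y
          rw [dd_cis (hsm.contDiffAt.differentiableAt (by simp))]
          have h2 : PsiDO.dd ((F.param E).dir i) (fun y : 𝒳 × E => l y.1 y.2) y =
              l (F.dir i) y.2 := by
            have h3 : HasFDerivAt (fun y : 𝒳 × E => l y.1 y.2) _ y :=
              (l.hasFDerivAt.comp y hasFDerivAt_fst).clm_apply hasFDerivAt_snd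
            simp only [PsiDO.dd, h3.fderiv]
            simp [Frame.param]
          rw [h2]
        rw [e]
        rcases hl i with h0 | h0
        · have h1 := (SB.of_param_const (F := F) (s := univ)
            (fun ζ : E => Complex.I * (l (F.dir i) ζ : ℝ)) N).mul hC isOpen_univ subset_rfl
              (contDiff_const.mul (Complex.ofRealCLM.contDiff.comp
                ((l (F.dir i)).contDiff.comp contDiff_snd))).contDiffOn hcs.contDiffOn
          rw [add_zero] at h1
          have h0' : (F.param E).loss i = 0 := h0
          rw [h0', sub_zero]
          refine ⟨2 ^ N * (‖l (F.dir i)‖ * |C|), h1.mono_weight fun y _ => ?_⟩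
          have h3 : ‖Complex.I * ((l (F.dir i) y.2 : ℝ) : ℂ)‖ ≤ ‖l (F.dir i)‖ * jb 1 y.2 := by
            rw [norm_mul, Complex.norm_I, one_mul, Complex.norm_real]
            exact ((l (F.dir i)).le_opNorm _).trans
              (mul_le_mul_of_nonneg_left (norm_le_jb _) (norm_nonneg _))
          have h4 : C * jb (N : ℝ) y.2 ≤ |C| * jb (N : ℝ) y.2 :=
            mul_le_mul_of_nonneg_right (le_abs_self _) (jb_pos _ _).le
          have h5 := mul_le_mul h3 h4 (hC.weight_nonneg y trivial)
            (mul_nonneg (norm_nonneg _) (jb_pos _ _).le)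
          rw [mul_assoc (2 ^ N)]
          refine mul_le_mul_of_nonneg_left (h5.trans_eq ?_) (by positivity)
          rw [show ((N + 1 : ℕ) : ℝ) = 1 + (N : ℝ) by push_cast; ring, jb_add]
          ring
        · refine ⟨0, ?_⟩
          simp only [h0, zero_mul, zero_apply, Complex.ofReal_zero, mul_zero]
          exact SB.zero
  obtain ⟨C, hC⟩ := key
  exact ⟨C, N, hC.mono_set (Set.subset_univ _)⟩

end Decay

/-! ### Shifting the frequency variable by a parameter -/

section Shift

variable {n : ℕ} {E : Type*} [NormedAddCommGroup E] [NormedSpace ℝ E]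

theorem peetre {V : Type*} [NormedAddCommGroup V] (μ : ℝ) (x y : V) :
    (1 + ‖x + y‖) ^ μ ≤ (1 + ‖x‖) ^ μ * (1 + ‖y‖) ^ |μ| := by
  have key : ∀ x y : V, 1 + ‖x + y‖ ≤ (1 + ‖x‖) * (1 + ‖y‖) := fun x y => by
    nlinarith [norm_add_le x y, mul_nonneg (norm_nonneg x) (norm_nonneg y)]
  rcases le_or_gt 0 μ with h | h
  · rw [abs_of_nonneg h, ← Real.mul_rpow (by positivity) (by positivity)]
    exact Real.rpow_le_rpow (by positivity) (key x y) h
  · have h1 := key (x + y) (-y)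
    rw [add_neg_cancel_right, norm_neg] at h1
    have h2 := Real.rpow_le_rpow_of_nonpos (by positivity) h1 h.le
    rw [Real.mul_rpow (by positivity) (by positivity)] at h2
    rw [abs_of_neg h]
    calc (1 + ‖x + y‖) ^ μ = (1 + ‖x + y‖) ^ μ * (1 + ‖y‖) ^ μ * (1 + ‖y‖) ^ (-μ) := by
          rw [mul_assoc, ← Real.rpow_add (by positivity)]; simp
      _ ≤ _ := mul_le_mul_of_nonneg_right h2 (by positivity)

/-- The shift of the frequency variable. -/
def shiftArg (L : E →L[ℝ] Rn n) (y : (ℝ × Ph n) × E) : Ph n × E :=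
  ((y.1.2.1, y.1.2.2 + y.1.1 • L y.2), y.2)

theorem contDiff_shiftArg (L : E →L[ℝ] Rn n) : ContDiff ℝ ∞ (shiftArg L) := by
  unfold shiftArg
  have : ContDiff ℝ ∞ fun y : (ℝ × Ph n) × E => L y.2 := L.contDiff.comp contDiff_snd
  fun_prop

theorem peetre_shift (L : E →L[ℝ] Rn n) (μ : ℝ) : ∃ (D : ℝ) (k : ℕ), 0 ≤ D ∧
    ∀ y : (ℝ × Ph n) × E, |y.1.1| < 2 →
      (1 + ‖y.1.2.2 + y.1.1 • L y.2‖) ^ μ ≤ D * jb (k : ℝ) y.2 * (1 + ‖y.1.2.2‖) ^ μ := by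
  refine ⟨(1 + 2 * ‖L‖) ^ (⌈|μ|⌉₊ : ℝ), ⌈|μ|⌉₊, by positivity, fun y hy => ?_⟩
  refine (peetre μ _ _).trans ?_
  rw [mul_comm]
  refine mul_le_mul_of_nonneg_right ?_ (by positivity)
  have h1 : 1 + ‖y.1.1 • L y.2‖ ≤ (1 + 2 * ‖L‖) * (1 + ‖y.2‖) := by
    rw [norm_smul, Real.norm_eq_abs]
    have := mul_le_mul hy.le (L.le_opNorm y.2) (norm_nonneg _) zero_le_two
    nlinarith [norm_nonneg L, norm_nonneg y.2]
  calc (1 + ‖y.1.1 • L y.2‖) ^ |μ| ≤ (1 + ‖y.1.1 • L y.2‖) ^ (⌈|μ|⌉₊ : ℝ) :=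
        Real.rpow_le_rpow_of_exponent_le (by linarith [norm_nonneg (y.1.1 • L y.2)]) (Nat.le_ceil _)
    _ ≤ ((1 + 2 * ‖L‖) * (1 + ‖y.2‖)) ^ (⌈|μ|⌉₊ : ℝ) :=
        Real.rpow_le_rpow (by positivity) h1 (by positivity)
    _ = _ := by rw [Real.mul_rpow (by positivity) (by positivity), jb]

theorem dd_shift_none {g : Ph n × E → ℂ} (hg : ContDiff ℝ ∞ g) (L : E →L[ℝ] Rn n) :
    dd (((frY n).param E).dir none) (fun y => g (shiftArg L y)) =
      fun y => ∑ i, ((L y.2 i : ℝ) : ℂ) *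
        dd (((frX n).param E).dir (Sum.inr i)) g (shiftArg L y) := by
  funext y
  rw [dd_eq_of_line (f := fun y => g (shiftArg L y)) (g := g) (p := shiftArg L y) (w := ((0, L y.2), 0))
    ((hg.comp (contDiff_shiftArg L)).contDiffAt.differentiableAt (by simp))
    (hg.contDiffAt.differentiableAt (by simp)) fun t => ?_]
  · have e : (((0, L y.2), 0) : Ph n × E) =
        ∑ i, (L y.2 i) • (((frX n).param E).dir (Sum.inr i)) := by
      have : L y.2 = ∑ i, L y.2 i • eb i := (sum_coord_smul_eb _).symm
      ext1
      · ext1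
        · simp [Prod.fst_sum]
        · simp only [Prod.fst_sum, Prod.snd_sum, Prod.smul_fst, Prod.smul_snd, Sum.elim_inr]
          exact this
      · simp [Prod.snd_sum]
    simp only [dd]
    rw [e, map_sum]
    exact sum_congr rfl fun i _ => by rw [map_smul, Complex.real_smul]
  · congr 1
    simp [shiftArg, add_smul, add_assoc]

theorem dd_shift_some {g : Ph n × E → ℂ} (hg : ContDiff ℝ ∞ g) (L : E →L[ℝ] Rn n)
    (j : Fin n ⊕ Fin n) :
    dd (((frY n).param E).dir (some j)) (fun y => g (shiftArg L y)) =
      fun y => dd (((frX n).param E).dir j) g (shiftArg L y) := by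
  funext y
  refine dd_eq_of_line ((hg.comp (contDiff_shiftArg L)).contDiffAt.differentiableAt (by simp))
    (hg.contDiffAt.differentiableAt (by simp)) fun t => ?_
  congr 1
  rcases j with j | j
  · simp [shiftArg]
  · simp [shiftArg]
    abel

theorem SB.shift (L : E →L[ℝ] Rn n) (N : ℕ) (μ : ℝ) : ∃ (D : ℝ) (k : ℕ), 0 ≤ D ∧
    ∀ (w : E → ℝ) (g : Ph n × E → ℂ), ContDiff ℝ ∞ g →
      SB ((frX n).param E) univ (fun y => w y.2) N μ g →
      SB ((frY n).param E) (slab n ×ˢ univ) (fun y => D * jb (k : ℝ) y.2 * w y.2) N μ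
        (fun y => g (shiftArg L y)) := by
  have key : ∀ μ : ℝ, ∃ (D : ℝ) (k : ℕ), 0 ≤ D ∧ ∀ (w : E → ℝ) (g : Ph n × E → ℂ),
      (∀ y, ‖g y‖ ≤ w y.2 * ((frX n).param E).ρ y ^ μ) → ∀ y ∈ slab n ×ˢ (univ : Set E),
      ‖g (shiftArg L y)‖ ≤ D * jb (k : ℝ) y.2 * w y.2 * ((frY n).param E).ρ y ^ μ := by
    intro μ
    obtain ⟨D, k, hD, h⟩ := peetre_shift L μ
    refine ⟨D, k, hD, fun w g hg y hy => (hg _).trans ?_⟩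
    have hw : 0 ≤ w y.2 := by
      have := (norm_nonneg _).trans (hg ((0, 0), y.2))
      exact nonneg_of_mul_nonneg_left this (Real.rpow_pos_of_pos (((frX n).param E).ρ_pos _) _)
    have := mul_le_mul_of_nonneg_left (h y hy.1) hw
    refine this.trans_eq ?_
    change w y.2 * _ = _ * (1 + ‖y.1.2.2‖) ^ μ
    ring
  induction N generalizing μ with
  | zero =>
    obtain ⟨D, k, hD, h⟩ := key μ
    exact ⟨D, k, hD, fun w g _ hb => h w g fun y => hb y trivial⟩
  | succ N ih =>
    obtain ⟨D0, k0, hD0, h0⟩ := key μ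
    obtain ⟨D1, k1, hD1, h1⟩ := ih μ
    obtain ⟨D2, k2, hD2, h2⟩ := ih (μ - 1)
    have hn : (0 : ℝ) ≤ n * (2 ^ N * (‖L‖ * D2)) := by positivity
    refine ⟨D0 + D1 + D2 + n * (2 ^ N * (‖L‖ * D2)), k0 + k1 + k2 + 1, by positivity,
      fun w g hg hb => ?_⟩
    have hw : ∀ ζ, 0 ≤ w ζ := fun ζ => hb.weight_nonneg ((0, 0), ζ) trivial
    have hjb : ∀ (ζ : E) {k : ℕ}, k ≤ k0 + k1 + k2 + 1 →
        jb (k : ℝ) ζ ≤ jb ((k0 + k1 + k2 + 1 : ℕ) : ℝ) ζ :=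
      fun ζ k hk => jb_mono (Nat.cast_le.2 hk) ζ
    have mono : ∀ {D : ℝ} {k : ℕ} (ζ : E), 0 ≤ D → k ≤ k0 + k1 + k2 + 1 →
        D ≤ D0 + D1 + D2 + n * (2 ^ N * (‖L‖ * D2)) → D * jb (k : ℝ) ζ * w ζ ≤
        (D0 + D1 + D2 + n * (2 ^ N * (‖L‖ * D2))) * jb ((k0 + k1 + k2 + 1 : ℕ) : ℝ) ζ * w ζ :=
      fun {D k} ζ hD hk hle => mul_le_mul_of_nonneg_right (mul_le_mul hle (hjb ζ hk)
        (jb_pos _ _).le (hD.trans hle)) (hw ζ)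
    refine ⟨fun y hy => ?_, fun i => ?_⟩
    · refine (h0 w g (fun y => hb.bound y trivial) y hy).trans (mul_le_mul_of_nonneg_right ?_
        (Real.rpow_nonneg (((frY n).param E).ρ_pos y).le _))
      exact mono y.2 hD0 (by omega) (by linarith)
    · rcases i with _ | j
      · rw [dd_shift_none hg]
        have hg' : ∀ i, ContDiff ℝ ∞ (dd (((frX n).param E).dir (Sum.inr i)) g) := fun i =>
          ContDiff.dd hg _
        have hgs : ∀ i, ContDiff ℝ ∞ fun y =>
            dd (((frX n).param E).dir (Sum.inr i)) g (shiftArg L y) := fun i =>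
          (hg' i).comp (contDiff_shiftArg L)
        have hc : ∀ i, ContDiff ℝ ∞ fun y : (ℝ × Ph n) × E => ((L y.2 i : ℝ) : ℂ) := fun i =>
          Complex.ofRealCLM.contDiff.comp (((EuclideanSpace.proj i).comp L).contDiff.comp
            contDiff_snd)
        have h3 := SB.sum Finset.univ (fun i _ => SB.mul
          (SB.of_param_const (F := frY n) (s := slab n ×ˢ (univ : Set E))
            (fun ζ : E => ((L ζ i : ℝ) : ℂ)) N)
          (h2 w _ (hg' i) (hb.2 (Sum.inr i))) (isOpen_slab.prod isOpen_univ) subset_rfl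
          (hc i).contDiffOn (hgs i).contDiffOn) (isOpen_slab.prod isOpen_univ) subset_rfl
          fun i _ => ((hc i).mul (hgs i)).contDiffOn
        rw [zero_add] at h3
        refine h3.mono_weight fun y _ => ?_
        have h4 : ∀ i, ‖((L y.2 i : ℝ) : ℂ)‖ ≤ ‖L‖ * jb 1 y.2 := fun i => by
          rw [Complex.norm_real]
          exact (PiLp.norm_apply_le _ i).trans ((L.le_opNorm _).trans
            (mul_le_mul_of_nonneg_left (norm_le_jb _) (norm_nonneg _)))
        calc _ ≤ ∑ i : Fin n, 2 ^ N * ((‖L‖ * jb 1 y.2) * (D2 * jb (k2 : ℝ) y.2 * w y.2)) :=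
              sum_le_sum fun i _ => mul_le_mul_of_nonneg_left
                (mul_le_mul_of_nonneg_right (h4 i) (mul_nonneg (mul_nonneg hD2 (jb_pos _ _).le)
                  (hw _))) (by positivity)
          _ = (n * (2 ^ N * (‖L‖ * D2))) * jb ((k2 + 1 : ℕ) : ℝ) y.2 * w y.2 := by
              rw [sum_const, Finset.card_univ, Fintype.card_fin, nsmul_eq_mul]
              push_cast
              rw [jb_add]; ring
          _ ≤ _ := mono y.2 hn (by omega) (by linarith)
      · rw [dd_shift_some hg]
        rcases j with j | j
        · have := h1 w _ (ContDiff.dd hg _) (by simpa using (hb.2 (Sum.inl j)).of_le le_rfl)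
          simp only [Option.elim_some, Sum.elim_inl, sub_zero] at this ⊢
          exact this.mono_weight fun y _ => mono y.2 hD1 (by omega) (by linarith)
        · have := h2 w _ (ContDiff.dd hg _) (hb.2 (Sum.inr j))
          exact this.mono_weight fun y _ => mono y.2 hD2 (by omega) (by linarith)

variable {μ : ℝ} {g : Ph n × E → ℂ}

theorem RD.shift (h : RD (frX n) univ μ g) (L : E →L[ℝ] Rn n) :
    RD (frY n) (slab n) μ (fun y => g (shiftArg L y)) where
  smooth := h.smooth.comp (contDiff_shiftArg L)
  bound N k := by
    obtain ⟨D, k', hD, hsh⟩ := SB.shift L N μ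
    obtain ⟨C, hC⟩ := h.bound N (k + k')
    refine ⟨D * C, (hsh (fun ζ => C * jb (-((k + k' : ℕ) : ℝ)) ζ) g h.smooth
      (by simpa using hC)).mono_weight fun y _ => le_of_eq ?_⟩
    rw [← jb_neg_mul k k']; ring

theorem PG.shift (h : PG (frX n) univ μ g) (L : E →L[ℝ] Rn n) :
    PG (frY n) (slab n) μ (fun y => g (shiftArg L y)) where
  smooth := h.smooth.comp (contDiff_shiftArg L)
  bound N := by
    obtain ⟨D, k', hD, hsh⟩ := SB.shift L N μ
    obtain ⟨C, k, hC⟩ := h.bound N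
    refine ⟨D * C, k' + k, (hsh (fun ζ => C * jb (k : ℝ) ζ) g h.smooth
      (by simpa using hC)).mono_weight fun y _ => le_of_eq ?_⟩
    rw [show ((k' + k : ℕ) : ℝ) = (k' : ℝ) + k by push_cast; ring, jb_add]; ring

end Shift

/-! ### Partial Fourier transforms -/

section Partial

variable {n : ℕ}

/-- The frame of functions on `T^*ℝⁿ × ℝⁿ`, with the weight of the first factor. -/
abbrev frP (n : ℕ) : Frame (Ph n × Rn n) where
  ι := (Fin n ⊕ Fin n) ⊕ Fin n
  ρ y := 1 + ‖y.1.2‖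
  one_le y := by linarith [norm_nonneg y.1.2]
  dir := Sum.elim (fun i => ((frX n).dir i, 0)) fun j => (0, eb j)
  loss := Sum.elim (frX n).loss fun _ => 0

theorem frP_spans : (frP n).Spans := by
  obtain ⟨T, c, hc⟩ := frX_spans (n := n)
  refine ⟨T.disjSum Finset.univ, Sum.elim (fun i => (c i).comp (fst ℝ (Ph n) (Rn n)))
    (fun i => (EuclideanSpace.proj i).comp (snd ℝ (Ph n) (Rn n))), fun v => ?_⟩
  rw [Finset.sum_disjSum]
  ext1
  · simp only [Sum.elim_inl, Sum.elim_inr, Prod.fst_add, Prod.fst_sum, Prod.smul_fst, smul_zero,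
      Finset.sum_const_zero, add_zero]
    exact hc v.1
  · simp only [Sum.elim_inl, Sum.elim_inr, Prod.snd_add, Prod.snd_sum, Prod.smul_snd, smul_zero,
      Finset.sum_const_zero, zero_add]
    exact (sum_coord_smul_eb v.2).symm

theorem frP_continuous : Continuous (frP n).ρ := by
  change Continuous fun z : Ph n × Rn n => 1 + ‖z.1.2‖
  fun_prop

/-- Symbols depending on a further variable, with compact support in it. -/
structure TC (μ : ℝ) (f : Ph n × Rn n → ℂ) : Prop where
  smooth : ContDiff ℝ ∞ f
  supp : ∃ R : ℝ, ∀ y : Ph n × Rn n, R < ‖y.2‖ → f y = 0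
  bound : ∀ N : ℕ, ∃ C : ℝ, SB (frP n) univ (fun _ => C) N μ f

variable {μ : ℝ} {f : Ph n × Rn n → ℂ}

theorem TC.dir (h : TC μ f) (i : (frP n).ι) : TC (μ - (frP n).loss i) (dd ((frP n).dir i) f) where
  smooth := ContDiff.dd h.smooth _
  supp := by
    obtain ⟨R, hR⟩ := h.supp
    refine ⟨R, fun y hy => ?_⟩
    have : f =ᶠ[𝓝 y] fun _ => 0 := by
      filter_upwards [(isOpen_lt continuous_const (continuous_snd.norm)).mem_nhds hy] with z hz
      exact hR z hz
    rw [(dd_congr this).self_of_nhds]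
    simp [dd]
  bound N := (h.bound (N + 1)).imp fun _ hC => hC.2 i

/-- The partial Fourier transform in the last variable. -/
def pft (f : Ph n × Rn n → ℂ) (y : Ph n × Rn n) : ℂ := ft (fun t => f (y.1, t)) y.2

/-- The integrand of the partial Fourier transform. -/
def pftKer (f : Ph n × Rn n → ℂ) (q : (Ph n × Rn n) × Rn n) : ℂ :=
  cis (-(inner ℝ q.2 q.1.2)) * f (q.1.1, q.2)

theorem pft_eq (f : Ph n × Rn n → ℂ) (y : Ph n × Rn n) : pft f y = ∫ t, pftKer f (y, t) := rfl

theorem TC.intClass (h : TC μ f) : IntClass (frP n) univ volume μ (pftKer f) := by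
  have hcs : PG (frP n) univ 0 (fun q : (Ph n × Rn n) × Rn n => cis (-(inner ℝ q.2 q.1.2))) := by
    have := pg_cis (F := frP n) (U := univ) (-((innerSL ℝ).comp (snd ℝ (Ph n) (Rn n))) :
        (Ph n × Rn n) →L[ℝ] (Rn n) →L[ℝ] ℝ) (fun i => by
        rcases i with (i | i) | i
        · left; rfl
        · right; ext v; simp
        · left; rfl)
    have e : (fun q : (Ph n × Rn n) × Rn n => cis (-(inner ℝ q.2 q.1.2))) =
        fun q => cis ((-((innerSL ℝ).comp (snd ℝ (Ph n) (Rn n))) :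
          (Ph n × Rn n) →L[ℝ] (Rn n) →L[ℝ] ℝ) q.1 q.2) := by
      funext q
      rw [real_inner_comm]; rfl
    rw [e]; exact this
  have hf2 : ContDiff ℝ ∞ fun q : (Ph n × Rn n) × Rn n => f (q.1.1, q.2) :=
    h.smooth.comp (by fun_prop)
  refine ⟨hcs.smooth.mul hf2, fun N => ?_⟩
  obtain ⟨C, hC⟩ := h.bound N
  obtain ⟨C', k, hC'⟩ := hcs.bound N
  obtain ⟨R, hR⟩ := h.supp
  have h1 := SB.comp_affine (F' := (frP n).param (Rn n)) (s' := univ)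
    (((fst ℝ (Ph n) (Rn n)).comp (fst ℝ (Ph n × Rn n) (Rn n))).prod
      (snd ℝ (Ph n × Rn n) (Rn n))) 0 hC isOpen_univ subset_rfl
      h.smooth.contDiffOn (fun _ _ => trivial) (fun y _ => hC.weight_nonneg 0 trivial)
      (fun y => by simp) (fun j => by
        rcases j with j | j
        · exact Or.inr ⟨Sum.inl j, 1, by simp, by simp, rfl⟩
        · left; simp)
  simp only [ContinuousLinearMap.prod_apply, ContinuousLinearMap.comp_apply,
    ContinuousLinearMap.coe_fst', ContinuousLinearMap.coe_snd', add_zero] at h1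
  rw [Set.univ_prod_univ] at hC' ⊢
  have h2 := hC'.mul h1 isOpen_univ subset_rfl hcs.smooth.contDiffOn hf2.contDiffOn
  rw [zero_add] at h2
  refine ⟨Set.indicator (closedBall 0 R) fun t => 2 ^ N * (C' * jb (k : ℝ) t * C), ?_, ?_⟩
  · rw [integrable_indicator_iff Metric.isClosed_closedBall.measurableSet]
    refine ContinuousOn.integrableOn_compact (isCompact_closedBall _ _) (Continuous.continuousOn ?_)
    unfold jb
    have : Continuous fun t : Rn n => (1 + ‖t‖) ^ (k : ℝ) :=
      (by fun_prop : Continuous fun t : Rn n => 1 + ‖t‖).rpow_const fun t => Or.inl (by positivity)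
    fun_prop
  · refine SB.of_singletons fun y _ => ?_
    by_cases hy : ‖y.2‖ ≤ R
    · refine (h2.mono_set (Set.subset_univ {y})).mono_weight fun z hz => ?_
      obtain rfl : z = y := hz
      rw [indicator_of_mem (by simpa using hy)]
    · have : (fun _ => 0) =ᶠ[𝓝 y] pftKer f := by
        filter_upwards [(isOpen_lt continuous_const (continuous_snd.norm)).mem_nhds
          (not_le.1 hy)] with z hz
        simp only [pftKer]
        rw [hR (z.1.1, z.2) hz, mul_zero]
      refine ((SB.zero.congr fun z hz => ?_) : SB _ _ (fun _ => 0) _ _ _).mono_weight fun z hz => ?_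
      · obtain rfl : z = y := hz
        exact this
      · obtain rfl : z = y := hz
        rw [indicator_of_notMem (by simpa using hy)]

theorem TC.contDiff_pft (h : TC μ f) : ContDiff ℝ ∞ (pft f) := by
  rw [← contDiffOn_univ]
  exact h.intClass.contDiffOn frP_spans frP_continuous isOpen_univ

theorem TC.dd_pft (h : TC μ f) (i : Fin n ⊕ Fin n) :
    dd ((frX n).dir i, 0) (pft f) = pft (dd ((frX n).dir i, 0) f) := by
  funext y
  have := h.intClass.dd_integral frP_spans frP_continuous isOpen_univ (Sum.inl i) (Set.mem_univ y)
  refine this.trans ?_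
  rw [pft_eq]
  refine integral_congr_ae (of_forall fun t => ?_)
  have hd : DifferentiableAt ℝ (fun q : (Ph n × Rn n) × Rn n => cis (-(inner ℝ q.2 q.1.2))) (y, t) :=
    (contDiff_cis.comp (contDiff_snd.inner ℝ (contDiff_snd.comp contDiff_fst)).neg).contDiffAt.differentiableAt
      (by simp)
  have hf2 : ContDiff ℝ ∞ fun q : (Ph n × Rn n) × Rn n => f (q.1.1, q.2) :=
    h.smooth.comp (by fun_prop)
  have hd2 := hf2.contDiffAt.differentiableAt (x := (y, t)) (by simp)
  have e : pftKer f = fun q : (Ph n × Rn n) × Rn n => cis (-(inner ℝ q.2 q.1.2)) * f (q.1.1, q.2) := rfl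
  have h0 : dd ((((frX n).dir i, 0), 0) : (Ph n × Rn n) × Rn n)
      (fun q : (Ph n × Rn n) × Rn n => cis (-(inner ℝ q.2 q.1.2))) (y, t) = 0 :=
    dd_eq_zero_of_line hd fun r => by simp
  have h1 : dd ((((frX n).dir i, 0), 0) : (Ph n × Rn n) × Rn n)
      (fun q : (Ph n × Rn n) × Rn n => f (q.1.1, q.2)) (y, t) = dd ((frX n).dir i, 0) f (y.1, t) :=
    dd_eq_of_line hd2 (h.smooth.contDiffAt.differentiableAt (by simp)) fun r => by simp
  change dd ((((frX n).dir i, 0), 0) : (Ph n × Rn n) × Rn n) (pftKer f) (y, t) = _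
  rw [e]
  simp only [dd] at h0 h1 ⊢
  rw [fderiv_fun_mul hd hd2]
  simp only [add_apply, smul_apply, smul_eq_mul, h0, h1, mul_zero, add_zero]
  rfl

theorem TC.hasCompactSupport (h : TC μ f) (p : Ph n) : HasCompactSupport fun t => f (p, t) := by
  obtain ⟨R, hR⟩ := h.supp
  refine HasCompactSupport.of_support_subset_isCompact (isCompact_closedBall (0 : Rn n) R) fun t ht => ?_
  by_contra hc
  exact ht (hR (p, t) (by simpa using hc))

theorem ft_fderiv {g : Rn n → ℂ} (hs : ContDiff ℝ ∞ g) (hcs : HasCompactSupport g) (j : Fin n)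
    (v : Rn n) : ft (dd (eb j) g) v = Complex.I * (v j : ℝ) * ft g v := by
  have hl : ContDiff ℝ ∞ fun t : Rn n => -(inner ℝ t v) := (contDiff_id.inner ℝ contDiff_const).neg
  have he : ContDiff ℝ ∞ fun t : Rn n => cis (-(inner ℝ t v)) := contDiff_cis.comp hl
  have e2 : ∀ t, fderiv ℝ (fun t : Rn n => cis (-(inner ℝ t v))) t (eb j) =
      -(Complex.I * (v j : ℝ) * cis (-(inner ℝ t v))) := fun t => by
    have := dd_cis (hl.contDiffAt.differentiableAt (x := t) (by simp)) (eb j)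
    have h3 : dd (eb j) (fun t : Rn n => -(inner ℝ t v)) t = -(v j) := by
      have h4 : HasFDerivAt (fun t : Rn n => -(inner ℝ t v)) (-(innerSL ℝ v)) t := by
        have := (innerSL ℝ v).hasFDerivAt (x := t)
        refine this.neg.congr_of_eventuallyEq (of_forall fun t => ?_)
        simp [real_inner_comm]
      simp only [dd, h4.fderiv]
      simp [eb, EuclideanSpace.inner_single_right]
    rw [h3] at this
    simp only [dd] at this
    rw [this]; push_cast; ring
  have hcd : HasCompactSupport fun t => fderiv ℝ g t (eb j) := hcs.fderiv_apply (𝕜 := ℝ) (eb j)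
  have cd1 : Continuous fun t => fderiv ℝ g t (eb j) :=
    (hs.continuous_fderiv (by simp)).clm_apply continuous_const
  have cd2 : Continuous fun t => fderiv ℝ (fun t : Rn n => cis (-(inner ℝ t v))) t (eb j) :=
    (he.continuous_fderiv (by simp)).clm_apply continuous_const
  have hib := integral_mul_fderiv_eq_neg_fderiv_mul_of_integrable (μ := (volume : Measure (Rn n)))
    (f := fun t : Rn n => cis (-(inner ℝ t v))) (g := g) (v := eb j)
    ((cd2.mul hs.continuous).integrable_of_hasCompactSupport hcs.mul_left)
    ((he.continuous.mul cd1).integrable_of_hasCompactSupport hcd.mul_left)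
    ((he.continuous.mul hs.continuous).integrable_of_hasCompactSupport hcs.mul_left)
    (fun t _ => he.contDiffAt.differentiableAt (by simp))
    (fun t _ => hs.contDiffAt.differentiableAt (by simp))
  simp only [ft, dd]
  rw [hib, ← integral_neg, ← integral_const_mul]
  congr 1; funext t
  rw [e2]; ring

theorem TC.pft_dir (h : TC μ f) (j : Fin n) (y : Ph n × Rn n) :
    pft (dd (0, eb j) f) y = Complex.I * (y.2 j : ℝ) * pft f y := by
  have hs : ContDiff ℝ ∞ fun t => f (y.1, t) := h.smooth.comp (by fun_prop)
  have e1 : (fun t => dd (0, eb j) f (y.1, t)) = dd (eb j) (fun t => f (y.1, t)) := funext fun t =>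
    dd_eq_of_line (h.smooth.contDiffAt.differentiableAt (by simp))
      (hs.contDiffAt.differentiableAt (by simp)) fun r => by simp
  rw [pft, e1, ft_fderiv hs (h.hasCompactSupport y.1), pft]

theorem one_add_norm_le_sum (ζ : Rn n) : 1 + ‖ζ‖ ≤ 1 + ∑ j, |ζ j| := by
  have : ‖ζ‖ ≤ ∑ j, |ζ j| := by
    conv_lhs => rw [← sum_coord_smul_eb ζ]
    refine (norm_sum_le _ _).trans_eq (sum_congr rfl fun j _ => ?_)
    rw [norm_smul, eb]; simp
  linarith

theorem TC.norm_pft_le (h : TC μ f) (k : ℕ) : ∃ C : ℝ, ∀ y : Ph n × Rn n,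
    ‖pft f y‖ ≤ C * jb (-(k : ℝ)) y.2 * (1 + ‖y.1.2‖) ^ μ := by
  have key : ∀ {f : Ph n × Rn n → ℂ}, TC μ f → ∃ C : ℝ, ∀ y : Ph n × Rn n,
      jb (k : ℝ) y.2 * ‖pft f y‖ ≤ C * (1 + ‖y.1.2‖) ^ μ := by
    induction k with
    | zero =>
      intro f h
      obtain ⟨w, hw, hb⟩ := h.intClass.bound 0
      have := h.intClass.sb frP_spans frP_continuous isOpen_univ 0 hw hb
      refine ⟨∫ ζ, w ζ, fun y => ?_⟩
      have h1 := this.bound y trivial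
      rw [pft_eq]
      simpa [jb] using h1
    | succ k ih =>
      intro f h
      obtain ⟨C0, h0⟩ := ih h
      have hj : ∀ j : Fin n, ∃ C : ℝ, ∀ y : Ph n × Rn n,
          jb (k : ℝ) y.2 * ‖pft (PsiDO.dd (0, eb j) f) y‖ ≤ C * (1 + ‖y.1.2‖) ^ μ := fun j => by
        have := h.dir (Sum.inr j)
        simp only [Sum.elim_inr, sub_zero] at this
        exact ih this
      choose C hC using hj
      refine ⟨C0 + ∑ j, C j, fun y => ?_⟩
      have e : jb ((k + 1 : ℕ) : ℝ) y.2 = jb (k : ℝ) y.2 * (1 + ‖y.2‖) := by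
        push_cast; rw [jb_add]; simp [jb]
      rw [e, add_mul, sum_mul]
      calc jb (k : ℝ) y.2 * (1 + ‖y.2‖) * ‖pft f y‖
          ≤ jb (k : ℝ) y.2 * (1 + ∑ j, |y.2 j|) * ‖pft f y‖ :=
            mul_le_mul_of_nonneg_right (mul_le_mul_of_nonneg_left (one_add_norm_le_sum _)
              (jb_pos _ _).le) (norm_nonneg _)
        _ = jb (k : ℝ) y.2 * ‖pft f y‖ + ∑ j, jb (k : ℝ) y.2 * (|y.2 j| * ‖pft f y‖) := by
            rw [← mul_sum, ← sum_mul]; ring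
        _ ≤ _ := by
            refine add_le_add (h0 y) (sum_le_sum fun j _ => ?_)
            refine le_trans (le_of_eq ?_) (hC j y)
            rw [h.pft_dir]
            simp
  obtain ⟨C, hC⟩ := key h
  refine ⟨C, fun y => ?_⟩
  have h1 := mul_le_mul_of_nonneg_left (hC y) (jb_pos (-(k : ℝ)) y.2).le
  rw [← mul_assoc, ← jb_add, neg_add_cancel] at h1
  calc _ = jb 0 y.2 * ‖pft f y‖ := by simp [jb]
    _ ≤ _ := h1
    _ = _ := by ring

theorem TC.rd (h : TC μ f) : RD (frX n) univ μ (pft f) := by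
  refine ⟨h.contDiff_pft, fun N k => ?_⟩
  induction N generalizing μ f with
  | zero =>
    obtain ⟨C, hC⟩ := h.norm_pft_le k
    exact ⟨C, fun y _ => hC y⟩
  | succ N ih =>
    haveI : Finite ((frX n).param (Rn n)).ι := inferInstanceAs (Finite (Fin n ⊕ Fin n))
    obtain ⟨C, hC⟩ := h.norm_pft_le k
    refine SB.exists_succ (fun y _ => (jb_pos _ _).le) ⟨C, fun y _ => hC y⟩ fun i => ?_
    have := ih (h.dir (Sum.inl i))
    change ∃ C : ℝ, SB _ _ _ N _ (PsiDO.dd ((frX n).dir i, 0) (pft f))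
    rw [h.dd_pft]
    exact this

theorem integrable_of_jb_le {E : Type*} [NormedAddCommGroup E] [NormedSpace ℝ E]
    [FiniteDimensional ℝ E] [MeasurableSpace E] [BorelSpace E]
    {ν : Measure E} [ν.IsAddHaarMeasure] {g : E → ℂ} (hg : Continuous g)
    (h : ∀ k : ℕ, ∃ C : ℝ, ∀ ζ, ‖g ζ‖ ≤ C * jb (-(k : ℝ)) ζ) : Integrable g ν := by
  obtain ⟨C, hC⟩ := h (finrank ℝ E + 1)
  exact ((integrable_jb ν (by push_cast; linarith)).const_mul C).mono' hg.aestronglyMeasurable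
    (of_forall fun ζ => hC ζ)

theorem TC.inversion (h : TC μ f) (p : Ph n) (t : Rn n) :
    f (p, t) = cpi n * ∫ ζ, cis (inner ℝ t ζ) * pft f (p, ζ) := by
  have hs : Continuous fun t => f (p, t) := h.smooth.continuous.comp (by fun_prop)
  have hI : Integrable (fun t => f (p, t)) volume :=
    Continuous.integrable_of_hasCompactSupport hs (h.hasCompactSupport p)
  have hc : Continuous fun ζ : Rn n => pft f (p, ζ) := h.contDiff_pft.continuous.comp (by fun_prop)
  have hJ : Integrable (fun ζ : Rn n => pft f (p, ζ)) volume := integrable_of_jb_le hc fun k => by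
    obtain ⟨C, hC⟩ := h.norm_pft_le k
    refine ⟨C * (1 + ‖p.2‖) ^ μ, fun ζ => (hC (p, ζ)).trans_eq ?_⟩
    simp only; ring
  exact ft_inversion hs hI hJ t

end Partial

/-! ### Rapidly decreasing functions -/

section Rapid

variable {n : ℕ}

instance : (volume : Measure (Rn n × Rn n)).IsAddHaarMeasure :=
  Measure.prod.instIsAddHaarMeasure _ _

variable {E E' : Type*} [NormedAddCommGroup E] [NormedSpace ℝ E] [FiniteDimensional ℝ E]
  [MeasureSpace E] [BorelSpace E] [(volume : Measure E).IsAddHaarMeasure]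
  [NormedAddCommGroup E']

/-- Rapidly decreasing functions. -/
def Rap (g : E' → ℂ) : Prop := ∀ k : ℕ, ∃ C : ℝ, ∀ ζ, ‖g ζ‖ ≤ C * jb (-(k : ℝ)) ζ

theorem jb_neg_le_of_le {E₁ E₂ : Type*} [NormedAddCommGroup E₁] [NormedAddCommGroup E₂] {x : E₁}
    {y : E₂} {D : ℝ} (hD : 0 ≤ D) (h : 1 + ‖x‖ ≤ D * (1 + ‖y‖)) (k : ℕ) :
    jb (-(k : ℝ)) y ≤ D ^ (k : ℝ) * jb (-(k : ℝ)) x := by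
  have h1 : jb (k : ℝ) x ≤ D ^ (k : ℝ) * jb (k : ℝ) y := by
    simp only [jb]
    rw [← Real.mul_rpow hD (by positivity)]
    exact Real.rpow_le_rpow (by positivity) h (by positivity)
  have h2 : jb (k : ℝ) x * jb (-(k : ℝ)) x = 1 := by rw [← jb_add]; simp [jb]
  have h3 : jb (k : ℝ) y * jb (-(k : ℝ)) y = 1 := by rw [← jb_add]; simp [jb]
  have h4 := mul_le_mul_of_nonneg_right h1
    (mul_nonneg (jb_pos (-(k : ℝ)) x).le (jb_pos (-(k : ℝ)) y).le)
  calc jb (-(k : ℝ)) y = jb (k : ℝ) x * (jb (-(k : ℝ)) x * jb (-(k : ℝ)) y) := by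
        rw [← mul_assoc, h2, one_mul]
    _ ≤ _ := h4
    _ = D ^ (k : ℝ) * jb (-(k : ℝ)) x * (jb (k : ℝ) y * jb (-(k : ℝ)) y) := by ring
    _ = _ := by rw [h3, mul_one]

theorem Rap.nonneg_const {g : E' → ℂ} (h : Rap g) (k : ℕ) :
    ∃ C : ℝ, 0 ≤ C ∧ ∀ ζ, ‖g ζ‖ ≤ C * jb (-(k : ℝ)) ζ := by
  obtain ⟨C, hC⟩ := h k
  refine ⟨C, ?_, hC⟩
  exact nonneg_of_mul_nonneg_left ((norm_nonneg _).trans (hC 0)) (jb_pos _ _)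

theorem Rap.comp {E₁ : Type*} [NormedAddCommGroup E₁] {g : E' → ℂ} (h : Rap g) {f : E₁ → E'} {D : ℝ}
    (hD : 0 ≤ D) (hf : ∀ x, 1 + ‖x‖ ≤ D * (1 + ‖f x‖)) : Rap (fun x => g (f x)) := fun k => by
  obtain ⟨C, hC0, hC⟩ := h.nonneg_const k
  refine ⟨C * D ^ (k : ℝ), fun x => (hC _).trans ?_⟩
  rw [mul_assoc]
  exact mul_le_mul_of_nonneg_left (jb_neg_le_of_le hD (hf x) k) hC0

theorem Rap.of_norm_le {g g' : E' → ℂ} (h : Rap g) (hg : ∀ x, ‖g' x‖ ≤ ‖g x‖) : Rap g' := fun k =>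
  (h k).imp fun _ hC x => (hg x).trans (hC x)

theorem Rap.integrable {g : E → ℂ} (h : Rap g) (hc : Continuous g) : Integrable g :=
  integrable_of_jb_le hc h

theorem jb_mul_le_prod {E₁ E₂ : Type*} [NormedAddCommGroup E₁] [NormedAddCommGroup E₂] (x : E₁)
    (y : E₂) (k : ℕ) : jb (-(k : ℝ)) x * jb (-(k : ℝ)) y ≤ jb (-(k : ℝ)) (x, y) := by
  simp only [jb]
  rw [← Real.mul_rpow (by positivity) (by positivity)]
  refine Real.rpow_le_rpow_of_nonpos (by positivity) ?_ (by simp)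
  rw [Prod.norm_def]
  rcases max_cases ‖x‖ ‖y‖ with ⟨e, _⟩ | ⟨e, _⟩ <;> simp only [e] <;>
    nlinarith [norm_nonneg x, norm_nonneg y, mul_nonneg (norm_nonneg x) (norm_nonneg y)]

theorem jb_prod_le {E₁ E₂ : Type*} [NormedAddCommGroup E₁] [NormedAddCommGroup E₂] (x : E₁)
    (y : E₂) (k : ℕ) : jb (-((k + k : ℕ) : ℝ)) (x, y) ≤ jb (-(k : ℝ)) x * jb (-(k : ℝ)) y := by
  have : -((k + k : ℕ) : ℝ) = -(k : ℝ) + -(k : ℝ) := by push_cast; ring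
  rw [this, jb_add]
  have h1 : jb (-(k : ℝ)) (x, y) ≤ jb (-(k : ℝ)) x :=
    Real.rpow_le_rpow_of_nonpos (by positivity) (by gcongr; exact norm_fst_le (x, y)) (by simp)
  have h2 : jb (-(k : ℝ)) (x, y) ≤ jb (-(k : ℝ)) y :=
    Real.rpow_le_rpow_of_nonpos (by positivity) (by gcongr; exact norm_snd_le (x, y)) (by simp)
  exact mul_le_mul h1 h2 (jb_pos _ _).le (jb_pos _ _).le

theorem Rap.integrable_prod {g : Rn n × E → ℂ} (h : Rap g) (hc : Continuous g) :
    Integrable g (volume.prod volume) :=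
  haveI : ((volume : Measure (Rn n)).prod (volume : Measure E)).IsAddHaarMeasure :=
    Measure.prod.instIsAddHaarMeasure _ _
  integrable_of_jb_le hc h

theorem Rap.integral {X : Type*} [NormedAddCommGroup X] {g : X × E → ℂ} (h : Rap g)
    (hc : Continuous g) : Continuous (fun x => ∫ ζ, g (x, ζ)) ∧ Rap (fun x => ∫ ζ, g (x, ζ)) := by
  have hb : ∀ k : ℕ, ∃ C : ℝ, ∀ x (ζ : E), ‖g (x, ζ)‖ ≤
      C * jb (-(k : ℝ)) x * jb (-((finrank ℝ E + 1 : ℕ) : ℝ)) ζ := fun k => by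
    obtain ⟨C, hC0, hC⟩ := h.nonneg_const ((k + (finrank ℝ E + 1)) + (k + (finrank ℝ E + 1)))
    refine ⟨C, fun x ζ => (hC _).trans ?_⟩
    rw [mul_assoc]
    refine mul_le_mul_of_nonneg_left ((jb_prod_le _ _ _).trans ?_) hC0
    exact mul_le_mul (jb_mono (by push_cast; linarith) _) (jb_mono (by push_cast; linarith) _)
      (jb_pos _ _).le (jb_pos _ _).le
  have hi : Integrable (fun ζ : E => jb (-((finrank ℝ E + 1 : ℕ) : ℝ)) ζ) :=
    integrable_jb volume (by push_cast; linarith)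
  refine ⟨?_, fun k => ?_⟩
  · obtain ⟨C, hC⟩ := hb 0
    refine continuous_of_dominated (bound := fun ζ => C * jb (-((finrank ℝ E + 1 : ℕ) : ℝ)) ζ)
      (fun x => (hc.comp (by fun_prop : Continuous fun ζ : E => (x, ζ))).aestronglyMeasurable)
      (fun x => of_forall fun ζ => (hC x ζ).trans_eq (by simp [jb])) (hi.const_mul C)
      (of_forall fun ζ => hc.comp (by fun_prop : Continuous fun x : X => (x, ζ)))
  · obtain ⟨C, hC⟩ := hb k
    refine ⟨C * ∫ ζ : E, jb (-((finrank ℝ E + 1 : ℕ) : ℝ)) ζ, fun x => ?_⟩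
    refine (norm_integral_le_of_norm_le (hi.const_mul (C * jb (-(k : ℝ)) x))
      (of_forall fun ζ => hC x ζ)).trans_eq ?_
    rw [integral_const_mul]; ring

theorem Rap.shear {g : Rn n × E → ℂ} (h : Rap g) (L : E →L[ℝ] Rn n) :
    Rap (fun p : Rn n × E => g (p.1 + L p.2, p.2)) := by
  refine h.comp (D := 2 + ‖L‖) (by positivity) fun p => ?_
  have h1 : ‖p.1‖ ≤ ‖p.1 + L p.2‖ + ‖L‖ * ‖p.2‖ := by
    have := norm_sub_le (p.1 + L p.2) (L p.2)
    rw [add_sub_cancel_right] at this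
    exact this.trans (add_le_add le_rfl (L.le_opNorm _))
  have h2 := norm_fst_le (p.1 + L p.2, p.2)
  have h3 := norm_snd_le (p.1 + L p.2, p.2)
  simp only at h2 h3
  rw [Prod.norm_def]
  rcases max_cases ‖p.1‖ ‖p.2‖ with ⟨e, _⟩ | ⟨e, _⟩ <;> rw [e] <;>
    nlinarith [norm_nonneg L, norm_nonneg p.2, norm_nonneg (p.1 + L p.2),
      mul_le_mul_of_nonneg_left h3 (norm_nonneg L)]

theorem integral_shear {g : Rn n × E → ℂ} (h : Rap g) (hc : Continuous g) (L : E →L[ℝ] Rn n) :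
    ∫ ξ, ∫ ζ, g (ξ, ζ) = ∫ ξ, ∫ ζ, g (ξ + L ζ, ζ) := by
  rw [integral_integral_swap (f := fun ξ ζ => g (ξ, ζ)) (h.integrable_prod hc),
    integral_integral_swap (f := fun ξ ζ => g (ξ + L ζ, ζ)) ((h.shear L).integrable_prod
      (hc.comp (by fun_prop)))]
  congr 1; funext ζ
  exact (integral_add_right_eq_self (fun ξ => g (ξ, ζ)) (L ζ)).symm

theorem rap_of_shift {μ : ℝ} {g : Rn n × E' → ℂ} [NormedSpace ℝ E'] (L : E' →L[ℝ] Rn n)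
    (h : ∀ k K : ℕ, ∃ C : ℝ, ∀ p, ‖g p‖ ≤
      C * jb (-(k : ℝ)) p.2 * jb μ p.1 * jb (-(K : ℝ)) (p.1 + L p.2)) : Rap g := fun k => by
  set K := k + ⌈|μ|⌉₊ with hK
  obtain ⟨C, hC⟩ := h (k + K) K
  have hC0 : 0 ≤ C := by
    have := (norm_nonneg _).trans (hC 0)
    have h2 := nonneg_of_mul_nonneg_left this (jb_pos _ _)
    exact nonneg_of_mul_nonneg_left (nonneg_of_mul_nonneg_left h2 (jb_pos _ _)) (jb_pos _ _)
  refine ⟨C * (1 + ‖L‖) ^ (K : ℝ), fun p => (hC p).trans ?_⟩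
  have h1 : jb (-(K : ℝ)) (p.1 + L p.2) ≤ jb (-(K : ℝ)) p.1 * ((1 + ‖L‖) ^ (K : ℝ) * jb (K : ℝ) p.2) := by
    refine (peetre (-(K : ℝ)) p.1 (L p.2)).trans ?_
    refine mul_le_mul_of_nonneg_left ?_ (jb_pos _ _).le
    rw [abs_neg, Nat.abs_cast, jb, ← Real.mul_rpow (by positivity) (by positivity)]
    refine Real.rpow_le_rpow (by positivity) ?_ (by positivity)
    nlinarith [L.le_opNorm p.2, norm_nonneg L, norm_nonneg p.2]
  have h2 : jb μ p.1 * jb (-(K : ℝ)) p.1 ≤ jb (-(k : ℝ)) p.1 := by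
    rw [← jb_add]
    refine jb_mono ?_ _
    have := Nat.le_ceil |μ|
    have := le_abs_self μ
    rw [hK]; push_cast; linarith
  have h3 : jb (-((k + K : ℕ) : ℝ)) p.2 * jb (K : ℝ) p.2 = jb (-(k : ℝ)) p.2 := by
    rw [← jb_add]; congr 1; push_cast; ring
  calc C * jb (-((k + K : ℕ) : ℝ)) p.2 * jb μ p.1 * jb (-(K : ℝ)) (p.1 + L p.2)
      ≤ C * jb (-((k + K : ℕ) : ℝ)) p.2 * jb μ p.1 *
        (jb (-(K : ℝ)) p.1 * ((1 + ‖L‖) ^ (K : ℝ) * jb (K : ℝ) p.2)) :=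
        mul_le_mul_of_nonneg_left h1 (mul_nonneg (mul_nonneg hC0 (jb_pos _ _).le) (jb_pos _ _).le)
    _ = C * (1 + ‖L‖) ^ (K : ℝ) * ((jb μ p.1 * jb (-(K : ℝ)) p.1) *
        (jb (-((k + K : ℕ) : ℝ)) p.2 * jb (K : ℝ) p.2)) := by ring
    _ ≤ C * (1 + ‖L‖) ^ (K : ℝ) * (jb (-(k : ℝ)) p.1 * jb (-(k : ℝ)) p.2) := by
        rw [h3]
        exact mul_le_mul_of_nonneg_left (mul_le_mul_of_nonneg_right h2 (jb_pos _ _).le)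
          (by positivity)
    _ ≤ _ := mul_le_mul_of_nonneg_left (jb_mul_le_prod _ _ _) (by positivity)

end Rapid

/-! ### Fourier transforms of Schwartz functions -/

section SchwartzFT

open scoped FourierTransform LineDeriv SchwartzMap

variable {n : ℕ}

theorem rap_schwartz {V : Type*} [NormedAddCommGroup V] [NormedSpace ℝ V] (u : 𝓢(V, ℂ)) :
    Rap u := fun k => by
  refine ⟨2 ^ k * ((Finset.Iic (k, 0)).sup fun m => SchwartzMap.seminorm ℝ m.1 m.2) u, fun x => ?_⟩
  · have := SchwartzMap.one_add_le_sup_seminorm_apply (𝕜 := ℝ) (m := (k, 0)) (k := k) (n := 0)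
      le_rfl le_rfl u x
    rw [norm_iteratedFDeriv_zero] at this
    have h2 := mul_le_mul_of_nonneg_left this (jb_pos (-(k : ℝ)) x).le
    have h3 : jb (-(k : ℝ)) x * (1 + ‖x‖) ^ k = 1 := by
      rw [← Real.rpow_natCast, ← jb, ← jb_add]; simp [jb]
    rw [← mul_assoc, h3, one_mul] at h2
    linarith

theorem ft_schwartz_eq (u : 𝓢(Rn n, ℂ)) :
    ft u = fun ξ => (𝓕 u : 𝓢(Rn n, ℂ)) ((2 * Real.pi)⁻¹ • ξ) := by
  funext ξ
  rw [ft_eq_fourier, SchwartzMap.fourier_coe]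

theorem contDiff_ft_schwartz (u : 𝓢(Rn n, ℂ)) : ContDiff ℝ ∞ (ft u) := by
  rw [ft_schwartz_eq]
  exact ((𝓕 u : 𝓢(Rn n, ℂ)).smooth ⊤).comp (contDiff_const_smul _)

theorem rap_ft_schwartz (u : 𝓢(Rn n, ℂ)) : Rap (ft u) := by
  rw [ft_schwartz_eq]
  refine (rap_schwartz (𝓕 u : 𝓢(Rn n, ℂ))).comp (D := 1 + 2 * Real.pi) (by positivity) fun x => ?_
  rw [norm_smul, Real.norm_eq_abs, abs_of_pos (by positivity)]
  have h1 : ‖x‖ = 2 * Real.pi * ((2 * Real.pi)⁻¹ * ‖x‖) := by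
    rw [← mul_assoc, mul_inv_cancel₀ (by positivity), one_mul]
  have h2 : 0 ≤ (2 * Real.pi)⁻¹ * ‖x‖ := by positivity
  nlinarith [Real.pi_pos]

/-- The coordinate directions of `ℝⁿ`, with a constant weight. -/
abbrev frC (n : ℕ) (r : ℝ) (hr : 1 ≤ r) : Frame (Rn n) where
  ι := Fin n
  ρ _ := r
  one_le _ := hr
  dir := eb
  loss _ := 0

theorem ft_decay (R : ℝ) (N : ℕ) : ∃ C : ℝ, 0 ≤ C ∧ ∀ (f : Rn n → ℂ) (B r μ : ℝ) (hr : 1 ≤ r),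
    ContDiff ℝ ∞ f → (∀ y, R < ‖y‖ → f y = 0) → SB (frC n r hr) univ (fun _ => B) N μ f →
    ∀ ξ, ‖ft f ξ‖ ≤ C * (B * r ^ μ) * jb (-(N : ℝ)) ξ := by
  have key : ∃ C : ℝ, 0 ≤ C ∧ ∀ (f : Rn n → ℂ) (B r μ : ℝ) (hr : 1 ≤ r),
      ContDiff ℝ ∞ f → (∀ y, R < ‖y‖ → f y = 0) → SB (frC n r hr) univ (fun _ => B) N μ f →
      ∀ ξ, jb (N : ℝ) ξ * ‖ft f ξ‖ ≤ C * (B * r ^ μ) := by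
    induction N with
    | zero =>
      refine ⟨volume.real (closedBall (0 : Rn n) R), measureReal_nonneg,
        fun f B r μ hr hf hs hb ξ => ?_⟩
      have h0 : ∀ y ∉ closedBall (0 : Rn n) R, cis (-(inner ℝ y ξ)) * f y = 0 :=
        fun y hy => by rw [hs y (by simpa using hy), mul_zero]
      rw [ft, ← setIntegral_eq_integral_of_forall_compl_eq_zero h0]
      have := norm_setIntegral_le_of_norm_le_const (μ := volume) (C := B * r ^ μ)
        (f := fun y => cis (-(inner ℝ y ξ)) * f y)
        (isCompact_closedBall (0 : Rn n) R).measure_lt_top fun y _ => by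
          rw [norm_mul, norm_cis, one_mul]; exact hb y trivial
      refine le_trans (le_of_eq ?_) (this.trans_eq (mul_comm _ _))
      simp [jb]
    | succ N ih =>
      obtain ⟨C, hC0, hC⟩ := ih
      refine ⟨C + n * C, by positivity, fun f B r μ hr hf hs hb ξ => ?_⟩
      have hcs : HasCompactSupport f := HasCompactSupport.of_support_subset_isCompact
        (isCompact_closedBall (0 : Rn n) R) fun y hy => by
          by_contra hc
          exact hy (hs y (by simpa using hc))
      have hj : ∀ j, jb (N : ℝ) ξ * ‖ft (dd (eb j) f) ξ‖ ≤ C * (B * r ^ μ) := fun j => by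
        refine hC _ B r μ hr (ContDiff.dd hf _) (fun y hy => ?_) ?_ ξ
        · have : f =ᶠ[𝓝 y] fun _ => 0 := by
            filter_upwards [(isOpen_lt continuous_const continuous_norm).mem_nhds hy] with z hz
            exact hs z hz
          rw [(dd_congr this).self_of_nhds]
          simp [dd]
        · have := hb.2 j
          rwa [sub_zero] at this
      have e : jb ((N + 1 : ℕ) : ℝ) ξ = jb (N : ℝ) ξ * (1 + ‖ξ‖) := by
        push_cast; rw [jb_add]; simp [jb]
      calc jb ((N + 1 : ℕ) : ℝ) ξ * ‖ft f ξ‖ ≤ jb (N : ℝ) ξ * (1 + ∑ j, |ξ j|) * ‖ft f ξ‖ := by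
            rw [e]
            exact mul_le_mul_of_nonneg_right (mul_le_mul_of_nonneg_left (one_add_norm_le_sum _)
              (jb_pos _ _).le) (norm_nonneg _)
        _ = jb (N : ℝ) ξ * ‖ft f ξ‖ + ∑ j, jb (N : ℝ) ξ * (|ξ j| * ‖ft f ξ‖) := by
            rw [← mul_sum, ← sum_mul]; ring
        _ ≤ C * (B * r ^ μ) + ∑ _j : Fin n, C * (B * r ^ μ) := by
            refine add_le_add (hC f B r μ hr hf hs hb.of_succ ξ) (sum_le_sum fun j _ => ?_)
            refine le_trans (le_of_eq ?_) (hj j)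
            rw [ft_fderiv hf hcs]
            simp
        _ = _ := by simp; ring
  obtain ⟨C, hC0, hC⟩ := key
  refine ⟨C, hC0, fun f B r μ hr hf hs hb ξ => ?_⟩
  have h1 := mul_le_mul_of_nonneg_left (hC f B r μ hr hf hs hb ξ) (jb_pos (-(N : ℝ)) ξ).le
  rw [← mul_assoc, ← jb_add, neg_add_cancel] at h1
  calc _ = jb 0 ξ * ‖ft f ξ‖ := by simp [jb]
    _ ≤ _ := h1
    _ = _ := by ring

theorem sb_schwartz (u : 𝓢(Rn n, ℂ)) (N : ℕ) : ∃ C : ℝ, ∀ (r : ℝ) (hr : 1 ≤ r),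
    SB (frC n r hr) univ (fun _ => C) N 0 u := by
  have key : ∀ u : 𝓢(Rn n, ℂ), ∃ C : ℝ, ∀ y, ‖u y‖ ≤ C := fun u => by
    obtain ⟨C, hC⟩ := rap_schwartz u 0
    exact ⟨C, fun y => (hC y).trans_eq (by simp [jb])⟩
  induction N generalizing u with
  | zero =>
    obtain ⟨C, hC⟩ := key u
    exact ⟨C, fun r hr y _ => by simpa using hC y⟩
  | succ N ih =>
    obtain ⟨C, hC⟩ := key u
    have h : ∀ j : Fin n, ∃ C : ℝ, ∀ (r : ℝ) (hr : 1 ≤ r),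
        SB (frC n r hr) univ (fun _ => C) N 0 (dd (eb j) u) := fun j => by
      have e : dd (eb j) u = ⇑(∂_{eb j} u : 𝓢(Rn n, ℂ)) := by
        funext x; rw [SchwartzMap.lineDerivOp_apply_eq_fderiv]; rfl
      rw [e]
      exact ih _
    choose K hK using h
    obtain ⟨D, hC', hle⟩ := exists_upper_bound C K
    refine ⟨D, fun r hr => ⟨fun y _ => ?_, fun i => ?_⟩⟩
    · simpa using (hC y).trans hC'
    · rw [sub_zero]
      exact (hK i r hr).mono_weight fun _ _ => hle i

end SchwartzFT

/-! ### The families of symbols for compositions and for cutoffs -/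

section Families

variable {n : ℕ} {μ μ' : ℝ}

theorem sder_succ' (J : ℝ × Ph n → ℂ) (r : ℕ) : sder J (r + 1) = sder (dd (1, 0) J) r :=
  Function.iterate_succ_apply _ _ _

theorem sder_congr {J J' : ℝ × Ph n → ℂ} (h : EqOn J J' (slab n)) (r : ℕ) :
    EqOn (sder J r) (sder J' r) (slab n) := by
  induction r generalizing J J' with
  | zero => exact h
  | succ r ih =>
    rw [sder_succ', sder_succ']
    exact ih fun y hy => (dd_congr (eventuallyEq_of_mem (isOpen_slab.mem_nhds hy) h)).self_of_nhds

theorem dd_lin_on {𝒳 κ : Type*} [NormedAddCommGroup 𝒳] [NormedSpace ℝ 𝒳] {U : Set 𝒳}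
    (hU : IsOpen U) (T : Finset κ) (c : κ → ℂ) {J : κ → 𝒳 → ℂ}
    (hJ : ∀ k ∈ T, ContDiffOn ℝ ∞ (J k) U) (v : 𝒳) :
    EqOn (dd v (fun y => ∑ k ∈ T, c k * J k y)) (fun y => ∑ k ∈ T, c k * dd v (J k) y) U := by
  intro y hy
  have h : HasFDerivAt (fun y => ∑ k ∈ T, c k * J k y) (∑ k ∈ T, c k • fderiv ℝ (J k) y) y :=
    HasFDerivAt.fun_sum fun k hk => (ContDiffOn.diffAt (hJ k hk) hU hy).hasFDerivAt.const_mul (c k)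
  simp only [dd, h.fderiv]
  rw [sum_apply]
  rfl

theorem sder_lin {κ : Type*} (T : Finset κ) (c : κ → ℂ) {J : κ → ℝ × Ph n → ℂ}
    (hJ : ∀ k ∈ T, ContDiffOn ℝ ∞ (J k) (slab n)) (r : ℕ) :
    EqOn (sder (fun y => ∑ k ∈ T, c k * J k y) r) (fun y => ∑ k ∈ T, c k * sder (J k) r y)
      (slab n) := by
  induction r generalizing J with
  | zero => exact fun _ _ => rfl
  | succ r ih =>
    intro y hy
    simp only [sder_succ']
    rw [sder_congr (dd_lin_on isOpen_slab T c hJ (1, 0)) r hy]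
    exact ih (fun k hk => ContDiffOn.dd (hJ k hk) isOpen_slab _) hy

variable {E E' : Type*} [NormedAddCommGroup E] [NormedSpace ℝ E] [NormedAddCommGroup E']
  [NormedSpace ℝ E']

theorem RD.prod_shift {H : Ph n × E → ℂ} {K : Ph n × E' → ℂ} (h : RD (frX n) univ μ H)
    (h' : RD (frX n) univ μ' K) (L L' : E × E' →L[ℝ] Rn n) :
    RD (frY n) (slab n) (μ + μ') (fun y : (ℝ × Ph n) × (E × E') =>
      H ((shiftArg L y).1, y.2.1) * K ((shiftArg L' y).1, y.2.2)) := by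
  have hH : ContDiff ℝ ∞ fun q : Ph n × (E × E') => H (q.1, q.2.1) := h.smooth.comp (by fun_prop)
  have hK : ContDiff ℝ ∞ fun q : Ph n × (E × E') => K (q.1, q.2.2) := h'.smooth.comp (by fun_prop)
  have hH' := hH.comp (contDiff_shiftArg L)
  have hK' := hK.comp (contDiff_shiftArg L')
  refine ⟨hH'.mul hK', fun N k => ?_⟩
  obtain ⟨D, l, hD, hs⟩ := SB.shift L N μ
  obtain ⟨D', l', hD', hs'⟩ := SB.shift L' N μ'
  obtain ⟨C, hC⟩ := h.bound N (k + l + l')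
  obtain ⟨C', hC'⟩ := h'.bound N (k + l + l')
  set k' := k + l + l'
  have h1 := hs (fun ζ => C * jb (-(k' : ℝ)) ζ.1) _ hH (by
    simpa using SB.lift_param (fst ℝ E E')
      (w := fun ζ => C * jb (-(k' : ℝ)) ζ) isOpen_univ hC h.smooth)
  have h2 := hs' (fun ζ => C' * jb (-(k' : ℝ)) ζ.2) _ hK (by
    simpa using SB.lift_param (snd ℝ E E')
      (w := fun ζ => C' * jb (-(k' : ℝ)) ζ) isOpen_univ hC' h'.smooth)
  have hC0 : 0 ≤ C := nonneg_of_mul_nonneg_left (hC.weight_nonneg 0 (by simp)) (jb_pos _ _)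
  have hC0' : 0 ≤ C' := nonneg_of_mul_nonneg_left (hC'.weight_nonneg 0 (by simp)) (jb_pos _ _)
  refine ⟨2 ^ N * (D * D' * C * C'), (h1.mul h2 (isOpen_slab.prod isOpen_univ) subset_rfl
    hH'.contDiffOn hK'.contDiffOn).mono_weight fun y _ => ?_⟩
  have e : jb (l : ℝ) y.2 * jb (l' : ℝ) y.2 * jb (-(k' : ℝ)) y.2 = jb (-(k : ℝ)) y.2 := by
    rw [← jb_add, ← jb_add]; congr 1; simp only [k']; push_cast; ring
  calc _ = 2 ^ N * (D * D' * C * C') * (jb (l : ℝ) y.2 * jb (l' : ℝ) y.2 *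
        (jb (-(k' : ℝ)) y.2.1 * jb (-(k' : ℝ)) y.2.2)) := by
        ring
    _ ≤ 2 ^ N * (D * D' * C * C') * (jb (l : ℝ) y.2 * jb (l' : ℝ) y.2 * jb (-(k' : ℝ)) y.2) :=
        mul_le_mul_of_nonneg_left (mul_le_mul_of_nonneg_left (jb_mul_le_prod _ _ _)
          (mul_pos (jb_pos _ _) (jb_pos _ _)).le) (by positivity)
    _ = _ := by rw [e]

theorem RD.symFam [FiniteDimensional ℝ E] [MeasurableSpace E] [BorelSpace E] {ν : Measure E}
    [ν.IsAddHaarMeasure] {H : (ℝ × Ph n) × E → ℂ} (h : RD (frY n) (slab n) μ H) :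
    SymFam μ (fun y => ∫ ζ, H (y, ζ) ∂ν) where
  smooth := (h.intClass ν).contDiffOn frY_spans frY_continuous isOpen_slab
  bound N := by
    obtain ⟨w, hw, hb⟩ := (h.intClass ν).bound N
    exact ⟨_, (h.intClass ν).sb frY_spans frY_continuous isOpen_slab N hw hb⟩

theorem RD.const_mul {𝒳 : Type*} [NormedAddCommGroup 𝒳] [NormedSpace ℝ 𝒳] {F : Frame 𝒳}
    {U : Set 𝒳} (hU : IsOpen U) {H : 𝒳 × E → ℂ} (h : RD F U μ H) (c : ℂ) :
    RD F U μ (fun y => c * H y) :=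
  ⟨contDiff_const.mul h.smooth, fun N k => by
    obtain ⟨C, hC⟩ := h.bound N k
    refine ⟨‖c‖ * C, (hC.const_mul c (hU.prod isOpen_univ) subset_rfl
      h.smooth.contDiffOn).mono_weight fun y _ => le_of_eq (by ring)⟩⟩

/-! #### Symbols with compact support in `x` -/

/-- Symbols of order `μ` with compact support in `x`. -/
structure XC (μ : ℝ) (a : Ph n → ℂ) : Prop where
  smooth : ContDiff ℝ ∞ a
  supp : ∃ R : ℝ, ∀ z : Ph n, R < ‖z.1‖ → a z = 0
  sym : SymOn univ μ a

theorem XC.tc {a : Ph n → ℂ} (h : XC μ a) : TC μ (fun y : Ph n × Rn n => a (y.2, y.1.2)) where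
  smooth := h.smooth.comp (by fun_prop)
  supp := by
    obtain ⟨R, hR⟩ := h.supp
    exact ⟨R, fun y hy => hR _ hy⟩
  bound N := by
    obtain ⟨C, hC⟩ := h.sym N
    refine ⟨C, ?_⟩
    have := SB.comp_affine (F' := frP n) (s' := univ) ((snd ℝ (Ph n) (Rn n)).prod
      ((snd ℝ (Rn n) (Rn n)).comp (fst ℝ (Ph n) (Rn n)))) 0
      hC isOpen_univ subset_rfl h.smooth.contDiffOn (fun _ _ => trivial)
      (fun _ _ => hC.weight_nonneg 0 trivial) (fun y => by simp) (fun j => by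
        rcases j with (j | j) | j
        · left; simp
        · exact Or.inr ⟨Sum.inr j, 1, by simp, by simp, rfl⟩
        · exact Or.inr ⟨Sum.inl j, 1, by simp, by simp, rfl⟩)
    simpa using this

theorem dd_eventually_zero {𝒳 : Type*} [NormedAddCommGroup 𝒳] [NormedSpace ℝ 𝒳] {f : 𝒳 → ℂ}
    {y : 𝒳} (h : f =ᶠ[𝓝 y] fun _ => 0) (v : 𝒳) : dd v f y = 0 := by
  rw [(dd_congr h).self_of_nhds]; simp [dd]

theorem XC.dir {a : Ph n → ℂ} (h : XC μ a) (j : Fin n ⊕ Fin n) :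
    XC (μ - (frX n).loss j) (dd ((frX n).dir j) a) where
  smooth := ContDiff.dd h.smooth _
  supp := by
    obtain ⟨R, hR⟩ := h.supp
    refine ⟨R, fun z hz => dd_eventually_zero ?_ _⟩
    filter_upwards [(isOpen_lt continuous_const (continuous_fst.norm)).mem_nhds hz] with z hz
    exact hR z hz
  sym := h.sym.dir j

/-- The Fourier transform in `x`. -/
def hat (a : Ph n → ℂ) : Ph n × Rn n → ℂ := pft fun y => a (y.2, y.1.2)

theorem XC.inversion {a : Ph n → ℂ} (h : XC μ a) (x z ξ : Rn n) :
    a (z, ξ) = ∫ ζ, cis (inner ℝ z ζ) * (cpi n * hat a ((x, ξ), ζ)) := by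
  have := h.tc.inversion (x, ξ) z
  simp only at this
  rw [this, ← integral_const_mul]
  congr 1; funext ζ
  rw [hat]; ring

theorem XC.dd_hat_xi {a : Ph n → ℂ} (h : XC μ a) (i : Fin n) :
    dd ((0, eb i), 0) (hat a) = hat (dd (0, eb i) a) := by
  have := h.tc.dd_pft (Sum.inr i)
  simp only [Sum.elim_inr] at this
  rw [hat, this, hat]
  congr 1; funext y
  exact dd_eq_of_line (h.tc.smooth.contDiffAt.differentiableAt (by simp))
    (h.smooth.contDiffAt.differentiableAt (by simp)) fun t => by simp

theorem XC.hat_dd_x {a : Ph n → ℂ} (h : XC μ a) (i : Fin n) (y : Ph n × Rn n) :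
    hat (dd (eb i, 0) a) y = Complex.I * (y.2 i : ℝ) * hat a y := by
  rw [hat, hat, ← h.tc.pft_dir]
  congr 1; funext y
  exact (dd_eq_of_line (h.tc.smooth.contDiffAt.differentiableAt (by simp))
    (h.smooth.contDiffAt.differentiableAt (by simp)) fun t => by simp).symm

/-! #### Compositions -/

/-- The integrand of the family which joins the product of two symbols to their Weyl composition. -/
def compKer (a b : Ph n → ℂ) (y : (ℝ × Ph n) × (Rn n × Rn n)) : ℂ :=
  cis (inner ℝ y.1.2.1 (y.2.1 + y.2.2)) *
    ((cpi n * hat a ((y.1.2.1, y.1.2.2 + y.1.1 • ((2 : ℝ)⁻¹ • y.2.2)), y.2.1)) *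
      (cpi n * hat b ((y.1.2.1, y.1.2.2 + y.1.1 • (-((2 : ℝ)⁻¹ • y.2.1))), y.2.2)))

/-- The family which joins the product of two symbols to their Weyl composition. -/
def compFam (a b : Ph n → ℂ) (y : ℝ × Ph n) : ℂ := ∫ ζ, compKer a b (y, ζ)

/-- The shift of the frequency in the first factor. -/
def shiftL (n : ℕ) : Rn n × Rn n →L[ℝ] Rn n := (2 : ℝ)⁻¹ • snd ℝ (Rn n) (Rn n)
/-- The shift of the frequency in the second factor. -/
def shiftR (n : ℕ) : Rn n × Rn n →L[ℝ] Rn n := -((2 : ℝ)⁻¹ • fst ℝ (Rn n) (Rn n))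

theorem pg_cis_pair : PG (frY n) (slab n) 0
    (fun y : (ℝ × Ph n) × (Rn n × Rn n) => cis (inner ℝ y.1.2.1 (y.2.1 + y.2.2))) := by
  have := pg_cis (F := frY n) (U := slab n) (E := Rn n × Rn n)
    (((ContinuousLinearMap.compL ℝ (Rn n × Rn n) (Rn n) ℝ).flip
      (fst ℝ (Rn n) (Rn n) + snd ℝ (Rn n) (Rn n))).comp
      ((innerSL ℝ).comp ((fst ℝ (Rn n) (Rn n)).comp (snd ℝ ℝ (Ph n))))) (fun i => by
      rcases i with _ | i | i
      · right; ext v <;> simp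
      · left; rfl
      · right; ext v <;> simp)
  exact this

variable {a b : Ph n → ℂ}

theorem rd_compKer (ha : XC μ a) (hb : XC μ' b) : RD (frY n) (slab n) (μ + μ') (compKer a b) := by
  have h1 := RD.prod_shift (ha.tc.rd.const_mul isOpen_univ (cpi n))
    (hb.tc.rd.const_mul isOpen_univ (cpi n)) (shiftL n) (shiftR n)
  have h2 := h1.mul_pg pg_cis_pair isOpen_slab
  rw [add_zero] at h2
  have e : compKer a b = fun y => (cpi n * pft (fun y => a (y.2, y.1.2))
      ((shiftArg (shiftL n) y).1, y.2.1)) * (cpi n * pft (fun y => b (y.2, y.1.2))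
      ((shiftArg (shiftR n) y).1, y.2.2)) * cis (inner ℝ y.1.2.1 (y.2.1 + y.2.2)) := by
    funext y
    rw [compKer, mul_comm]; rfl
  rw [e]; exact h2

theorem symFam_compFam (ha : XC μ a) (hb : XC μ' b) : SymFam (μ + μ') (compFam a b) :=
  (rd_compKer ha hb).symFam

theorem compFam_zero (ha : XC μ a) (hb : XC μ' b) (z : Ph n) : compFam a b (0, z) = a z * b z := by
  obtain ⟨x, ξ⟩ := z
  rw [ha.inversion x x ξ, hb.inversion x x ξ, ← integral_prod_mul]
  simp only [compFam, compKer, zero_smul, add_zero, inner_add_right, cis_add]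
  change ∫ ζ, _ ∂(volume.prod volume) = _
  congr 1; funext ζ; ring

/-- The coefficients of the Poisson bracket. -/
def sgn {n : ℕ} : Fin n ⊕ Fin n → ℂ := Sum.elim (fun _ => -Complex.I / 2) fun _ => Complex.I / 2

theorem dd_compKer (ha : XC μ a) (hb : XC μ' b) :
    dd (((frY n).param (Rn n × Rn n)).dir none) (compKer a b) = fun y =>
      ∑ j, sgn j * compKer (dd ((frX n).dir j.swap) a) (dd ((frX n).dir j) b) y := by
  set gA : Ph n × (Rn n × Rn n) → ℂ := fun q => hat a (q.1, q.2.1) with hgA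
  set gB : Ph n × (Rn n × Rn n) → ℂ := fun q => hat b (q.1, q.2.2) with hgB
  have sA : ContDiff ℝ ∞ gA := ha.tc.contDiff_pft.comp (by fun_prop)
  have sB : ContDiff ℝ ∞ gB := hb.tc.contDiff_pft.comp (by fun_prop)
  set A := fun y => gA (shiftArg (shiftL n) y) with hA
  set B := fun y => gB (shiftArg (shiftR n) y) with hB
  have sA' : ContDiff ℝ ∞ A := sA.comp (contDiff_shiftArg _)
  have sB' : ContDiff ℝ ∞ B := sB.comp (contDiff_shiftArg _)
  set c := fun y : (ℝ × Ph n) × (Rn n × Rn n) => cis (inner ℝ y.1.2.1 (y.2.1 + y.2.2)) with hc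
  have sc : ContDiff ℝ ∞ c := pg_cis_pair.smooth
  have e : compKer a b = fun y => (cpi n * cpi n * c y) * (A y * B y) := by
    funext y; simp only [compKer, hA, hB, hc, hgA, hgB, shiftArg, shiftL, shiftR]
    simp only [smul_apply, neg_apply, ContinuousLinearMap.coe_fst', ContinuousLinearMap.coe_snd']
    ring
  have hdA : ∀ q i, dd (((frX n).param (Rn n × Rn n)).dir (Sum.inr i)) gA q =
      hat (dd (0, eb i) a) (q.1, q.2.1) := fun q i => by
    rw [← ha.dd_hat_xi]
    exact dd_eq_of_line (sA.contDiffAt.differentiableAt (by simp))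
      (ha.tc.contDiff_pft.contDiffAt.differentiableAt (by simp)) fun t => by simp [gA]
  have hdB : ∀ q i, dd (((frX n).param (Rn n × Rn n)).dir (Sum.inr i)) gB q =
      hat (dd (0, eb i) b) (q.1, q.2.2) := fun q i => by
    rw [← hb.dd_hat_xi]
    exact dd_eq_of_line (sB.contDiffAt.differentiableAt (by simp))
      (hb.tc.contDiff_pft.contDiffAt.differentiableAt (by simp)) fun t => by simp [gB]
  funext y
  rw [e, dd_mul_on (contDiffOn_univ.2 (contDiff_const.mul sc)) (contDiffOn_univ.2 (sA'.mul sB'))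
    isOpen_univ _ (Set.mem_univ y)]
  have hc0 : dd (((frY n).param (Rn n × Rn n)).dir none) (fun y => cpi n * cpi n * c y) y = 0 :=
    dd_eq_zero_of_line ((contDiff_const.mul sc).contDiffAt.differentiableAt (by simp))
      fun t => by simp [c]
  simp only
  rw [hc0, zero_mul, zero_add, dd_mul_on (contDiffOn_univ.2 sA') (contDiffOn_univ.2 sB')
    isOpen_univ _ (Set.mem_univ y)]
  simp only
  rw [hA, dd_shift_none sA, hB, dd_shift_none sB]
  simp only [hdA, hdB]
  rw [Fintype.sum_sum_type, mul_add, sum_mul, mul_sum, mul_sum, mul_sum]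
  congr 1 <;> refine sum_congr rfl fun i _ => ?_
  · simp only [compKer, sgn, Sum.elim_inl, Sum.elim_inr, Sum.swap_inl, hb.hat_dd_x, hgB, shiftArg,
      shiftL, shiftR, c]
    simp only [smul_apply, neg_apply, ContinuousLinearMap.coe_fst', ContinuousLinearMap.coe_snd',
      PiLp.smul_apply, smul_eq_mul]
    push_cast
    linear_combination ((1 / 2 : ℂ) * cpi n * cpi n * cis (inner ℝ y.1.2.1 (y.2.1 + y.2.2)) *
      ((y.2.2 i : ℝ) : ℂ) * hat (dd (0, eb i) a)
        ((y.1.2.1, y.1.2.2 + y.1.1 • ((2 : ℝ)⁻¹ • y.2.2)), y.2.1) *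
      hat b ((y.1.2.1, y.1.2.2 + y.1.1 • (-((2 : ℝ)⁻¹ • y.2.1))), y.2.2)) * Complex.I_mul_I
  · simp only [compKer, sgn, Sum.elim_inl, Sum.elim_inr, Sum.swap_inr, ha.hat_dd_x, hgA, shiftArg,
      shiftL, shiftR, c]
    simp only [smul_apply, neg_apply, ContinuousLinearMap.coe_fst', ContinuousLinearMap.coe_snd',
      PiLp.smul_apply, PiLp.neg_apply, smul_eq_mul]
    push_cast
    linear_combination (-(1 / 2 : ℂ) * cpi n * cpi n * cis (inner ℝ y.1.2.1 (y.2.1 + y.2.2)) *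
      ((y.2.1 i : ℝ) : ℂ) * hat a ((y.1.2.1, y.1.2.2 + y.1.1 • ((2 : ℝ)⁻¹ • y.2.2)), y.2.1) *
      hat (dd (0, eb i) b) ((y.1.2.1, y.1.2.2 + y.1.1 • (-((2 : ℝ)⁻¹ • y.2.1))), y.2.2)) *
        Complex.I_mul_I

theorem dd_family {E : Type*} [NormedAddCommGroup E] [NormedSpace ℝ E] [FiniteDimensional ℝ E]
    [MeasurableSpace E] [BorelSpace E] {ν : Measure E} [ν.IsAddHaarMeasure] {κ : Type*}
    (T : Finset κ) (c : κ → ℂ) {H : (ℝ × Ph n) × E → ℂ} {K : κ → (ℝ × Ph n) × E → ℂ}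
    (h : RD (frY n) (slab n) μ H) (hK : ∀ k ∈ T, ∃ μ, RD (frY n) (slab n) μ (K k))
    (e : dd (((frY n).param E).dir none) H = fun y => ∑ k ∈ T, c k * K k y) :
    EqOn (dd (1, 0) fun y => ∫ ζ, H (y, ζ) ∂ν) (fun y => ∑ k ∈ T, c k * ∫ ζ, K k (y, ζ) ∂ν)
      (slab n) := fun y hy => by
  have h1 := (h.intClass ν).dd_integral frY_spans frY_continuous isOpen_slab none hy
  refine h1.trans ?_
  change ∫ ζ, dd (((frY n).param E).dir none) H (y, ζ) ∂ν = _
  rw [e]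
  simp only
  rw [integral_finset_sum _ fun k hk => ?_]
  · exact sum_congr rfl fun k _ => integral_const_mul _ _
  · obtain ⟨μ, hμ⟩ := hK k hk
    exact ((hμ.intClass ν).integrable hy).const_mul _

/-- The terms of the expansion of the Weyl composition. -/
def moyal : ℕ → (Ph n → ℂ) → (Ph n → ℂ) → Ph n → ℂ
  | 0, a, b => fun z => a z * b z
  | r + 1, a, b => fun z =>
      ∑ j, sgn j * moyal r (dd ((frX n).dir j.swap) a) (dd ((frX n).dir j) b) z

theorem sder_compFam (ha : XC μ a) (hb : XC μ' b) (r : ℕ) (z : Ph n) :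
    sder (compFam a b) r (0, z) = moyal r a b z := by
  induction r generalizing μ μ' a b with
  | zero => exact compFam_zero ha hb z
  | succ r ih =>
    have h0 : ((0 : ℝ), z) ∈ slab n := by simp [slab]
    rw [sder_succ']
    refine (sder_congr (dd_family (ν := volume) Finset.univ sgn (rd_compKer ha hb)
      (fun j _ => ⟨_, rd_compKer (ha.dir j.swap) (hb.dir j)⟩) (dd_compKer ha hb)) r h0).trans ?_
    have := sder_lin Finset.univ sgn
      (J := fun j => compFam (dd ((frX n).dir j.swap) a) (dd ((frX n).dir j) b))
      (fun j _ => (symFam_compFam (ha.dir j.swap) (hb.dir j)).smooth) r h0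
    refine this.trans ?_
    rw [moyal]
    exact sum_congr rfl fun j _ => by rw [ih (ha.dir j.swap) (hb.dir j)]

/-! #### Cutoffs -/

/-- The integrand of the family for multiplication of the kernel by a cutoff. -/
def ampKer (f : Ph n × Rn n → ℂ) (a : Ph n → ℂ) (y : (ℝ × Ph n) × Rn n) : ℂ :=
  (cpi n * pft f (y.1.2, y.2)) * a (y.1.2.1, y.1.2.2 + y.1.1 • (-y.2))

/-- The family for multiplication of the kernel by a cutoff. -/
def ampFam (f : Ph n × Rn n → ℂ) (a : Ph n → ℂ) (y : ℝ × Ph n) : ℂ := ∫ ζ, ampKer f a (y, ζ)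

variable {f : Ph n × Rn n → ℂ}

theorem pg_const (ha : ContDiff ℝ ∞ a) (hs : SymOn univ μ a) :
    PG (frX n) univ μ (fun q : Ph n × E => a q.1) := by
  refine ⟨ha.comp contDiff_fst, fun N => ?_⟩
  obtain ⟨C, hC⟩ := hs N
  refine ⟨C, 0, ?_⟩
  have := SB.comp_affine (F' := (frX n).param E) (s' := univ)
    (fst ℝ (Ph n) E) 0 hC isOpen_univ subset_rfl ha.contDiffOn
    (fun _ _ => trivial) (fun _ _ => hC.weight_nonneg 0 trivial) (fun y => by simp)
    (fun j => Or.inr ⟨j, 1, by simp, by simp, rfl⟩)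
  simpa [jb] using this

theorem rd_ampKer (hf : TC μ f) (ha : ContDiff ℝ ∞ a) (hs : SymOn univ μ' a) :
    RD (frY n) (slab n) (μ + μ') (ampKer f a) := by
  have h1 := (hf.rd.const_mul isOpen_univ (cpi n)).shift (0 : Rn n →L[ℝ] Rn n)
  have h2 := (pg_const (E := Rn n) ha hs).shift (-ContinuousLinearMap.id ℝ (Rn n))
  have := h1.mul_pg h2 isOpen_slab
  have e : ampKer f a = fun y => (cpi n * pft f (shiftArg (0 : Rn n →L[ℝ] Rn n) y)) *
      a (shiftArg (-ContinuousLinearMap.id ℝ (Rn n)) y).1 := by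
    funext y; simp [ampKer, shiftArg]
  rw [e]; exact this

theorem symFam_ampFam (hf : TC μ f) (ha : ContDiff ℝ ∞ a) (hs : SymOn univ μ' a) :
    SymFam (μ + μ') (ampFam f a) := (rd_ampKer hf ha hs).symFam

theorem ampFam_zero (hf : TC μ f) (z : Ph n) : ampFam f a (0, z) = f (z, 0) * a z := by
  rw [hf.inversion z 0, mul_comm, ← integral_const_mul, ← integral_const_mul, ampFam]
  congr 1; funext ζ
  simp [ampKer, cis_zero]
  ring

theorem dd_ampKer (hf : TC μ f) (ha : ContDiff ℝ ∞ a) :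
    dd (((frY n).param (Rn n)).dir none) (ampKer f a) = fun y =>
      ∑ j, Complex.I * ampKer (dd (0, eb j) f) (dd (0, eb j) a) y := by
  set A := fun y : (ℝ × Ph n) × Rn n => cpi n * pft f (y.1.2, y.2) with hA
  set g : Ph n × Rn n → ℂ := fun q => a q.1 with hg
  set B := fun y => g (shiftArg (-ContinuousLinearMap.id ℝ (Rn n)) y) with hB
  have sg : ContDiff ℝ ∞ g := ha.comp contDiff_fst
  have sA : ContDiff ℝ ∞ A := contDiff_const.mul (hf.contDiff_pft.comp (by fun_prop))
  have sB : ContDiff ℝ ∞ B := sg.comp (contDiff_shiftArg _)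
  have e : ampKer f a = fun y => A y * B y := by funext y; simp [ampKer, A, B, g, shiftArg]
  have hd : ∀ q i, dd (((frX n).param (Rn n)).dir (Sum.inr i)) g q = dd (0, eb i) a q.1 :=
    fun q i => dd_eq_of_line (sg.contDiffAt.differentiableAt (by simp))
      (ha.contDiffAt.differentiableAt (by simp)) fun t => by simp [g]
  funext y
  rw [e, dd_mul_on (contDiffOn_univ.2 sA) (contDiffOn_univ.2 sB) isOpen_univ _ (Set.mem_univ y)]
  have h0 : dd (((frY n).param (Rn n)).dir none) A y = 0 :=
    dd_eq_zero_of_line (sA.contDiffAt.differentiableAt (by simp)) fun t => by simp [A]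
  simp only
  rw [h0, zero_mul, zero_add, hB, dd_shift_none sg, mul_sum]
  refine sum_congr rfl fun i _ => ?_
  rw [hd]
  simp only [ampKer, hf.pft_dir, shiftArg, A]
  simp only [neg_apply, ContinuousLinearMap.id_apply, PiLp.neg_apply]
  push_cast
  linear_combination (-(cpi n * pft f (y.1.2, y.2) * ((y.2 i : ℝ) : ℂ) *
    dd (0, eb i) a (y.1.2.1, y.1.2.2 + y.1.1 • (-y.2)))) * Complex.I_mul_I

/-- The terms of the expansion of the symbol of a cut off kernel. -/
def camp : ℕ → (Ph n × Rn n → ℂ) → (Ph n → ℂ) → Ph n → ℂ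
  | 0, f, a => fun z => f (z, 0) * a z
  | r + 1, f, a => fun z => ∑ j, Complex.I * camp r (dd (0, eb j) f) (dd (0, eb j) a) z

theorem TC.dir_last (hf : TC μ f) (j : Fin n) : TC μ (dd (0, eb j) f) := by
  have := hf.dir (Sum.inr j)
  simpa using this

theorem sder_ampFam (hf : TC μ f) (ha : ContDiff ℝ ∞ a) (hs : SymOn univ μ' a) (r : ℕ)
    (z : Ph n) : sder (ampFam f a) r (0, z) = camp r f a z := by
  induction r generalizing μ' f a with
  | zero => exact ampFam_zero hf z
  | succ r ih =>
    have h0 : ((0 : ℝ), z) ∈ slab n := by simp [slab]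
    have hs' : ∀ j, SymOn univ (μ' - 1) (dd (0, eb j) a) := fun j => hs.dir (Sum.inr j)
    rw [sder_succ']
    refine (sder_congr (dd_family (ν := volume) Finset.univ (fun _ => Complex.I) (rd_ampKer hf ha hs)
      (fun j _ => ⟨_, rd_ampKer (hf.dir_last j) (ContDiff.dd ha _) (hs' j)⟩)
      (dd_ampKer hf ha)) r h0).trans ?_
    have := sder_lin Finset.univ (fun _ => Complex.I)
      (J := fun j => ampFam (dd (0, eb j) f) (dd (0, eb j) a))
      (fun j _ => (symFam_ampFam (hf.dir_last j) (ContDiff.dd ha _) (hs' j)).smooth) r h0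
    refine this.trans ?_
    rw [camp]
    exact sum_congr rfl fun j _ => by rw [ih (hf.dir_last j) (ContDiff.dd ha _) (hs' j)]

end Families

/-! ### Identities for Weyl operators -/

section Weyl

open scoped SchwartzMap

variable {n : ℕ} {μ μ' : ℝ}
variable {E : Type*} [NormedAddCommGroup E] [NormedSpace ℝ E] [FiniteDimensional ℝ E]
  [MeasureSpace E] [BorelSpace E] [(volume : Measure E).IsAddHaarMeasure]

/-- The inner integral of the Weyl quantization. -/
def weylInner (a : Ph n → ℂ) (u : Rn n → ℂ) (x ξ : Rn n) : ℂ :=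
  ∫ y, cis (inner ℝ (x - y) ξ) * a ((2 : ℝ)⁻¹ • (x + y), ξ) * u y

theorem weylOp_eq (a : Ph n → ℂ) (u : 𝓢(Rn n, ℂ)) (x : Rn n) :
    weylOp a u x = cpi n * ∫ ξ, weylInner a u x ξ := rfl

/-- A representation of a symbol as a superposition of exponentials in `x`. -/
structure OscRep (μ : ℝ) (L : E →L[ℝ] Rn n) (G : Rn n × E → ℂ) (a : Ph n → ℂ) : Prop where
  cont : Continuous G
  bound : ∀ k : ℕ, ∃ C : ℝ, ∀ p, ‖G p‖ ≤ C * jb (-(k : ℝ)) p.2 * jb μ p.1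
  eq : ∀ z ξ, a (z, ξ) = ∫ ζ, cis (inner ℝ z (L ζ)) * G (ξ, ζ)

/-- The integrand of the Weyl operator of a superposition of exponentials. -/
def oscInt (L : E →L[ℝ] Rn n) (G : Rn n × E → ℂ) (v : Rn n → ℂ) (x : Rn n) (p : Rn n × E) : ℂ :=
  cis (inner ℝ x (p.1 + (2 : ℝ)⁻¹ • L p.2)) * (G p * v (p.1 - (2 : ℝ)⁻¹ • L p.2))

variable {L : E →L[ℝ] Rn n} {G : Rn n × E → ℂ} {a b : Ph n → ℂ} {v : Rn n → ℂ}

theorem OscRep.rap' (h : OscRep μ L G a) (hv : Rap v) :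
    Rap (fun p => G p * v (p.1 - (2 : ℝ)⁻¹ • L p.2)) := by
  refine rap_of_shift (μ := μ) (-((2 : ℝ)⁻¹ • L)) fun k K => ?_
  obtain ⟨C, hC⟩ := h.bound k
  obtain ⟨C', hC0, hC'⟩ := hv.nonneg_const K
  refine ⟨C * C', fun p => ?_⟩
  have e : p.1 + (-((2 : ℝ)⁻¹ • L)) p.2 = p.1 - (2 : ℝ)⁻¹ • L p.2 := by simp [sub_eq_add_neg]
  rw [norm_mul, e]
  calc ‖G p‖ * ‖v (p.1 - (2 : ℝ)⁻¹ • L p.2)‖ ≤ (C * jb (-(k : ℝ)) p.2 * jb μ p.1) *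
        (C' * jb (-(K : ℝ)) (p.1 - (2 : ℝ)⁻¹ • L p.2)) :=
        mul_le_mul (hC p) (hC' _) (norm_nonneg _) ((norm_nonneg _).trans (hC p))
    _ = _ := by ring

theorem OscRep.rap (h : OscRep μ L G a) (hv : Rap v) (x : Rn n) : Rap (oscInt L G v x) :=
  (h.rap' hv).of_norm_le fun p => by rw [oscInt, norm_mul, norm_cis, one_mul]

theorem OscRep.continuous (h : OscRep μ L G a) (hv : Continuous v) (x : Rn n) :
    Continuous (oscInt L G v x) := by
  unfold oscInt
  exact (continuous_cis.comp (by fun_prop)).mul (h.cont.mul (hv.comp (by fun_prop)))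

theorem OscRep.rap_left (h : OscRep μ L G a) (ξ : Rn n) : Rap (fun ζ => G (ξ, ζ)) := fun k => by
  obtain ⟨C, hC⟩ := h.bound k
  exact ⟨C * jb μ ξ, fun ζ => (hC (ξ, ζ)).trans_eq (by ring)⟩

theorem OscRep.inner_eq (h : OscRep μ L G a) (u : 𝓢(Rn n, ℂ)) (x ξ : Rn n) :
    weylInner a u x ξ = ∫ ζ, oscInt L G (ft u) x (ξ, ζ) := by
  have hG : Continuous fun ζ => G (ξ, ζ) := h.cont.comp (by fun_prop)
  have hint : Integrable (Function.uncurry fun (y : Rn n) (ζ : E) =>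
      cis (inner ℝ (x - y) ξ + inner ℝ ((2 : ℝ)⁻¹ • (x + y)) (L ζ)) * (u y * G (ξ, ζ)))
      (volume.prod volume) := by
    refine ((u.integrable (μ := volume)).mul_prod ((h.rap_left ξ).integrable hG)).mono ?_ ?_
    · refine Continuous.aestronglyMeasurable ?_
      exact (continuous_cis.comp (by fun_prop)).mul
        ((u.continuous.comp continuous_fst).mul (hG.comp continuous_snd))
    · refine of_forall fun p => ?_
      simp only [Function.uncurry]
      rw [norm_mul, norm_cis, one_mul]
  have e : ∀ y, cis (inner ℝ (x - y) ξ) * a ((2 : ℝ)⁻¹ • (x + y), ξ) * u y = ∫ ζ : E,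
      cis (inner ℝ (x - y) ξ + inner ℝ ((2 : ℝ)⁻¹ • (x + y)) (L ζ)) * (u y * G (ξ, ζ)) := fun y => by
    rw [h.eq, ← integral_const_mul, ← integral_mul_const]
    congr 1; funext ζ
    rw [cis_add]; ring
  simp only [weylInner, e]
  rw [integral_integral_swap hint]
  congr 1; funext ζ
  rw [oscInt, ft, ← integral_const_mul, ← integral_const_mul]
  congr 1; funext y
  have : inner ℝ (x - y) ξ + inner ℝ ((2 : ℝ)⁻¹ • (x + y)) (L ζ) =
      inner ℝ x (ξ + (2 : ℝ)⁻¹ • L ζ) + -(inner ℝ y (ξ - (2 : ℝ)⁻¹ • L ζ)) := by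
    simp only [inner_sub_left, inner_add_left, inner_smul_left, inner_add_right, inner_sub_right,
      inner_smul_right, conj_trivial]
    ring
  simp only at this ⊢
  rw [this, cis_add]; ring

theorem OscRep.weyl_eq (h : OscRep μ L G a) (u : 𝓢(Rn n, ℂ)) (x : Rn n) :
    weylOp a u x = cpi n * ∫ ξ, ∫ ζ, oscInt L G (ft u) x (ξ, ζ) := by
  rw [weylOp_eq]; simp only [h.inner_eq]

theorem OscRep.integrable_inner (h : OscRep μ L G a) (u : 𝓢(Rn n, ℂ)) (x : Rn n) :
    Integrable (weylInner a u x) := by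
  have e : weylInner a u x = fun ξ => ∫ ζ, oscInt L G (ft u) x (ξ, ζ) := funext (h.inner_eq u x)
  have h1 := (h.rap (rap_ft_schwartz u) x).integral
    (h.continuous (contDiff_ft_schwartz u).continuous x)
  rw [e]
  exact h1.2.integrable h1.1

/-- The amplitude in the representation of a symbol with compact support in `x`. -/
def hatAmp (a : Ph n → ℂ) (p : Rn n × Rn n) : ℂ := cpi n * hat a ((0, p.1), p.2)

theorem XC.oscRep (h : XC μ a) : OscRep μ (ContinuousLinearMap.id ℝ (Rn n)) (hatAmp a) a where
  cont := continuous_const.mul (h.tc.contDiff_pft.continuous.comp (by fun_prop))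
  bound k := by
    obtain ⟨C, hC⟩ := h.tc.norm_pft_le k
    refine ⟨‖cpi n‖ * C, fun p => ?_⟩
    rw [hatAmp, norm_mul, mul_assoc, mul_assoc]
    exact mul_le_mul_of_nonneg_left ((hC _).trans_eq (by simp [jb]; ring)) (norm_nonneg _)
  eq z ξ := h.inversion 0 z ξ

theorem integrable_weyl_y {a : Ph n → ℂ} (ha : ContDiff ℝ ∞ a) (hs : SymOn univ μ a)
    (u : 𝓢(Rn n, ℂ)) (x ξ : Rn n) :
    Integrable fun y => cis (inner ℝ (x - y) ξ) * a ((2 : ℝ)⁻¹ • (x + y), ξ) * u y := by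
  obtain ⟨C, hC⟩ := hs 0
  refine ((u.integrable (μ := volume)).norm.const_mul (C * (frX n).ρ ((0 : Rn n), ξ) ^ μ)).mono' ?_ ?_
  · refine Continuous.aestronglyMeasurable ?_
    exact ((continuous_cis.comp (by fun_prop)).mul (ha.continuous.comp (by fun_prop))).mul
      u.continuous
  · refine of_forall fun y => ?_
    rw [norm_mul, norm_mul, norm_cis, one_mul]
    exact mul_le_mul_of_nonneg_right (hC.bound ((2 : ℝ)⁻¹ • (x + y), ξ) trivial) (norm_nonneg _)

/-- Symbols for which the outer integral in the Weyl quantization converges absolutely. -/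
structure Good (a : Ph n → ℂ) : Prop where
  int_y : ∀ (u : 𝓢(Rn n, ℂ)) (x ξ : Rn n), Integrable fun y =>
    cis (inner ℝ (x - y) ξ) * a ((2 : ℝ)⁻¹ • (x + y), ξ) * u y
  int_xi : ∀ (u : 𝓢(Rn n, ℂ)) (x : Rn n), Integrable (weylInner a u x)

theorem XC.good (h : XC μ a) : Good a :=
  ⟨integrable_weyl_y h.smooth h.sym, fun u x => h.oscRep.integrable_inner u x⟩

theorem weylOp_zero (u : 𝓢(Rn n, ℂ)) (x : Rn n) : weylOp (fun _ : Ph n => 0) u x = 0 := by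
  simp [weylOp]

theorem Good.lin {κ : Type*} (T : Finset κ) (c : κ → ℂ) {a : κ → Ph n → ℂ}
    (ha : ∀ k ∈ T, Good (a k)) (u : 𝓢(Rn n, ℂ)) (x : Rn n) :
    weylOp (fun z => ∑ k ∈ T, c k * a k z) u x = ∑ k ∈ T, c k * weylOp (a k) u x := by
  have h1 : ∀ ξ, weylInner (fun z => ∑ k ∈ T, c k * a k z) u x ξ =
      ∑ k ∈ T, c k * weylInner (a k) u x ξ := fun ξ => by
    simp only [weylInner, mul_sum, sum_mul]
    rw [integral_finset_sum]
    · refine sum_congr rfl fun k _ => ?_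
      rw [← integral_const_mul]
      congr 1; funext y; ring
    · intro k hk
      refine (((ha k hk).int_y u x ξ).const_mul (c k)).congr (of_forall fun y => ?_)
      simp only; ring
  simp only [weylOp_eq, h1]
  rw [integral_finset_sum _ fun k hk => ((ha k hk).int_xi u x).const_mul _, mul_sum]
  refine sum_congr rfl fun k _ => ?_
  rw [integral_const_mul]; ring

theorem weylInner_one (u : 𝓢(Rn n, ℂ)) (x ξ : Rn n) :
    weylInner (fun _ : Ph n => 1) u x ξ = cis (inner ℝ x ξ) * ft u ξ := by
  rw [weylInner, ft, ← integral_const_mul]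
  congr 1; funext y
  rw [inner_sub_left, sub_eq_add_neg, cis_add]; ring

theorem weylOp_one (u : 𝓢(Rn n, ℂ)) (x : Rn n) : weylOp (fun _ : Ph n => 1) u x = u x := by
  rw [weylOp_eq]
  simp only [weylInner_one]
  exact (ft_inversion u.continuous u.integrable
    ((rap_ft_schwartz u).integrable (contDiff_ft_schwartz u).continuous) x).symm

/-- The Weyl composition of two symbols with compact support in `x`. -/
def comp (a b : Ph n → ℂ) (z : Ph n) : ℂ := compFam a b (1, z)

/-- The amplitude in the representation of the composition. -/
def compAmp (a b : Ph n → ℂ) (p : Rn n × (Rn n × Rn n)) : ℂ :=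
  hatAmp a (p.1 + (2 : ℝ)⁻¹ • p.2.2, p.2.1) * hatAmp b (p.1 - (2 : ℝ)⁻¹ • p.2.1, p.2.2)

theorem compKer_one (a b : Ph n → ℂ) (z ξ : Rn n) (ζ : Rn n × Rn n) :
    compKer a b ((1, z, ξ), ζ) = cis (inner ℝ z (ζ.1 + ζ.2)) * compAmp a b (ξ, ζ) := by
  simp only [compKer, compAmp, hatAmp, one_smul, sub_eq_add_neg]
  rfl

/-- The sum of two covectors. -/
def sumL (n : ℕ) : Rn n × Rn n →L[ℝ] Rn n := fst ℝ (Rn n) (Rn n) + snd ℝ (Rn n) (Rn n)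

theorem oscRep_comp (ha : XC μ a) (hb : XC μ' b) :
    OscRep (μ + μ') (sumL n) (compAmp a b) (comp a b) where
  cont := (ha.oscRep.cont.comp (by fun_prop)).mul (hb.oscRep.cont.comp (by fun_prop))
  bound k := by
    obtain ⟨C, hC⟩ := (rd_compKer ha hb).bound 0 k
    refine ⟨C, fun p => ?_⟩
    have h := hC.bound ((1, 0, p.1), p.2) ⟨by simp [slab], trivial⟩
    rw [compKer_one, norm_mul, norm_cis, one_mul] at h
    exact h
  eq z ξ := by
    simp only [comp, compFam, compKer_one]
    rfl

theorem XC.weyl_eq_inverse (hb : XC μ b) (u : 𝓢(Rn n, ℂ)) (y : Rn n) :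
    weylOp b u y = cpi n * ∫ η, cis (inner ℝ y η) *
      ∫ β, hatAmp b (η - (2 : ℝ)⁻¹ • β, β) * ft u (η - β) := by
  rw [hb.oscRep.weyl_eq, integral_shear (hb.oscRep.rap (rap_ft_schwartz u) y)
    (hb.oscRep.continuous (contDiff_ft_schwartz u).continuous y)
    (-((2 : ℝ)⁻¹ • ContinuousLinearMap.id ℝ (Rn n)))]
  congr 2; funext η
  rw [← integral_const_mul]
  congr 1; funext β
  simp only [oscInt, neg_apply, smul_apply, ContinuousLinearMap.id_apply]
  have e1 : η + -((2 : ℝ)⁻¹ • β) + (2 : ℝ)⁻¹ • β = η := by abel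
  have e2 : η + -((2 : ℝ)⁻¹ • β) - (2 : ℝ)⁻¹ • β = η - β := by
    have : β = (2 : ℝ)⁻¹ • β + (2 : ℝ)⁻¹ • β := by rw [← add_smul]; norm_num
    conv_rhs => rw [this]
    abel
  rw [e1, e2, ← sub_eq_add_neg]

theorem XC.rap_conv (hb : XC μ b) (u : 𝓢(Rn n, ℂ)) :
    Continuous (fun q : Rn n × Rn n => hatAmp b (q.1 - (2 : ℝ)⁻¹ • q.2, q.2) * ft u (q.1 - q.2)) ∧
    Rap (fun q : Rn n × Rn n => hatAmp b (q.1 - (2 : ℝ)⁻¹ • q.2, q.2) * ft u (q.1 - q.2)) := by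
  refine ⟨(hb.oscRep.cont.comp (by fun_prop)).mul
    ((contDiff_ft_schwartz u).continuous.comp (by fun_prop)), ?_⟩
  have h := (hb.oscRep.rap' (rap_ft_schwartz u)).shear
    (-((2 : ℝ)⁻¹ • ContinuousLinearMap.id ℝ (Rn n)))
  refine h.of_norm_le fun q => le_of_eq ?_
  simp only [neg_apply, smul_apply, ContinuousLinearMap.id_apply]
  have e2 : q.1 + -((2 : ℝ)⁻¹ • q.2) - (2 : ℝ)⁻¹ • q.2 = q.1 - q.2 := by
    have : q.2 = (2 : ℝ)⁻¹ • q.2 + (2 : ℝ)⁻¹ • q.2 := by rw [← add_smul]; norm_num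
    conv_rhs => rw [this]
    abel
  rw [e2, sub_eq_add_neg]

theorem XC.ft_weyl (hb : XC μ b) (u v : 𝓢(Rn n, ℂ)) (hv : ∀ y, v y = weylOp b u y) :
    ft v = fun η => ∫ β, hatAmp b (η - (2 : ℝ)⁻¹ • β, β) * ft u (η - β) := by
  have h1 := (hb.rap_conv u).2.integral (hb.rap_conv u).1
  exact ft_eq_of_inverse h1.1 (h1.2.integrable h1.1) v.integrable fun y => by
    rw [hv, hb.weyl_eq_inverse]

theorem weylOp_comp (ha : XC μ a) (hb : XC μ' b) (u v : 𝓢(Rn n, ℂ))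
    (hv : ∀ y, v y = weylOp b u y) (x : Rn n) : weylOp a v x = weylOp (comp a b) u x := by
  have hu := contDiff_ft_schwartz u
  have hr := (oscRep_comp ha hb).rap (rap_ft_schwartz u) x
  have hc := (oscRep_comp ha hb).continuous hu.continuous x
  rw [(oscRep_comp ha hb).weyl_eq, ha.oscRep.weyl_eq, integral_shear hr hc (-shiftL n)]
  congr 2; funext ξ
  have hi : Integrable (fun ζ : Rn n × Rn n =>
      oscInt (sumL n) (compAmp a b) (ft u) x (ξ + (-shiftL n) ζ, ζ)) (volume.prod volume) := by
    have h2 := (hr.shear (-shiftL n)).comp (f := fun ζ : Rn n × Rn n => (ξ, ζ)) (D := 1)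
      zero_le_one fun ζ => by rw [one_mul]; exact add_le_add le_rfl (norm_snd_le (ξ, ζ))
    have hc2 : Continuous fun ζ : Rn n × Rn n => (ξ + (-shiftL n) ζ, ζ) := by fun_prop
    exact Rap.integrable_prod h2 (hc.comp hc2)
  change _ = ∫ ζ, oscInt (sumL n) (compAmp a b) (ft u) x (ξ + (-shiftL n) ζ, ζ) ∂(volume.prod volume)
  rw [integral_prod _ hi]
  congr 1; funext α
  rw [oscInt, hb.ft_weyl u v hv, ← integral_const_mul, ← integral_const_mul]
  congr 1; funext β
  simp only [oscInt, compAmp, shiftL, sumL, neg_apply, smul_apply, add_apply,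
    ContinuousLinearMap.coe_fst', ContinuousLinearMap.coe_snd', ContinuousLinearMap.id_apply,
    smul_add]
  have e0 : ξ + -((2 : ℝ)⁻¹ • β) + ((2 : ℝ)⁻¹ • α + (2 : ℝ)⁻¹ • β) = ξ + (2 : ℝ)⁻¹ • α := by abel
  have e1 : ξ + -((2 : ℝ)⁻¹ • β) + (2 : ℝ)⁻¹ • β = ξ := by abel
  have e2 : ξ + -((2 : ℝ)⁻¹ • β) - (2 : ℝ)⁻¹ • α = ξ - (2 : ℝ)⁻¹ • α - (2 : ℝ)⁻¹ • β := by abel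
  have e3 : ξ + -((2 : ℝ)⁻¹ • β) - ((2 : ℝ)⁻¹ • α + (2 : ℝ)⁻¹ • β) = ξ - (2 : ℝ)⁻¹ • α - β := by
    have : β = (2 : ℝ)⁻¹ • β + (2 : ℝ)⁻¹ • β := by rw [← add_smul]; norm_num
    conv_rhs => rw [this]
    abel
  rw [e0, e1, e2, e3]
  ring

end Weyl

/-! ### Multiplication of the kernel by cutoffs -/

section Cutoff

open scoped SchwartzMap

variable {n : ℕ} {μ μ' : ℝ}

theorem frC_spans (r : ℝ) (hr : 1 ≤ r) : (frC n r hr).Spans :=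
  ⟨(Finset.univ : Finset (Fin n)), fun i => EuclideanSpace.proj i,
    fun v => (sum_coord_smul_eb v).symm⟩

theorem XC.contDiff_weylOp {a : Ph n → ℂ} (h : XC μ a) (u : 𝓢(Rn n, ℂ)) :
    ContDiff ℝ ∞ (weylOp a u) := by
  set g : Rn n × Rn n → ℂ := fun p => hatAmp a p * ft u (p.1 - (2 : ℝ)⁻¹ • p.2) with hg
  have sg : ContDiff ℝ ∞ g := (contDiff_const.mul (h.tc.contDiff_pft.comp (by fun_prop))).mul
    ((contDiff_ft_schwartz u).comp (by fun_prop))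
  have rg : Rap g := h.oscRep.rap' (rap_ft_schwartz u)
  have hc := pg_cis (F := frC n 1 le_rfl) (U := univ) (E := Rn n × Rn n)
    (((ContinuousLinearMap.compL ℝ (Rn n × Rn n) (Rn n) ℝ).flip (fst ℝ (Rn n) (Rn n) +
        (2 : ℝ)⁻¹ • snd ℝ (Rn n) (Rn n))).comp (innerSL ℝ))
    (fun i => Or.inl rfl)
  have hr : RD (frC n 1 le_rfl) univ 0 (fun y : Rn n × (Rn n × Rn n) => g y.2) := by
    refine ⟨sg.comp contDiff_snd, fun N k => ?_⟩
    obtain ⟨C, hC⟩ := rg k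
    exact ⟨C, (SB.of_param_const g N).mono_weight fun y _ => hC y.2⟩
  have hi := ((hr.mul_pg hc isOpen_univ).intClass volume).contDiffOn (frC_spans 1 le_rfl)
    continuous_const isOpen_univ
  have e : weylOp a u = fun x => cpi n * ∫ p : Rn n × Rn n, g p *
      cis (inner ℝ x (p.1 + (2 : ℝ)⁻¹ • p.2)) := by
    funext x
    have hri := (h.oscRep.rap (rap_ft_schwartz u) x).integrable_prod
      (h.oscRep.continuous (contDiff_ft_schwartz u).continuous x)
    rw [h.oscRep.weyl_eq, ← integral_prod _ hri]
    change _ = cpi n * ∫ p, _ ∂(volume.prod volume)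
    congr 2; funext p
    rw [oscInt, mul_comm]; rfl
  rw [e]
  exact contDiff_const.mul (contDiffOn_univ.1 hi)

theorem tc_of_compact {h : Ph n → ℂ} (hs : ContDiff ℝ ∞ h) (hc : HasCompactSupport h) :
    TC 0 (fun y : Ph n × Rn n => h (y.1.1, y.2)) := by
  have hsm : ∀ {h : Ph n → ℂ}, ContDiff ℝ ∞ h →
    ContDiff ℝ ∞ (fun y : Ph n × Rn n => h (y.1.1, y.2)) := fun hs => hs.comp (by fun_prop)
  refine ⟨hsm hs, ?_, fun N => ?_⟩
  · obtain ⟨R, hR⟩ := hc.isCompact.isBounded.subset_closedBall 0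
    refine ⟨R, fun y hy => image_eq_zero_of_notMem_tsupport fun hm => ?_⟩
    have := hR hm
    simp only [mem_closedBall_zero_iff] at this
    exact absurd ((norm_snd_le (y.1.1, y.2)).trans this) (not_le.2 hy)
  · have key : ∃ C : ℝ, SB (frP n) univ (fun _ => C * 1) N 0
        (fun y : Ph n × Rn n => h (y.1.1, y.2)) := by
      induction N generalizing h with
      | zero =>
        obtain ⟨C, hC⟩ := hs.continuous.bounded_above_of_compact_support hc
        exact ⟨C, fun y _ => by simpa using hC _⟩
      | succ N ih =>
        haveI : Finite (frP n).ι := inferInstanceAs (Finite ((Fin n ⊕ Fin n) ⊕ Fin n))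
        obtain ⟨C, hC⟩ := hs.continuous.bounded_above_of_compact_support hc
        refine SB.exists_succ (fun _ _ => zero_le_one) ⟨C, fun y _ => by simpa using hC _⟩ fun i => ?_
        have hl : ∀ (v : Ph n × Rn n) (w : Ph n), (v.1.1, v.2) = w →
            dd v (fun y : Ph n × Rn n => h (y.1.1, y.2)) = fun y => dd w h (y.1.1, y.2) :=
          fun v w e => funext fun y => dd_eq_of_line ((hsm hs).contDiffAt.differentiableAt (by simp))
            (hs.contDiffAt.differentiableAt (by simp)) fun t => by simp [← e]
        rcases i with (i | i) | i
        · rw [hl _ (eb i, 0) (by simp)]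
          simpa using ih (ContDiff.dd hs _) (hc.fderiv_apply (𝕜 := ℝ) _)
        · rw [hl _ 0 (by simp)]
          exact ⟨0, by simpa [dd] using SB.zero.mono_weight fun _ _ => by simp⟩
        · rw [hl _ (0, eb i) (by simp)]
          simpa using ih (ContDiff.dd hs _) (hc.fderiv_apply (𝕜 := ℝ) _)
    simpa using key

/-- A smooth function of compact support on `ℝⁿ`. -/
structure IsCut (g : Rn n → ℂ) : Prop where
  smooth : ContDiff ℝ ∞ g
  compact : HasCompactSupport g

/-- The product `φ(x) ψ(y)` in the coordinates `z = (x + y) / 2`, `t = x - y`. -/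
def cutF (φ ψ : Rn n → ℂ) (y : Ph n × Rn n) : ℂ :=
  φ (y.1.1 + (2 : ℝ)⁻¹ • y.2) * ψ (y.1.1 - (2 : ℝ)⁻¹ • y.2)

/-- The linear change of variables `(z, t) ↦ (z + t / 2, z - t / 2)`. -/
def midEquiv (n : ℕ) : Ph n ≃ₜ Ph n where
  toFun z := (z.1 + (2 : ℝ)⁻¹ • z.2, z.1 - (2 : ℝ)⁻¹ • z.2)
  invFun w := ((2 : ℝ)⁻¹ • (w.1 + w.2), w.1 - w.2)
  left_inv z := by ext1 <;> module
  right_inv w := by ext1 <;> module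
  continuous_toFun := by fun_prop
  continuous_invFun := by fun_prop

variable {φ ψ : Rn n → ℂ} {a : Ph n → ℂ}

theorem hasCompactSupport_cut (hφ : IsCut φ) (hψ : IsCut ψ) :
    HasCompactSupport fun z : Ph n => φ (z.1 + (2 : ℝ)⁻¹ • z.2) * ψ (z.1 - (2 : ℝ)⁻¹ • z.2) := by
  have h1 : HasCompactSupport fun w : Ph n => φ w.1 * ψ w.2 := by
    refine HasCompactSupport.of_support_subset_isCompact (hφ.compact.isCompact.prod hψ.compact.isCompact)
      fun w hw => ?_
    have := mul_ne_zero_iff.1 hw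
    exact ⟨subset_tsupport _ this.1, subset_tsupport _ this.2⟩
  exact h1.comp_homeomorph (midEquiv n)

theorem tc_cutF (hφ : IsCut φ) (hψ : IsCut ψ) : TC 0 (cutF φ ψ) :=
  tc_of_compact (h := fun z => φ (z.1 + (2 : ℝ)⁻¹ • z.2) * ψ (z.1 - (2 : ℝ)⁻¹ • z.2))
    ((hφ.smooth.comp (by fun_prop)).mul (hψ.smooth.comp (by fun_prop))) (hasCompactSupport_cut hφ hψ)

/-- The symbol of the operator `φ a^w ψ`. -/
def ampS (φ ψ : Rn n → ℂ) (a : Ph n → ℂ) (z : Ph n) : ℂ := ampFam (cutF φ ψ) a (1, z)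

theorem cutF_supp (hφ : IsCut φ) (hψ : IsCut ψ) :
    ∃ R : ℝ, ∀ y : Ph n × Rn n, R < ‖y.1.1‖ → cutF φ ψ y = 0 := by
  obtain ⟨R, hR⟩ := (hasCompactSupport_cut hφ hψ).isCompact.isBounded.subset_closedBall 0
  refine ⟨R, fun y hy => ?_⟩
  have h0 : (y.1.1, y.2) ∉ tsupport fun z : Ph n =>
      φ (z.1 + (2 : ℝ)⁻¹ • z.2) * ψ (z.1 - (2 : ℝ)⁻¹ • z.2) := fun hm => by
    have := hR hm
    simp only [mem_closedBall_zero_iff] at this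
    exact absurd ((norm_fst_le (y.1.1, y.2)).trans this) (not_le.2 hy)
  have := image_eq_zero_of_notMem_tsupport h0
  exact this

theorem pft_cutF_supp (hφ : IsCut φ) (hψ : IsCut ψ) :
    ∃ R : ℝ, ∀ y : Ph n × Rn n, R < ‖y.1.1‖ → pft (cutF φ ψ) y = 0 := by
  obtain ⟨R, hR⟩ := cutF_supp hφ hψ
  refine ⟨R, fun y hy => ?_⟩
  rw [pft, ft]
  have h0 : ∀ t, cutF φ ψ (y.1, t) = 0 := fun t => hR (y.1, t) hy
  simp only [h0, mul_zero, integral_zero]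

theorem xc_ampS (hφ : IsCut φ) (hψ : IsCut ψ) (ha : ContDiff ℝ ∞ a) (hs : SymOn univ μ a) :
    XC μ (ampS φ ψ a) where
  smooth := (symFam_ampFam (tc_cutF hφ hψ) ha hs).contDiff_at (by norm_num)
  supp := by
    obtain ⟨R, hR⟩ := pft_cutF_supp hφ hψ
    refine ⟨R, fun z hz => ?_⟩
    simp only [ampS, ampFam, ampKer, hR (z, _) hz, mul_zero, zero_mul, integral_zero]
  sym := by
    have := (symFam_ampFam (tc_cutF hφ hψ) ha hs).symOn_at (t := 1) (by norm_num)
    rwa [zero_add] at this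

theorem integral_swap_of_bound {k : Rn n × Rn n → ℂ} (hk : Continuous k) {C : ℝ}
    (hb : ∀ p, ‖k p‖ ≤ C * jb (-((n + 1 : ℕ) : ℝ)) p.2) (u : 𝓢(Rn n, ℂ)) :
    ∫ ζ, ∫ y, k (y, ζ) * u y = ∫ y, ∫ ζ, k (y, ζ) * u y := by
  refine (integral_integral_swap (f := fun y ζ => k (y, ζ) * u y) ?_).symm
  have hj : Integrable (fun ζ : Rn n => C * jb (-((n + 1 : ℕ) : ℝ)) ζ) :=
    (integrable_jb volume (by rw [finrank_euclideanSpace_fin]; push_cast; linarith)).const_mul C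
  refine ((u.integrable (μ := volume)).norm.mul_prod hj).mono' ?_ ?_
  · exact (hk.mul (u.continuous.comp continuous_fst)).aestronglyMeasurable
  · refine of_forall fun p => ?_
    simp only [Function.uncurry]
    rw [norm_mul, mul_comm]
    exact mul_le_mul_of_nonneg_left (hb p) (norm_nonneg _)

/-- The amplitude of the cut off operator. -/
def cutAmp (φ ψ : Rn n → ℂ) (a : Ph n → ℂ) (q : Ph n × Rn n) : ℂ :=
  (cpi n * pft (cutF φ ψ) q) * a q.1

/-- The integrand in the comparison of the two sides of the cutoff formula. -/
def cutInt (H : Ph n × Rn n → ℂ) (u : Rn n → ℂ) (x : Rn n) (p : Rn n × Rn n) (y : Rn n) : ℂ :=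
  cis (inner ℝ (x - y) (p.1 + p.2)) * H (((2 : ℝ)⁻¹ • (x + y), p.1), p.2) * u y

theorem rd_cutAmp (hφ : IsCut φ) (hψ : IsCut ψ) (ha : ContDiff ℝ ∞ a) (hs : SymOn univ μ a) :
    RD (frX n) univ μ (cutAmp φ ψ a) := by
  have := ((tc_cutF hφ hψ).rd.const_mul isOpen_univ (cpi n)).mul_pg
    (pg_const (E := Rn n) ha hs) isOpen_univ
  rwa [zero_add] at this

section CutInt

variable {H : Ph n × Rn n → ℂ} {R : ℝ} {x : Rn n}

theorem mid_supp (hR : ∀ y : Ph n × Rn n, R < ‖y.1.1‖ → H y = 0) (ξ ζ y : Rn n)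
    (hy : 2 * R + ‖x‖ < ‖y‖) : H (((2 : ℝ)⁻¹ • (x + y), ξ), ζ) = 0 := by
  refine hR _ ?_
  change R < ‖(2 : ℝ)⁻¹ • (x + y)‖
  rw [norm_smul]
  have h1 := norm_sub_le (x + y) x
  rw [add_sub_cancel_left] at h1
  norm_num
  linarith

theorem continuous_cutInt (hc : Continuous H) (hR : ∀ y : Ph n × Rn n, R < ‖y.1.1‖ → H y = 0)
    (u : 𝓢(Rn n, ℂ)) (x : Rn n) : Continuous fun p => ∫ y, cutInt H u x p y := by
  have cΦ : Continuous (Function.uncurry (cutInt H u x)) :=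
    ((continuous_cis.comp (by fun_prop)).mul (hc.comp (by fun_prop))).mul
      (u.continuous.comp continuous_snd)
  have := continuous_parametric_integral_of_continuous (μ := (volume : Measure (Rn n))) cΦ
    (isCompact_closedBall (0 : Rn n) (2 * R + ‖x‖))
  refine this.congr fun p => setIntegral_eq_integral_of_forall_compl_eq_zero fun y hy => ?_
  rw [cutInt, mid_supp hR _ _ _ (by simpa using hy), mul_zero, zero_mul]

theorem sb_mid {w : Rn n → ℝ} {N : ℕ} (hH : ContDiff ℝ ∞ H)
    (hS : SB ((frX n).param (Rn n)) (univ ×ˢ univ) (fun y => w y.2) N μ H) (ξ ζ : Rn n)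
    (hr : 1 ≤ 1 + ‖ξ‖) : SB (frC n (1 + ‖ξ‖) hr) univ (fun _ => w ζ) N μ
      (fun y : Rn n => H (((2 : ℝ)⁻¹ • (x + y), ξ), ζ)) := by
  have h1 := SB.comp_affine (F' := frC n (1 + ‖ξ‖) hr) (s' := univ)
    ((inl ℝ (Ph n) (Rn n)).comp ((inl ℝ (Rn n) (Rn n)).comp
      ((2 : ℝ)⁻¹ • ContinuousLinearMap.id ℝ (Rn n)))) ((((2 : ℝ)⁻¹ • x, ξ), ζ) : Ph n × Rn n)
    hS (isOpen_univ.prod isOpen_univ) subset_rfl hH.contDiffOn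
    (fun _ _ => ⟨trivial, trivial⟩) (fun y _ => hS.weight_nonneg _ ⟨trivial, trivial⟩)
    (fun y => by simp)
    (fun j => Or.inr ⟨Sum.inl j, 2⁻¹, by rw [abs_of_pos] <;> norm_num, by simp, rfl⟩)
  have e1 : ∀ y : Rn n, (2 : ℝ)⁻¹ • y + (2 : ℝ)⁻¹ • x = (2 : ℝ)⁻¹ • (x + y) := fun y => by
    rw [← smul_add, add_comm]
  simpa [e1] using h1

theorem rap_cutInt (rH : RD (frX n) univ μ H) (hR : ∀ y : Ph n × Rn n, R < ‖y.1.1‖ → H y = 0)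
    (u : 𝓢(Rn n, ℂ)) (x : Rn n) : Rap fun p => ∫ y, cutInt H u x p y := by
  refine rap_of_shift (μ := μ) (ContinuousLinearMap.id ℝ (Rn n)) fun k K => ?_
  obtain ⟨C, hC0, hC⟩ := ft_decay (n := n) (2 * R + ‖x‖) K
  obtain ⟨C1, hC1⟩ := rH.bound K k
  obtain ⟨C2, hC2⟩ := sb_schwartz u K
  refine ⟨C * (2 ^ K * (C1 * C2)), fun p => ?_⟩
  have hr : 1 ≤ 1 + ‖p.1‖ := by linarith [norm_nonneg p.1]
  have s1 : ContDiff ℝ ∞ fun y : Rn n => H (((2 : ℝ)⁻¹ • (x + y), p.1), p.2) :=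
    rH.smooth.comp (by fun_prop)
  have su : ContDiff ℝ ∞ u := u.smooth ⊤
  have h3 := (sb_mid (x := x) (w := fun ζ => C1 * jb (-(k : ℝ)) ζ) rH.smooth hC1 p.1 p.2 hr).mul
    (hC2 _ hr) isOpen_univ subset_rfl s1.contDiffOn su.contDiffOn
  rw [add_zero] at h3
  have h4 := hC _ _ _ _ hr (s1.mul su) (fun y hy => by rw [mid_supp hR _ _ _ hy, zero_mul]) h3
    (p.1 + p.2)
  have e : ∫ y, cutInt H u x p y = cis (inner ℝ x (p.1 + p.2)) *
      ft (fun y => H (((2 : ℝ)⁻¹ • (x + y), p.1), p.2) * u y) (p.1 + p.2) := by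
    rw [ft, ← integral_const_mul]
    congr 1; funext y
    rw [cutInt, inner_sub_left, sub_eq_add_neg, cis_add]; ring
  rw [e, norm_mul, norm_cis, one_mul]
  refine h4.trans_eq ?_
  simp only [ContinuousLinearMap.id_apply, jb]; ring

end CutInt

theorem integral_cutInt_left (hφ : IsCut φ) (hψ : IsCut ψ) (ha : ContDiff ℝ ∞ a)
    (hs : SymOn univ μ a) (u v : 𝓢(Rn n, ℂ)) (hv : ∀ y, v y = ψ y * u y) (x ξ : Rn n) :
    ∫ ζ, ∫ y, cutInt (cutAmp φ ψ a) u x (ξ, ζ) y = φ x * weylInner a v x ξ := by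
  have rH := rd_cutAmp hφ hψ ha hs
  obtain ⟨C0, hC0⟩ := rH.bound 0 (n + 1)
  simp only [cutInt]
  rw [integral_swap_of_bound (k := fun p => cis (inner ℝ (x - p.1) (ξ + p.2)) *
    cutAmp φ ψ a (((2 : ℝ)⁻¹ • (x + p.1), ξ), p.2)) ((continuous_cis.comp (by fun_prop)).mul
      (rH.smooth.continuous.comp (by fun_prop))) (C := C0 * (1 + ‖ξ‖) ^ μ) (fun p => ?_) u]
  · rw [weylInner, ← integral_const_mul]
    congr 1; funext y
    have hi := (tc_cutF hφ hψ).inversion ((2 : ℝ)⁻¹ • (x + y), ξ) (x - y)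
    have e1 : cutF φ ψ (((2 : ℝ)⁻¹ • (x + y), ξ), x - y) = φ x * ψ y := by
      have e2 := (midEquiv n).right_inv (x, y)
      have e3 : (2 : ℝ)⁻¹ • (x + y) + (2 : ℝ)⁻¹ • (x - y) = x := congrArg Prod.fst e2
      have e4 : (2 : ℝ)⁻¹ • (x + y) - (2 : ℝ)⁻¹ • (x - y) = y := congrArg Prod.snd e2
      simp only [cutF]
      rw [e3, e4]
    rw [e1] at hi
    rw [hv, show φ x * (cis (inner ℝ (x - y) ξ) * a ((2 : ℝ)⁻¹ • (x + y), ξ) * (ψ y * u y)) =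
      (φ x * ψ y) * (cis (inner ℝ (x - y) ξ) * a ((2 : ℝ)⁻¹ • (x + y), ξ) * u y) by ring, hi,
      ← integral_const_mul, ← integral_mul_const]
    congr 1; funext ζ
    simp only [cutAmp]
    rw [inner_add_right, cis_add]; ring
  · rw [norm_mul, norm_cis, one_mul]
    refine (hC0.bound (((2 : ℝ)⁻¹ • (x + p.1), ξ), p.2) ⟨trivial, trivial⟩).trans_eq ?_
    simp only; ring

theorem integral_cutInt_right (hφ : IsCut φ) (hψ : IsCut ψ) (ha : ContDiff ℝ ∞ a)
    (hs : SymOn univ μ a) (u : 𝓢(Rn n, ℂ)) (x ξ : Rn n) :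
    ∫ ζ, ∫ y, cutInt (cutAmp φ ψ a) u x (ξ + (-ContinuousLinearMap.id ℝ (Rn n)) ζ, ζ) y =
      weylInner (ampS φ ψ a) u x ξ := by
  have hk := rd_ampKer (tc_cutF hφ hψ) ha hs
  obtain ⟨C1, hC1⟩ := hk.bound 0 (n + 1)
  have eΦ : ∀ ζ y, cutInt (cutAmp φ ψ a) u x (ξ + (-ContinuousLinearMap.id ℝ (Rn n)) ζ, ζ) y =
      cis (inner ℝ (x - y) ξ) * ampKer (cutF φ ψ) a ((1, (2 : ℝ)⁻¹ • (x + y), ξ), ζ) * u y :=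
    fun ζ y => by
      have eK : cutAmp φ ψ a (((2 : ℝ)⁻¹ • (x + y), ξ + -ζ), ζ) =
          ampKer (cutF φ ψ) a ((1, (2 : ℝ)⁻¹ • (x + y), ξ), ζ) := by
        simp only [cutAmp, ampKer, one_smul]
        rfl
      simp only [cutInt, neg_apply, ContinuousLinearMap.id_apply]
      rw [eK, neg_add_cancel_right]
  simp only [eΦ]
  rw [integral_swap_of_bound (k := fun p => cis (inner ℝ (x - p.1) ξ) *
    ampKer (cutF φ ψ) a ((1, (2 : ℝ)⁻¹ • (x + p.1), ξ), p.2)) ((continuous_cis.comp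
      (by fun_prop)).mul (hk.smooth.continuous.comp (by fun_prop)))
      (C := C1 * (1 + ‖ξ‖) ^ (0 + μ)) (fun p => ?_) u]
  · rw [weylInner]
    congr 1; funext y
    simp only [ampS, ampFam]
    rw [← integral_const_mul, ← integral_mul_const]
  · rw [norm_mul, norm_cis, one_mul]
    refine (hC1.bound ((1, (2 : ℝ)⁻¹ • (x + p.1), ξ), p.2) ⟨by simp [slab], trivial⟩).trans_eq ?_
    simp only; ring

theorem weylOp_ampS (hφ : IsCut φ) (hψ : IsCut ψ) (ha : ContDiff ℝ ∞ a) (hs : SymOn univ μ a)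
    (u v : 𝓢(Rn n, ℂ)) (hv : ∀ y, v y = ψ y * u y) (x : Rn n) :
    weylOp (ampS φ ψ a) u x = φ x * weylOp a v x := by
  have rH := rd_cutAmp hφ hψ ha hs
  obtain ⟨R, hR⟩ := pft_cutF_supp hφ hψ
  have hR' : ∀ y : Ph n × Rn n, R < ‖y.1.1‖ → cutAmp φ ψ a y = 0 := fun y hy => by
    rw [cutAmp, hR y hy, mul_zero, zero_mul]
  have key := integral_shear (rap_cutInt rH hR' u x)
    (continuous_cutInt rH.smooth.continuous hR' u x) (-ContinuousLinearMap.id ℝ (Rn n))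
  have e1 : ∫ ξ, ∫ ζ, ∫ y, cutInt (cutAmp φ ψ a) u x (ξ, ζ) y = ∫ ξ, φ x * weylInner a v x ξ :=
    congrArg _ (funext fun ξ => integral_cutInt_left hφ hψ ha hs u v hv x ξ)
  have e2 : ∫ ξ, ∫ ζ, ∫ y, cutInt (cutAmp φ ψ a) u x
      (ξ + (-ContinuousLinearMap.id ℝ (Rn n)) ζ, ζ) y = ∫ ξ, weylInner (ampS φ ψ a) u x ξ :=
    congrArg _ (funext fun ξ => integral_cutInt_right hφ hψ ha hs u x ξ)
  have h := e1.symm.trans (key.trans e2)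
  rw [integral_const_mul] at h
  rw [weylOp_eq, ← h, weylOp_eq]; ring

end Cutoff

/-! ### Classical symbols -/

section Classical

variable {n : ℕ} {μ μ' : ℝ}

/-- The complement of the zero section. -/
def U0 (n : ℕ) : Set (Ph n) := {z | z.2 ≠ 0}

theorem isOpen_U0 : IsOpen (U0 n) := isOpen_ne_fun continuous_snd continuous_const

/-- The region where asymptotic expansions are considered. -/
def S1 (n : ℕ) : Set (Ph n) := {z | 1 ≤ ‖z.2‖}

theorem S1_subset : S1 n ⊆ U0 n := fun z hz h0 => by
  have hz : 1 ≤ ‖z.2‖ := hz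
  rw [h0, norm_zero] at hz; linarith

/-- Smooth functions outside the zero section which satisfy the symbol estimates for large `ξ`. -/
structure Sy (μ : ℝ) (f : Ph n → ℂ) : Prop where
  smooth : ContDiffOn ℝ ∞ f (U0 n)
  sym : SymOn (S1 n) μ f

variable {f g h : Ph n → ℂ}

theorem Sy.of_symbol (hf : ContDiff ℝ ∞ f) (hs : SymOn univ μ f) : Sy μ f :=
  ⟨hf.contDiffOn, hs.mono_set (Set.subset_univ _)⟩

theorem Sy.add (hf : Sy μ f) (hg : Sy μ g) : Sy μ (fun z => f z + g z) :=
  ⟨hf.smooth.add hg.smooth, hf.sym.add hg.sym isOpen_U0 S1_subset hf.smooth hg.smooth⟩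

theorem Sy.const_mul (c : ℂ) (hf : Sy μ f) : Sy μ (fun z => c * f z) :=
  ⟨contDiffOn_const.mul hf.smooth, hf.sym.const_mul c isOpen_U0 S1_subset hf.smooth⟩

theorem Sy.sum {κ : Type*} (T : Finset κ) {f : κ → Ph n → ℂ} (hf : ∀ k ∈ T, Sy μ (f k)) :
    Sy μ (fun z => ∑ k ∈ T, f k z) :=
  ⟨ContDiffOn.sum fun k hk => (hf k hk).smooth,
    SymOn.sum T (fun k hk => (hf k hk).sym) isOpen_U0 S1_subset fun k hk => (hf k hk).smooth⟩

theorem Sy.sub (hf : Sy μ f) (hg : Sy μ g) : Sy μ (fun z => f z - g z) := by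
  have := hf.add (hg.const_mul (-1))
  simpa [sub_eq_add_neg] using this

theorem Sy.mul (hf : Sy μ f) (hg : Sy μ' g) : Sy (μ + μ') (fun z => f z * g z) :=
  ⟨hf.smooth.mul hg.smooth, hf.sym.mul hg.sym isOpen_U0 S1_subset hf.smooth hg.smooth⟩

theorem Sy.dir (hf : Sy μ f) (i : Fin n ⊕ Fin n) : Sy (μ - (frX n).loss i) (dd ((frX n).dir i) f) :=
  ⟨ContDiffOn.dd hf.smooth isOpen_U0 _, hf.sym.dir i⟩

theorem Sy.mono (hf : Sy μ f) (h : μ ≤ μ') : Sy μ' f := ⟨hf.smooth, hf.sym.mono_order h⟩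

theorem Sy.congr (hf : Sy μ f) (h : EqOn f g (U0 n)) : Sy μ g :=
  ⟨hf.smooth.congr fun z hz => (h hz).symm, hf.sym.congr isOpen_U0 S1_subset h⟩

theorem loss_swap (j : Fin n ⊕ Fin n) : (frX n).loss j.swap + (frX n).loss j = 1 := by
  rcases j with j | j <;> simp

theorem Sy.moyal (hf : Sy μ f) (hg : Sy μ' g) (r : ℕ) : Sy (μ + μ' - r) (moyal r f g) := by
  induction r generalizing μ μ' f g with
  | zero => simpa [PsiDO.moyal] using hf.mul hg
  | succ r ih =>
    refine Sy.sum _ fun j _ => Sy.const_mul _ ?_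
    refine (ih (hf.dir j.swap) (hg.dir j)).mono (le_of_eq ?_)
    have := loss_swap j
    push_cast
    linarith

theorem dd_eqOn {𝒳 : Type*} [NormedAddCommGroup 𝒳] [NormedSpace ℝ 𝒳] {U : Set 𝒳} (hU : IsOpen U)
    {f g : 𝒳 → ℂ} (h : EqOn f g U) (v : 𝒳) : EqOn (dd v f) (dd v g) U := fun _ hy =>
  (dd_congr (eventuallyEq_of_mem (hU.mem_nhds hy) h)).self_of_nhds

variable {U : Set (Ph n)}

theorem moyal_congr (hU : IsOpen U) {f' g' : Ph n → ℂ} (hf : EqOn f f' U)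
    (hg : EqOn g g' U) (r : ℕ) : EqOn (moyal r f g) (moyal r f' g') U := by
  induction r generalizing f g f' g' with
  | zero => exact fun z hz => by simp only [moyal]; rw [hf hz, hg hz]
  | succ r ih =>
    intro z hz
    simp only [moyal]
    exact sum_congr rfl fun j _ => by rw [ih (dd_eqOn hU hf _) (dd_eqOn hU hg _) hz]

theorem dd_sum_on {𝒳 κ : Type*} [NormedAddCommGroup 𝒳] [NormedSpace ℝ 𝒳] {U : Set 𝒳}
    (hU : IsOpen U) (T : Finset κ) {J : κ → 𝒳 → ℂ}
    (hJ : ∀ k ∈ T, ContDiffOn ℝ ∞ (J k) U) (v : 𝒳) :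
    EqOn (dd v (fun y => ∑ k ∈ T, J k y)) (fun y => ∑ k ∈ T, dd v (J k) y) U := by
  simpa using dd_lin_on hU T (fun _ => 1) hJ v

theorem moyal_sum_left {κ : Type*} (hU : IsOpen U) (T : Finset κ) {f : κ → Ph n → ℂ}
    (hf : ∀ k ∈ T, ContDiffOn ℝ ∞ (f k) U) (g : Ph n → ℂ) (r : ℕ) :
    EqOn (moyal r (fun z => ∑ k ∈ T, f k z) g) (fun z => ∑ k ∈ T, moyal r (f k) g z) U := by
  induction r generalizing f g with
  | zero => exact fun z _ => by simp only [moyal, sum_mul]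
  | succ r ih =>
    intro z hz
    simp only [moyal]
    rw [sum_comm]
    refine sum_congr rfl fun j _ => ?_
    rw [moyal_congr hU (dd_sum_on hU T hf _) (fun _ _ => rfl) r hz,
      ih (fun k hk => ContDiffOn.dd (hf k hk) hU _) _ hz, mul_sum]

theorem moyal_sum_right {κ : Type*} (hU : IsOpen U) (T : Finset κ) {g : κ → Ph n → ℂ}
    (hg : ∀ k ∈ T, ContDiffOn ℝ ∞ (g k) U) (f : Ph n → ℂ) (r : ℕ) :
    EqOn (moyal r f (fun z => ∑ k ∈ T, g k z)) (fun z => ∑ k ∈ T, moyal r f (g k) z) U := by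
  induction r generalizing f g with
  | zero => exact fun z _ => by simp only [moyal, mul_sum]
  | succ r ih =>
    intro z hz
    simp only [moyal]
    rw [sum_comm]
    refine sum_congr rfl fun j _ => ?_
    rw [moyal_congr hU (fun _ _ => rfl) (dd_sum_on hU T hg _) r hz,
      ih (fun k hk => ContDiffOn.dd (hg k hk) hU _) _ hz, mul_sum]

theorem eqOn_sub_of_sum {Φ : (Ph n → ℂ) → Ph n → ℂ} (hΦ : ∀ F : Bool → Ph n → ℂ,
      (∀ b, ContDiffOn ℝ ∞ (F b) U) → EqOn (Φ fun z => ∑ b, F b z) (fun z => ∑ b, Φ (F b) z) U)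
    (hf : ContDiffOn ℝ ∞ f U) (hg : ContDiffOn ℝ ∞ g U) :
    EqOn (Φ fun z => f z - g z) (fun z => Φ f z - Φ g z) U := fun z hz => by
  have h1 := hΦ (fun b => if b then (fun z => f z - g z) else g)
    (fun b => by cases b; exacts [hg, hf.sub hg]) hz
  simp only [Fintype.sum_bool, if_true, Bool.false_eq_true, if_false, sub_add_cancel] at h1
  exact eq_sub_of_add_eq h1.symm

theorem moyal_sub_left (hU : IsOpen U) (hf : ContDiffOn ℝ ∞ f U) (hg : ContDiffOn ℝ ∞ g U)
    (h : Ph n → ℂ) (r : ℕ) :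
    EqOn (moyal r (fun z => f z - g z) h) (fun z => moyal r f h z - moyal r g h z) U :=
  eqOn_sub_of_sum (Φ := fun f => moyal r f h)
    (fun _ hF => moyal_sum_left hU Finset.univ (fun b _ => hF b) h r) hf hg

theorem moyal_sub_right (hU : IsOpen U) (hf : ContDiffOn ℝ ∞ f U) (hg : ContDiffOn ℝ ∞ g U)
    (h : Ph n → ℂ) (r : ℕ) :
    EqOn (moyal r h (fun z => f z - g z)) (fun z => moyal r h f z - moyal r h g z) U :=
  eqOn_sub_of_sum (fun _ hF => moyal_sum_right hU Finset.univ (fun b _ => hF b) h r) hf hg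

/-- Smooth functions outside the zero section which are homogeneous in `ξ`. -/
structure Hom (ν : ℝ) (f : Ph n → ℂ) : Prop where
  smooth : ContDiffOn ℝ ∞ f (U0 n)
  hom : ∀ (z : Ph n) (t : ℝ), z.2 ≠ 0 → 0 < t → f (z.1, t • z.2) = ((t ^ ν : ℝ) : ℂ) * f z

variable {ν ν' : ℝ}

theorem Hom.sum {κ : Type*} (T : Finset κ) {f : κ → Ph n → ℂ} (hf : ∀ k ∈ T, Hom ν (f k)) :
    Hom ν (fun z => ∑ k ∈ T, f k z) :=
  ⟨ContDiffOn.sum fun k hk => (hf k hk).smooth, fun z t hz ht => by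
    rw [mul_sum]
    exact sum_congr rfl fun k hk => (hf k hk).hom z t hz ht⟩

theorem Hom.mul (hf : Hom ν f) (hg : Hom ν' g) : Hom (ν + ν') (fun z => f z * g z) :=
  ⟨hf.smooth.mul hg.smooth, fun z t hz ht => by
    rw [hf.hom z t hz ht, hg.hom z t hz ht, Real.rpow_add ht]; push_cast; ring⟩

theorem Hom.of_fst {c : Rn n → ℂ} (hc : ContDiff ℝ ∞ c) : Hom 0 (fun z : Ph n => c z.1) :=
  ⟨(hc.comp contDiff_fst).contDiffOn, fun z t _ _ => by simp⟩

theorem Hom.const_mul (c : ℂ) (hf : Hom ν f) : Hom ν (fun z => c * f z) := by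
  simpa using (Hom.of_fst (n := n) (c := fun _ => c) contDiff_const).mul hf

theorem Hom.of_eq (hf : Hom ν f) (h : ν = ν') : Hom ν' f := h ▸ hf

theorem Hom.zero : Hom ν (fun _ : Ph n => (0 : ℂ)) := ⟨contDiffOn_const, fun _ _ _ _ => by simp⟩

/-- Dilation of the frequency variable. -/
def dilate (n : ℕ) (t : ℝ) : Ph n →L[ℝ] Ph n := (fst ℝ (Rn n) (Rn n)).prod (t • snd ℝ (Rn n) (Rn n))

theorem Hom.dd_dilate (hf : Hom ν f) {z : Ph n} {t : ℝ} (hz : z.2 ≠ 0) (ht : 0 < t) (v : Ph n) :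
    dd (dilate n t v) f (z.1, t • z.2) = ((t ^ ν : ℝ) : ℂ) * dd v f z := by
  have h1 : HasFDerivAt (fun y => f (dilate n t y)) ((fderiv ℝ f (z.1, t • z.2)).comp (dilate n t)) z :=
    HasFDerivAt.comp z (f := dilate n t) (ContDiffOn.diffAt hf.smooth isOpen_U0
      (smul_ne_zero ht.ne' hz : (z.1, t • z.2) ∈ U0 n)).hasFDerivAt (dilate n t).hasFDerivAt
  have h2 := (ContDiffOn.diffAt hf.smooth isOpen_U0 hz).hasFDerivAt.const_mul ((t ^ ν : ℝ) : ℂ)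
  exact DFunLike.congr_fun (h1.unique (h2.congr_of_eventuallyEq (eventuallyEq_of_mem
    (isOpen_U0.mem_nhds hz) fun y hy => hf.hom y t hy ht))) v

theorem Hom.dir (hf : Hom ν f) (i : Fin n ⊕ Fin n) :
    Hom (ν - (frX n).loss i) (dd ((frX n).dir i) f) := by
  refine ⟨ContDiffOn.dd hf.smooth isOpen_U0 _, fun z t hz ht => ?_⟩
  have h := hf.dd_dilate hz ht ((frX n).dir i)
  rcases i with i | i
  · have e : dilate n t ((frX n).dir (Sum.inl i)) = (frX n).dir (Sum.inl i) := by simp [dilate]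
    rw [e] at h
    simpa using h
  · have e : dilate n t ((frX n).dir (Sum.inr i)) = t • (frX n).dir (Sum.inr i) := by
      simp [dilate]
    simp only [e, dd, map_smul, Complex.real_smul] at h
    have ht0 : (t : ℂ) ≠ 0 := by exact_mod_cast ht.ne'
    simp only [Sum.elim_inr, dd] at h ⊢
    rw [Real.rpow_sub_one ht.ne']
    push_cast at h ⊢
    rw [div_mul_eq_mul_div, eq_div_iff ht0, mul_comm]
    exact h

theorem Hom.moyal (hf : Hom ν f) (hg : Hom ν' g) (r : ℕ) : Hom (ν + ν' - r) (moyal r f g) := by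
  induction r generalizing ν ν' f g with
  | zero => simpa [PsiDO.moyal] using hf.mul hg
  | succ r ih =>
    refine Hom.sum _ fun j _ => Hom.const_mul _ ?_
    refine (ih (hf.dir j.swap) (hg.dir j)).of_eq ?_
    have := loss_swap j
    push_cast
    linarith

/-! #### Expansions -/

variable {m m' : ℝ} {a a' : Ph n → ℂ} {b b' : ℕ → Ph n → ℂ}

theorem isClassicalSymbol_iff : IsClassicalSymbol m a b ↔ ContDiff ℝ ∞ a ∧ SymOn univ m a ∧
    (∀ j : ℕ, Hom (m - j) (b j)) ∧
    ∀ K : ℕ, Sy (m - K) (fun z => a z - ∑ j ∈ range K, b j z) := by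
  constructor
  · rintro ⟨h1, h2, h3, h4⟩
    rw [isSymbol_iff] at h1
    refine ⟨h1.1, h1.2, fun j => ⟨h2 j, fun z t hz ht => h3 j z.1 z.2 t hz ht⟩, fun K => ?_⟩
    have hs : ContDiffOn ℝ ∞ (fun z => a z - ∑ j ∈ range K, b j z) (U0 n) :=
      h1.1.contDiffOn.sub (ContDiffOn.sum fun j _ => h2 j)
    exact ⟨hs, (symbolBoundOn_iff isOpen_U0 S1_subset hs).1 (h4 K)⟩
  · rintro ⟨h1, h2, h3, h4⟩
    exact ⟨isSymbol_iff.2 ⟨h1, h2⟩, fun j => (h3 j).smooth,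
      fun j x ξ t hξ ht => (h3 j).hom (x, ξ) t hξ ht,
      fun K => (symbolBoundOn_iff isOpen_U0 S1_subset (h4 K).smooth).2 (h4 K).sym⟩

theorem IsClassicalSymbol.hom (h : IsClassicalSymbol m a b) (j : ℕ) :
    Hom (m - j) (b j) := (isClassicalSymbol_iff.1 h).2.2.1 j

theorem IsClassicalSymbol.rem (h : IsClassicalSymbol m a b) (K : ℕ) :
    Sy (m - K) (fun z => a z - ∑ j ∈ range K, b j z) := (isClassicalSymbol_iff.1 h).2.2.2 K

theorem IsClassicalSymbol.contDiff (h : IsClassicalSymbol m a b) : ContDiff ℝ ∞ a :=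
  (isClassicalSymbol_iff.1 h).1

theorem IsClassicalSymbol.symOn (h : IsClassicalSymbol m a b) :
    SymOn univ m a := (isClassicalSymbol_iff.1 h).2.1

theorem IsClassicalSymbol.sy (h : IsClassicalSymbol m a b) : Sy m a :=
  Sy.of_symbol h.contDiff h.symOn

theorem IsClassicalSymbol.sy_term (h : IsClassicalSymbol m a b) (j : ℕ) : Sy (m - j) (b j) := by
  have h1 := (h.rem j).sub ((h.rem (j + 1)).mono (μ' := m - j) (by push_cast; linarith))
  refine h1.congr fun z _ => ?_
  simp only [Finset.sum_range_succ]; ring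

theorem IsClassicalSymbol.lin {κ : Type*} (T : Finset κ) (c : κ → ℂ) {a : κ → Ph n → ℂ}
    {b : κ → ℕ → Ph n → ℂ} (h : ∀ k ∈ T, IsClassicalSymbol m (a k) (b k)) :
    IsClassicalSymbol m (fun z => ∑ k ∈ T, c k * a k z) (fun j z => ∑ k ∈ T, c k * b k j z) := by
  refine isClassicalSymbol_iff.2 ⟨ContDiff.sum fun k hk => contDiff_const.mul (h k hk).contDiff,
    SymOn.sum T (fun k hk => (h k hk).symOn.const_mul (c k) isOpen_univ subset_rfl
      (h k hk).contDiff.contDiffOn) isOpen_univ subset_rfl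
      fun k hk => (contDiff_const.mul (h k hk).contDiff).contDiffOn,
    fun j => Hom.sum T fun k hk => ((h k hk).hom j).const_mul (c k), fun K => ?_⟩
  refine (Sy.sum T fun k hk => ((h k hk).rem K).const_mul (c k)).congr fun z _ => ?_
  simp only [mul_sub, sum_sub_distrib]
  rw [sum_comm]
  simp only [mul_sum]

/-- Classical symbols with bounded support in `x`. -/
structure CS (m : ℝ) (a : Ph n → ℂ) (b : ℕ → Ph n → ℂ) : Prop extends IsClassicalSymbol m a b where
  supp : ∃ R : ℝ, ∀ z : Ph n, R < ‖z.1‖ → a z = 0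

theorem CS.xc (h : CS m a b) : XC m a := ⟨h.contDiff, h.supp, h.symOn⟩

/-- The terms of the expansion of `moyal r a a'`, from those of `a` and `a'`. -/
def pstar (r : ℕ) (b b' : ℕ → Ph n → ℂ) (s : ℕ) (z : Ph n) : ℂ :=
  ∑ j ∈ range (s + 1), moyal r (b j) (b' (s - j)) z

/-- The terms of the expansion of a composition. -/
def star (b b' : ℕ → Ph n → ℂ) (l : ℕ) (z : Ph n) : ℂ :=
  ∑ r ∈ range (l + 1), ((1 / r.factorial : ℝ) : ℂ) * pstar r b b' (l - r) z

theorem Hom.star (hb : ∀ j : ℕ, Hom (m - j) (b j)) (hb' : ∀ j : ℕ, Hom (m' - j) (b' j)) (l : ℕ) :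
    Hom (m + m' - l) (star b b' l) := by
  refine Hom.sum _ fun r hr => Hom.const_mul _ (Hom.sum _ fun j hj => ?_)
  refine ((hb j).moyal (hb' (l - r - j)) r).of_eq ?_
  have h1 := Finset.mem_range_succ_iff.1 hr
  have h2 := Finset.mem_range_succ_iff.1 hj
  have : ((l - r - j : ℕ) : ℝ) = l - r - j := by rw [Nat.cast_sub h2, Nat.cast_sub h1]
  rw [this]; ring

theorem sy_moyal_rem (h : IsClassicalSymbol m a b) (h' : IsClassicalSymbol m' a' b') (r K : ℕ) :
    Sy (m + m' - r - K) (fun z => moyal r a a' z - ∑ s ∈ range K, pstar r b b' s z) := by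
  have h1 : Sy (m + m' - r - K) (moyal r (fun z => a z - ∑ j ∈ range K, b j z) a') :=
    ((h.rem K).moyal h'.sy r).mono (by linarith)
  have h2 : Sy (m + m' - r - K) (fun z => ∑ j ∈ range K, moyal r (b j)
      (fun z => a' z - ∑ k ∈ range (K - j), b' k z) z) := Sy.sum _ fun j hj => by
    refine ((h.sy_term j).moyal (h'.rem (K - j)) r).mono (le_of_eq ?_)
    rw [Nat.cast_sub (Finset.mem_range.1 hj).le]; ring
  refine (h1.add h2).congr fun z hz => ?_
  have e1 := moyal_sub_left isOpen_U0 h.contDiff.contDiffOn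
    (ContDiffOn.sum fun j (_ : j ∈ range K) => (h.hom j).smooth) a' r hz
  have e2 := moyal_sum_left isOpen_U0 (range K) (fun j _ => (h.hom j).smooth) a' r hz
  have e3 : ∀ j ∈ range K, moyal r (b j)
      (fun z => a' z - ∑ k ∈ range (K - j), b' k z) z = moyal r (b j) a' z -
        ∑ k ∈ range (K - j), moyal r (b j) (b' k) z := fun j _ => by
    rw [moyal_sub_right isOpen_U0 h'.contDiff.contDiffOn
      (ContDiffOn.sum fun k (_ : k ∈ range (K - j)) => (h'.hom k).smooth) (b j) r hz]
    simp only
    rw [moyal_sum_right isOpen_U0 (range (K - j)) (fun k _ => (h'.hom k).smooth) (b j) r hz]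
  simp only at e1 e2 ⊢
  rw [e1, e2, sum_congr rfl e3, sum_sub_distrib]
  simp only [pstar]
  rw [Finset.sum_range_diag_flip K (fun j k => moyal r (b j) (b' k) z)]
  ring

theorem sum_star (b b' : ℕ → Ph n → ℂ) (K : ℕ) (z : Ph n) : ∑ l ∈ range K, star b b' l z =
    ∑ r ∈ range K, ((1 / r.factorial : ℝ) : ℂ) * ∑ s ∈ range (K - r), pstar r b b' s z := by
  simp only [star, mul_sum]
  exact Finset.sum_range_diag_flip K (fun r s => ((1 / r.factorial : ℝ) : ℂ) * pstar r b b' s z)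

theorem CS.comp (h : CS m a b) (h' : CS m' a' b') :
    IsClassicalSymbol (m + m') (comp a a') (star b b') := by
  have hF := symFam_compFam h.xc h'.xc
  refine isClassicalSymbol_iff.2 ⟨hF.contDiff_at (by norm_num), hF.symOn_at (by norm_num),
    fun l => Hom.star h.hom h'.hom l, fun K => ?_⟩
  have h1 : Sy (m + m' - K) (taylorRem K (compFam a a')) :=
    Sy.of_symbol (hF.contDiff_taylorRem K) (hF.symOn_taylorRem K)
  have h2 : Sy (m + m' - K) (fun z => ∑ r ∈ range K, ((1 / r.factorial : ℝ) : ℂ) *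
      (moyal r a a' z - ∑ s ∈ range (K - r), pstar r b b' s z)) := Sy.sum _ fun r hr => by
    refine ((sy_moyal_rem h.1 h'.1 r (K - r)).const_mul _).mono (le_of_eq ?_)
    rw [Nat.cast_sub (Finset.mem_range.1 hr).le]; ring
  refine (h1.add h2).congr fun z _ => ?_
  simp only [taylorRem, sder_compFam h.xc h'.xc, mul_sub, sum_sub_distrib, sum_star, PsiDO.comp]
  ring

/-! #### Cutoffs -/

theorem camp_congr (hU : IsOpen U) {f : Ph n × Rn n → ℂ} {a a' : Ph n → ℂ} (h : EqOn a a' U)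
    (r : ℕ) : EqOn (camp r f a) (camp r f a') U := by
  induction r generalizing f a a' with
  | zero => exact fun z hz => by simp only [camp]; rw [h hz]
  | succ r ih =>
    intro z hz
    simp only [camp]
    exact sum_congr rfl fun j _ => by rw [ih (dd_eqOn hU h _) hz]

theorem camp_sum {κ : Type*} (hU : IsOpen U) (T : Finset κ) (f : Ph n × Rn n → ℂ)
    {a : κ → Ph n → ℂ} (ha : ∀ k ∈ T, ContDiffOn ℝ ∞ (a k) U) (r : ℕ) :
    EqOn (camp r f (fun z => ∑ k ∈ T, a k z)) (fun z => ∑ k ∈ T, camp r f (a k) z) U := by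
  induction r generalizing f a with
  | zero => exact fun z _ => by simp only [camp, mul_sum]
  | succ r ih =>
    intro z hz
    simp only [camp]
    rw [sum_comm]
    refine sum_congr rfl fun j _ => ?_
    rw [camp_congr hU (dd_sum_on hU T ha _) r hz,
      ih _ (fun k hk => ContDiffOn.dd (ha k hk) hU _) hz, mul_sum]

theorem camp_sub (hU : IsOpen U) {a a' : Ph n → ℂ} (f : Ph n × Rn n → ℂ)
    (ha : ContDiffOn ℝ ∞ a U) (ha' : ContDiffOn ℝ ∞ a' U) (r : ℕ) :
    EqOn (camp r f (fun z => a z - a' z)) (fun z => camp r f a z - camp r f a' z) U :=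
  eqOn_sub_of_sum (fun _ hF => camp_sum hU Finset.univ f (fun b _ => hF b) r) ha ha'

theorem camp_zero_of_eventually {f : Ph n × Rn n → ℂ} {z : Ph n} (hf : f =ᶠ[𝓝 (z, 0)] fun _ => 0)
    (a : Ph n → ℂ) (r : ℕ) : camp r f a z = 0 := by
  induction r generalizing f a with
  | zero => simp [camp, hf.self_of_nhds]
  | succ r ih =>
    simp only [camp]
    refine sum_eq_zero fun j _ => ?_
    rw [ih, mul_zero]
    filter_upwards [dd_congr (v := ((0 : Ph n), eb j)) hf] with y hy
    rw [hy]; simp [dd]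

theorem sy_restrict {f : Ph n × Rn n → ℂ} (hf : TC 0 f) : Sy 0 (fun z : Ph n => f (z, 0)) := by
  refine Sy.of_symbol (hf.smooth.comp (by fun_prop)) fun N => ?_
  obtain ⟨C, hC⟩ := hf.bound N
  have := SB.comp_affine (F' := frX n) (s' := univ) (inl ℝ (Ph n) (Rn n)) 0
    hC isOpen_univ subset_rfl hf.smooth.contDiffOn (fun _ _ => trivial)
    (fun _ _ => hC.weight_nonneg 0 trivial) (fun y => by simp)
    (fun j => Or.inr ⟨Sum.inl j, 1, by simp, by simp, rfl⟩)
  exact ⟨C, by simpa using this⟩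

theorem sy_camp {f : Ph n × Rn n → ℂ} (hf : TC 0 f) (ha : Sy μ a) (r : ℕ) :
    Sy (μ - r) (camp r f a) := by
  induction r generalizing μ f a with
  | zero => simpa [camp] using (sy_restrict hf).mul ha
  | succ r ih =>
    refine Sy.sum _ fun j _ => Sy.const_mul _ ?_
    refine (ih (hf.dir_last j) (ha.dir (Sum.inr j))).mono (le_of_eq ?_)
    simp only [Sum.elim_inr]; push_cast; ring

theorem hom_camp {c : Ph n → ℂ} (hc : ContDiff ℝ ∞ c) (ha : Hom ν a) (r : ℕ) :
    Hom (ν - r) (camp r (fun y => c (y.1.1, y.2)) a) := by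
  induction r generalizing ν c a with
  | zero => simpa [camp] using (Hom.of_fst (hc.comp (by fun_prop :
      ContDiff ℝ ∞ fun x : Rn n => (x, (0 : Rn n))))).mul ha
  | succ r ih =>
    refine Hom.sum _ fun j _ => Hom.const_mul _ ?_
    have e : dd (0, eb j) (fun y : Ph n × Rn n => c (y.1.1, y.2)) =
        fun y => dd (0, eb j) c (y.1.1, y.2) := funext fun y =>
      dd_eq_of_line ((hc.comp (by fun_prop : ContDiff ℝ ∞ fun y : Ph n × Rn n =>
        (y.1.1, y.2))).contDiffAt.differentiableAt (by simp))
        (hc.contDiffAt.differentiableAt (by simp)) fun t => by simp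
    rw [e]
    refine (ih (ContDiff.dd hc _) (ha.dir (Sum.inr j))).of_eq ?_
    simp only [Sum.elim_inr]; push_cast; ring

/-- The terms of the expansion of the symbol of a cut off operator. -/
def ampT (φ ψ : Rn n → ℂ) (b : ℕ → Ph n → ℂ) (l : ℕ) (z : Ph n) : ℂ :=
  ∑ r ∈ range (l + 1), ((1 / r.factorial : ℝ) : ℂ) * camp r (cutF φ ψ) (b (l - r)) z

variable {φ ψ : Rn n → ℂ}

theorem IsClassicalSymbol.ampS (h : IsClassicalSymbol m a b) (hφ : IsCut φ) (hψ : IsCut ψ) :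
    CS m (ampS φ ψ a) (ampT φ ψ b) := by
  have hf := tc_cutF hφ hψ
  have hF := symFam_ampFam hf h.contDiff h.symOn
  rw [zero_add] at hF
  refine ⟨isClassicalSymbol_iff.2 ⟨hF.contDiff_at (by norm_num), hF.symOn_at (by norm_num),
    fun l => Hom.sum _ fun r hr => Hom.const_mul _ ?_, fun K => ?_⟩,
    (xc_ampS hφ hψ h.contDiff h.symOn).supp⟩
  · refine (hom_camp (c := fun z => φ (z.1 + (2 : ℝ)⁻¹ • z.2) * ψ (z.1 - (2 : ℝ)⁻¹ • z.2))
      ((hφ.smooth.comp (by fun_prop)).mul (hψ.smooth.comp (by fun_prop))) (h.hom (l - r)) r).of_eq ?_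
    rw [Nat.cast_sub (Finset.mem_range_succ_iff.1 hr)]; ring
  have h1 : Sy (m - K) (taylorRem K (ampFam (cutF φ ψ) a)) :=
    Sy.of_symbol (hF.contDiff_taylorRem K) (hF.symOn_taylorRem K)
  have h2 : Sy (m - K) (fun z => ∑ r ∈ range K, ((1 / r.factorial : ℝ) : ℂ) *
      camp r (cutF φ ψ) (fun z => a z - ∑ j ∈ range (K - r), b j z) z) := Sy.sum _ fun r hr => by
    refine ((sy_camp hf (h.rem (K - r)) r).const_mul _).mono (le_of_eq ?_)
    rw [Nat.cast_sub (Finset.mem_range.1 hr).le]; ring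
  refine (h1.add h2).congr fun z hz => ?_
  have e : ∀ r, camp r (cutF φ ψ) (fun z => a z - ∑ j ∈ range (K - r), b j z) z =
      camp r (cutF φ ψ) a z - ∑ j ∈ range (K - r), camp r (cutF φ ψ) (b j) z := fun r => by
    rw [camp_sub isOpen_U0 (cutF φ ψ) h.contDiff.contDiffOn
      (ContDiffOn.sum fun j (_ : j ∈ range (K - r)) => (h.hom j).smooth) r hz]
    simp only
    rw [camp_sum isOpen_U0 (range (K - r)) (cutF φ ψ) (fun j _ => (h.hom j).smooth) r hz]
  simp only [taylorRem, sder_ampFam hf h.contDiff h.symOn, e, mul_sub, sum_sub_distrib,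
    PsiDO.ampS, ampT, mul_sum]
  rw [Finset.sum_range_diag_flip K
    (fun r j => ((1 / r.factorial : ℝ) : ℂ) * camp r (cutF φ ψ) (b j) z)]
  ring

theorem ampT_zero (φ ψ : Rn n → ℂ) (b : ℕ → Ph n → ℂ) (z : Ph n) :
    ampT φ ψ b 0 z = φ z.1 * ψ z.1 * b 0 z := by
  simp [ampT, camp, cutF]

theorem ampT_eq {z : Ph n} (hφ : φ =ᶠ[𝓝 z.1] fun _ => 1) (hψ : ψ =ᶠ[𝓝 z.1] fun _ => 1)
    (b : ℕ → Ph n → ℂ) (l : ℕ) : ampT φ ψ b l z = b l z := by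
  have h1 : cutF φ ψ =ᶠ[𝓝 (z, 0)] fun _ => 1 := by
    have c1 : Tendsto (fun y : Ph n × Rn n => y.1.1 + (2 : ℝ)⁻¹ • y.2) (𝓝 (z, 0)) (𝓝 z.1) := by
      have : Continuous fun y : Ph n × Rn n => y.1.1 + (2 : ℝ)⁻¹ • y.2 := by fun_prop
      simpa using this.tendsto (z, 0)
    have c2 : Tendsto (fun y : Ph n × Rn n => y.1.1 - (2 : ℝ)⁻¹ • y.2) (𝓝 (z, 0)) (𝓝 z.1) := by
      have : Continuous fun y : Ph n × Rn n => y.1.1 - (2 : ℝ)⁻¹ • y.2 := by fun_prop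
      simpa using this.tendsto (z, 0)
    filter_upwards [c1.eventually hφ, c2.eventually hψ] with y h1 h2
    rw [cutF, h1, h2, one_mul]
  rw [ampT, sum_range_succ']
  simp only [Nat.factorial_zero, Nat.cast_one, div_one, Complex.ofReal_one, one_mul, Nat.sub_zero,
    camp, h1.self_of_nhds]
  rw [sum_eq_zero, zero_add]
  intro r _
  rw [sum_eq_zero, mul_zero]
  intro j _
  rw [camp_zero_of_eventually, mul_zero]
  filter_upwards [dd_congr (v := ((0 : Ph n), eb j)) h1] with y hy
  rw [hy]; simp [dd]

end Classical

/-! ### Homogeneous functions as symbols, and asymptotic summation -/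
section Borel
variable {n : ℕ} {ν μ : ℝ} {f : Ph n → ℂ}

theorem Hom.bound (hf : Hom ν f) {R : ℝ} (hR : ∀ z : Ph n, R < ‖z.1‖ → f z = 0) :
    ∃ C : ℝ, ∀ z ∈ S1 n, ‖f z‖ ≤ C * (1 + ‖z.2‖) ^ ν := by
  have hK : IsCompact (closedBall (0 : Rn n) R ×ˢ Metric.sphere (0 : Rn n) 1) :=
    (isCompact_closedBall _ _).prod (isCompact_sphere _ _)
  obtain ⟨C, hC⟩ := hK.exists_bound_of_continuousOn (f := f) (hf.smooth.continuousOn.mono (by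
    rintro ⟨x, ξ⟩ ⟨-, h⟩ h0
    simp only at h0
    subst h0
    simp at h))
  refine ⟨|C| * 2 ^ |ν|, fun z hz => ?_⟩
  have hz1 : 1 ≤ ‖z.2‖ := hz
  have hpos : 0 < ‖z.2‖ := by linarith
  have hpow : ‖z.2‖ ^ ν ≤ 2 ^ |ν| * (1 + ‖z.2‖) ^ ν := by
    rcases le_or_gt 0 ν with h | h
    · have h1 : ‖z.2‖ ^ ν ≤ (1 + ‖z.2‖) ^ ν := Real.rpow_le_rpow hpos.le (by linarith) h
      have h2 : (1 : ℝ) ≤ 2 ^ |ν| := Real.one_le_rpow (by norm_num) (abs_nonneg _)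
      nlinarith [Real.rpow_nonneg (by linarith : (0 : ℝ) ≤ 1 + ‖z.2‖) ν]
    · have h1 : (2 * ‖z.2‖) ^ ν ≤ (1 + ‖z.2‖) ^ ν :=
        Real.rpow_le_rpow_of_nonpos (by linarith) (by linarith) h.le
      rw [Real.mul_rpow (by norm_num) hpos.le] at h1
      rw [abs_of_neg h, Real.rpow_neg (by norm_num)]
      have h2 : (0 : ℝ) < 2 ^ ν := Real.rpow_pos_of_pos (by norm_num) _
      rw [inv_mul_eq_div, le_div_iff₀ h2]
      linarith
  have hnn : 0 ≤ (1 + ‖z.2‖) ^ ν := Real.rpow_nonneg (by linarith) _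
  rcases lt_or_ge R ‖z.1‖ with h | h
  · rw [hR z h, norm_zero]; positivity
  have h0 : ‖z.2‖⁻¹ • z.2 ≠ 0 := smul_ne_zero (inv_ne_zero hpos.ne') (norm_pos_iff.1 hpos)
  have h1 := hf.hom (z.1, ‖z.2‖⁻¹ • z.2) ‖z.2‖ h0 hpos
  simp only [smul_smul, mul_inv_cancel₀ hpos.ne', one_smul] at h1
  have h2 := hC (z.1, ‖z.2‖⁻¹ • z.2) ⟨by simpa using h, by
    simp [norm_smul, inv_mul_cancel₀ hpos.ne']⟩
  change ‖f (z.1, z.2)‖ ≤ _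
  rw [h1, norm_mul, Complex.norm_real, Real.norm_of_nonneg (Real.rpow_nonneg hpos.le _)]
  calc ‖z.2‖ ^ ν * ‖f (z.1, ‖z.2‖⁻¹ • z.2)‖ ≤ (2 ^ |ν| * (1 + ‖z.2‖) ^ ν) * |C| :=
        mul_le_mul hpow (h2.trans (le_abs_self _)) (norm_nonneg _) (by positivity)
    _ = _ := by ring

theorem Hom.sy (hf : Hom ν f) {R : ℝ} (hR : ∀ z : Ph n, R < ‖z.1‖ → f z = 0) : Sy ν f := by
  refine ⟨hf.smooth, fun N => ?_⟩
  induction N generalizing ν f with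
  | zero => exact hf.bound hR
  | succ N ih =>
    have hd : ∀ i, ∃ C : ℝ, SB (frX n) (S1 n) (fun _ => C) N (ν - (frX n).loss i)
        (dd ((frX n).dir i) f) := fun i => ih (hf.dir i) fun z hz => by
      have hU : IsOpen {z : Ph n | R < ‖z.1‖} :=
        isOpen_lt continuous_const (continuous_norm.comp continuous_fst)
      rw [dd_eqOn hU (g := fun _ => 0) (fun z hz => hR z hz) _ hz]
      simp [dd]
    haveI : Finite (frX n).ι := inferInstanceAs (Finite (Fin n ⊕ Fin n))
    obtain ⟨C0, hC0⟩ := hf.bound hR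
    choose C hC using hd
    letI : Fintype (frX n).ι := inferInstanceAs (Fintype (Fin n ⊕ Fin n))
    refine ⟨|C0| + ∑ i, |C i|, fun z hz => (hC0 z hz).trans ?_, fun i => (hC i).mono_weight
      fun z _ => ?_⟩
    · have := sum_nonneg fun i (_ : i ∈ Finset.univ) => abs_nonneg (C i)
      exact mul_le_mul_of_nonneg_right (by linarith [le_abs_self C0])
        (Real.rpow_nonneg (by positivity) _)
    · have := single_le_sum (fun i _ => abs_nonneg (C i)) (mem_univ i)
      linarith [le_abs_self (C i), abs_nonneg C0]

theorem SB.trade {𝒳 G : Type*} [NormedAddCommGroup 𝒳] [NormedSpace ℝ 𝒳] [NormedAddCommGroup G]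
    [NormedSpace ℝ G] {F : Frame 𝒳} {s : Set 𝒳} {w : 𝒳 → ℝ} {N : ℕ} {μ ε : ℝ} {a : 𝒳 → G}
    (h : SB F s w N μ a) (hs : ∀ y ∈ s, 1 ≤ ε * F.ρ y) :
    SB F s (fun y => ε * w y) N (μ + 1) a := by
  have key : ∀ {μ : ℝ} {a : 𝒳 → G}, (∀ y ∈ s, ‖a y‖ ≤ w y * F.ρ y ^ μ) →
      ∀ y ∈ s, ‖a y‖ ≤ (ε * w y) * F.ρ y ^ (μ + 1) := fun {μ a} hb y hy => by
    refine (hb y hy).trans ?_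
    have h1 := (norm_nonneg _).trans (hb y hy)
    rw [Real.rpow_add_one (F.ρ_pos y).ne']
    nlinarith [hs y hy]
  induction N generalizing μ a with
  | zero => exact key h
  | succ N ih => exact ⟨key h.1, fun i => by
      have := ih (h.2 i)
      rwa [show μ - F.loss i + 1 = μ + 1 - F.loss i by ring] at this⟩

theorem sb_scaled {g : Rn n → ℂ} (hg : ContDiff ℝ ∞ g) (hs : ∀ ξ, 2 < ‖ξ‖ → g ξ = 0) (N k : ℕ) :
    ∃ C : ℝ, ∀ ε : ℝ, 0 < ε → ε ≤ 1 →
      SB (frX n) univ (fun _ => C) N (-(k : ℝ)) (fun z => (ε : ℂ) ^ k * g (ε • z.2)) := by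
  have hbd : ∀ (g : Rn n → ℂ), ContDiff ℝ ∞ g → (∀ ξ, 2 < ‖ξ‖ → g ξ = 0) → ∀ k : ℕ, ∃ C : ℝ,
      0 ≤ C ∧ ∀ ε : ℝ, 0 < ε → ε ≤ 1 → ∀ z : Ph n,
        ‖(ε : ℂ) ^ k * g (ε • z.2)‖ ≤ C * (1 + ‖z.2‖) ^ (-(k : ℝ)) := fun g hg hs k => by
    obtain ⟨C, hC⟩ := (isCompact_closedBall (0 : Rn n) 2).exists_bound_of_continuousOn
      hg.continuous.continuousOn
    refine ⟨3 ^ k * |C|, by positivity, fun ε h0 h1 z => ?_⟩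
    have hp : 0 < 1 + ‖z.2‖ := by positivity
    rw [Real.rpow_neg hp.le, Real.rpow_natCast]
    rcases lt_or_ge 2 ‖ε • z.2‖ with h | h
    · rw [hs _ h, mul_zero, norm_zero]; positivity
    · have h2 := hC (ε • z.2) (by simpa using h)
      rw [norm_smul, Real.norm_of_nonneg h0.le] at h
      have h3 : ε ^ k * (1 + ‖z.2‖) ^ k ≤ 3 ^ k := by
        rw [← mul_pow]
        exact pow_le_pow_left₀ (by positivity) (by nlinarith) _
      rw [norm_mul, norm_pow, Complex.norm_real, Real.norm_of_nonneg h0.le,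
        ← div_eq_mul_inv, le_div_iff₀ (by positivity)]
      calc ε ^ k * ‖g (ε • z.2)‖ * (1 + ‖z.2‖) ^ k
          = (ε ^ k * (1 + ‖z.2‖) ^ k) * ‖g (ε • z.2)‖ := by ring
        _ ≤ 3 ^ k * |C| := mul_le_mul h3 (h2.trans (le_abs_self _)) (norm_nonneg _) (by positivity)
  induction N generalizing g k with
  | zero =>
    obtain ⟨C, -, hC⟩ := hbd g hg hs k
    exact ⟨C, fun ε h0 h1 z _ => hC ε h0 h1 z⟩
  | succ N ih =>
    obtain ⟨C0, hC00, hC0⟩ := hbd g hg hs k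
    have hd : ∀ i : Fin n, ∃ C : ℝ, ∀ ε : ℝ, 0 < ε → ε ≤ 1 → SB (frX n) univ (fun _ => C) N
        (-((k + 1 : ℕ) : ℝ)) (fun z => (ε : ℂ) ^ (k + 1) * dd (eb i) g (ε • z.2)) := fun i =>
      ih (ContDiff.dd hg _) (fun ξ hξ => by
        have hU : IsOpen {ξ : Rn n | 2 < ‖ξ‖} := isOpen_lt continuous_const continuous_norm
        rw [dd_eqOn hU (g := fun _ => 0) (fun z hz => hs z hz) _ hξ]
        simp [dd]) (k + 1)
    choose C hC using hd
    refine ⟨C0 + ∑ i, |C i|, fun ε h0 h1 => ⟨fun z _ => (hC0 ε h0 h1 z).trans ?_, fun i => ?_⟩⟩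
    · have := sum_nonneg fun i (_ : i ∈ Finset.univ) => abs_nonneg (C i)
      exact mul_le_mul_of_nonneg_right (by linarith) (Real.rpow_nonneg (by positivity) _)
    have hder : ∀ (z v : Ph n), dd v (fun z : Ph n => (ε : ℂ) ^ k * g (ε • z.2)) z
        = (ε : ℂ) ^ (k + 1) * fderiv ℝ g (ε • z.2) v.2 := fun z v => by
      have e1 : HasFDerivAt (fun z : Ph n => ε • z.2) (ε • snd ℝ (Rn n) (Rn n))
          z := (ε • snd ℝ (Rn n) (Rn n)).hasFDerivAt
      have e2 : HasFDerivAt g (fderiv ℝ g (ε • z.2)) (ε • z.2) :=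
        (hg.differentiable (by simp) _).hasFDerivAt
      have e3 := (e2.comp z e1).const_mul ((ε : ℂ) ^ k)
      simp only [dd]
      erw [e3.fderiv]
      simp [pow_succ]
      ring
    rcases i with i | i
    · refine ((SB.zero (F := frX n) (s := univ) (N := N)).congr (fun z _ => ?_)).mono_weight
        fun z _ => ?_
      · exact of_forall fun z => by rw [hder]; simp
      · have := sum_nonneg fun i (_ : i ∈ Finset.univ) => abs_nonneg (C i)
        positivity
    · have e := hC i ε h0 h1
      rw [show -((k + 1 : ℕ) : ℝ) = -(k : ℝ) - (frX n).loss (Sum.inr i) by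
        push_cast; simp only [Sum.elim_inr]; ring] at e
      refine (e.congr fun z _ => of_forall fun z => ?_).mono_weight fun z _ => ?_
      · rw [hder]; rfl
      · have := single_le_sum (fun i _ => abs_nonneg (C i)) (mem_univ i)
        linarith [le_abs_self (C i)]

/-- A fixed cutoff function of the fibre variable. -/
def cutB (n : ℕ) (ξ : Rn n) : ℂ := ((⟨1, 2, one_pos, one_lt_two⟩ : ContDiffBump (0 : Rn n)) ξ : ℝ)

theorem contDiff_cutB : ContDiff ℝ ∞ (cutB n) :=
  Complex.ofRealCLM.contDiff.comp (ContDiffBump.contDiff _)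

theorem cutB_zero (ξ : Rn n) (h : 2 < ‖ξ‖) : cutB n ξ = 0 := by
  rw [cutB, ContDiffBump.zero_of_le_dist]
  · simp
  · simpa using h.le

theorem cutB_one (ξ : Rn n) (h : ‖ξ‖ ≤ 1) : cutB n ξ = 1 := by
  rw [cutB, ContDiffBump.one_of_mem_closedBall]
  · simp
  · simpa using h

/-- A homogeneous function, cut off where `|ξ| < 1 / ε`. -/
def cutHom (ε : ℝ) (f : Ph n → ℂ) (z : Ph n) : ℂ := (1 - cutB n (ε • z.2)) * f z

variable {ε : ℝ}

theorem cutHom_zero {z : Ph n} (f : Ph n → ℂ) (h0 : 0 < ε) (hz : ε * ‖z.2‖ ≤ 1) :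
    cutHom ε f z = 0 := by
  rw [cutHom, cutB_one, sub_self, zero_mul]
  rwa [norm_smul, Real.norm_of_nonneg h0.le]

theorem cutHom_eventually_zero {z : Ph n} (f : Ph n → ℂ) (h0 : 0 < ε) (hz : ε * ‖z.2‖ < 1) :
    cutHom ε f =ᶠ[𝓝 z] fun _ => 0 := by
  have hU : IsOpen {z : Ph n | ε * ‖z.2‖ < 1} :=
    isOpen_lt (continuous_const.mul (continuous_norm.comp continuous_snd)) continuous_const
  filter_upwards [hU.mem_nhds hz] with y hy using cutHom_zero f h0 (le_of_lt hy)

theorem contDiff_cutEps (ε : ℝ) : ContDiff ℝ ∞ (fun z : Ph n => cutB n (ε • z.2)) :=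
  contDiff_cutB.comp (contDiff_snd.const_smul ε)

theorem contDiff_cutHom (hf : ContDiffOn ℝ ∞ f (U0 n)) (h0 : 0 < ε) :
    ContDiff ℝ ∞ (cutHom ε f) := by
  rw [contDiff_iff_contDiffAt]
  intro z
  by_cases hz : z.2 = 0
  · exact contDiffAt_const.congr_of_eventuallyEq (cutHom_eventually_zero f h0 (by simp [hz]))
  · exact ((contDiff_const.sub (contDiff_cutEps ε)).contDiffAt).mul
      (hf.contDiffAt (isOpen_U0.mem_nhds hz))

theorem sb_cutHom (hf : Sy μ f) (N : ℕ) : ∃ D : ℝ, 0 ≤ D ∧ ∀ ε : ℝ, 0 < ε → ε ≤ 1 →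
    SB (frX n) univ (fun _ => D) N μ (cutHom ε f) := by
  obtain ⟨C, hC⟩ := sb_scaled (contDiff_cutB (n := n)) cutB_zero N 0
  obtain ⟨C', hC'⟩ := hf.sym N
  have hone : SB (frX n) univ (fun _ => 1) N 0 (fun _ : Ph n => (1 : ℂ)) := by
    cases N with
    | zero => intro y _; simp
    | succ N =>
      refine ⟨fun y _ => by simp, fun i => ((SB.zero (F := frX n)).congr
        fun z _ => of_forall fun z => ?_).mono_weight fun _ _ => zero_le_one⟩
      simp [dd]
  refine ⟨|2 ^ N * ((1 + ‖(-1 : ℂ)‖ * C) * C')|, abs_nonneg _, fun ε h0 h1 =>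
    SB.of_singletons fun z _ => ?_⟩
  rcases lt_or_ge ‖z.2‖ 1 with hz | hz
  · exact ((SB.zero (F := frX n)).congr fun y hy => by
      rw [Set.mem_singleton_iff.1 hy]
      exact (cutHom_eventually_zero f h0 (by nlinarith [norm_nonneg z.2])).symm).mono_weight
        fun _ _ => abs_nonneg _
  · have hzs : ({z} : Set (Ph n)) ⊆ S1 n := Set.singleton_subset_iff.2 hz
    have e1 := hC ε h0 h1
    simp only [pow_zero, one_mul, Nat.cast_zero, neg_zero] at e1
    have e2 := hone.add (e1.const_mul (-1) isOpen_univ subset_rfl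
      (contDiff_cutEps ε).contDiffOn) isOpen_univ subset_rfl contDiffOn_const
      (contDiff_const.mul (contDiff_cutEps ε)).contDiffOn
    have e3 := (e2.mono_set (Set.subset_univ {z})).mul (hC'.mono_set hzs) isOpen_U0
      (hzs.trans S1_subset) (contDiff_const.add (contDiff_const.mul (contDiff_cutEps ε))).contDiffOn
      hf.smooth
    rw [zero_add] at e3
    refine (e3.congr fun y _ => of_forall fun y => ?_).mono_weight fun _ _ => le_abs_self _
    simp only [cutHom]; ring

theorem sb_cutHom_small {D : ℝ} {N : ℕ} (h0 : 0 < ε) (hD : 0 ≤ D)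
    (h : SB (frX n) univ (fun _ => D) N μ (cutHom ε f)) :
    SB (frX n) univ (fun _ => ε * D) N (μ + 1) (cutHom ε f) := by
  refine SB.of_singletons fun z _ => ?_
  rcases lt_or_ge (ε * ‖z.2‖) 1 with hz | hz
  · exact ((SB.zero (F := frX n)).congr fun y hy => by
      rw [Set.mem_singleton_iff.1 hy]
      exact (cutHom_eventually_zero f h0 hz).symm).mono_weight fun _ _ => by positivity
  · refine (h.mono_set (Set.subset_univ {z})).trade fun y hy => ?_
    rw [Set.mem_singleton_iff.1 hy]
    change 1 ≤ ε * (1 + ‖z.2‖)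
    linarith

theorem sy_cutHom (hf : Sy μ f) (h0 : 0 < ε) (h1 : ε ≤ 1) : Sy μ (cutHom ε f) :=
  Sy.of_symbol (contDiff_cutHom hf.smooth h0) fun N => by
    obtain ⟨D, -, hD⟩ := sb_cutHom hf N
    exact ⟨D, hD ε h0 h1⟩

theorem sy_cutHom_sub (hf : Sy μ f) (h0 : 0 < ε) (h1 : ε ≤ 1) (k : ℕ) :
    Sy (μ - k) (fun z => cutHom ε f z - f z) := by
  have e : Sy (-(k : ℝ)) (fun z : Ph n => (ε : ℂ) ^ k * cutB n (ε • z.2)) :=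
    Sy.of_symbol (contDiff_const.mul (contDiff_cutEps ε)) fun N => by
      obtain ⟨C, hC⟩ := sb_scaled (contDiff_cutB (n := n)) cutB_zero N k
      exact ⟨C, hC ε h0 h1⟩
  have e2 := (e.const_mul (-((ε : ℂ) ^ k)⁻¹)).mul hf
  rw [show -(k : ℝ) + μ = μ - k by ring] at e2
  refine e2.congr fun z _ => ?_
  have : (ε : ℂ) ^ k ≠ 0 := pow_ne_zero _ (by exact_mod_cast h0.ne')
  simp only [cutHom]
  field_simp
  ring

/-- The locally finite sum of cut off homogeneous functions. -/
def borelSum (ε : ℕ → ℝ) (b : ℕ → Ph n → ℂ) (z : Ph n) : ℂ :=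
  ∑ j ∈ range (⌊‖z.2‖⌋₊ + 1), cutHom (ε j) (b j) z

variable {e : ℕ → ℝ} {b : ℕ → Ph n → ℂ}

theorem borelSum_eq (he : ∀ j, 0 < e j ∧ e j * (j + 1) ≤ 1) {J : ℕ} {z : Ph n} (hz : ‖z.2‖ < J) :
    borelSum e b z = ∑ j ∈ range J, cutHom (e j) (b j) z := by
  refine Finset.sum_subset (fun j hj => ?_) fun j _ hj => cutHom_zero _ (he j).1 ?_
  · rw [mem_range] at hj ⊢
    have := (Nat.floor_lt (norm_nonneg z.2)).2 hz
    omega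
  · have h1 : ⌊‖z.2‖⌋₊ + 1 ≤ j := by simpa using hj
    have h2 := Nat.lt_floor_add_one ‖z.2‖
    have h3 : ((⌊‖z.2‖⌋₊ : ℕ) : ℝ) + 1 ≤ j := by exact_mod_cast h1
    nlinarith [(he j).1, (he j).2]

theorem borelSum_eventuallyEq (he : ∀ j, 0 < e j ∧ e j * (j + 1) ≤ 1) {J : ℕ} {z : Ph n}
    (hz : ‖z.2‖ < J) :
    borelSum e b =ᶠ[𝓝 z] fun y => ∑ j ∈ range J, cutHom (e j) (b j) y := by
  have hU : IsOpen {z : Ph n | ‖z.2‖ < J} :=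
    isOpen_lt (continuous_norm.comp continuous_snd) continuous_const
  filter_upwards [hU.mem_nhds hz] with y hy using borelSum_eq he hy

theorem contDiff_borelSum (he : ∀ j, 0 < e j ∧ e j * (j + 1) ≤ 1)
    (hb : ∀ j, ContDiffOn ℝ ∞ (b j) (U0 n)) : ContDiff ℝ ∞ (borelSum e b) := by
  rw [contDiff_iff_contDiffAt]
  intro z
  obtain ⟨J, hJ⟩ := exists_nat_gt ‖z.2‖
  exact (ContDiff.sum fun j _ => contDiff_cutHom (hb j) (he j).1).contDiffAt.congr_of_eventuallyEq
    (borelSum_eventuallyEq he hJ)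

theorem borelSum_rem {m : ℝ} (he : ∀ j, 0 < e j ∧ e j * (j + 1) ≤ 1)
    (hb : ∀ j, ContDiffOn ℝ ∞ (b j) (U0 n))
    (hs : ∀ j : ℕ, SB (frX n) univ (fun _ => (1 / 2 : ℝ) ^ j) j (m - j + 1)
      (cutHom (e j) (b j))) {K N L : ℕ} (hL : K + N + 1 ≤ L) :
    SB (frX n) univ (fun _ => 2) N (m - K)
      (fun z => borelSum e b z - ∑ j ∈ range L, cutHom (e j) (b j) z) := by
  refine SB.of_singletons fun z _ => ?_
  obtain ⟨J, hJ⟩ := exists_nat_gt (max ‖z.2‖ L)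
  have hJL : L ≤ J := by exact_mod_cast ((le_max_right _ _).trans hJ.le : (L : ℝ) ≤ J)
  have h1 : SB (frX n) {z} (fun _ => ∑ j ∈ Finset.Ico L J, (1 / 2 : ℝ) ^ j) N (m - K)
      (fun z => ∑ j ∈ Finset.Ico L J, cutHom (e j) (b j) z) :=
    SB.sum _ (fun j hj => (((hs j).mono_set (Set.subset_univ _)).of_le
      (by rw [Finset.mem_Ico] at hj; omega)).mono_order (by
        have : ((K + N + 1 : ℕ) : ℝ) ≤ j := by exact_mod_cast hL.trans (Finset.mem_Ico.1 hj).1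
        push_cast at this
        linarith [(Nat.cast_nonneg N : (0 : ℝ) ≤ N)])) isOpen_univ (Set.subset_univ _)
      fun j _ => (contDiff_cutHom (hb j) (he j).1).contDiffOn
  refine (h1.congr fun y hy => ?_).mono_weight fun _ _ => ?_
  · rw [Set.mem_singleton_iff.1 hy]
    filter_upwards [borelSum_eventuallyEq (b := b) he ((le_max_left _ _).trans_lt hJ)] with y hy
    rw [hy, Finset.sum_Ico_eq_sub _ hJL]
  · refine (Finset.sum_le_sum_of_subset_of_nonneg (t := range J) (fun j hj => ?_)
      fun _ _ _ => by positivity).trans (sum_geometric_two_le J)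
    rw [mem_range]; exact (Finset.mem_Ico.1 hj).2

/-- Asymptotic summation. -/
theorem exists_classical {m : ℝ} (hb : ∀ j : ℕ, Hom (m - j) (b j)) {R : ℝ}
    (hR : ∀ (j : ℕ) (z : Ph n), R < ‖z.1‖ → b j z = 0) :
    ∃ a : Ph n → ℂ, CS m a b := by
  have hsy : ∀ j : ℕ, Sy (m - j) (b j) := fun j => (hb j).sy (hR j)
  choose D hD0 hD using fun j : ℕ => sb_cutHom (hsy j) j
  set e : ℕ → ℝ := fun j => min (1 / (j + 1)) ((1 / 2) ^ j / (D j + 1)) with he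
  have he0 : ∀ j, 0 < e j := fun j => lt_min (by positivity)
    (div_pos (by positivity) (by linarith [hD0 j]))
  have he1 : ∀ j, 0 < e j ∧ e j * (j + 1) ≤ 1 := fun j => ⟨he0 j, by
    have : e j ≤ 1 / (j + 1) := min_le_left _ _
    rwa [le_div_iff₀ (by positivity)] at this⟩
  have hle : ∀ j, e j ≤ 1 := fun j => by
    nlinarith [(he1 j).2, he0 j, (Nat.cast_nonneg j : (0 : ℝ) ≤ j)]
  have hs : ∀ j : ℕ, SB (frX n) univ (fun _ => (1 / 2 : ℝ) ^ j) j (m - j + 1)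
      (cutHom (e j) (b j)) := fun j =>
    (sb_cutHom_small (he0 j) (hD0 j) (hD j _ (he0 j) (hle j))).mono_weight fun _ _ => by
      have : e j ≤ (1 / 2) ^ j / (D j + 1) := min_le_right _ _
      rw [le_div_iff₀ (by linarith [hD0 j])] at this
      nlinarith [he0 j]
  have hbs := fun j => (hb j).smooth
  have hsm := contDiff_borelSum he1 hbs
  have hsum : ∀ L : ℕ, ContDiff ℝ ∞ (fun z => ∑ j ∈ range L, cutHom (e j) (b j) z) :=
    fun L => ContDiff.sum fun j _ => contDiff_cutHom (hbs j) (he0 j)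
  have hsym : SymOn univ m (borelSum e b) := fun N => by
    have h1 := borelSum_rem he1 hbs hs (K := 0) (N := N) (L := 0 + N + 1) le_rfl
    rw [Nat.cast_zero, sub_zero] at h1
    have h2 : SymOn univ m (fun z => ∑ j ∈ range (0 + N + 1), cutHom (e j) (b j) z) :=
      SymOn.sum _ (fun j _ N => by
        obtain ⟨D, -, hD⟩ := sb_cutHom (hsy j) N
        exact ⟨D, (hD _ (he0 j) (hle j)).mono_order (by
          linarith [(Nat.cast_nonneg j : (0 : ℝ) ≤ j)])⟩) isOpen_univ subset_rfl
        fun j _ => (contDiff_cutHom (hbs j) (he0 j)).contDiffOn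
    obtain ⟨C, hC⟩ := h2 N
    refine ⟨2 + C, (h1.add hC isOpen_univ subset_rfl (hsm.sub (hsum _)).contDiffOn
      (hsum _).contDiffOn).congr fun y _ => of_forall fun y => ?_⟩
    simp
  refine ⟨borelSum e b, isClassicalSymbol_iff.2 ⟨hsm, hsym, hb, fun K => ?_⟩,
    R, fun z hz => sum_eq_zero fun j _ => by rw [cutHom, hR j z hz, mul_zero]⟩
  refine ⟨hsm.contDiffOn.sub (ContDiffOn.sum fun j _ => hbs j), fun N => ?_⟩
  have h1 := (borelSum_rem he1 hbs hs (K := K) (N := N) (L := K + N + 1) le_rfl).mono_set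
    (Set.subset_univ (S1 n))
  have h2 : Sy (m - K) (fun z => ∑ j ∈ range (K + N + 1),
      (cutHom (e j) (b j) z - if j < K then b j z else 0)) := Sy.sum _ fun j _ => by
    by_cases hj : j < K
    · simp only [if_pos hj]
      refine (sy_cutHom_sub (hsy j) (he0 j) (hle j) (K - j)).mono ?_
      rw [Nat.cast_sub hj.le]; linarith
    · simp only [if_neg hj, sub_zero]
      refine (sy_cutHom (hsy j) (he0 j) (hle j)).mono ?_
      have : (K : ℝ) ≤ j := by exact_mod_cast not_lt.1 hj
      linarith
  obtain ⟨C, hC⟩ := h2.sym N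
  refine ⟨2 + C, (h1.add hC isOpen_U0 S1_subset (hsm.sub (hsum _)).contDiffOn
    h2.smooth).congr fun y _ => of_forall fun y => ?_⟩
  have : ∑ j ∈ range (K + N + 1), (if j < K then b j y else 0) = ∑ j ∈ range K, b j y := by
    rw [← Finset.sum_filter]
    refine sum_congr ?_ fun _ _ => rfl
    ext j; simp only [Finset.mem_filter, mem_range]; omega
  simp only [sum_sub_distrib, this]
  ring

end Borel

/-! ### Homogeneous extension -/
section HomExt
variable {n : ℕ} {ν : ℝ}

/-- The fibre variable, rescaled to the length of `η₀`. -/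
def rescale (η₀ : Rn n) (z : Ph n) : Ph n := (z.1, (‖η₀‖ / ‖z.2‖) • z.2)

theorem contDiffOn_rescale (η₀ : Rn n) : ContDiffOn ℝ ∞ (rescale η₀) (U0 n) := by
  intro z hz
  have hz' : z.2 ≠ 0 := hz
  exact (contDiffAt_fst.prodMk ((contDiffAt_const.div (contDiffAt_snd.norm ℝ hz')
    (norm_ne_zero_iff.2 hz')).smul contDiffAt_snd)).contDiffWithinAt

theorem rescale_smul {η₀ : Rn n} {z : Ph n} {t : ℝ} (ht : 0 < t) :
    rescale η₀ (z.1, t • z.2) = rescale η₀ z := by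
  simp only [rescale, norm_smul, Real.norm_of_nonneg ht.le, smul_smul]
  congr 2
  rw [mul_comm t, div_mul_eq_mul_div, mul_div_mul_right _ _ ht.ne']

theorem rescale_mem {η₀ : Rn n} (h0 : η₀ ≠ 0) {z : Ph n} (hz : z ∈ U0 n) : rescale η₀ z ∈ U0 n :=
  smul_ne_zero (div_ne_zero (norm_ne_zero_iff.2 h0) (norm_ne_zero_iff.2 hz)) hz

theorem rescale_self {η₀ : Rn n} (h0 : η₀ ≠ 0) (x : Rn n) : rescale η₀ (x, η₀) = (x, η₀) := by
  simp [rescale, div_self (norm_ne_zero_iff.2 h0)]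

/-- The homogeneous function of degree `ν` which agrees with `f` where `|ξ| = |η₀|`. -/
def homExt (ν : ℝ) (η₀ : Rn n) (f : Ph n → ℂ) (z : Ph n) : ℂ :=
  (((‖z.2‖ / ‖η₀‖) ^ ν : ℝ) : ℂ) * f (rescale η₀ z)

theorem hom_homExt {η₀ : Rn n} (h0 : η₀ ≠ 0) {f : Ph n → ℂ} (hf : ContDiffOn ℝ ∞ f (U0 n)) :
    Hom ν (homExt ν η₀ f) := by
  refine ⟨?_, fun z t hz ht => ?_⟩
  · intro z hz
    have hz' : z.2 ≠ 0 := hz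
    have h1 : ContDiffAt ℝ ∞ (fun z : Ph n => (‖z.2‖ / ‖η₀‖) ^ ν) z :=
      ContDiffAt.rpow_const_of_ne ((contDiffAt_snd.norm ℝ hz').div_const _)
        (div_ne_zero (norm_ne_zero_iff.2 hz') (norm_ne_zero_iff.2 h0))
    have h2 : ContDiffAt ℝ ∞ (fun z : Ph n => (((‖z.2‖ / ‖η₀‖) ^ ν : ℝ) : ℂ)) z :=
      Complex.ofRealCLM.contDiff.contDiffAt.comp z h1
    have h3 : ContDiffAt ℝ ∞ (fun z => f (rescale η₀ z)) z :=
      (hf.contDiffAt (isOpen_U0.mem_nhds (rescale_mem h0 hz))).comp z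
        ((contDiffOn_rescale η₀).contDiffAt (isOpen_U0.mem_nhds hz))
    exact (h2.mul h3).contDiffWithinAt
  · simp only [homExt, rescale_smul ht, norm_smul, Real.norm_of_nonneg ht.le]
    rw [mul_div_assoc, Real.mul_rpow ht.le (by positivity)]
    push_cast
    ring

theorem Hom.homExt_eq {η₀ : Rn n} (h0 : η₀ ≠ 0) {f : Ph n → ℂ} (hf : Hom ν f) {z : Ph n}
    (hz : z ∈ U0 n) : homExt ν η₀ f z = f z := by
  have hz' : 0 < ‖z.2‖ := norm_pos_iff.2 hz
  have h0' : 0 < ‖η₀‖ := norm_pos_iff.2 h0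
  have h := hf.hom z (‖η₀‖ / ‖z.2‖) hz (by positivity)
  rw [homExt, rescale, h, ← mul_assoc, ← Complex.ofReal_mul, ← Real.mul_rpow (by positivity)
    (by positivity)]
  have : ‖z.2‖ / ‖η₀‖ * (‖η₀‖ / ‖z.2‖) = 1 := by field_simp
  rw [this]; simp

end HomExt

/-! ### Block diagonalization of the full symbol -/
section Recursion
variable {n : ℕ}

/-- The terms of index less than `l`. -/
def trunc (l : ℕ) (a : ℕ → Ph n → ℂ) (j : ℕ) : Ph n → ℂ := if j < l then a j else fun _ => 0

theorem star_trunc_left {l : ℕ} (a c : ℕ → Ph n → ℂ) (z : Ph n) :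
    star a c l z = star (trunc l a) c l z + a l z * c 0 z := by
  have h0 : pstar 0 a c l z = pstar 0 (trunc l a) c l z + a l z * c 0 z := by
    simp only [pstar, Finset.sum_range_succ _ l, moyal, Nat.sub_self, trunc, lt_irrefl, if_false,
      zero_mul, add_zero]
    rw [add_left_inj]
    refine sum_congr rfl fun j hj => ?_
    rw [if_pos (Finset.mem_range.1 hj)]
  have h1 : ∀ r ∈ range l, pstar (r + 1) a c (l - (r + 1)) z
      = pstar (r + 1) (trunc l a) c (l - (r + 1)) z := fun r hr => by
    refine sum_congr rfl fun j hj => ?_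
    rw [trunc, if_pos (by rw [mem_range] at hj hr; omega)]
  rw [star, star, sum_range_succ', sum_range_succ']
  simp only [Nat.sub_zero, h0]
  rw [sum_congr rfl fun r hr => by rw [h1 r hr]]
  simp
  ring

theorem star_congr_right {l : ℕ} {a c c' : ℕ → Ph n → ℂ} (h : ∀ j < l, c j = c' j) (z : Ph n) :
    star a c l z = star a c' l z + a 0 z * (c l z - c' l z) := by
  have h0 : pstar 0 a c l z = pstar 0 a c' l z + a 0 z * (c l z - c' l z) := by
    rw [pstar, pstar, sum_range_succ', sum_range_succ']
    simp only [moyal, Nat.sub_zero]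
    rw [sum_congr rfl fun j hj => by rw [h (l - (j + 1)) (by rw [mem_range] at hj; omega)]]
    ring
  have h1 : ∀ r ∈ range l, pstar (r + 1) a c (l - (r + 1)) z
      = pstar (r + 1) a c' (l - (r + 1)) z := fun r hr => by
    refine sum_congr rfl fun j hj => ?_
    rw [h _ (by rw [mem_range] at hj hr; omega)]
  rw [star, star, sum_range_succ', sum_range_succ']
  simp only [Nat.sub_zero, h0]
  rw [sum_congr rfl fun r hr => by rw [h1 r hr]]
  simp
  ring

theorem star_congr_lt {l : ℕ} {a c c' : ℕ → Ph n → ℂ} (h : ∀ j ≤ l, c j = c' j) :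
    star a c l = star a c' l := by
  funext z
  rw [star_congr_right (c' := c') (fun j hj => h j hj.le), h l le_rfl]
  simp

theorem star_zero (a c : ℕ → Ph n → ℂ) (z : Ph n) : star a c 0 z = a 0 z * c 0 z := by
  simp [star, pstar, moyal]

variable {ι : Type*} [Fintype ι] [DecidableEq ι]

/-- Matrices of symbol sequences. -/
abbrev MSeq (n : ℕ) (ι : Type*) : Type _ := ι → ι → ℕ → Ph n → ℂ

/-- The composition of matrices of symbol sequences. -/
def mstar (a c : MSeq n ι) : MSeq n ι := fun i j l z => ∑ k, star (a i k) (c k j) l z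

/-- The value of the term of index `l`. -/
def MSeq.at (a : MSeq n ι) (l : ℕ) (z : Ph n) : Matrix ι ι ℂ := Matrix.of fun i j => a i j l z

/-- Entrywise truncation. -/
def mtrunc (l : ℕ) (a : MSeq n ι) : MSeq n ι := fun i j => trunc l (a i j)

theorem mstar_at_zero (a c : MSeq n ι) (z : Ph n) : (mstar a c).at 0 z = a.at 0 z * c.at 0 z := by
  ext i j
  simp [MSeq.at, mstar, star_zero, mul_apply]

theorem mstar_trunc_left (a c : MSeq n ι) (l : ℕ) (z : Ph n) :
    (mstar a c).at l z = (mstar (mtrunc l a) c).at l z + a.at l z * c.at 0 z := by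
  ext i j
  simp only [MSeq.at, mstar, of_apply, Matrix.add_apply, mul_apply, ← Finset.sum_add_distrib]
  exact sum_congr rfl fun k _ => star_trunc_left _ _ _

theorem mstar_congr_right {a c c' : MSeq n ι} {l : ℕ} (h : ∀ i j, ∀ s < l, c i j s = c' i j s)
    (z : Ph n) :
    (mstar a c).at l z = (mstar a c').at l z + a.at 0 z * (c.at l z - c'.at l z) := by
  ext i j
  simp only [MSeq.at, mstar, of_apply, Matrix.add_apply, mul_apply, Matrix.sub_apply,
    ← Finset.sum_add_distrib]
  exact sum_congr rfl fun k _ => star_congr_right (fun s hs => h k j s hs) _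

/-- The part of the term of index `l` of `a # p # b` which involves only the terms of index less
than `l` of `a` and `b`. -/
def lowerPart (p a b : MSeq n ι) (l : ℕ) (z : Ph n) : Matrix ι ι ℂ :=
  (mstar (mtrunc l a) (mstar p (mtrunc l b))).at l z

theorem mstar_mstar_at (p a b : MSeq n ι) {l : ℕ} (hl : l ≠ 0) (z : Ph n) :
    (mstar a (mstar p b)).at l z = lowerPart p a b l z + a.at l z * (p.at 0 z * b.at 0 z)
      + a.at 0 z * (p.at 0 z * b.at l z) := by
  have h1 : ∀ i j, ∀ s < l, mstar p b i j s = mstar p (mtrunc l b) i j s := fun i j s hs => by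
    funext y
    refine sum_congr rfl fun k _ => ?_
    rw [star_congr_lt (c' := mtrunc l b k j) fun t ht => by
      simp only [mtrunc, trunc, if_pos (ht.trans_lt hs)]]
  have h2 : (mstar p b).at l z - (mstar p (mtrunc l b)).at l z = p.at 0 z * b.at l z := by
    rw [mstar_congr_right (c' := mtrunc l b) (fun i j s hs => by
      simp only [mtrunc, trunc, if_pos hs])]
    have : (mtrunc l b).at l z = 0 := by ext i j; simp [MSeq.at, mtrunc, trunc]
    rw [this]; simp
  have h3 : (mtrunc l a).at 0 z = a.at 0 z := by
    ext i j; simp [MSeq.at, mtrunc, trunc, Nat.pos_of_ne_zero hl]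
  rw [mstar_trunc_left, mstar_congr_right h1, h2, h3, mstar_at_zero, lowerPart]
  abel

variable (c : ι → Prop) [DecidablePred c]

/-- The projection onto the block `c`. -/
def blockProj : Matrix ι ι ℂ := Matrix.diagonal fun i => if c i then 1 else 0

variable {c}

theorem offdiag_vanish {A P B M R X Y : Matrix ι ι ℂ} (hM1 : M * (A * P * B) = 1 - blockProj c)
    (hM2 : A * P * B * M = 1 - blockProj c) (hX : X = -(blockProj c * R * M * A))
    (hY : Y = -(B * M * R * blockProj c)) {i j : ι} (hij : c i ↔ ¬ c j) :
    (R + X * (P * B) + A * (P * Y)) i j = 0 := by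
  have h1 : X * (P * B) = -(blockProj c * R * (1 - blockProj c)) := by
    rw [hX, ← hM1]; simp only [Matrix.neg_mul, Matrix.mul_assoc]
  have h2 : A * (P * Y) = -((1 - blockProj c) * R * blockProj c) := by
    rw [hY, ← hM2]; simp only [Matrix.mul_neg, Matrix.mul_assoc]
  rw [h1, h2]
  have e1 : (1 : Matrix ι ι ℂ) - blockProj c = Matrix.diagonal fun i => if c i then 0 else 1 := by
    rw [← Matrix.diagonal_one, blockProj, Matrix.diagonal_sub]
    congr 1; funext i; split_ifs <;> simp
  rw [e1]
  simp only [blockProj, Matrix.add_apply, Matrix.neg_apply, Matrix.mul_diagonal,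
    Matrix.diagonal_mul]
  by_cases hi : c i <;> by_cases hj : c j <;> simp_all

/-- Recursion over all smaller indices. -/
def recSeq {T : Type*} [Zero T] (F : ℕ → (ℕ → T) → T) (l : ℕ) : T :=
  F l fun j => if _ : j < l then recSeq F j else 0
termination_by l

/-- Matrices of homogeneous functions of orders `m - l`. -/
def HomSeq (m : ℝ) (a : MSeq n ι) : Prop := ∀ i j (l : ℕ), Hom (m - l) (a i j l)

theorem HomSeq.mstar {m m' : ℝ} {a b : MSeq n ι} (ha : HomSeq m a) (hb : HomSeq m' b) :
    HomSeq (m + m') (mstar a b) := fun i j l =>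
  Hom.sum _ fun k _ => Hom.star (ha i k) (hb k j) l

theorem HomSeq.lowerPart {m : ℝ} {p a b : MSeq n ι} (hp : HomSeq m p) {l : ℕ}
    (ha : ∀ i j, ∀ s < l, Hom (0 - (s : ℝ)) (a i j s))
    (hb : ∀ i j, ∀ s < l, Hom (0 - (s : ℝ)) (b i j s)) (i j : ι) :
    Hom (m - l) (fun z => lowerPart p a b l z i j) := by
  have ht : ∀ a : MSeq n ι, (∀ i j, ∀ s < l, Hom (0 - (s : ℝ)) (a i j s)) →
      HomSeq 0 (mtrunc l a) := fun a ha i j s => by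
    simp only [mtrunc, trunc]
    split_ifs with h
    · exact ha i j s h
    · exact Hom.zero
  exact (((ht a ha).mstar (hp.mstar (ht b hb))) i j l).of_eq (by ring)

theorem Hom.congr_fun {ν : ℝ} {f g : Ph n → ℂ} (hf : Hom ν f) (h : ∀ z, f z = g z) : Hom ν g :=
  (funext h : f = g) ▸ hf

theorem hom_mul {m m' : ℝ} {A B : Ph n → Matrix ι ι ℂ} (hA : ∀ i j, Hom m (fun z => A z i j))
    (hB : ∀ i j, Hom m' (fun z => B z i j)) (i j : ι) : Hom (m + m') (fun z => (A z * B z) i j) := by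
  simp only [mul_apply]
  exact Hom.sum _ fun k _ => (hA i k).mul (hB k j)

theorem hom_diag_mul {m : ℝ} {A : Ph n → Matrix ι ι ℂ} (hA : ∀ i j, Hom m (fun z => A z i j))
    (i j : ι) : Hom m (fun z => (blockProj c * A z) i j) := by
  simp only [blockProj, Matrix.diagonal_mul]
  exact (hA i j).const_mul _

theorem hom_mul_diag {m : ℝ} {A : Ph n → Matrix ι ι ℂ} (hA : ∀ i j, Hom m (fun z => A z i j))
    (i j : ι) : Hom m (fun z => (A z * blockProj c) i j) := by
  simp only [blockProj, Matrix.mul_diagonal, mul_comm _ (ite _ _ _)]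
  exact (hA i j).const_mul _

theorem exists_block_sequences {m R : ℝ} {p : MSeq n ι} (hp : HomSeq m p)
    {a₀ b₀ M : Ph n → Matrix ι ι ℂ} (ha₀ : ∀ i j, Hom 0 (fun z => a₀ z i j))
    (hb₀ : ∀ i j, Hom 0 (fun z => b₀ z i j)) (hM : ∀ i j, Hom (-m) (fun z => M z i j))
    (hMR : ∀ z : Ph n, R < ‖z.1‖ → M z = 0) :
    ∃ a b : MSeq n ι, HomSeq 0 a ∧ HomSeq 0 b ∧ (∀ z, a.at 0 z = a₀ z) ∧ (∀ z, b.at 0 z = b₀ z) ∧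
      (∀ l ≠ 0, ∀ z : Ph n, R < ‖z.1‖ → a.at l z = 0 ∧ b.at l z = 0) ∧
      ∀ z : Ph n, M z * (a₀ z * p.at 0 z * b₀ z) = 1 - blockProj c →
        a₀ z * p.at 0 z * b₀ z * M z = 1 - blockProj c →
        ∀ l ≠ 0, ∀ i j, (c i ↔ ¬ c j) → mstar a (mstar p b) i j l z = 0 := by
  set T : Type _ := (ι → ι → Ph n → ℂ) × (ι → ι → Ph n → ℂ)
  set L : ℕ → (ℕ → T) → Ph n → Matrix ι ι ℂ := fun l s =>
    lowerPart p (fun i j t => (s t).1 i j) (fun i j t => (s t).2 i j) l with hL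
  set F : ℕ → (ℕ → T) → T := fun l s => if l = 0 then (fun i j z => a₀ z i j, fun i j z => b₀ z i j)
    else (fun i j z => (-(blockProj c * L l s z * M z * a₀ z)) i j,
      fun i j z => (-(b₀ z * M z * L l s z * blockProj c)) i j) with hF
  set a : MSeq n ι := fun i j l => (recSeq F l).1 i j with ha
  set b : MSeq n ι := fun i j l => (recSeq F l).2 i j with hb
  have hL' : ∀ l, L l (fun j => if _ : j < l then recSeq F j else 0) = lowerPart p a b l :=
    fun l => by
    funext z
    simp only [hL, lowerPart]
    congr 2
    · funext i j t
      simp only [mtrunc, trunc, ha]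
      split_ifs <;> rfl
    · congr 1
      funext i j t
      simp only [mtrunc, trunc, hb]
      split_ifs <;> rfl
  have h0 : recSeq F 0 = (fun i j z => a₀ z i j, fun i j z => b₀ z i j) := by rw [recSeq]; simp [hF]
  have hl : ∀ l ≠ 0, recSeq F l =
      (fun i j z => (-(blockProj c * lowerPart p a b l z * M z * a₀ z)) i j,
      fun i j z => (-(b₀ z * M z * lowerPart p a b l z * blockProj c)) i j) := fun l h => by
    rw [recSeq]
    refine (if_neg h).trans ?_
    rw [hL']
  have ha0 : ∀ z, a.at 0 z = a₀ z := fun z => by ext i j; simp [MSeq.at, ha, h0]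
  have hb0 : ∀ z, b.at 0 z = b₀ z := fun z => by ext i j; simp [MSeq.at, hb, h0]
  have hal : ∀ l ≠ 0, ∀ z, a.at l z = -(blockProj c * lowerPart p a b l z * M z * a₀ z) :=
    fun l h z => by ext i j; simp only [MSeq.at, of_apply, ha, hl l h]
  have hbl : ∀ l ≠ 0, ∀ z, b.at l z = -(b₀ z * M z * lowerPart p a b l z * blockProj c) :=
    fun l h z => by ext i j; simp only [MSeq.at, of_apply, hb, hl l h]
  have hhom : ∀ l : ℕ, (∀ i j, Hom (0 - (l : ℝ)) (a i j l)) ∧ ∀ i j, Hom (0 - (l : ℝ)) (b i j l) := by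
    intro l
    induction l using Nat.strong_induction_on with
    | _ l ih =>
      by_cases h : l = 0
      · subst h
        simp only [ha, hb, h0]
        exact ⟨fun i j => (ha₀ i j).of_eq (by simp), fun i j => (hb₀ i j).of_eq (by simp)⟩
      · have hR := hp.lowerPart (fun i j s hs => (ih s hs).1 i j) fun i j s hs => (ih s hs).2 i j
        simp only [ha, hb, hl l h, Matrix.neg_apply]
        refine ⟨fun i j => ?_, fun i j => ?_⟩
        · refine (((hom_mul (hom_mul (hom_diag_mul (c := c) hR) hM) ha₀ i j).const_mul (-1)).of_eq
            (by ring : m - (l : ℝ) + -m + 0 = 0 - l)).congr_fun ?_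
          intro z; simp; rfl
        · refine (((hom_mul_diag (c := c) (hom_mul (hom_mul hb₀ hM) hR) i j).const_mul (-1)).of_eq
            (by ring : 0 + -m + (m - (l : ℝ)) = 0 - l)).congr_fun ?_
          intro z; simp; rfl
  refine ⟨a, b, fun i j l => (hhom l).1 i j, fun i j l => (hhom l).2 i j, ha0, hb0,
    fun l h z hz => ?_, fun z h1 h2 l h i j hij => ?_⟩
  · rw [hal l h, hbl l h, hMR z hz]; simp
  · have e := mstar_mstar_at p a b h z
    have e2 := congrFun (congrFun e i) j
    rw [ha0, hb0] at e2
    exact e2.trans (offdiag_vanish h1 h2 (hal l h z) (hbl l h z) hij)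

end Recursion

/-! ### Germs of smooth functions -/
section Germs
variable {E G : Type*} [NormedAddCommGroup E] [NormedSpace ℝ E] [NormedAddCommGroup G]
  [NormedSpace ℝ G] {y₀ : E}

/-- Smoothness in a neighbourhood of a point. -/
def GS (f : E → G) (y₀ : E) : Prop := ∀ᶠ y in 𝓝 y₀, ContDiffAt ℝ ∞ f y

theorem GS.const (c : G) : GS (fun _ : E => c) y₀ := of_forall fun _ => contDiffAt_const

theorem GS.add {f g : E → G} (hf : GS f y₀) (hg : GS g y₀) : GS (fun y => f y + g y) y₀ := by
  filter_upwards [hf, hg] with y h h' using h.add h'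

theorem GS.sub {f g : E → G} (hf : GS f y₀) (hg : GS g y₀) : GS (fun y => f y - g y) y₀ := by
  filter_upwards [hf, hg] with y h h' using h.sub h'

theorem GS.mul {f g : E → ℂ} (hf : GS f y₀) (hg : GS g y₀) : GS (fun y => f y * g y) y₀ := by
  filter_upwards [hf, hg] with y h h' using h.mul h'

theorem GS.sum {κ : Type*} {T : Finset κ} {f : κ → E → G} (hf : ∀ k ∈ T, GS (f k) y₀) :
    GS (fun y => ∑ k ∈ T, f k y) y₀ := by
  filter_upwards [(Finset.eventually_all T).2 hf] with y h using ContDiffAt.sum fun k hk => h k hk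

theorem GS.prod {κ : Type*} {T : Finset κ} {f : κ → E → ℂ} (hf : ∀ k ∈ T, GS (f k) y₀) :
    GS (fun y => ∏ k ∈ T, f k y) y₀ := by
  filter_upwards [(Finset.eventually_all T).2 hf] with y h using contDiffAt_prod fun k hk => h k hk

theorem GS.continuousAt {f : E → G} (hf : GS f y₀) : ContinuousAt f y₀ :=
  hf.self_of_nhds.continuousAt

theorem GS.diffAt {f : E → G} (hf : GS f y₀) : DifferentiableAt ℝ f y₀ :=
  hf.self_of_nhds.differentiableAt (by simp)

theorem GS.inv {f : E → ℂ} (hf : GS f y₀) (h0 : f y₀ ≠ 0) : GS (fun y => (f y)⁻¹) y₀ := by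
  filter_upwards [hf, hf.continuousAt.eventually_ne h0] with y h h' using h.inv h'

variable {ι κ τ : Type*} [Fintype κ]

/-- Entrywise smoothness of matrix valued functions in a neighbourhood of a point. -/
def GSM (A : E → Matrix ι τ ℂ) (y₀ : E) : Prop := ∀ i j, GS (fun y => A y i j) y₀

theorem GSM.const (A : Matrix ι τ ℂ) : GSM (fun _ : E => A) y₀ := fun _ _ => GS.const _

theorem GSM.mul {A : E → Matrix ι κ ℂ} {B : E → Matrix κ τ ℂ} (hA : GSM A y₀) (hB : GSM B y₀) :
    GSM (fun y => A y * B y) y₀ := fun i j => by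
  simp only [mul_apply]
  exact GS.sum fun k _ => (hA i k).mul (hB k j)

theorem GSM.add {A B : E → Matrix ι τ ℂ} (hA : GSM A y₀) (hB : GSM B y₀) :
    GSM (fun y => A y + B y) y₀ := fun i j => (hA i j).add (hB i j)

theorem GSM.sub {A B : E → Matrix ι τ ℂ} (hA : GSM A y₀) (hB : GSM B y₀) :
    GSM (fun y => A y - B y) y₀ := fun i j => (hA i j).sub (hB i j)

theorem GSM.smul {f : E → ℂ} {A : E → Matrix ι τ ℂ} (hf : GS f y₀) (hA : GSM A y₀) :
    GSM (fun y => f y • A y) y₀ := fun i j => hf.mul (hA i j)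

theorem GSM.det [DecidableEq κ] {A : E → Matrix κ κ ℂ} (hA : GSM A y₀) :
    GS (fun y => (A y).det) y₀ := by
  simp only [Matrix.det_apply']
  exact GS.sum fun σ _ => (GS.const _).mul (GS.prod fun i _ => hA _ _)

theorem GSM.inv [DecidableEq κ] {A : E → Matrix κ κ ℂ} (hA : GSM A y₀) (h0 : (A y₀).det ≠ 0) :
    GSM (fun y => (A y)⁻¹) y₀ := fun i j => by
  simp only [Matrix.inv_def, Ring.inverse_eq_inv', Matrix.smul_apply, smul_eq_mul,
    Matrix.adjugate_apply]
  refine (hA.det.inv h0).mul (GSM.det (A := fun y => (A y).updateRow j (Pi.single i 1))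
    fun k l => ?_)
  simp only [Matrix.updateRow_apply]
  split_ifs
  · exact GS.const _
  · exact hA k l

theorem GSM.fromBlocks {α β : Type*} {A : E → Matrix α α ℂ} {B : E → Matrix α β ℂ}
    {C : E → Matrix β α ℂ} {D : E → Matrix β β ℂ} (hA : GSM A y₀) (hB : GSM B y₀) (hC : GSM C y₀)
    (hD : GSM D y₀) : GSM (fun y => fromBlocks (A y) (B y) (C y) (D y)) y₀ := by
  rintro (i | i) (j | j)
  exacts [hA i j, hB i j, hC i j, hD i j]

theorem GSM.det_ne [DecidableEq κ] {A : E → Matrix κ κ ℂ} (hA : GSM A y₀) (h0 : (A y₀).det ≠ 0) :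
    ∀ᶠ y in 𝓝 y₀, (A y).det ≠ 0 := hA.det.continuousAt.eventually_ne h0

/-- Entrywise derivative in the direction `v`. -/
def dM (v : E) (A : E → Matrix ι τ ℂ) (y : E) : Matrix ι τ ℂ :=
  Matrix.of fun i j => fderiv ℝ (fun y => A y i j) y v

theorem dM_congr {A B : E → Matrix ι τ ℂ} (h : ∀ᶠ y in 𝓝 y₀, A y = B y) (v : E) :
    dM v A y₀ = dM v B y₀ := by
  ext i j
  have : (fun y => A y i j) =ᶠ[𝓝 y₀] fun y => B y i j := by
    filter_upwards [h] with y hy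
    rw [hy]
  simp only [dM, of_apply, this.fderiv_eq]

theorem dM_mul {A : E → Matrix ι κ ℂ} {B : E → Matrix κ τ ℂ} (hA : GSM A y₀) (hB : GSM B y₀)
    (v : E) : dM v (fun y => A y * B y) y₀ = dM v A y₀ * B y₀ + A y₀ * dM v B y₀ := by
  ext i j
  simp only [dM, mul_apply, of_apply, Matrix.add_apply]
  rw [fderiv_fun_sum fun k _ => ((hA i k).mul (hB k j)).diffAt]
  simp only [ContinuousLinearMap.sum_apply, ← Finset.sum_add_distrib]
  refine sum_congr rfl fun k _ => ?_
  rw [fderiv_fun_mul (hA i k).diffAt (hB k j).diffAt]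
  simp
  ring

theorem dM_add {A B : E → Matrix ι τ ℂ} (hA : GSM A y₀) (hB : GSM B y₀)
    (v : E) : dM v (fun y => A y + B y) y₀ = dM v A y₀ + dM v B y₀ := by
  ext i j
  simp only [dM, of_apply, Matrix.add_apply]
  rw [fderiv_fun_add (hA i j).diffAt (hB i j).diffAt]
  rfl

theorem dM_const (A : Matrix ι τ ℂ) (v : E) : dM v (fun _ : E => A) y₀ = 0 := by ext i j; simp [dM]

theorem dM_smul {f : E → ℂ} {A : E → Matrix ι τ ℂ} (hf : GS f y₀) (hA : GSM A y₀) (v : E) :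
    dM v (fun y => f y • A y) y₀ = fderiv ℝ f y₀ v • A y₀ + f y₀ • dM v A y₀ := by
  ext i j
  simp only [dM, of_apply, Matrix.add_apply, Matrix.smul_apply, smul_eq_mul]
  rw [fderiv_fun_mul hf.diffAt (hA i j).diffAt]
  simp
  ring

/-! ### A smooth section of eigenvalues -/

theorem exists_local_inverse [CompleteSpace E] {F : E → E} (hF : GS F y₀) (e : E ≃L[ℝ] E)
    (he : fderiv ℝ F y₀ = e) :
    ∃ G : E → E, GS G (F y₀) ∧ ∀ᶠ y in 𝓝 y₀, G (F y) = y := by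
  have hF0 := hF.self_of_nhds
  have hd : HasFDerivAt F (e : E →L[ℝ] E) y₀ := he ▸ (hF0.differentiableAt (by simp)).hasFDerivAt
  set Φ := hF0.toOpenPartialHomeomorph F hd (by simp) with hΦ
  have hco : (Φ : E → E) = F := hF0.toOpenPartialHomeomorph_coe hd (by simp)
  have hs : y₀ ∈ Φ.source := hF0.mem_toOpenPartialHomeomorph_source hd (by simp)
  have ht : F y₀ ∈ Φ.target := hF0.image_mem_toOpenPartialHomeomorph_target hd (by simp)
  have hsy : Φ.symm (F y₀) = y₀ := by rw [← hco]; exact Φ.left_inv hs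
  have hcont : ContinuousAt (fderiv ℝ F) y₀ := (hF0.fderiv_right (m := ∞) (by simp)).continuousAt
  have hinv : ∀ᶠ y in 𝓝 y₀, ∃ e' : E ≃L[ℝ] E, (e' : E →L[ℝ] E) = fderiv ℝ F y := by
    have := hcont.eventually (he ▸ ContinuousLinearEquiv.nhds e)
    filter_upwards [this] with y hy using hy
  refine ⟨Φ.symm, ?_, ?_⟩
  · have hlim : Tendsto Φ.symm (𝓝 (F y₀)) (𝓝 y₀) := by
      have := (Φ.continuousAt_symm ht).tendsto
      rwa [hsy] at this
    filter_upwards [Φ.open_target.mem_nhds ht, hlim.eventually hinv, hlim.eventually hF]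
      with y hy ⟨e', he'⟩ hs
    refine Φ.contDiffAt_symm hy (f₀' := e') ?_ ?_
    · rw [he', hco]; exact (hs.differentiableAt (by simp)).hasFDerivAt
    · rw [hco]; exact hs
  · filter_upwards [Φ.open_source.mem_nhds hs] with y hy
    rw [← hco]; exact Φ.left_inv hy

theorem exists_implicit [CompleteSpace E] {f : E × ℂ → ℂ} (hf : GS f (y₀, 0)) (h0 : f (y₀, 0) = 0)
    {d : ℂ} (hd : HasDerivAt (fun μ => f (y₀, μ)) d 0) (hd0 : d ≠ 0) :
    ∃ l : E → ℂ, GS l y₀ ∧ l y₀ = 0 ∧ ∀ᶠ q in 𝓝 (y₀, (0 : ℂ)), f q = 0 → l q.1 = q.2 := by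
  set f' := fderiv ℝ f (y₀, 0) with hf'
  have hdf : HasFDerivAt f f' (y₀, 0) := hf.diffAt.hasFDerivAt
  have hmu : ∀ μ : ℂ, f' (0, μ) = d * μ := fun μ => by
    have h1 : HasFDerivAt (fun μ : ℂ => f (y₀, μ)) (f'.comp (inr ℝ E ℂ)) 0 :=
      HasFDerivAt.comp (0 : ℂ) (f := fun μ : ℂ => (y₀, μ)) hdf (hasFDerivAt_prodMk_right y₀ 0)
    have h2 := (hd.hasFDerivAt.restrictScalars ℝ).unique h1
    have h3 := DFunLike.congr_fun h2 μ
    simp at h3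
    rw [← h3, mul_comm]
  have hsplit : ∀ q : E × ℂ, f' q = f' (q.1, 0) + d * q.2 := fun q => by rw [← hmu, ← map_add]; simp
  set T : E × ℂ →L[ℝ] E × ℂ := (fst ℝ E ℂ).prod f' with hT
  set B : E × ℂ →L[ℝ] E × ℂ := (fst ℝ E ℂ).prod
    (((d⁻¹ : ℂ) • (ContinuousLinearMap.id ℝ ℂ)).comp ((snd ℝ E ℂ) -
      (f'.comp (inl ℝ E ℂ)).comp (fst ℝ E ℂ))) with hB
  set e : (E × ℂ) ≃L[ℝ] E × ℂ := ContinuousLinearEquiv.equivOfInverse T B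
    (fun q => by
      ext
      · simp [hT, hB]
      · simp only [hT, hB, ContinuousLinearMap.prod_apply, ContinuousLinearMap.comp_apply,
          ContinuousLinearMap.sub_apply, ContinuousLinearMap.smul_apply, hsplit q]
        simp [hd0])
    (fun q => by
      ext
      · simp [hT, hB]
      · simp only [hT, hB, ContinuousLinearMap.prod_apply, ContinuousLinearMap.comp_apply,
          ContinuousLinearMap.sub_apply, ContinuousLinearMap.smul_apply]
        rw [hsplit]
        simp [hd0]) with he
  set F : E × ℂ → E × ℂ := fun q => (q.1, f q) with hF
  have hFs : GS F (y₀, 0) := by filter_upwards [hf] with q hq using contDiffAt_fst.prodMk hq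
  have hFd : fderiv ℝ F (y₀, 0) = e := by
    have : HasFDerivAt F T (y₀, 0) := hasFDerivAt_fst.prodMk hdf
    rw [this.fderiv]; rfl
  obtain ⟨G, hG, hGF⟩ := exists_local_inverse hFs e hFd
  have hF0 : F (y₀, 0) = (y₀, 0) := by simp [hF, h0]
  rw [hF0] at hG
  refine ⟨fun y => (G (y, 0)).2, ?_, ?_, ?_⟩
  · have hlim : Tendsto (fun y : E => (y, (0 : ℂ))) (𝓝 y₀) (𝓝 (y₀, 0)) :=
      (Continuous.prodMk_left (0 : ℂ)).tendsto y₀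
    filter_upwards [hlim.eventually hG] with y hy
    exact contDiffAt_snd.comp y (hy.comp y (contDiffAt_id.prodMk contDiffAt_const))
  · have := hGF.self_of_nhds
    rw [hF0] at this
    simp [this]
  · filter_upwards [hGF] with q hq hq0
    simp only [hF, hq0] at hq
    rw [hq]

theorem pow_card_le_norm_prod {ε : ℝ} (hε : 0 ≤ ε) (s : Multiset ℂ) (h : ∀ x ∈ s, ε ≤ ‖x‖) :
    ε ^ s.card ≤ ‖s.prod‖ := by
  induction s using Multiset.induction_on with
  | empty => simp
  | cons a s ih =>
    rw [Multiset.card_cons, Multiset.prod_cons, norm_mul, pow_succ, mul_comm]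
    exact mul_le_mul (h a (Multiset.mem_cons_self _ _))
      (ih fun x hx => h x (Multiset.mem_cons_of_mem hx)) (by positivity) (norm_nonneg _)

variable [DecidableEq κ]

theorem det_sub_scalar (A : Matrix κ κ ℂ) (μ : ℂ) :
    (A - scalar κ μ).det = 0 ↔ A.charpoly.IsRoot μ := by
  rw [Polynomial.IsRoot, Matrix.eval_charpoly, ← neg_sub A, Matrix.det_neg]
  simp

theorem exists_small_eigenvalue {A : E → Matrix κ κ ℂ} (hA : GSM A y₀) (h0 : (A y₀).det = 0)
    {ε : ℝ} (hε : 0 < ε) :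
    ∀ᶠ y in 𝓝 y₀, ∃ μ : ℂ, ‖μ‖ < ε ∧ (A y - scalar κ μ).det = 0 := by
  have h1 : ∀ᶠ y in 𝓝 y₀, ‖(A y).det‖ < ε ^ Fintype.card κ := by
    have := hA.det.continuousAt.norm
    refine this.eventually_lt continuousAt_const ?_
    rw [h0, norm_zero]; positivity
  filter_upwards [h1] with y hy
  by_contra! hcon
  rw [Matrix.det_eq_prod_roots_charpoly] at hy
  have hcard : (A y).charpoly.roots.card = Fintype.card κ := by
    rw [Polynomial.splits_iff_card_roots.1 (IsAlgClosed.splits _), Matrix.charpoly_natDegree_eq_dim]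
  have := pow_card_le_norm_prod hε.le (A y).charpoly.roots fun x hx => by
    by_contra! hlt
    exact hcon x hlt ((det_sub_scalar _ _).2 (Polynomial.isRoot_of_mem_roots hx))
  rw [hcard] at this
  linarith

theorem gs_charpoly_coeff {A : E → Matrix κ κ ℂ} (hA : GSM A y₀) (i : ℕ) :
    GS (fun y => (A y).charpoly.coeff i) y₀ := by
  have h : ∀ q : MvPolynomial (κ × κ) ℂ,
      GS (fun y => MvPolynomial.eval₂Hom (RingHom.id ℂ) (fun ij => A y ij.1 ij.2) q) y₀ := by
    intro q
    induction q using MvPolynomial.induction_on with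
    | C c => simpa using GS.const c
    | add p q hp hq => simp only [map_add]; exact hp.add hq
    | mul_X p ij hp =>
      simp only [map_mul, MvPolynomial.coe_eval₂Hom, MvPolynomial.eval₂_X] at hp ⊢
      exact hp.mul (hA _ _)
  have := h ((Matrix.charpoly.univ ℂ κ).coeff i)
  simp only [Matrix.charpoly.univ_coeff_eval₂Hom] at this
  exact this

theorem gs_charpoly_deriv {A : E → Matrix κ κ ℂ} (hA : GSM A y₀) (k : ℕ) (μ₀ : ℂ) :
    GS (fun q : E × ℂ => ((Polynomial.derivative^[k]) (A q.1).charpoly).eval q.2) (y₀, μ₀) := by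
  have h : ∀ q : E × ℂ, ((Polynomial.derivative^[k]) (A q.1).charpoly).eval q.2
      = ∑ i ∈ range (Fintype.card κ + 1),
        ((i + k).descFactorial k * (A q.1).charpoly.coeff (i + k)) * q.2 ^ i := fun q => by
    rw [Polynomial.eval_eq_sum_range' (n := Fintype.card κ + 1)]
    · simp [Polynomial.coeff_iterate_derivative]
    · have := Polynomial.natDegree_iterate_derivative (A q.1).charpoly k
      rw [Matrix.charpoly_natDegree_eq_dim] at this
      omega
  simp only [h]
  refine GS.sum fun i _ => ((GS.const _).mul ?_).mul ?_
  · have hlim : Tendsto (fun q : E × ℂ => q.1) (𝓝 (y₀, μ₀)) (𝓝 y₀) :=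
      continuous_fst.tendsto (y₀, μ₀)
    filter_upwards [hlim.eventually (gs_charpoly_coeff hA (i + k))] with q hq
    exact hq.comp q contDiffAt_fst
  · exact of_forall fun q => contDiffAt_snd.pow i

theorem exists_eigenvalue_section [CompleteSpace E] {A : E → Matrix κ κ ℂ} (hA : GSM A y₀)
    (h0 : (A y₀).det = 0) {ε : ℝ} (hε : 0 < ε)
    (hcc : ∀ᶠ y in 𝓝 y₀, ∀ μ : ℂ, ‖μ‖ < ε → (A y - scalar κ μ).det = 0 →
      algMult (A y) μ = algMult (A y₀) 0 ∧ geomMult (A y) μ = geomMult (A y₀) 0) :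
    ∃ l : E → ℂ, GS l y₀ ∧ l y₀ = 0 ∧ ∀ᶠ y in 𝓝 y₀, (A y - scalar κ (l y)).det = 0 ∧
      geomMult (A y) (l y) = geomMult (A y₀) 0 := by
  set k := algMult (A y₀) 0 with hk
  have hne : (A y₀).charpoly ≠ 0 := (Matrix.charpoly_monic _).ne_zero
  have hroot : (A y₀).charpoly.IsRoot 0 := (det_sub_scalar _ _).1 (by simpa using h0)
  have hkpos : 0 < k := (Polynomial.rootMultiplicity_pos hne).2 hroot
  set f : E × ℂ → ℂ := fun q => ((Polynomial.derivative^[k - 1]) (A q.1).charpoly).eval q.2 with hf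
  have hd : HasDerivAt (fun μ => f (y₀, μ))
      (((Polynomial.derivative^[k]) (A y₀).charpoly).eval 0) 0 := by
    have := ((Polynomial.derivative^[k - 1]) (A y₀).charpoly).hasDerivAt 0
    rwa [← Function.iterate_succ_apply' Polynomial.derivative, Nat.succ_eq_add_one,
      Nat.sub_add_cancel hkpos] at this
  obtain ⟨l, hl, hl0, huniq⟩ := exists_implicit (f := f) (gs_charpoly_deriv hA (k - 1) 0)
    (Polynomial.isRoot_iterate_derivative_of_lt_rootMultiplicity (by
      change k - 1 < k; omega)) hd (by
      change ((Polynomial.derivative^[(A y₀).charpoly.rootMultiplicity 0]) _).eval 0 ≠ 0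
      rw [Polynomial.eval_iterate_derivative_rootMultiplicity, nsmul_eq_mul]
      exact mul_ne_zero (Nat.cast_ne_zero.2 (Nat.factorial_ne_zero _))
        (Polynomial.eval_divByMonic_pow_rootMultiplicity_ne_zero _ hne))
  refine ⟨l, hl, hl0, ?_⟩
  rw [nhds_prod_eq] at huniq
  obtain ⟨P1, hP1, P2, hP2, hP⟩ := eventually_prod_iff.1 huniq
  obtain ⟨δ, hδ, hball⟩ := Metric.eventually_nhds_iff.1 hP2
  filter_upwards [hP1, hcc, exists_small_eigenvalue hA h0 (lt_min hδ hε)] with y h1 h2 ⟨μ, hμ, hμ0⟩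
  obtain ⟨h3, h4⟩ := h2 μ (hμ.trans_le (min_le_right _ _)) hμ0
  have h5 : l y = μ := hP h1 (hball (by simpa using hμ.trans_le (min_le_left _ _)))
    (Polynomial.isRoot_iterate_derivative_of_lt_rootMultiplicity (by
      change k - 1 < algMult (A y) μ; omega))
  rw [h5]
  exact ⟨hμ0, h4⟩

end Germs

/-! ### Smooth block diagonalization of a matrix function of principal type -/
section BlockDiag
variable {E : Type*} [NormedAddCommGroup E] [NormedSpace ℝ E] {y₀ : E}
variable {ι α β : Type*} [Fintype ι] [DecidableEq ι] [Fintype α] [DecidableEq α] [Fintype β]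
  [DecidableEq β]

/-- The map `ker p → Coker p` induced by `q` is injective. -/
def PT (p q : Matrix ι ι ℂ) : Prop :=
  ∀ u : ι → ℂ, p.mulVec u = 0 → (∃ w, q.mulVec u = p.mulVec w) → u = 0

theorem mulVec_eq_zero_of_det {V : Matrix ι ι ℂ} (hV : V.det ≠ 0) {u : ι → ℂ}
    (h : V.mulVec u = 0) : u = 0 := by
  by_contra hu
  exact hV (Matrix.exists_mulVec_eq_zero_iff.1 ⟨u, hu, h⟩)

theorem PT.conj {p q V U : Matrix ι ι ℂ} (h : PT p q) (hV : V.det ≠ 0) (hU : U.det ≠ 0) :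
    PT (V * p * U) (V * q * U) := by
  rintro u hu ⟨w, hw⟩
  have inj : ∀ a b : ι → ℂ, V.mulVec a = V.mulVec b → a = b := fun a b hab => by
    rw [← sub_eq_zero, ← Matrix.mulVec_sub] at hab
    exact sub_eq_zero.1 (mulVec_eq_zero_of_det hV hab)
  refine mulVec_eq_zero_of_det hU (h _ (inj _ _ ?_) ⟨U.mulVec w, inj _ _ ?_⟩)
  · simpa only [Matrix.mulVec_mulVec, Matrix.mul_assoc, Matrix.mulVec_zero] using hu
  · simpa only [Matrix.mulVec_mulVec, Matrix.mul_assoc] using hw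

theorem PT.submatrix {p q : Matrix ι ι ℂ} (h : PT p q) (g : α ≃ ι) :
    PT (p.submatrix g g) (q.submatrix g g) := by
  rintro u hu ⟨w, hw⟩
  rw [Matrix.submatrix_mulVec_equiv] at hu
  rw [Matrix.submatrix_mulVec_equiv, Matrix.submatrix_mulVec_equiv] at hw
  have h1 := h (u ∘ g.symm) (by
    funext i; simpa using congrFun hu (g.symm i)) ⟨w ∘ g.symm, by
    funext i; simpa using congrFun hw (g.symm i)⟩
  funext i
  simpa using congrFun h1 (g i)

theorem PT.block {q : Matrix (α ⊕ β) (α ⊕ β) ℂ} (h : PT (fromBlocks 0 0 0 1) q) {x : α → ℂ}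
    (hx : q.toBlocks₁₁.mulVec x = 0) : x = 0 := by
  have h1 := h (Sum.elim x 0) (by simp [Matrix.fromBlocks_mulVec])
    ⟨Sum.elim 0 (q.toBlocks₂₁.mulVec x), by
      rw [← Matrix.fromBlocks_toBlocks q]
      simp [Matrix.fromBlocks_mulVec, hx]⟩
  funext i
  simpa using congrFun h1 (Sum.inl i)

theorem schur_eq_zero {A : Matrix α α ℂ} {B : Matrix α β ℂ} {C : Matrix β α ℂ} {D : Matrix β β ℂ}
    (hD : D.det ≠ 0) (hr : finrank ℂ (ker
      (toLin' (fromBlocks A B C D))) = Fintype.card α) : A - B * D⁻¹ * C = 0 := by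
  have hDu : IsUnit D.det := isUnit_iff_ne_zero.2 hD
  set Z := ker (toLin' (fromBlocks A B C D)) with hZ
  have hmem : ∀ u ∈ Z, A.mulVec (u ∘ Sum.inl) + B.mulVec (u ∘ Sum.inr) = 0 ∧
      C.mulVec (u ∘ Sum.inl) + D.mulVec (u ∘ Sum.inr) = 0 := fun u hu => by
    have h : (fromBlocks A B C D).mulVec u = 0 := by simpa [hZ] using hu
    rw [Matrix.fromBlocks_mulVec] at h
    exact ⟨funext fun i => congrFun h (Sum.inl i), funext fun i => congrFun h (Sum.inr i)⟩
  have hinr : ∀ u ∈ Z, u ∘ Sum.inr = -(D⁻¹ * C).mulVec (u ∘ Sum.inl) := fun u hu => by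
    have h := congrArg D⁻¹.mulVec (eq_neg_of_add_eq_zero_right (hmem u hu).2)
    rwa [Matrix.mulVec_mulVec, Matrix.nonsing_inv_mul _ hDu, Matrix.one_mulVec, Matrix.mulVec_neg,
      Matrix.mulVec_mulVec] at h
  set T : Z →ₗ[ℂ] (α → ℂ) := (LinearMap.funLeft ℂ ℂ Sum.inl).comp Z.subtype with hT
  have hTa : ∀ u : Z, T u = (u : α ⊕ β → ℂ) ∘ Sum.inl := fun u => rfl
  have hinj : Function.Injective T := by
    rw [← LinearMap.ker_eq_bot, LinearMap.ker_eq_bot']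
    intro u hu
    rw [hTa] at hu
    have h2 := hinr u u.2
    rw [hu, Matrix.mulVec_zero, neg_zero] at h2
    ext i
    rcases i with i | i
    · exact congrFun hu i
    · exact congrFun h2 i
  have hsurj := (LinearMap.injective_iff_surjective_of_finrank_eq_finrank (by
    rw [hr, Module.finrank_fintype_fun_eq_card])).1 hinj
  ext i j
  obtain ⟨u, hu⟩ := hsurj (Pi.single j 1)
  have h1 := (hmem u u.2).1
  rw [hinr u u.2, ← hTa, hu, Matrix.mulVec_neg, Matrix.mulVec_mulVec, ← Matrix.mul_assoc,
    ← sub_eq_add_neg, ← Matrix.sub_mulVec] at h1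
  simpa using congrFun h1 i

theorem schur_algebra {l : ℂ} {A e : Matrix α α ℂ} {B b : Matrix α β ℂ} {C c : Matrix β α ℂ}
    {D d : Matrix β β ℂ} (hD : D.det ≠ 0) (hX : (D - l • d).det ≠ 0)
    (h : (A - l • e) - (B - l • b) * (D - l • d)⁻¹ * (C - l • c) = 0) :
    A - B * D⁻¹ * C = l • (e + B * ((D - l • d)⁻¹ * d * D⁻¹) * C - b * (D - l • d)⁻¹ * C
      - B * (D - l • d)⁻¹ * c + l • (b * (D - l • d)⁻¹ * c)) := by
  set X := (D - l • d)⁻¹ with hXd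
  have hres : X - D⁻¹ = l • (X * d * D⁻¹) := by
    have h1 : X * (D - l • d) = 1 := Matrix.nonsing_inv_mul _ (isUnit_iff_ne_zero.2 hX)
    have h2 : D * D⁻¹ = 1 := Matrix.mul_nonsing_inv _ (isUnit_iff_ne_zero.2 hD)
    calc X - D⁻¹ = X * (D * D⁻¹) - (X * (D - l • d)) * D⁻¹ := by rw [h1, h2]; simp
      _ = l • (X * d * D⁻¹) := by
        simp only [Matrix.mul_sub, Matrix.sub_mul, Matrix.mul_assoc, Matrix.mul_smul,
          Matrix.smul_mul]
        abel
  have hA : A = l • e + (B - l • b) * X * (C - l • c) := by rw [sub_sub, sub_eq_zero] at h; exact h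
  have hB : B * X * C - B * D⁻¹ * C = l • (B * (X * d * D⁻¹) * C) := by
    rw [← Matrix.sub_mul, ← Matrix.mul_sub, hres, Matrix.mul_smul, Matrix.smul_mul]
  calc A - B * D⁻¹ * C = l • e + (B * X * C - B * D⁻¹ * C) - l • (b * X * C) - l • (B * X * c)
        + l • l • (b * X * c) := by
        rw [hA]
        simp only [Matrix.mul_sub, Matrix.sub_mul, Matrix.mul_smul, Matrix.smul_mul, smul_sub]
        abel
    _ = _ := by rw [hB]; simp only [smul_add, smul_sub]

theorem block_diag_identity {l : ℂ} {A e : Matrix α α ℂ} {B : Matrix α β ℂ}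
    {C : Matrix β α ℂ} {D : Matrix β β ℂ} (hD : D.det ≠ 0) (he : e.det ≠ 0)
    (hs : A - B * D⁻¹ * C = l • e) :
    fromBlocks e⁻¹ (-(e⁻¹ * (B * D⁻¹))) 0 1 * fromBlocks A B C D *
      fromBlocks 1 0 (-(D⁻¹ * C)) 1 = fromBlocks (scalar α l) 0 0 D := by
  have h1 : D⁻¹ * D = 1 := Matrix.nonsing_inv_mul _ (isUnit_iff_ne_zero.2 hD)
  have h2 : D * D⁻¹ = 1 := Matrix.mul_nonsing_inv _ (isUnit_iff_ne_zero.2 hD)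
  have h3 : e⁻¹ * e = 1 := Matrix.nonsing_inv_mul _ (isUnit_iff_ne_zero.2 he)
  have h4 : e⁻¹ * B + -(e⁻¹ * (B * D⁻¹)) * D = 0 := by
    rw [Matrix.neg_mul, Matrix.mul_assoc, Matrix.mul_assoc, h1, Matrix.mul_one, add_neg_cancel]
  have h5 : e⁻¹ * A + -(e⁻¹ * (B * D⁻¹)) * C = scalar α l := by
    rw [Matrix.neg_mul, Matrix.mul_assoc, ← sub_eq_add_neg, ← Matrix.mul_sub, hs,
      Matrix.mul_smul, h3, Matrix.smul_one_eq_diagonal]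
    rfl
  rw [Matrix.fromBlocks_multiply, Matrix.fromBlocks_multiply, h4, h5]
  simp only [Matrix.zero_mul, Matrix.one_mul, Matrix.mul_one, Matrix.mul_zero, zero_add, add_zero,
    Matrix.mul_neg, ← Matrix.mul_assoc, h2, Matrix.one_mul, add_neg_cancel,
    neg_zero]

theorem exists_block_diag [CompleteSpace E] [Nonempty α] {p : E → Matrix (α ⊕ β) (α ⊕ β) ℂ}
    (hp : GSM p y₀) (hp0 : p y₀ = fromBlocks 0 0 0 1) {e₀ : Matrix (α ⊕ β) (α ⊕ β) ℂ}
    {l : E → ℂ} (hl : GS l y₀) (hl0 : l y₀ = 0)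
    (hker : ∀ᶠ y in 𝓝 y₀, finrank ℂ (ker (toLin' (p y - l y • e₀)))
      = Fintype.card α) {v : E} (hpt : PT (p y₀) (dM v p y₀)) :
    ∃ a b : E → Matrix (α ⊕ β) (α ⊕ β) ℂ, ∃ r : E → Matrix β β ℂ, GSM a y₀ ∧ GSM b y₀ ∧ GSM r y₀ ∧
      (a y₀).det ≠ 0 ∧ (b y₀).det ≠ 0 ∧ (r y₀).det ≠ 0 ∧
      ∀ᶠ y in 𝓝 y₀, a y * p y * b y = fromBlocks (scalar α (l y)) 0 0 (r y) := by
  set A := fun y => (p y).toBlocks₁₁ with hA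
  set B := fun y => (p y).toBlocks₁₂ with hB
  set C := fun y => (p y).toBlocks₂₁ with hC
  set D := fun y => (p y).toBlocks₂₂ with hD
  have hAs : GSM A y₀ := fun i j => hp _ _
  have hBs : GSM B y₀ := fun i j => hp _ _
  have hCs : GSM C y₀ := fun i j => hp _ _
  have hDs : GSM D y₀ := fun i j => hp _ _
  have hB0 : B y₀ = 0 := by simp [hB, hp0]
  have hC0 : C y₀ = 0 := by simp [hC, hp0]
  have hD0 : D y₀ = 1 := by simp [hD, hp0]
  set e := e₀.toBlocks₁₁ with he
  set b := e₀.toBlocks₁₂ with hb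
  set c := e₀.toBlocks₂₁ with hc
  set d := e₀.toBlocks₂₂ with hd
  have hXs0 : GSM (fun y => D y - l y • d) y₀ := hDs.sub (GSM.smul hl (GSM.const d))
  have hX0 : (D y₀ - l y₀ • d).det ≠ 0 := by simp [hD0, hl0]
  have hD0' : (D y₀).det ≠ 0 := by simp [hD0]
  set X := fun y => (D y - l y • d)⁻¹ with hX
  have hXs : GSM X y₀ := hXs0.inv hX0
  have hschur : ∀ᶠ y in 𝓝 y₀, (A y - l y • e) - (B y - l y • b) * X y * (C y - l y • c) = 0 := by
    filter_upwards [hker, hXs0.det_ne hX0] with y hy hy2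
    have h1 : fromBlocks (A y - l y • e) (B y - l y • b) (C y - l y • c) (D y - l y • d)
        = p y - l y • e₀ := by
      rw [← Matrix.fromBlocks_toBlocks (p y - l y • e₀)]
      rfl
    refine schur_eq_zero hy2 ?_
    rw [h1, hy]
  have hBl : GSM (fun y => B y - l y • b) y₀ := hBs.sub (GSM.smul hl (GSM.const b))
  have hCl : GSM (fun y => C y - l y • c) y₀ := hCs.sub (GSM.smul hl (GSM.const c))
  have hderiv : dM v A y₀ = fderiv ℝ l y₀ v • e := by
    rw [dM_congr (B := fun y => l y • e + ((B y - l y • b) * X y) * (C y - l y • c)) (by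
      filter_upwards [hschur] with y hy
      rw [sub_sub, sub_eq_zero] at hy; exact hy),
      dM_add (GSM.smul hl (GSM.const e)) ((hBl.mul hXs).mul hCl), dM_smul hl (GSM.const e), dM_const,
      dM_mul (hBl.mul hXs) hCl]
    simp [hB0, hC0, hl0]
  have hG : (dM v A y₀).det ≠ 0 := fun h => by
    obtain ⟨x, hx, hx0⟩ := Matrix.exists_mulVec_eq_zero_iff.2 h
    rw [hp0] at hpt
    exact hx (hpt.block hx0)
  have hedet : e.det ≠ 0 := fun h => hG (by rw [hderiv, Matrix.det_smul, h, mul_zero])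
  set ε := fun y => e + B y * (X y * d * (D y)⁻¹) * C y - b * X y * C y - B y * X y * c
    + l y • (b * X y * c) with hε
  have hDi : GSM (fun y => (D y)⁻¹) y₀ := hDs.inv hD0'
  have hεs : GSM ε y₀ := ((((GSM.const e).add ((hBs.mul ((hXs.mul (GSM.const d)).mul hDi)).mul
    hCs)).sub (((GSM.const b).mul hXs).mul hCs)).sub ((hBs.mul hXs).mul (GSM.const c))).add
    (GSM.smul hl (((GSM.const b).mul hXs).mul (GSM.const c)))
  have hε0 : ε y₀ = e := by simp [hε, hB0, hC0, hl0]
  have hεdet : (ε y₀).det ≠ 0 := by rwa [hε0]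
  have hεi : GSM (fun y => (ε y)⁻¹) y₀ := hεs.inv hεdet
  refine ⟨fun y => fromBlocks (ε y)⁻¹ (0 - (ε y)⁻¹ * (B y * (D y)⁻¹)) 0 1,
    fun y => fromBlocks 1 0 (0 - (D y)⁻¹ * C y) 1, D,
    GSM.fromBlocks hεi ((GSM.const 0).sub (hεi.mul (hBs.mul hDi))) (GSM.const 0) (GSM.const 1),
    GSM.fromBlocks (GSM.const 1) (GSM.const 0) ((GSM.const 0).sub (hDi.mul hCs)) (GSM.const 1), hDs,
    ?_, ?_, hD0', ?_⟩
  · rw [Matrix.det_fromBlocks_zero₂₁, Matrix.det_one, mul_one]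
    exact (Matrix.isUnit_nonsing_inv_det _ (isUnit_iff_ne_zero.2 hεdet)).ne_zero
  · rw [Matrix.det_fromBlocks_zero₁₂, Matrix.det_one, Matrix.det_one, mul_one]
    exact one_ne_zero
  · filter_upwards [hschur, hXs0.det_ne hX0, hDs.det_ne hD0', hεs.det_ne hεdet] with y h1 h2 h3 h4
    simp only [zero_sub]
    rw [← block_diag_identity h3 h4 (schur_algebra h3 h2 h1), Matrix.fromBlocks_toBlocks]

theorem finrank_ker_toLin' (T : Matrix ι ι ℂ) :
    finrank ℂ (ker (toLin' T)) = Fintype.card ι - T.rank := by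
  have h1 := LinearMap.finrank_range_add_finrank_ker (toLin' T)
  have h2 : finrank ℂ (LinearMap.range (toLin' T)) = T.rank := rfl
  rw [Module.finrank_fintype_fun_eq_card] at h1
  omega

theorem finrank_ker_toLin'_of_det {T : Matrix ι ι ℂ} (h : T.det ≠ 0) :
    finrank ℂ (ker (toLin' T)) = 0 := by
  rw [finrank_ker_toLin', Matrix.rank_of_isUnit _
    ((Matrix.isUnit_iff_isUnit_det _).2 (isUnit_iff_ne_zero.2 h)), Nat.sub_self]

theorem exists_normal_form {N K L : ℕ} (M : Matrix (Fin N) (Fin N) ℂ)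
    (hK : K = finrank ℂ (ker (toLin' M))) (g : Fin K ⊕ Fin L ≃ Fin N) :
    ∃ V U : Matrix (Fin N) (Fin N) ℂ, V.det ≠ 0 ∧ U.det ≠ 0 ∧
      (V * M * U).submatrix g g = fromBlocks 0 0 0 1 := by
  obtain ⟨V, U, e, hV, hU, h⟩ := M.exists_rank_normal_form
  have hN : K + L = N := by simpa using Fintype.card_congr g
  have hrank : M.rank = L := by
    have h1 := M.rank_le_width
    rw [finrank_ker_toLin', Fintype.card_fin] at hK
    omega
  set f : Fin K ⊕ Fin L ≃ Fin M.rank ⊕ Fin (Fintype.card (Fin N) - M.rank) :=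
    (Equiv.sumComm _ _).trans (Equiv.sumCongr (finCongr hrank.symm)
      (finCongr (by rw [Fintype.card_fin]; omega))) with hf
  set σ : Fin N ≃ Fin N := (g.symm.trans f).trans e.symm with hσ
  have hVd : V.det ≠ 0 := ((Matrix.isUnit_iff_isUnit_det _).1 hV).ne_zero
  have hUd : U.det ≠ 0 := ((Matrix.isUnit_iff_isUnit_det _).1 hU).ne_zero
  refine ⟨V.submatrix σ id, U.submatrix id σ, ?_, ?_, ?_⟩
  · rw [Matrix.det_permute]; simpa using hVd
  · rw [Matrix.det_permute']; simpa using hUd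
  · have h1 : V.submatrix σ id * M * U.submatrix id σ = (V * M * U).submatrix σ σ := by
      ext i j; simp [mul_apply]
    rw [h1, h]
    ext i j
    rcases i with i | i <;> rcases j with j | j <;>
      simp [hσ, hf, Matrix.one_apply]

/-- The block diagonal matrix with blocks `l Id` and `r`. -/
def diagBlock {N K L : ℕ} (g : Fin K ⊕ Fin L ≃ Fin N) (l : ℂ) (r : Matrix (Fin L) (Fin L) ℂ) :
    Matrix (Fin N) (Fin N) ℂ :=
  reindex g g (fromBlocks (scalar (Fin K) l) 0 0 r)

/-- Germs which bring `p` to block diagonal form near `y₀`. -/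
structure Diag {N K L : ℕ} (g : Fin K ⊕ Fin L ≃ Fin N) (p : E → Matrix (Fin N) (Fin N) ℂ) (y₀ : E)
    (a b : E → Matrix (Fin N) (Fin N) ℂ) (l : E → ℂ) (r : E → Matrix (Fin L) (Fin L) ℂ) :
    Prop where
  ha : GSM a y₀
  hb : GSM b y₀
  hl : GS l y₀
  hr : GSM r y₀
  ha0 : (a y₀).det ≠ 0
  hb0 : (b y₀).det ≠ 0
  hr0 : (r y₀).det ≠ 0
  diag : ∀ᶠ y in 𝓝 y₀, a y * p y * b y = diagBlock g (l y) (r y)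

theorem GSM.eventually {A : E → Matrix ι ι ℂ} (h : GSM A y₀) : ∀ᶠ y in 𝓝 y₀, GSM A y :=
  eventually_all.2 fun i => eventually_all.2 fun j => eventually_eventually_nhds.2 (h i j)

theorem Diag.eventually {N K L : ℕ} {g : Fin K ⊕ Fin L ≃ Fin N}
    {p a b : E → Matrix (Fin N) (Fin N) ℂ} {l : E → ℂ} {r : E → Matrix (Fin L) (Fin L) ℂ}
    (h : Diag g p y₀ a b l r) : ∀ᶠ y in 𝓝 y₀, Diag g p y a b l r := by
  filter_upwards [h.ha.eventually, h.hb.eventually, eventually_eventually_nhds.2 h.hl,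
    h.hr.eventually, h.ha.det_ne h.ha0, h.hb.det_ne h.hb0, h.hr.det_ne h.hr0,
    eventually_eventually_nhds.2 h.diag] with y h1 h2 h3 h4 h5 h6 h7 h8
  exact ⟨h1, h2, h3, h4, h5, h6, h7, h8⟩

theorem exists_diagonalizers [CompleteSpace E] {N K L : ℕ} {p : E → Matrix (Fin N) (Fin N) ℂ}
    (hp : GSM p y₀) (hK : K = finrank ℂ (ker (toLin' (p y₀))))
    (g : Fin K ⊕ Fin L ≃ Fin N) {v : E} (hpt : PT (p y₀) (dM v p y₀)) {ε : ℝ} (hε : 0 < ε)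
    (hcc : 0 < K → ∀ᶠ y in 𝓝 y₀, ∀ μ : ℂ, ‖μ‖ < ε → (p y - scalar (Fin N) μ).det = 0 →
      algMult (p y) μ = algMult (p y₀) 0 ∧ geomMult (p y) μ = geomMult (p y₀) 0) :
    ∃ a b : E → Matrix (Fin N) (Fin N) ℂ, ∃ (l : E → ℂ) (r : E → Matrix (Fin L) (Fin L) ℂ),
      Diag g p y₀ a b l r ∧
      (0 < K → l y₀ = 0 ∧ ∀ᶠ y in 𝓝 y₀, (p y - scalar (Fin N) (l y)).det = 0) := by
  obtain ⟨V, U, hV, hU, hVU⟩ := exists_normal_form (p y₀) hK g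
  set q : E → Matrix (Fin K ⊕ Fin L) (Fin K ⊕ Fin L) ℂ := fun y => (V * p y * U).submatrix g g
    with hq
  have hqs : GSM q y₀ := fun i j => (((GSM.const V).mul hp).mul (GSM.const U)) (g i) (g j)
  have hback : ∀ (a b : Matrix (Fin K ⊕ Fin L) (Fin K ⊕ Fin L) ℂ) (y : E),
      (a.submatrix g.symm g.symm * V) * p y * (U * b.submatrix g.symm g.symm)
        = reindex g g (a * q y * b) := fun a b y => by
    rw [reindex_apply, ← Matrix.submatrix_mul_equiv _ _ _ g.symm,
      ← Matrix.submatrix_mul_equiv _ _ _ g.symm]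
    simp only [hq, Matrix.submatrix_submatrix, Equiv.self_comp_symm, Matrix.submatrix_id_id,
      Matrix.mul_assoc]
  have hdet : ∀ a : Matrix (Fin K ⊕ Fin L) (Fin K ⊕ Fin L) ℂ,
      (a.submatrix g.symm g.symm).det = a.det := fun a => Matrix.det_submatrix_equiv_self _ _
  rcases Nat.eq_zero_or_pos K with hK0 | hK0
  · subst hK0
    have hr0 : (q y₀).toBlocks₂₂ = 1 := by rw [hq]; simp only [hVU]; simp
    refine ⟨fun _ => V, fun _ => U, fun _ => 1, fun y => (q y).toBlocks₂₂, ⟨GSM.const _,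
      GSM.const _, GS.const _, fun i j => hqs _ _, hV, hU, by simp [hr0], of_forall fun y => ?_⟩,
      fun h => absurd h (lt_irrefl _)⟩
    have := hback 1 1 y
    simp only [Matrix.submatrix_one_equiv, one_mul, mul_one] at this
    rw [this, diagBlock]
    congr 1
    ext i j
    rcases i with i | i
    · exact i.elim0
    · rcases j with j | j
      · exact j.elim0
      · rfl
  · have hdet0 : (p y₀).det = 0 := by
      by_contra h
      rw [finrank_ker_toLin'_of_det h] at hK
      omega
    obtain ⟨l, hl, hl0, hev⟩ := exists_eigenvalue_section hp hdet0 hε (hcc hK0)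
    haveI : Nonempty (Fin K) := ⟨⟨0, hK0⟩⟩
    have hgeom : geomMult (p y₀) 0 = K := by rw [hK, geomMult, map_zero, sub_zero]
    have hker : ∀ᶠ y in 𝓝 y₀, finrank ℂ (ker (toLin'
        (q y - l y • (V * U).submatrix g g))) = Fintype.card (Fin K) := by
      filter_upwards [hev] with y hy
      have h1 : q y - l y • (V * U).submatrix g g
          = (V * (p y - scalar (Fin N) (l y)) * U).submatrix g g := by
        have : scalar (Fin N) (l y) = l y • (1 : Matrix (Fin N) (Fin N) ℂ) :=
          (Matrix.smul_one_eq_diagonal _).symm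
        rw [this, Matrix.mul_sub, Matrix.sub_mul, Matrix.mul_smul, Matrix.mul_one, Matrix.smul_mul]
        rfl
      rw [h1, finrank_ker_toLin', Fintype.card_congr g, Matrix.rank_submatrix,
        Matrix.rank_mul_eq_left_of_isUnit_det _ _ (isUnit_iff_ne_zero.2 hU),
        Matrix.rank_mul_eq_right_of_isUnit_det _ _ (isUnit_iff_ne_zero.2 hV),
        ← finrank_ker_toLin', Fintype.card_fin, ← hgeom]
      exact hy.2
    have hpt' : PT (q y₀) (dM v q y₀) := by
      have h1 : dM v q y₀ = (V * dM v p y₀ * U).submatrix g g := by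
        have h2 : dM v (fun y => V * p y * U) y₀ = V * dM v p y₀ * U := by
          rw [dM_mul ((GSM.const V).mul hp) (GSM.const U), dM_mul (GSM.const V) hp, dM_const,
            dM_const]
          simp
        rw [← h2]; rfl
      rw [h1]
      exact (hpt.conj hV hU).submatrix g
    obtain ⟨a, b, r, ha, hb, hr, ha0, hb0, hr0, hab⟩ := exists_block_diag hqs hVU hl hl0 hker hpt'
    have hsub : ∀ {a : E → Matrix (Fin K ⊕ Fin L) (Fin K ⊕ Fin L) ℂ}, GSM a y₀ →
        GSM (fun y => (a y).submatrix g.symm g.symm) y₀ := fun ha i j => ha _ _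
    refine ⟨fun y => (a y).submatrix g.symm g.symm * V, fun y => U * (b y).submatrix g.symm g.symm,
      l, r, ⟨(hsub ha).mul (GSM.const V), (GSM.const U).mul (hsub hb), hl, hr, ?_, ?_, hr0, ?_⟩,
      fun _ => ⟨hl0, hev.mono fun y hy => hy.1⟩⟩
    · rw [Matrix.det_mul, hdet]; exact mul_ne_zero ha0 hV
    · rw [Matrix.det_mul, hdet]; exact mul_ne_zero hU hb0
    · filter_upwards [hab] with y hy
      rw [hback, hy, diagBlock]

/-- The eigenvalue in a diagonalization of a symbol of principal type is of principal type. -/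
theorem fderiv_ne_zero_of_diag {N K L : ℕ} (hK : 0 < K) {p a b : E → Matrix (Fin N) (Fin N) ℂ}
    {l : E → ℂ} {r : E → Matrix (Fin L) (Fin L) ℂ} (g : Fin K ⊕ Fin L ≃ Fin N) (hp : GSM p y₀)
    (ha : GSM a y₀) (hb : GSM b y₀) (hl : GS l y₀) (ha0 : (a y₀).det ≠ 0) (hb0 : (b y₀).det ≠ 0)
    (h : ∀ᶠ y in 𝓝 y₀, a y * p y * b y = reindex g g (fromBlocks (scalar (Fin K) (l y)) 0 0 (r y)))
    {v : E} (hpt : PT (p y₀) (dM v p y₀)) (hl0 : l y₀ = 0) : fderiv ℝ l y₀ v ≠ 0 := by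
  intro hd
  set i₀ : Fin N := g (Sum.inl ⟨0, hK⟩) with hi₀
  set x : Matrix (Fin N) (Fin 1) ℂ := Matrix.of fun i _ => if i = i₀ then 1 else 0 with hx
  have hcol : ∀ᶠ y in 𝓝 y₀, a y * (p y * (b y * x)) = l y • x := by
    filter_upwards [h] with y hy
    rw [← Matrix.mul_assoc, ← Matrix.mul_assoc, hy]
    ext i j
    simp only [hx, mul_apply, of_apply, Matrix.smul_apply, mul_ite, mul_one, mul_zero,
      Finset.sum_ite_eq', mem_univ, if_true, smul_eq_mul]
    obtain ⟨k, rfl⟩ := g.surjective i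
    rcases k with k | k <;> simp [hi₀, Matrix.diagonal_apply]
  have ha0' : ∀ u : Fin N → ℂ, (a y₀).mulVec u = 0 → u = 0 := fun u => mulVec_eq_zero_of_det ha0
  have hcolv : ∀ T : Matrix (Fin N) (Fin 1) ℂ, a y₀ * T = 0 → T = 0 := fun T hT => by
    have := ha0' (fun i => T i 0) (by
      funext i; simpa [mul_apply, Matrix.mulVec, dotProduct] using congrFun (congrFun hT i) 0)
    ext i j
    rw [Subsingleton.elim j 0]
    exact congrFun this i
  have hbx : GSM (fun y => b y * x) y₀ := hb.mul (GSM.const x)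
  have h0 : p y₀ * (b y₀ * x) = 0 := hcolv _ (by rw [hcol.self_of_nhds, hl0, zero_smul])
  have h1 := dM_congr hcol v
  rw [dM_mul ha (hp.mul hbx), dM_mul hp hbx, dM_smul hl (GSM.const x), dM_const, h0, hd] at h1
  simp only [Matrix.mul_zero, zero_smul, smul_zero, zero_add, add_zero] at h1
  have h2 := hcolv _ h1
  have h3 : (fun i => (b y₀ * x) i 0) = 0 := hpt _ (by
    funext i; simpa [mul_apply, Matrix.mulVec, dotProduct] using congrFun (congrFun h0 i) 0)
    ⟨fun i => -(dM v (fun y => b y * x) y₀) i 0, by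
      funext i
      have := congrFun (congrFun h2 i) 0
      simp only [Matrix.add_apply, mul_apply, Matrix.zero_apply] at this
      simp only [Matrix.mulVec, dotProduct, mul_apply, mul_neg, Finset.sum_neg_distrib]
      exact eq_neg_of_add_eq_zero_left this⟩
  have h4 := mulVec_eq_zero_of_det hb0 (u := fun i => x i 0) (by
    rw [← h3]; funext i; simp [mul_apply, Matrix.mulVec, dotProduct])
  have := congrFun h4 i₀
  simp [hx] at this

end BlockDiag

/-! ### Coordinates on the cotangent bundle -/
variable {n : ℕ} {M : Type*} [TopologicalSpace M] [ChartedSpace (Rn n) M]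
  [IsManifold 𝓘(ℝ, Rn n) ∞ M] {κ : OpenPartialHomeomorph M (Rn n)}

section Cot

/-- Membership in the maximal atlas. -/
abbrev IsChart (κ : OpenPartialHomeomorph M (Rn n)) : Prop :=
  κ ∈ IsManifold.maximalAtlas 𝓘(ℝ, Rn n) ∞ M

/-- The derivative of a chart. -/
def dchart (κ : OpenPartialHomeomorph M (Rn n)) (x : M) : Rn n →L[ℝ] Rn n :=
  mfderiv 𝓘(ℝ, Rn n) 𝓘(ℝ, Rn n) κ x

/-- The derivative of the inverse of a chart, at the image of `x`. -/
def dchartSymm (κ : OpenPartialHomeomorph M (Rn n)) (x : M) : Rn n →L[ℝ] Rn n :=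
  mfderiv 𝓘(ℝ, Rn n) 𝓘(ℝ, Rn n) κ.symm (κ x)

/-- A covector as a linear form on `ℝⁿ`. -/
def cotForm (w : Cotangent n M) : Rn n →L[ℝ] ℝ := w.2

/-- The coordinates of a covector in a chart. -/
def cotCoord (κ : OpenPartialHomeomorph M (Rn n)) (w : Cotangent n M) : Ph n :=
  (κ w.1, ∑ j, cotForm w (dchartSymm κ w.1 (eb j)) • eb j)

/-- The covector with given coordinates. -/
def cotPoint (κ : OpenPartialHomeomorph M (Rn n)) (z : Ph n) : Cotangent n M :=
  covector κ (κ.symm z.1) z.2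

theorem contMDiffAt_chart (hκ : IsChart κ) {x : M}
    (hx : x ∈ κ.source) : ContMDiffAt 𝓘(ℝ, Rn n) 𝓘(ℝ, Rn n) ∞ κ x :=
  (contMDiffOn_of_mem_maximalAtlas hκ).contMDiffAt (κ.open_source.mem_nhds hx)

theorem contMDiffAt_chart_symm (hκ : IsChart κ) {z : Rn n}
    (hz : z ∈ κ.target) : ContMDiffAt 𝓘(ℝ, Rn n) 𝓘(ℝ, Rn n) ∞ κ.symm z :=
  (contMDiffOn_symm_of_mem_maximalAtlas hκ).contMDiffAt (κ.open_target.mem_nhds hz)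

theorem dchart_dchartSymm (hκ : IsChart κ) {x : M}
    (hx : x ∈ κ.source) (v : Rn n) : dchart κ x (dchartSymm κ x v) = v := by
  have h1 : MDifferentiableAt 𝓘(ℝ, Rn n) 𝓘(ℝ, Rn n) κ (κ.symm (κ x)) := by
    rw [κ.left_inv hx]; exact (contMDiffAt_chart hκ hx).mdifferentiableAt (by simp)
  have h2 := (contMDiffAt_chart_symm hκ (κ.map_source hx)).mdifferentiableAt (n := ∞) (by simp)
  have h3 := mfderiv_comp (κ x) h1 h2
  have h4 : κ ∘ κ.symm =ᶠ[𝓝 (κ x)] id := κ.eventually_right_inverse (κ.map_source hx)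
  rw [h4.mfderiv_eq, mfderiv_id, κ.left_inv hx] at h3
  exact (DFunLike.congr_fun h3 v).symm

theorem dchartSymm_dchart (hκ : IsChart κ) {x : M}
    (hx : x ∈ κ.source) (v : Rn n) : dchartSymm κ x (dchart κ x v) = v := by
  have h1 := (contMDiffAt_chart hκ hx).mdifferentiableAt (n := ∞) (by simp)
  have h2 := (contMDiffAt_chart_symm hκ (κ.map_source hx)).mdifferentiableAt (n := ∞) (by simp)
  have h3 := mfderiv_comp x h2 h1
  have h4 : κ.symm ∘ κ =ᶠ[𝓝 x] id := κ.eventually_left_inverse hx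
  rw [h4.mfderiv_eq, mfderiv_id] at h3
  exact (DFunLike.congr_fun h3 v).symm

theorem cotForm_covector (x : M) (η v : Rn n) :
    cotForm (covector κ x η) v = inner ℝ η (dchart κ x v) := rfl

theorem cotCoord_covector (hκ : IsChart κ) {x : M}
    (hx : x ∈ κ.source) (η : Rn n) : cotCoord κ (covector κ x η) = (κ x, η) := by
  refine Prod.ext rfl ?_
  change ∑ j, inner ℝ η (dchart κ x (dchartSymm κ x (eb j))) • eb j = η
  simp only [dchart_dchartSymm hκ hx, eb, EuclideanSpace.inner_single_right, one_mul]
  exact sum_coord_smul_eb η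

theorem cotForm_injective {w w' : Cotangent n M} (h1 : w.1 = w'.1)
    (h2 : ∀ v, cotForm w v = cotForm w' v) : w = w' := by
  obtain ⟨x, f⟩ := w
  obtain ⟨x', f'⟩ := w'
  obtain rfl : x = x' := h1
  congr 1
  exact ContinuousLinearMap.ext h2

theorem covector_cotCoord (hκ : IsChart κ) {w : Cotangent n M}
    (hw : w.1 ∈ κ.source) : covector κ w.1 (cotCoord κ w).2 = w := by
  refine cotForm_injective rfl fun v => ?_
  rw [cotForm_covector, cotCoord]
  simp only [sum_inner, inner_smul_left, eb, EuclideanSpace.inner_single_left, map_one, one_mul]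
  conv_rhs => rw [← dchartSymm_dchart hκ hw v, ← sum_coord_smul_eb (dchart κ w.1 v)]
  simp only [map_sum, map_smul, smul_eq_mul, eb]
  exact sum_congr rfl fun j _ => mul_comm _ _

theorem cotPoint_cotCoord (hκ : IsChart κ) {w : Cotangent n M}
    (hw : w.1 ∈ κ.source) : cotPoint κ (cotCoord κ w) = w := by
  conv_rhs => rw [← covector_cotCoord hκ hw]
  change covector κ (κ.symm (κ w.1)) _ = _
  rw [κ.left_inv hw]

theorem cotCoord_cotPoint (hκ : IsChart κ) {z : Ph n}
    (hz : z.1 ∈ κ.target) : cotCoord κ (cotPoint κ z) = z := by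
  rw [cotPoint, cotCoord_covector hκ (κ.map_target hz), κ.right_inv hz]

theorem cotCoord_smul (w : Cotangent n M) (t : ℝ) :
    cotCoord κ ⟨w.1, t • w.2⟩ = ((cotCoord κ w).1, t • (cotCoord κ w).2) := by
  refine Prod.ext rfl ?_
  change ∑ j, (t * cotForm w (dchartSymm κ w.1 (eb j))) • eb j
    = t • ∑ j, cotForm w (dchartSymm κ w.1 (eb j)) • eb j
  simp only [Finset.smul_sum, smul_smul]

theorem cotCoord_snd_ne_zero (hκ : IsChart κ)
    {w : Cotangent n M} (hw : w.1 ∈ κ.source) : (cotCoord κ w).2 ≠ 0 ↔ w.2 ≠ 0 := by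
  rw [not_iff_not]
  constructor
  · intro h
    have h1 := covector_cotCoord hκ hw
    rw [h] at h1
    have h2 : ∀ v, cotForm w v = 0 := fun v => by rw [← h1, cotForm_covector, inner_zero_left]
    exact ContinuousLinearMap.ext h2
  · intro h
    have h2 : ∀ v, cotForm w v = 0 := fun v => by rw [cotForm, h]; rfl
    simp [cotCoord, h2]

theorem contMDiffAt_constField (hκ : IsChart κ) (v : Rn n) {x : M}
    (hx : x ∈ κ.source) : ContMDiffAt 𝓘(ℝ, Rn n) (𝓘(ℝ, Rn n).prod 𝓘(ℝ, Rn n)) ∞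
      (fun y : M => (⟨κ y, v⟩ : TangentBundle 𝓘(ℝ, Rn n) (Rn n))) x := by
  rw [Bundle.contMDiffAt_totalSpace]
  refine ⟨contMDiffAt_chart hκ hx, ?_⟩
  have : (fun y : M => ((trivializationAt (Rn n) (TangentSpace 𝓘(ℝ, Rn n)) (κ x))
      (⟨κ y, v⟩ : TangentBundle 𝓘(ℝ, Rn n) (Rn n))).2) = fun _ => v := by
    funext y
    simp [TangentBundle.trivializationAt_apply]
  exact this ▸ contMDiffAt_const

theorem contMDiffAt_dchartSymm (hκ : IsChart κ) (v : Rn n) {x : M}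
    (hx : x ∈ κ.source) : ContMDiffAt 𝓘(ℝ, Rn n) (𝓘(ℝ, Rn n).prod 𝓘(ℝ, Rn n)) ∞
      (fun y : M => (⟨y, dchartSymm κ y v⟩ : TangentBundle 𝓘(ℝ, Rn n) M)) x := by
  have h1 := (contMDiffOn_symm_of_mem_maximalAtlas hκ).contMDiffOn_tangentMapWithin
    (m := ∞) (by simp) κ.open_target.uniqueMDiffOn
  have hs : IsOpen (Bundle.TotalSpace.proj ⁻¹' κ.target : Set (TangentBundle 𝓘(ℝ, Rn n) (Rn n))) :=
    κ.open_target.preimage (FiberBundle.continuous_proj _ _)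
  have h2 := h1.contMDiffAt (x := (⟨κ x, v⟩ : TangentBundle 𝓘(ℝ, Rn n) (Rn n)))
    (hs.mem_nhds (κ.map_source hx))
  have h3 := h2.comp x (contMDiffAt_constField hκ v hx)
  refine h3.congr_of_eventuallyEq ?_
  filter_upwards [κ.open_source.mem_nhds hx] with y hy
  have e1 : mfderivWithin 𝓘(ℝ, Rn n) 𝓘(ℝ, Rn n) κ.symm κ.target (κ y)
      = mfderiv 𝓘(ℝ, Rn n) 𝓘(ℝ, Rn n) κ.symm (κ y) :=
    mfderivWithin_of_isOpen κ.open_target (κ.map_source hy)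
  simp only [Function.comp_apply, tangentMapWithin, e1]
  exact congrArg (fun b : M => (⟨b, dchartSymm κ y v⟩ : TangentBundle 𝓘(ℝ, Rn n) M))
    (κ.left_inv hy).symm

theorem contMDiffAt_cotForm (hκ : IsChart κ) (v : Rn n)
    {w : Cotangent n M} (hw : w.1 ∈ κ.source) : ContMDiffAt (cotModel n) 𝓘(ℝ, ℝ) ∞
      (fun w : Cotangent n M => cotForm w (dchartSymm κ w.1 v)) w := by
  have hπ : ContMDiffAt (cotModel n) 𝓘(ℝ, Rn n) ∞ (fun w : Cotangent n M => w.1) w :=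
    Bundle.contMDiffAt_proj _
  have h1 : ContMDiffAt (cotModel n) (𝓘(ℝ, Rn n).prod 𝓘(ℝ, Rn n)) ∞
      (fun w : Cotangent n M => (⟨w.1, dchartSymm κ w.1 v⟩ : TangentBundle 𝓘(ℝ, Rn n) M)) w :=
    (contMDiffAt_dchartSymm hκ v hw).comp w hπ
  have h2 := ContMDiffAt.clm_bundle_apply (F₁ := Rn n) (F₂ := ℝ)
    (E₁ := (TangentSpace 𝓘(ℝ, Rn n) : M → Type _)) (E₂ := Bundle.Trivial M ℝ) (n := ∞)
    (b := fun w : Cotangent n M => w.1) (ϕ := fun w => w.2)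
    (v := fun w => dchartSymm κ w.1 v) (x := w) (IM := cotModel n) contMDiffAt_id h1
  rw [Bundle.contMDiffAt_totalSpace] at h2
  exact h2.2

theorem contMDiffAt_cotCoord (hκ : IsChart κ) {w : Cotangent n M} (hw : w.1 ∈ κ.source) :
    ContMDiffAt (cotModel n) 𝓘(ℝ, Ph n) ∞ (cotCoord κ) w := by
  have hπ : ContMDiffAt (cotModel n) 𝓘(ℝ, Rn n) ∞ (fun w : Cotangent n M => w.1) w :=
    Bundle.contMDiffAt_proj _
  have h1 : ContMDiffAt (cotModel n) 𝓘(ℝ, Rn n) ∞ (fun w : Cotangent n M => κ w.1) w :=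
    (contMDiffAt_chart hκ hw).comp w hπ
  refine h1.prodMk_space (ContMDiffAt.sum fun j _ => ?_)
  exact (contMDiffAt_cotForm hκ (eb j) hw).smul contMDiffAt_const

theorem contMDiffAt_cotPoint (hκ : IsChart κ) {z : Ph n} (hz : z.1 ∈ κ.target) :
    ContMDiffAt 𝓘(ℝ, Ph n) (cotModel n) ∞ (cotPoint (M := M) κ) z := by
  have hfst : ContMDiffAt 𝓘(ℝ, Ph n) 𝓘(ℝ, Rn n) ∞ (fun z : Ph n => z.1) z :=
    contDiff_fst.contMDiff.contMDiffAt
  have hb : ContMDiffAt 𝓘(ℝ, Ph n) 𝓘(ℝ, Rn n) ∞ (fun z : Ph n => κ.symm z.1) z :=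
    (contMDiffAt_chart_symm hκ hz).comp z hfst
  refine (contMDiffAt_hom_bundle _).2 ⟨hb, ?_⟩
  have h1 : ContMDiffAt 𝓘(ℝ, Rn n) 𝓘(ℝ, Rn n →L[ℝ] Rn n) ∞
      (inTangentCoordinates 𝓘(ℝ, Rn n) 𝓘(ℝ, Rn n) id κ (mfderiv 𝓘(ℝ, Rn n) 𝓘(ℝ, Rn n) κ)
        (κ.symm z.1)) (κ.symm z.1) :=
    ContMDiffAt.mfderiv_const (contMDiffAt_chart hκ (κ.map_target hz)) (by simp)
  have h2 := h1.comp z hb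
  have h3 : ContMDiffAt 𝓘(ℝ, Ph n) 𝓘(ℝ, Rn n →L[ℝ] ℝ) ∞ (fun z : Ph n => innerSL ℝ z.2) z :=
    ((innerSL ℝ).contDiff.comp contDiff_snd).contMDiff.contMDiffAt
  refine (h3.clm_comp h2).congr_of_eventuallyEq (of_forall fun y => ?_)
  ext v
  simp only [Function.comp_apply, inTangentCoordinates, ContinuousLinearMap.inCoordinates,
    cotPoint, covector, TangentBundle.continuousLinearMapAt_model_space]
  have e : ∀ (a b : M) (c : ℝ), Bundle.Trivialization.continuousLinearMapAt ℝ
      (trivializationAt ℝ (Bundle.Trivial M ℝ) a) b c = c := fun a b c =>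
    DFunLike.congr_fun (Bundle.Trivial.continuousLinearMapAt_trivialization ℝ M ℝ b) c
  exact (e _ _ _).trans rfl

end Cot

/-! ### Charts around two points -/
section Charts

theorem mem_maximalAtlas_of_contMDiffOn {e : OpenPartialHomeomorph M (Rn n)}
    (h : ∀ x ∈ e.source, ContMDiffAt 𝓘(ℝ, Rn n) 𝓘(ℝ, Rn n) ∞ e x)
    (h' : ∀ z ∈ e.target, ContMDiffAt 𝓘(ℝ, Rn n) 𝓘(ℝ, Rn n) ∞ e.symm z) :
    IsChart e := by
  refine mem_maximalAtlas_iff.2 fun e' he' => ?_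
  have hm := IsManifold.subset_maximalAtlas (I := 𝓘(ℝ, Rn n)) (n := ∞) he'
  have k1 : ContDiffOn ℝ ∞ (e' ∘ e.symm) (e.symm ≫ₕ e').source := by
    rw [← contMDiffOn_iff_contDiffOn]
    intro z hz
    rw [OpenPartialHomeomorph.trans_source] at hz
    exact ((contMDiffAt_chart hm hz.2).comp z (h' z hz.1)).contMDiffWithinAt
  have k2 : ContDiffOn ℝ ∞ (e ∘ e'.symm) (e'.symm ≫ₕ e).source := by
    rw [← contMDiffOn_iff_contDiffOn]
    intro z hz
    rw [OpenPartialHomeomorph.trans_source] at hz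
    exact ((h _ hz.2).comp z (contMDiffAt_chart_symm hm hz.1)).contMDiffWithinAt
  have e1 : (e.symm ≫ₕ e').target = (e'.symm ≫ₕ e).source := by
    rw [← OpenPartialHomeomorph.symm_source, OpenPartialHomeomorph.trans_symm_eq_symm_trans_symm,
      OpenPartialHomeomorph.symm_symm]
  have e2 : (e'.symm ≫ₕ e).target = (e.symm ≫ₕ e').source := by
    rw [← OpenPartialHomeomorph.symm_source, OpenPartialHomeomorph.trans_symm_eq_symm_trans_symm,
      OpenPartialHomeomorph.symm_symm]
  constructor <;> refine mem_groupoid_of_pregroupoid.2 ⟨?_, ?_⟩ <;>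
    simp only [contDiffPregroupoid, contDiffGroupoid, modelWithCornersSelf_coe,
      modelWithCornersSelf_coe_symm, Function.comp_id, Function.id_comp, Set.preimage_id,
      Set.range_id, Set.inter_univ]
  · exact k1
  · rw [e1]; exact k2
  · exact k2
  · rw [e2]; exact k1

theorem exists_translated_chart {e : OpenPartialHomeomorph M (Rn n)} (he : IsChart e) (t : Rn n) :
    ∃ e', IsChart e' ∧ e'.source = e.source ∧ ∀ x, e' x = e x + t := by
  refine ⟨e.transHomeomorph (Homeomorph.addRight t), mem_maximalAtlas_of_contMDiffOn
    (fun x hx => ?_) fun z hz => ?_, rfl, fun x => rfl⟩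
  · exact ((contDiff_id.add contDiff_const).contMDiff.contMDiffAt (x := e x)).comp x
      (contMDiffAt_chart he hx)
  · have hs : ∀ y : Rn n, (Homeomorph.addRight t).symm y = y - t := fun y => by
      rw [sub_eq_add_neg]; rfl
    have hz' : z - t ∈ e.target := by rw [← hs]; exact hz
    refine (((contMDiffAt_chart_symm he hz').comp z
      ((contDiff_id.sub contDiff_const).contMDiff.contMDiffAt (x := z)))).congr_of_eventuallyEq
        (of_forall fun y => congrArg e.symm (hs y))

theorem exists_restricted_chart {e : OpenPartialHomeomorph M (Rn n)}
    (he : IsChart e) {s : Set M} (hs : IsOpen s) :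
    ∃ e', IsChart e' ∧ e'.source = e.source ∩ s ∧ (e' : M → Rn n) = e :=
  ⟨e.restr s, restr_mem_maximalAtlas _ he hs, by rw [e.restr_source, hs.interior_eq], rfl⟩

open Classical in
theorem exists_union_chart {e e' : OpenPartialHomeomorph M (Rn n)} (he : IsChart e)
    (he' : IsChart e') (Hs : Disjoint e.source e'.source)
    (Ht : Disjoint e.target e'.target) :
    ∃ f, IsChart f ∧ f.source = e.source ∪ e'.source ∧ ∀ x ∈ e.source, f =ᶠ[𝓝 x] e := by
  have c1 : ∀ x ∈ e.source, e.disjointUnion e' Hs Ht =ᶠ[𝓝 x] e := fun x hx => by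
    filter_upwards [e.open_source.mem_nhds hx] with y hy
    exact Set.piecewise_eq_of_mem _ _ _ hy
  have c2 : ∀ x ∈ e'.source, e.disjointUnion e' Hs Ht =ᶠ[𝓝 x] e' := fun x hx => by
    filter_upwards [e'.open_source.mem_nhds hx] with y hy
    exact Set.piecewise_eq_of_notMem _ _ _ (Hs.notMem_of_mem_right hy)
  have c3 : ∀ x ∈ e.target, (e.disjointUnion e' Hs Ht).symm =ᶠ[𝓝 x] e.symm := fun x hx => by
    filter_upwards [e.open_target.mem_nhds hx] with y hy
    exact Set.piecewise_eq_of_mem _ _ _ hy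
  have c4 : ∀ x ∈ e'.target, (e.disjointUnion e' Hs Ht).symm =ᶠ[𝓝 x] e'.symm := fun x hx => by
    filter_upwards [e'.open_target.mem_nhds hx] with y hy
    exact Set.piecewise_eq_of_notMem _ _ _ (Ht.notMem_of_mem_right hy)
  refine ⟨e.disjointUnion e' Hs Ht, mem_maximalAtlas_of_contMDiffOn ?_ ?_, rfl, c1⟩
  · rintro x (hx | hx)
    · exact (contMDiffAt_chart he hx).congr_of_eventuallyEq (c1 x hx)
    · exact (contMDiffAt_chart he' hx).congr_of_eventuallyEq (c2 x hx)
  · rintro z (hz | hz)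
    · exact (contMDiffAt_chart_symm he hz).congr_of_eventuallyEq (c3 z hz)
    · exact (contMDiffAt_chart_symm he' hz).congr_of_eventuallyEq (c4 z hz)

theorem exists_chart_avoiding {K : Set M} (hK : IsClosed K) {x : M} (hx : x ∉ K) :
    ∃ e : OpenPartialHomeomorph M (Rn n), IsChart e ∧ x ∈ e.source ∧ ∀ y ∈ e.source, y ∉ K := by
  obtain ⟨e, he, hs, -⟩ := exists_restricted_chart
    (IsManifold.chart_mem_maximalAtlas (I := 𝓘(ℝ, Rn n)) (n := ∞) x) hK.isOpen_compl
  refine ⟨e, he, ?_, fun y hy => ?_⟩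
  · rw [hs]; exact ⟨mem_chart_source _ _, hx⟩
  · rw [hs] at hy; exact hy.2

theorem exists_chart_pair_aux [T2Space M] [Nontrivial (Rn n)] {K : Set M} {x₁ x₂ : M} (h : x₁ ≠ x₂)
    {e₁ e₂ : OpenPartialHomeomorph M (Rn n)}
    (h₁ : IsChart e₁)
    (h₂ : IsChart e₂) (hx₁ : x₁ ∈ e₁.source)
    (hx₂ : x₂ ∈ e₂.source) (hK : ∀ y ∈ e₂.source, y ∉ K) :
    ∃ f, IsChart f ∧ x₁ ∈ f.source ∧ x₂ ∈ f.source ∧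
      ∀ x ∈ f.source, x ∈ K → x ∈ e₁.source ∧ f =ᶠ[𝓝 x] e₁ := by
  obtain ⟨v, hv⟩ := exists_ne (0 : Rn n)
  obtain ⟨e, he, hes, hev⟩ := exists_translated_chart h₂ (e₁ x₁ - e₂ x₂ + v)
  have hne : e₁ x₁ ≠ e x₂ := by
    rw [hev]; intro h; apply hv
    have : e₂ x₂ + (e₁ x₁ - e₂ x₂ + v) = e₁ x₁ + v := by abel
    rw [this] at h; exact left_eq_add.1 h
  obtain ⟨W₁, W₂, hW₁, hW₂, hxW₁, hxW₂, hW⟩ := t2_separation hne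
  obtain ⟨O₁, O₂, hO₁, hO₂, hxO₁, hxO₂, hO⟩ := t2_separation h
  obtain ⟨f₁, hf₁, hf₁s, hf₁e⟩ := exists_restricted_chart h₁
    (hO₁.inter (e₁.isOpen_inter_preimage hW₁))
  obtain ⟨f₂, hf₂, hf₂s, hf₂e⟩ := exists_restricted_chart he
    (hO₂.inter (e.isOpen_inter_preimage hW₂))
  have Hs : Disjoint f₁.source f₂.source := by
    rw [hf₁s, hf₂s]
    exact hO.mono (fun y hy => hy.2.1) fun y hy => hy.2.1
  have ht : ∀ (f g : OpenPartialHomeomorph M (Rn n)) (W : Set (Rn n)),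
      (f : M → Rn n) = g → (∀ y ∈ f.source, g y ∈ W) → f.target ⊆ W := fun f g W hfg hfW z hz => by
    have := hfW _ (f.map_target hz)
    rwa [← hfg, f.right_inv hz] at this
  have Ht : Disjoint f₁.target f₂.target := hW.mono
    (ht f₁ e₁ W₁ hf₁e fun y hy => by rw [hf₁s] at hy; exact hy.2.2.2)
    (ht f₂ e W₂ hf₂e fun y hy => by rw [hf₂s] at hy; exact hy.2.2.2)
  obtain ⟨f, hf, hfs, hfe⟩ := exists_union_chart hf₁ hf₂ Hs Ht
  refine ⟨f, hf, ?_, ?_, fun x hx hxK => ?_⟩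
  · rw [hfs, hf₁s]; exact Or.inl ⟨hx₁, hxO₁, hx₁, hxW₁⟩
  · rw [hfs, hf₂s, hes]; exact Or.inr ⟨hx₂, hxO₂, hx₂, hxW₂⟩
  · rw [hfs] at hx
    rcases hx with hx | hx
    · have := hfe x hx
      rw [hf₁e] at this
      rw [hf₁s] at hx
      exact ⟨hx.1, this⟩
    · rw [hf₂s, hes] at hx
      exact absurd hxK (hK x hx.1)

theorem exists_chart_pair [T2Space M] [Nontrivial (Rn n)]
    (hκ : IsChart κ) {K : Set M} (hK : IsClosed K)
    (hKs : K ⊆ κ.source) (x₁ x₂ : M) :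
    ∃ e, IsChart e ∧ x₁ ∈ e.source ∧ x₂ ∈ e.source ∧ ∀ x ∈ e.source, x ∈ K → e =ᶠ[𝓝 x] κ := by
  have key : ∀ x₁ x₂ : M, x₂ ∉ κ.source → ∃ e, IsChart e ∧ x₁ ∈ e.source ∧ x₂ ∈ e.source ∧
        ∀ x ∈ e.source, x ∈ K → e =ᶠ[𝓝 x] κ := fun x₁ x₂ hx₂ => by
    obtain ⟨e₂, he₂, hxe₂, hKe₂⟩ := exists_chart_avoiding (n := n) hK fun h => hx₂ (hKs h)
    by_cases h : x₁ = x₂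
    · exact ⟨e₂, he₂, h ▸ hxe₂, hxe₂, fun x hx hxK => absurd hxK (hKe₂ x hx)⟩
    by_cases hx₁ : x₁ ∈ κ.source
    · obtain ⟨f, hf, h1, h2, h3⟩ := exists_chart_pair_aux h hκ he₂ hx₁ hxe₂ hKe₂
      exact ⟨f, hf, h1, h2, fun x hx hxK => (h3 x hx hxK).2⟩
    · obtain ⟨e₁, he₁, hxe₁, hKe₁⟩ := exists_chart_avoiding (n := n) hK fun h => hx₁ (hKs h)
      obtain ⟨f, hf, h1, h2, h3⟩ := exists_chart_pair_aux h he₁ he₂ hxe₁ hxe₂ hKe₂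
      exact ⟨f, hf, h1, h2, fun x hx hxK => absurd hxK (hKe₁ x (h3 x hx hxK).1)⟩
  by_cases h₂ : x₂ ∈ κ.source
  · by_cases h₁ : x₁ ∈ κ.source
    · exact ⟨κ, hκ, h₁, h₂, fun x _ _ => EventuallyEq.rfl⟩
    · obtain ⟨e, he, h1, h2, h3⟩ := key x₂ x₁ h₁
      exact ⟨e, he, h2, h1, h3⟩
  · exact key x₁ x₂ h₂

end Charts

/-! ### Operators localized in a chart -/
section Weyl
open scoped SchwartzMap
variable {μ : ℝ} {a : Ph n → ℂ}

theorem weylOp_const (c : ℂ) (u : 𝓢(Rn n, ℂ)) (x : Rn n) :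
    weylOp (fun _ : Ph n => c) u x = c * u x := by
  conv_rhs => rw [← weylOp_one u x]
  simp only [weylOp, mul_one]
  rw [mul_left_comm, ← integral_const_mul c]
  refine congrArg _ (integral_congr_ae (of_forall fun ξ => ?_))
  simp only
  rw [← integral_const_mul c]
  exact integral_congr_ae (of_forall fun y => by simp only; ring)

theorem Good.add (h : Good a) {u v w : 𝓢(Rn n, ℂ)} (hw : ∀ y, w y = u y + v y) (x : Rn n) :
    weylOp a w x = weylOp a u x + weylOp a v x := by
  rw [weylOp_eq, weylOp_eq, weylOp_eq, ← mul_add, ← integral_add (h.int_xi u x) (h.int_xi v x)]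
  refine congrArg _ (integral_congr_ae (of_forall fun ξ => ?_))
  simp only [weylInner]
  rw [← integral_add (h.int_y u x ξ) (h.int_y v x ξ)]
  exact integral_congr_ae (of_forall fun y => by simp only [hw]; ring)

theorem weylOp_smul (a : Ph n → ℂ) (c : ℂ) {u w : 𝓢(Rn n, ℂ)} (hw : ∀ y, w y = c * u y)
    (x : Rn n) : weylOp a w x = c * weylOp a u x := by
  rw [weylOp_eq, weylOp_eq, mul_left_comm, ← integral_const_mul c]
  refine congrArg _ (integral_congr_ae (of_forall fun ξ => ?_))
  simp only [weylInner]
  rw [← integral_const_mul c]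
  exact integral_congr_ae (of_forall fun y => by simp only [hw]; ring)

theorem symOn_const (c : ℂ) : SymOn univ 0 (fun _ : Ph n => c) := fun N => ⟨‖c‖, by
  cases N with
  | zero => intro y _; simp
  | succ N =>
    refine ⟨fun y _ => by simp, fun i => ?_⟩
    have : dd ((frX n).dir i) (fun _ : Ph n => c) = fun _ => 0 := by funext y; simp [dd]
    rw [this]
    exact SB.zero.mono_weight fun _ _ => norm_nonneg c⟩

theorem isClassicalSymbol_const {m : ℝ} {c : ℂ} (h : m = 0 ∨ c = 0) :
    IsClassicalSymbol m (fun _ : Ph n => c) (fun j _ => if j = 0 then c else 0) := by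
  have hz : ∀ ν : ℝ, Sy ν (fun _ : Ph n => (0 : ℂ)) := fun ν => ⟨contDiffOn_const, SymOn.zero⟩
  rcases h with rfl | rfl
  · refine isClassicalSymbol_iff.2 ⟨contDiff_const, symOn_const c, fun j => ?_, fun K => ?_⟩
    · by_cases hj : j = 0
      · subst hj
        simpa using Hom.of_fst (n := n) (c := fun _ => c) contDiff_const
      · simp only [hj, if_false]; exact Hom.zero
    · by_cases hK : K = 0
      · subst hK
        simpa using Sy.of_symbol (n := n) contDiff_const (symOn_const c)
      · simpa [Nat.pos_of_ne_zero hK] using hz _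
  · refine isClassicalSymbol_iff.2 ⟨contDiff_const, SymOn.zero, fun j => ?_, fun K => ?_⟩
    · simpa using Hom.zero
    · simpa using hz _
end Weyl

section Cutoffs
open scoped SchwartzMap

/-- A cutoff function in the coordinates `κ`. -/
structure Cut (κ : OpenPartialHomeomorph M (Rn n)) where
  toFun : Rn n → ℂ
  smooth : ContDiff ℝ ∞ toFun
  compact : HasCompactSupport toFun
  supp : tsupport toFun ⊆ κ.target

instance : CoeFun (Cut κ) fun _ => Rn n → ℂ := ⟨Cut.toFun⟩

theorem Cut.isCut (g : Cut κ) : IsCut g := ⟨g.smooth, g.compact⟩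

/-- A cutoff function as a Schwartz function. -/
def Cut.schwartz (g : Cut κ) : 𝓢(Rn n, ℂ) := g.compact.toSchwartzMap g.smooth

theorem Cut.schwartz_apply (g : Cut κ) (z : Rn n) : g.schwartz z = g z := rfl

/-- The product of a cutoff function and a smooth function. -/
def Cut.mul (g : Cut κ) (f : Rn n → ℂ) (hf : ContDiff ℝ ∞ f) : Cut κ where
  toFun z := g z * f z
  smooth := g.smooth.mul hf
  compact := g.compact.mul_right
  supp := (tsupport_mul_subset_left).trans g.supp

theorem contDiff_of_tsupport {g : Rn n → ℂ} (h : ∀ z ∈ tsupport g, ContDiffAt ℝ ∞ g z) :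
    ContDiff ℝ ∞ g := by
  rw [contDiff_iff_contDiffAt]
  intro z
  by_cases hz : z ∈ tsupport g
  · exact h z hz
  · exact contDiffAt_const.congr_of_eventuallyEq (notMem_tsupport_iff_eventuallyEq.1 hz)

theorem contDiffAt_comp_symm (hκ : IsChart κ) {u : M → ℂ}
    (hu : u ∈ SmoothFun n M) {z : Rn n} (hz : z ∈ κ.target) :
    ContDiffAt ℝ ∞ (fun z => u (κ.symm z)) z :=
  ((hu (κ.symm z)).comp z (contMDiffAt_chart_symm hκ hz)).contDiffAt

/-- The product of a cutoff function and a smooth function on the manifold. -/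
def Cut.pull (g : Cut κ) (hκ : IsChart κ) (u : SmoothFun n M) : Cut κ where
  toFun z := g z * (u : M → ℂ) (κ.symm z)
  smooth := contDiff_of_tsupport fun z hz => g.smooth.contDiffAt.mul
    (contDiffAt_comp_symm hκ u.2 (g.supp (tsupport_mul_subset_left hz)))
  compact := g.compact.mul_right
  supp := (tsupport_mul_subset_left).trans g.supp

theorem Cut.pull_apply (g : Cut κ) (hκ : IsChart κ)
    (u : SmoothFun n M) (z : Rn n) : g.pull hκ u z = g z * (u : M → ℂ) (κ.symm z) := rfl

/-- A function in the coordinates `κ`, extended by zero to the manifold. -/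
def push (κ : OpenPartialHomeomorph M (Rn n)) (g : Rn n → ℂ) : M → ℂ :=
  κ.source.indicator fun x => g (κ x)

theorem push_of_mem {g : Rn n → ℂ} {x : M} (hx : x ∈ κ.source) : push κ g x = g (κ x) :=
  indicator_of_mem hx _

theorem push_of_notMem {g : Rn n → ℂ} {x : M} (hx : x ∉ κ.source) : push κ g x = 0 :=
  indicator_of_notMem hx _

theorem push_symm {g : Rn n → ℂ} {z : Rn n} (hz : z ∈ κ.target) : push κ g (κ.symm z) = g z := by
  rw [push_of_mem (κ.map_target hz), κ.right_inv hz]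

/-- The support of a cutoff function in the manifold. -/
def Cut.image (g : Cut κ) : Set M := κ.symm '' tsupport g

theorem Cut.isCompact_image (g : Cut κ) : IsCompact g.image :=
  g.compact.isCompact.image_of_continuousOn (κ.continuousOn_symm.mono g.supp)

theorem Cut.image_subset (g : Cut κ) : g.image ⊆ κ.source := by
  rintro _ ⟨z, hz, rfl⟩
  exact κ.map_target (g.supp hz)

theorem Cut.mem_image {g : Cut κ} {x : M} (hx : x ∈ κ.source) (h : g (κ x) ≠ 0) : x ∈ g.image :=
  ⟨κ x, subset_closure h, κ.left_inv hx⟩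

theorem Cut.tsupport_push [T2Space M] (g : Cut κ) : tsupport (push κ g) ⊆ g.image := by
  refine closure_minimal (fun x hx => ?_) g.isCompact_image.isClosed
  by_cases h : x ∈ κ.source
  · rw [Function.mem_support, push_of_mem h] at hx
    exact g.mem_image h hx
  · exact absurd (push_of_notMem h) hx

/-- A cutoff function as a test function on the manifold. -/
def Cut.test [T2Space M] (g : Cut κ) (hκ : IsChart κ) :
    TestFun n M :=
  ⟨push κ g, contMDiff_of_tsupport fun x hx => by
    have hs := g.image_subset (g.tsupport_push hx)
    refine (g.smooth.contMDiff.contMDiffAt.comp x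
      (contMDiffAt_chart hκ hs)).congr_of_eventuallyEq ?_
    filter_upwards [κ.open_source.mem_nhds hs] with y hy using push_of_mem hy,
    g.isCompact_image.of_isClosed_subset (isClosed_tsupport _) g.tsupport_push⟩

theorem Cut.test_apply [T2Space M] (g : Cut κ) (hκ : IsChart κ)
    (x : M) : (g.test hκ : M → ℂ) x = push κ g x := rfl

/-- A test function supported in the domain of `κ` as a cutoff function. -/
def testCut (hκ : IsChart κ) (φ : TestFun n M) (hφ : tsupport (φ : M → ℂ) ⊆ κ.source) : Cut κ :=
  have hK : IsCompact (κ '' tsupport (φ : M → ℂ)) :=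
    φ.2.2.isCompact.image_of_continuousOn (κ.continuousOn.mono hφ)
  have hs : tsupport (κ.target.indicator fun z => (φ : M → ℂ) (κ.symm z)) ⊆
      κ '' tsupport (φ : M → ℂ) := by
    refine closure_minimal (fun z hz => ?_) hK.isClosed
    by_cases h : z ∈ κ.target
    · rw [Function.mem_support, indicator_of_mem h] at hz
      exact ⟨κ.symm z, subset_closure hz, κ.right_inv h⟩
    · exact absurd (indicator_of_notMem h _) hz
  have ht : tsupport (κ.target.indicator fun z => (φ : M → ℂ) (κ.symm z)) ⊆ κ.target := by
    refine hs.trans ?_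
    rintro _ ⟨x, hx, rfl⟩
    exact κ.map_source (hφ hx)
  { toFun := κ.target.indicator fun z => (φ : M → ℂ) (κ.symm z)
    smooth := contDiff_of_tsupport fun z hz => (contDiffAt_comp_symm hκ φ.2.1 (ht hz)
      ).congr_of_eventuallyEq (by
        filter_upwards [κ.open_target.mem_nhds (ht hz)] with y hy using indicator_of_mem hy _)
    compact := hK.of_isClosed_subset (isClosed_tsupport _) hs
    supp := ht }

theorem testCut_apply (hκ : IsChart κ) (φ : TestFun n M)
    (hφ : tsupport (φ : M → ℂ) ⊆ κ.source) {z : Rn n} (hz : z ∈ κ.target) :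
    testCut hκ φ hφ z = (φ : M → ℂ) (κ.symm z) :=
  indicator_of_mem hz fun z => (φ : M → ℂ) (κ.symm z)

theorem testCut_chart (hκ : IsChart κ) (φ : TestFun n M)
    (hφ : tsupport (φ : M → ℂ) ⊆ κ.source) {x : M} (hx : x ∈ κ.source) :
    testCut hκ φ hφ (κ x) = (φ : M → ℂ) x := by
  rw [testCut_apply hκ φ hφ (κ.map_source hx), κ.left_inv hx]

variable [T2Space M] {m : ℝ} {q : Ph n → ℂ}

/-- The operator `g q^w g` in the coordinates `κ`, as an operator on the manifold. -/
def locOp (hκ : IsChart κ) (g : Cut κ) (hq : XC m q) : SmoothFun n M →ₗ[ℂ] SmoothFun n M where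
  toFun u := ⟨push κ fun z => g z * weylOp q (g.pull hκ u).schwartz z,
    ((g.mul _ (hq.contDiff_weylOp (g.pull hκ u).schwartz)).test hκ).2.1⟩
  map_add' u v := by
    apply Subtype.ext
    funext x
    by_cases hx : x ∈ κ.source
    · simp only [Submodule.coe_add, Pi.add_apply, push_of_mem hx]
      rw [← mul_add, hq.good.add (u := (g.pull hκ u).schwartz) (v := (g.pull hκ v).schwartz) fun y => by
        simp only [Cut.schwartz_apply, Cut.pull_apply, Submodule.coe_add, Pi.add_apply, mul_add]]
    · simp only [Submodule.coe_add, Pi.add_apply, push_of_notMem hx, add_zero]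
  map_smul' c u := by
    apply Subtype.ext
    funext x
    by_cases hx : x ∈ κ.source
    · simp only [Submodule.coe_smul, Pi.smul_apply, push_of_mem hx, RingHom.id_apply, smul_eq_mul]
      rw [weylOp_smul q c (u := (g.pull hκ u).schwartz) fun y => by
        simp only [Cut.schwartz_apply, Cut.pull_apply, Submodule.coe_smul, Pi.smul_apply,
          smul_eq_mul]; ring]
      ring
    · simp only [Submodule.coe_smul, Pi.smul_apply, push_of_notMem hx, RingHom.id_apply, smul_zero]

theorem locOp_apply (hκ : IsChart κ) (g : Cut κ) (hq : XC m q)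
    (u : SmoothFun n M) : (locOp hκ g hq u : M → ℂ) =
      push κ fun z => g z * weylOp q (g.pull hκ u).schwartz z := rfl

/-- The operator `c + g q^w g`. -/
def constAdd (hκ : IsChart κ) (g : Cut κ) (hq : XC m q) (c : ℂ) : ProperOp n M where
  toLin := c • LinearMap.id + locOp hκ g hq
  support_subset S hS := by
    refine ⟨S ∪ g.image, hS.union g.isCompact_image, fun u hu => ?_⟩
    refine closure_minimal (fun x hx => ?_) (hS.union g.isCompact_image).isClosed
    by_contra h
    rw [Set.mem_union, not_or] at h
    apply hx
    have h1 : (u : M → ℂ) x = 0 := image_eq_zero_of_notMem_tsupport fun h' => h.1 (hu h')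
    have h2 : push κ (fun z => g z * weylOp q (g.pull hκ u).schwartz z) x = 0 := by
      by_cases hs : x ∈ κ.source
      · rw [push_of_mem hs]
        by_contra h'
        exact h.2 (g.mem_image hs (left_ne_zero_of_mul h'))
      · exact push_of_notMem hs
    change c * (u : M → ℂ) x + push κ _ x = 0
    rw [h1, h2, mul_zero, add_zero]
  local_dependence S hS := by
    refine ⟨S ∪ g.image, hS.union g.isCompact_image, fun u hu x hx => ?_⟩
    have h0 : (g.pull hκ u).schwartz = 0 := by
      ext z
      change g z * (u : M → ℂ) (κ.symm z) = 0
      by_cases h : g z = 0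
      · rw [h, zero_mul]
      · rw [hu _ (Or.inr ⟨z, subset_closure h, rfl⟩), mul_zero]
    change c * (u : M → ℂ) x + push κ _ x = 0
    rw [hu x (Or.inl hx), mul_zero, zero_add, h0]
    have h1 : ∀ z, weylOp q (0 : 𝓢(Rn n, ℂ)) z = 0 := fun z => by
      rw [weylOp_smul q 0 (u := 0) fun y => by simp, zero_mul]
    by_cases hs : x ∈ κ.source
    · rw [push_of_mem hs, h1, mul_zero]
    · exact push_of_notMem hs

theorem constAdd_apply (hκ : IsChart κ) (g : Cut κ)
    (hq : XC m q) (c : ℂ) (u : SmoothFun n M) (x : M) :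
    ((constAdd hκ g hq c).toLin u : M → ℂ) x = c * (u : M → ℂ) x + (locOp hκ g hq u : M → ℂ) x :=
  rfl

end Cutoffs

/-! ### Compositions of systems in a chart -/
section Systems
open scoped SchwartzMap
variable {m m' : ℝ}

/-- The symbol of the operator `φ₁ c ψ₁ + φ₂ a^w ψ₂`. -/
def cutSym (φ₁ ψ₁ φ₂ ψ₂ : Rn n → ℂ) (c : ℂ) (a : Ph n → ℂ) (z : Ph n) : ℂ :=
  ∑ k : Fin 2, 1 * (![ampS φ₁ ψ₁ fun _ => c, ampS φ₂ ψ₂ a] k z)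

/-- The terms of the expansion of `cutSym`. -/
def cutSymT (φ₁ ψ₁ φ₂ ψ₂ : Rn n → ℂ) (c : ℂ) (b : ℕ → Ph n → ℂ) (l : ℕ) (z : Ph n) : ℂ :=
  ∑ k : Fin 2, 1 * (![ampT φ₁ ψ₁ fun j _ => if j = 0 then c else 0, ampT φ₂ ψ₂ b] k l z)

variable {φ₁ ψ₁ φ₂ ψ₂ : Rn n → ℂ} {c : ℂ} {a : Ph n → ℂ} {b : ℕ → Ph n → ℂ}

theorem cs_cutSym (h₁ : IsCut φ₁) (h₂ : IsCut ψ₁) (h₃ : IsCut φ₂) (h₄ : IsCut ψ₂)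
    (hm : m = 0 ∨ c = 0) (ha : IsClassicalSymbol m a b) :
    CS m (cutSym φ₁ ψ₁ φ₂ ψ₂ c a) (cutSymT φ₁ ψ₁ φ₂ ψ₂ c b) := by
  have k₁ := (isClassicalSymbol_const hm).ampS h₁ h₂
  have k₂ := ha.ampS h₃ h₄
  refine ⟨IsClassicalSymbol.lin Finset.univ (fun _ => 1) fun k _ => ?_, ?_⟩
  · fin_cases k
    exacts [k₁.1, k₂.1]
  · obtain ⟨⟨R, hR⟩, R', hR'⟩ := And.intro k₁.supp k₂.supp
    exact ⟨max R R', fun z hz => by simp [cutSym, hR z ((le_max_left _ _).trans_lt hz),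
      hR' z ((le_max_right _ _).trans_lt hz)]⟩

theorem weylOp_cutSym (h₁ : IsCut φ₁) (h₂ : IsCut ψ₁) (h₃ : IsCut φ₂) (h₄ : IsCut ψ₂)
    (ha : IsClassicalSymbol m a b) (u v : 𝓢(Rn n, ℂ)) (hv : ∀ y, v y = ψ₂ y * u y) (z : Rn n) :
    weylOp (cutSym φ₁ ψ₁ φ₂ ψ₂ c a) u z = φ₁ z * (c * (ψ₁ z * u z)) + φ₂ z * weylOp a v z := by
  have hc := isClassicalSymbol_const (n := n) (m := 0) (c := c) (Or.inl rfl)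
  have e := Good.lin Finset.univ (fun _ => 1) (a := ![ampS φ₁ ψ₁ fun _ => c, ampS φ₂ ψ₂ a])
    (fun k _ => by
      fin_cases k
      exacts [(hc.ampS h₁ h₂).xc.good, (ha.ampS h₃ h₄).xc.good]) u z
  refine e.trans ?_
  simp only [Fin.sum_univ_two, Matrix.cons_val_zero, Matrix.cons_val_one, one_mul]
  rw [weylOp_ampS h₁ h₂ hc.contDiff hc.symOn u ((h₂.compact.mul_right (f' := u)).toSchwartzMap
      (h₂.smooth.mul (u.smooth ⊤))) (fun y => rfl) z,
    weylOp_ampS h₃ h₄ ha.contDiff ha.symOn u v hv, weylOp_const]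
  rfl

theorem cutSymT_eq {z : Ph n} (h₁ : φ₁ =ᶠ[𝓝 z.1] fun _ => 1) (h₂ : ψ₁ =ᶠ[𝓝 z.1] fun _ => 1)
    (h₃ : φ₂ =ᶠ[𝓝 z.1] fun _ => 1) (h₄ : ψ₂ =ᶠ[𝓝 z.1] fun _ => 1) (l : ℕ) :
    cutSymT φ₁ ψ₁ φ₂ ψ₂ c b l z = (if l = 0 then c else 0) + b l z := by
  simp only [cutSymT, Fin.sum_univ_two, Matrix.cons_val_zero, Matrix.cons_val_one, one_mul,
    ampT_eq h₁ h₂, ampT_eq h₃ h₄]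

theorem good_comp {a' : Ph n → ℂ} {b' : ℕ → Ph n → ℂ} (h : CS m a b) (h' : CS m' a' b') :
    Good (comp a a') :=
  ⟨integrable_weyl_y (h.comp h').contDiff (h.comp h').symOn,
    fun u x => (oscRep_comp h.xc h'.xc).integrable_inner u x⟩

variable {ι : Type*} [Fintype ι] [DecidableEq ι]

/-- The symbol of the composition of two systems, with cutoffs on both sides. -/
def mcomp (G : Rn n → ℂ) (a a' : ι → ι → Ph n → ℂ) (i j : ι) : Ph n → ℂ :=
  ampS G G fun z => ∑ k, 1 * comp (a i k) (a' k j) z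

variable {G : Rn n → ℂ} {s s' : ι → ι → Ph n → ℂ} {t t' : MSeq n ι}

theorem isClassicalSymbol_mcomp (h : ∀ i j, CS m (s i j) (t i j))
    (h' : ∀ i j, CS m' (s' i j) (t' i j)) (i j : ι) :
    IsClassicalSymbol (m + m') (fun z => ∑ k, 1 * comp (s i k) (s' k j) z) (mstar t t' i j) := by
  have := IsClassicalSymbol.lin Finset.univ (fun _ => (1 : ℂ)) fun k _ => (h i k).comp (h' k j)
  simp only [one_mul] at this ⊢
  exact this

theorem cs_mcomp (hG : IsCut G) (h : ∀ i j, CS m (s i j) (t i j))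
    (h' : ∀ i j, CS m' (s' i j) (t' i j)) (i j : ι) :
    CS (m + m') (mcomp G s s' i j) (ampT G G (mstar t t' i j)) :=
  (isClassicalSymbol_mcomp h h' i j).ampS hG hG

theorem weylOp_mcomp (hG : IsCut G) (h : ∀ i j, CS m (s i j) (t i j))
    (h' : ∀ i j, CS m' (s' i j) (t' i j)) (i j : ι) (u v : 𝓢(Rn n, ℂ))
    (hv : ∀ y, v y = G y * u y) (w : ι → 𝓢(Rn n, ℂ)) (hw : ∀ k y, w k y = weylOp (s' k j) v y)
    (z : Rn n) : weylOp (mcomp G s s' i j) u z = G z * ∑ k, weylOp (s i k) (w k) z := by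
  have k := isClassicalSymbol_mcomp h h' i j
  rw [mcomp, weylOp_ampS hG hG k.contDiff k.symOn u v hv,
    Good.lin Finset.univ (fun _ => 1) fun k _ => good_comp (h i k) (h' k j)]
  refine congrArg _ (sum_congr rfl fun k _ => ?_)
  rw [one_mul, weylOp_comp (h i k).xc (h' k j).xc v (w k) (hw k)]

theorem star_congr_on {U : Set (Ph n)} (hU : IsOpen U) {a a' b b' : ℕ → Ph n → ℂ}
    (ha : ∀ l, EqOn (a l) (a' l) U) (hb : ∀ l, EqOn (b l) (b' l) U) (l : ℕ) :
    EqOn (star a b l) (star a' b' l) U := fun z hz =>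
  sum_congr rfl fun r _ => congrArg _ (sum_congr rfl fun j _ => moyal_congr hU (ha j) (hb _) r hz)

theorem mstar_congr_on {U : Set (Ph n)} (hU : IsOpen U) {a a' b b' : MSeq n ι}
    (ha : ∀ i j l, EqOn (a i j l) (a' i j l) U) (hb : ∀ i j l, EqOn (b i j l) (b' i j l) U)
    (i j : ι) (l : ℕ) : EqOn (mstar a b i j l) (mstar a' b' i j l) U := fun _ hz =>
  sum_congr rfl fun k _ => star_congr_on hU (ha i k) (hb k j) l hz

end Systems

/-! ### Localized operators are pseudodifferential operators -/
section Classical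
open scoped SchwartzMap
variable {e : OpenPartialHomeomorph M (Rn n)} {m : ℝ} {q : Ph n → ℂ}

open Classical in
/-- The function `g² f` on the cotangent bundle, for `f` in the coordinates `κ`. -/
def locSymb (κ : OpenPartialHomeomorph M (Rn n)) (g : Rn n → ℂ) (f : Ph n → ℂ)
    (w : Cotangent n M) : ℂ :=
  if w.1 ∈ κ.source then g (κ w.1) * g (κ w.1) * f (cotCoord κ w) else 0

theorem locSymb_of_mem {g : Rn n → ℂ} {f : Ph n → ℂ} {w : Cotangent n M} (h : w.1 ∈ κ.source) :
    locSymb κ g f w = g (κ w.1) * g (κ w.1) * f (cotCoord κ w) := if_pos h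

theorem locSymb_of_notMem {g : Rn n → ℂ} {f : Ph n → ℂ} {w : Cotangent n M}
    (h : w.1 ∉ κ.source) : locSymb κ g f w = 0 := if_neg h

theorem cut_transition {g : Cut κ} (he : ∀ x ∈ e.source, x ∈ g.image → e =ᶠ[𝓝 x] κ) {z : Rn n}
    (hz : g z ≠ 0) (hs : κ.symm z ∈ e.source) : e (κ.symm z) = z ∧ z ∈ e.target ∧
      e.symm z = κ.symm z ∧ z ∈ κ.target := by
  have hzt : z ∈ κ.target := g.supp (subset_closure hz)
  have h1 : e (κ.symm z) = z :=
    (he _ hs ⟨z, subset_closure hz, rfl⟩).self_of_nhds.trans (κ.right_inv hzt)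
  refine ⟨h1, h1 ▸ e.map_source hs, ?_, hzt⟩
  conv_lhs => rw [← h1]
  exact e.left_inv hs

variable [T2Space M]

theorem loc_push {g : Cut κ} (he : ∀ x ∈ e.source, x ∈ g.image → e =ᶠ[𝓝 x] κ) {φ : M → ℂ}
    (hφs : tsupport φ ⊆ e.source) (f : Rn n → ℂ) (z : Rn n) :
    e.target.indicator (fun z => φ (e.symm z) * push κ (fun z => g z * f z) (e.symm z)) z =
      g z * φ (κ.symm z) * f z := by
  have hs : ∀ x, φ x ≠ 0 → x ∈ e.source := fun x hx => hφs (subset_closure hx)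
  by_cases h : z ∈ e.target ∧ e.symm z ∈ κ.source ∧ g (κ (e.symm z)) ≠ 0
  · obtain ⟨h1, h2, h3⟩ := h
    have hk := he _ (e.map_target h1) (g.mem_image h2 h3)
    have h4 : κ (e.symm z) = z := hk.self_of_nhds.symm.trans (e.right_inv h1)
    rw [indicator_of_mem h1, push_of_mem h2, h4]
    have h5 : κ.symm z = e.symm z := by rw [← h4, κ.left_inv h2, h4]
    rw [h5]; ring
  · have h1 : g z * φ (κ.symm z) = 0 := by
      by_contra h'
      obtain ⟨k1, k2, k3, k4⟩ := cut_transition he (left_ne_zero_of_mul h')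
        (hs _ (right_ne_zero_of_mul h'))
      refine h ⟨k2, ?_, ?_⟩
      · rw [k3]; exact κ.map_target k4
      · rw [k3, κ.right_inv k4]; exact left_ne_zero_of_mul h'
    rw [h1, zero_mul]
    by_cases hz : z ∈ e.target
    · rw [indicator_of_mem hz]
      by_cases h2 : e.symm z ∈ κ.source
      · have h3 : g (κ (e.symm z)) = 0 := by
          by_contra h3; exact h ⟨hz, h2, h3⟩
        rw [push_of_mem h2, h3, zero_mul, mul_zero]
      · rw [push_of_notMem h2, mul_zero]
    · exact indicator_of_notMem hz _

theorem locallyWeyl_constAdd (hκ : IsChart κ) (g : Cut κ) {b : ℕ → Ph n → ℂ} (hq : CS m q b) (c : ℂ)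
    {R : Op n M} (hR : ∀ u x, (R u : M → ℂ) x = c * (u : M → ℂ) x +
      push κ (fun z => g z * weylOp q (g.pull hκ ⟨u, u.2.1⟩).schwartz z) x) (he : IsChart e)
    (heκ : ∀ x ∈ e.source, x ∈ g.image → e =ᶠ[𝓝 x] κ) {φ ψ : TestFun n M}
    (hφ : tsupport (φ : M → ℂ) ⊆ e.source) (hψ : tsupport (ψ : M → ℂ) ⊆ e.source) :
    LocallyWeyl R e he φ ψ hψ (cutSym (testCut he φ hφ) (testCut he ψ hψ)
      (g.pull hκ ⟨φ, φ.2.1⟩) (g.pull hκ ⟨ψ, ψ.2.1⟩) c q) := by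
  intro u z
  set v := liftCutoff e he ψ hψ u with hv
  rw [weylOp_cutSym (testCut he φ hφ).isCut (testCut he ψ hψ).isCut (g.pull hκ ⟨φ, φ.2.1⟩).isCut
    (g.pull hκ ⟨ψ, ψ.2.1⟩).isCut hq.1 u (g.pull hκ ⟨v, v.2.1⟩).schwartz fun y => by
      change g y * ((ψ : M → ℂ) (κ.symm y) * u (e (κ.symm y))) = g y * (ψ : M → ℂ) (κ.symm y) * u y
      by_cases h : g y * (ψ : M → ℂ) (κ.symm y) = 0
      · rw [← mul_assoc, h, zero_mul, zero_mul]
      · rw [(cut_transition heκ (left_ne_zero_of_mul h)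
          (hψ (subset_closure (right_ne_zero_of_mul h)))).1, mul_assoc]]
  have e3 := loc_push heκ hφ (weylOp q (g.pull hκ ⟨v, v.2.1⟩).schwartz) z
  rw [g.pull_apply, ← e3]
  by_cases hz : z ∈ e.target
  · simp only [indicator_of_mem hz, hR]
    rw [testCut_apply he φ hφ hz, mul_add]
    congr 2
    change c * ((ψ : M → ℂ) (e.symm z) * u (e (e.symm z))) = c * (testCut he ψ hψ z * u z)
    rw [testCut_apply he ψ hψ hz, e.right_inv hz]
  · simp only [indicator_of_notMem hz]
    rw [show testCut he φ hφ z = 0 from indicator_of_notMem hz fun z => (φ : M → ℂ) (e.symm z),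
      zero_mul, zero_add]

theorem locSymb_covector (hκ : IsChart κ) {g : Cut κ}
    (heκ : ∀ x ∈ e.source, x ∈ g.image → e =ᶠ[𝓝 x] κ) (φ ψ : M → ℂ)
    (hφ : tsupport φ ⊆ e.source) {x : M} (hx : x ∈ e.source) (η : Rn n) (f : Ph n → ℂ) :
    g (e x) * φ (κ.symm (e x)) * (g (e x) * ψ (κ.symm (e x))) * f (e x, η) =
      φ x * ψ x * locSymb κ g f (covector e x η) := by
  by_cases h : x ∈ κ.source ∧ g (κ x) ≠ 0
  · obtain ⟨h1, h2⟩ := h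
    have hk := heκ x hx (g.mem_image h1 h2)
    have h3 : covector e x η = covector κ x η := by rw [covector, covector, hk.mfderiv_eq]
    rw [h3, locSymb_of_mem (w := covector κ x η) h1, cotCoord_covector hκ h1, hk.self_of_nhds,
      κ.left_inv h1]
    change _ = _ * (g (κ x) * g (κ x) * _)
    ring
  · have h1 : g (e x) * φ (κ.symm (e x)) = 0 := by
      by_contra h'
      obtain ⟨k1, k2, k3, k4⟩ := cut_transition heκ (left_ne_zero_of_mul h')
        (hφ (subset_closure (right_ne_zero_of_mul h')))
      rw [e.left_inv hx] at k3
      refine h ⟨k3 ▸ κ.map_target k4, ?_⟩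
      rw [k3, κ.right_inv k4]; exact left_ne_zero_of_mul h'
    have h2 : locSymb κ g f (covector e x η) = 0 := by
      by_cases hs : x ∈ κ.source
      · rw [locSymb_of_mem (w := covector e x η) hs]
        change g (κ x) * _ * _ = 0
        rw [not_and, not_not] at h
        rw [h hs, zero_mul, zero_mul]
      · exact locSymb_of_notMem (w := covector e x η) hs
    rw [h1, h2, zero_mul, zero_mul, mul_zero]

theorem isClassicalPsiDO_of_local [Nontrivial (Rn n)] {ι : Type*} (hκ : IsChart κ) (g : Cut κ)
    {q : ι → ι → Ph n → ℂ} {b : ι → ι → ℕ → Ph n → ℂ} (hb : ∀ i j, CS m (q i j) (b i j))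
    {c : ι → ι → ℂ} (hc : ∀ i j, m = 0 ∨ c i j = 0) {R : Matrix ι ι (Op n M)}
    (hR : ∀ i j u x, (R i j u : M → ℂ) x = c i j * (u : M → ℂ) x +
      push κ (fun z => g z * weylOp (q i j) (g.pull hκ ⟨u, u.2.1⟩).schwartz z) x) :
    IsClassicalPsiDO m R fun w => Matrix.of fun i j => c i j + locSymb κ g (b i j 0) w := by
  intro x₁ x₂
  obtain ⟨e, he, h1, h2, heκ⟩ := exists_chart_pair hκ g.isCompact_image.isClosed
    g.image_subset x₁ x₂
  refine ⟨e, he, h1, h2, fun i j φ ψ hφ hψ => ⟨_, _, (cs_cutSym (testCut he φ hφ).isCut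
    (testCut he ψ hψ).isCut (g.pull hκ ⟨φ, φ.2.1⟩).isCut (g.pull hκ ⟨ψ, ψ.2.1⟩).isCut (hc i j)
    (hb i j).1).1, locallyWeyl_constAdd hκ g (hb i j) (c i j) (hR i j) he heκ hφ hψ,
    fun x hx η hη => ?_⟩⟩
  simp only [cutSymT, Fin.sum_univ_two, Matrix.cons_val_zero, Matrix.cons_val_one, one_mul, ampT_zero,
    if_true, of_apply, mul_add]
  rw [testCut_chart he φ hφ hx, testCut_chart he ψ hψ hx]
  exact congrArg _ (locSymb_covector hκ heκ φ ψ hφ hx η _)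

end Classical

/-! ### The localized composition `A P B` -/
section Composition
open scoped SchwartzMap
variable [T2Space M] {m : ℝ} {g G : Cut κ}

theorem Cut.eq_zero (g : Cut κ) {z : Rn n} (hz : z ∉ κ.target) : g z = 0 :=
  image_eq_zero_of_notMem_tsupport fun h => hz (g.supp h)

theorem Cut.test_supp (g : Cut κ) (hκ : IsChart κ) :
    tsupport (g.test hκ : M → ℂ) ⊆ κ.source := g.tsupport_push.trans g.image_subset

/-- The function `g u` in the coordinates `κ` as a test function on the manifold. -/
def Cut.lift (g : Cut κ) (hκ : IsChart κ) (u : 𝓢(Rn n, ℂ)) :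
    TestFun n M := liftCutoff κ hκ (g.test hκ) (g.test_supp hκ) u

theorem Cut.lift_of_mem (g : Cut κ) (hκ : IsChart κ) (u : 𝓢(Rn n, ℂ)) {x : M} (hx : x ∈ κ.source) :
    (g.lift hκ u : M → ℂ) x = g (κ x) * u (κ x) :=
  congrArg (· * u (κ x)) (push_of_mem hx)

theorem Cut.lift_of_notMem (g : Cut κ) (hκ : IsChart κ)
    (u : 𝓢(Rn n, ℂ)) {x : M} (hx : x ∉ κ.source) : (g.lift hκ u : M → ℂ) x = 0 :=
  (congrArg (· * u (κ x)) (push_of_notMem hx)).trans (zero_mul _)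

theorem Cut.pull_lift (g g' : Cut κ) (hκ : IsChart κ) (u : 𝓢(Rn n, ℂ)) (y : Rn n) :
    g'.pull hκ ⟨g.lift hκ u, (g.lift hκ u).2.1⟩ y = g' y * (g y * u y) := by
  rw [Cut.pull_apply]
  by_cases hy : y ∈ κ.target
  · rw [g.lift_of_mem hκ u (κ.map_target hy), κ.right_inv hy]
  · rw [g'.eq_zero hy, zero_mul, zero_mul]

/-- The Schwartz function `c g u + g b^w g² u`. -/
def innerCut (g : Cut κ) {b : Ph n → ℂ} (hb : XC 0 b) (c : ℂ) (u : 𝓢(Rn n, ℂ)) : Cut κ :=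
  g.mul (fun y => c * u y + weylOp b ((g.mul g g.smooth).mul u (u.smooth ⊤)).schwartz y)
    ((contDiff_const.mul (u.smooth ⊤)).add (hb.contDiff_weylOp _))

theorem onTest_lift (hκ : IsChart κ)
    (hgG : ∀ z, g z * G z = g z) {b : Ph n → ℂ} (hb : XC 0 b) (c : ℂ) (u : 𝓢(Rn n, ℂ)) :
    (constAdd hκ g hb c).onTest (g.lift hκ u) = G.lift hκ (innerCut g hb c u).schwartz := by
  apply Subtype.ext
  funext x
  have h1 : (g.pull hκ ⟨g.lift hκ u, (g.lift hκ u).2.1⟩).schwartz =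
      ((g.mul g g.smooth).mul u (u.smooth ⊤)).schwartz := by
    ext y
    exact (g.pull_lift g hκ u y).trans (mul_assoc _ _ _).symm
  change c * (g.lift hκ u : M → ℂ) x + push κ (fun z => g z *
    weylOp b (g.pull hκ ⟨g.lift hκ u, (g.lift hκ u).2.1⟩).schwartz z) x = _
  rw [h1]
  by_cases hx : x ∈ κ.source
  · rw [g.lift_of_mem hκ u hx, G.lift_of_mem hκ _ hx, push_of_mem hx]
    change _ = G (κ x) * (g (κ x) * (c * u (κ x) + _))
    rw [← mul_assoc (G (κ x)), mul_comm (G (κ x)), hgG]; ring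
  · rw [g.lift_of_notMem hκ u hx, G.lift_of_notMem hκ _ hx, push_of_notMem hx, mul_zero, add_zero]

theorem constAdd_symm (hκ : IsChart κ) {a : Ph n → ℂ}
    (ha : XC 0 a) (c : ℂ) (F : SmoothFun n M) (z : Rn n) :
    g z * ((constAdd hκ g ha c).toLin F : M → ℂ) (κ.symm z) =
      g z * (c * (F : M → ℂ) (κ.symm z)) + g z * g z * weylOp a (g.pull hκ F).schwartz z := by
  by_cases hz : z ∈ κ.target
  · rw [constAdd_apply, locOp_apply, push_symm hz]; ring
  · rw [g.eq_zero hz]; ring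

variable {ι : Type*} [Fintype ι] [DecidableEq ι]

/-- The symbol of the left factor, with cutoffs. -/
def leftSym (g G : Cut κ) (c : Matrix ι ι ℂ) (a : ι → ι → Ph n → ℂ) (i k : ι) : Ph n → ℂ :=
  cutSym g G (g.mul g g.smooth) g (c i k) (a i k)

/-- The symbol of the right factor, with cutoffs. -/
def rightSym (g G : Cut κ) (c : Matrix ι ι ℂ) (a : ι → ι → Ph n → ℂ) (i k : ι) : Ph n → ℂ :=
  cutSym G g g (g.mul g g.smooth) (c i k) (a i k)

/-- The symbol of the localized composition. -/
def tripleSym (g G : Cut κ) (c c' : Matrix ι ι ℂ) (a p b : ι → ι → Ph n → ℂ) : ι → ι → Ph n → ℂ :=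
  mcomp G (leftSym g G c a) (mcomp G (fun k l => ampS G G (p k l)) (rightSym g G c' b))

/-- The terms of the expansion of the symbol of the localized composition. -/
def tripleT (g G : Cut κ) (c c' : Matrix ι ι ℂ) (a p b : MSeq n ι) (i j : ι) : ℕ → Ph n → ℂ :=
  ampT G G (mstar (fun i k => cutSymT g G (g.mul g g.smooth) g (c i k) (a i k))
    (fun k j => ampT G G (mstar (fun k l => ampT G G (p k l))
      (fun l j => cutSymT G g g (g.mul g g.smooth) (c' l j) (b l j)) k j)) i j)

variable {c c' : Matrix ι ι ℂ} {a p b : ι → ι → Ph n → ℂ} {at' pt bt : MSeq n ι}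

theorem cs_leftSym (g G : Cut κ) (ha : ∀ i j, CS 0 (a i j) (at' i j)) (i j : ι) :
    CS 0 (leftSym g G c a i j) (cutSymT g G (g.mul g g.smooth) g (c i j) (at' i j)) :=
  cs_cutSym g.isCut G.isCut (g.mul g g.smooth).isCut g.isCut (Or.inl rfl) (ha i j).1

theorem cs_rightSym (g G : Cut κ) (hb : ∀ i j, CS 0 (b i j) (bt i j)) (i j : ι) :
    CS 0 (rightSym g G c' b i j) (cutSymT G g g (g.mul g g.smooth) (c' i j) (bt i j)) :=
  cs_cutSym G.isCut g.isCut g.isCut (g.mul g g.smooth).isCut (Or.inl rfl) (hb i j).1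

theorem cs_triple (g G : Cut κ) (ha : ∀ i j, CS 0 (a i j) (at' i j))
    (hp : ∀ i j, IsClassicalSymbol m (p i j) (pt i j)) (hb : ∀ i j, CS 0 (b i j) (bt i j))
    (i j : ι) : CS m (tripleSym g G c c' a p b i j) (tripleT g G c c' at' pt bt i j) := by
  have h := cs_mcomp G.isCut (cs_leftSym (c := c) g G ha) (cs_mcomp G.isCut
    (fun i k => (hp i k).ampS G.isCut G.isCut) (cs_rightSym (c' := c') g G hb)) i j
  rwa [zero_add, add_zero] at h

theorem weylOp_triple (hκ : IsChart κ)
    (hgG : ∀ z, g z * G z = g z) (ha : ∀ i j, CS 0 (a i j) (at' i j))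
    (hp : ∀ i j, IsClassicalSymbol m (p i j) (pt i j)) (hb : ∀ i j, CS 0 (b i j) (bt i j))
    {P : Matrix ι ι (Op n M)}
    (hP : ∀ k l, LocallyWeyl (P k l) κ hκ (G.test hκ) (G.test hκ) (G.test_supp hκ) (p k l))
    (i j : ι) (u : 𝓢(Rn n, ℂ)) (z : Rn n) :
    weylOp (tripleSym g G c c' a p b i j) u z =
      g z * (sysComp (fun i k => constAdd hκ g (ha i k).xc (c i k)) P
        (fun l j => constAdd hκ g (hb l j).xc (c' l j)) i j (g.lift hκ u) : M → ℂ) (κ.symm z) := by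
  have hGg : ∀ z, G z * g z = g z := fun z => by rw [mul_comm, hgG]
  have g2 := (g.mul g g.smooth).isCut
  have sa := cs_leftSym (c := c) g G ha
  have sb := cs_rightSym (c' := c') g G hb
  have sp := fun i k => (hp i k).ampS G.isCut G.isCut
  set u₁ := (G.mul u (u.smooth ⊤)).schwartz with hu₁
  set u₂ := (G.mul u₁ (u₁.smooth ⊤)).schwartz with hu₂
  set B : Matrix ι ι (ProperOp n M) := fun l j => constAdd hκ g (hb l j).xc (c' l j) with hB
  have hu2 : ∀ y, u₂ y = G y * (G y * u y) := fun y => rfl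
  set v : ι → 𝓢(Rn n, ℂ) := fun l => (innerCut g (hb l j).xc (c' l j) u).schwartz with hv
  have hv1 : ∀ l y, v l y = weylOp (rightSym g G c' b l j) u₂ y := fun l y => by
    rw [rightSym, weylOp_cutSym G.isCut g.isCut g.isCut g2 (hb l j).1 u₂
      ((g.mul g g.smooth).mul u (u.smooth ⊤)).schwartz (fun y => by
        change g y * g y * u y = g y * g y * _
        rw [hu2]
        calc _ = g y * (g y * G y * G y) * u y := by rw [hgG, hgG]
          _ = _ := by ring) y, hu2]
    change g y * (c' l j * u y + _) = _
    rw [mul_add]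
    congr 1
    calc _ = g y * G y * G y * G y * (c' l j * u y) := by rw [hgG, hgG, hgG]
      _ = _ := by ring
  have hv2 : ∀ l y, v l y = G y * v l y := fun l y => by
    change g y * _ = G y * (g y * _)
    rw [← mul_assoc, hGg]
  set F : ι → SmoothFun n M := fun k => ∑ l, P k l ((B l j).onTest (g.lift hκ u)) with hF
  have hF1 : ∀ k y, (F k : M → ℂ) y = ∑ l, (P k l (G.lift hκ (v l)) : M → ℂ) y := fun k y => by
    rw [hF]
    simp only [AddSubmonoidClass.coe_finset_sum, Finset.sum_apply]
    exact sum_congr rfl fun l _ => by rw [hB, onTest_lift hκ hgG]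
  have hp1 : ∀ k l y, weylOp (p k l) (v l) y =
      G y * (P k l (G.lift hκ (v l)) : M → ℂ) (κ.symm y) := fun k l y => by
    rw [← hP k l (v l) y]
    by_cases hy : y ∈ κ.target
    · rw [indicator_of_mem hy, Cut.test_apply, push_symm hy]; rfl
    · rw [indicator_of_notMem hy, G.eq_zero hy, zero_mul]
  set w : ι → 𝓢(Rn n, ℂ) := fun k =>
    (((G.mul G G.smooth).mul G G.smooth).pull hκ (F k)).schwartz with hw
  have hw1 : ∀ k y, w k y =
      weylOp (mcomp G (fun i k => ampS G G (p i k)) (rightSym g G c' b) k j) u₁ y := fun k y => by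
    refine Eq.trans ?_ (weylOp_mcomp G.isCut sp sb k j u₁ u₂ (fun y => rfl) v hv1 y).symm
    change G y * G y * G y * (F k : M → ℂ) (κ.symm y) = _
    rw [hF1, mul_assoc, mul_assoc, mul_sum, mul_sum]
    refine congrArg _ (sum_congr rfl fun l _ => ?_)
    rw [weylOp_ampS G.isCut G.isCut (hp k l).contDiff (hp k l).symOn (v l) (v l) (hv2 l), hp1]
  have hgw : ∀ y, g y * (G y * G y * G y) = g y := fun y => by
    rw [← mul_assoc, ← mul_assoc, hgG, hgG, hgG]
  have ha1 : ∀ k, weylOp (leftSym g G c a i k) (w k) z =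
      g z * ((constAdd hκ g (ha i k).xc (c i k)).toLin (F k) : M → ℂ) (κ.symm z) := fun k => by
    rw [leftSym, weylOp_cutSym g.isCut G.isCut g2 g.isCut (ha i k).1 (w k)
      (g.pull hκ (F k)).schwartz (fun y => by
        change g y * _ = g y * (G y * G y * G y * _)
        rw [← mul_assoc, hgw]), constAdd_symm]
    congr 1
    change g z * (c i k * (G z * (G z * G z * G z * (F k : M → ℂ) (κ.symm z)))) = _
    calc _ = g z * G z * (G z * G z * G z) * (c i k * (F k : M → ℂ) (κ.symm z)) := by ring
      _ = _ := by rw [hgG, hgw]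
  refine (weylOp_mcomp G.isCut sa (cs_mcomp G.isCut sp sb) i j u u₁ (fun y => rfl) w hw1 z).trans ?_
  rw [sum_congr rfl fun k _ => ha1 k, ← mul_sum, ← mul_assoc, hGg]
  congr 1
  simp only [sysComp, LinearMap.sum_apply, LinearMap.comp_apply, AddSubmonoidClass.coe_finset_sum,
    Finset.sum_apply]
  refine sum_congr rfl fun k _ => ?_
  simp only [hF, map_sum, AddSubmonoidClass.coe_finset_sum, Finset.sum_apply]

theorem tripleT_eq {V : Set (Rn n)} (hV : IsOpen V) (hg : EqOn g (fun _ => 1) V)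
    (hG : EqOn G (fun _ => 1) V) (at' pt bt : MSeq n ι) (i j : ι) (l : ℕ) :
    EqOn (tripleT g G c c' at' pt bt i j l)
      (mstar (fun i k l z => (if l = 0 then c i k else 0) + at' i k l z)
        (mstar pt fun i k l z => (if l = 0 then c' i k else 0) + bt i k l z) i j l)
      {z | z.1 ∈ V} := by
  have hU : IsOpen {z : Ph n | z.1 ∈ V} := hV.preimage continuous_fst
  have kg : ∀ z : Ph n, z.1 ∈ V → (g : Rn n → ℂ) =ᶠ[𝓝 z.1] fun _ => 1 := fun z hz =>
    hg.eventuallyEq_of_mem (hV.mem_nhds hz)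
  have kG : ∀ z : Ph n, z.1 ∈ V → (G : Rn n → ℂ) =ᶠ[𝓝 z.1] fun _ => 1 := fun z hz =>
    hG.eventuallyEq_of_mem (hV.mem_nhds hz)
  have kg2 : ∀ z : Ph n, z.1 ∈ V →
      ((g.mul g g.smooth : Cut κ) : Rn n → ℂ) =ᶠ[𝓝 z.1] fun _ => 1 := fun z hz => by
    filter_upwards [kg z hz] with y hy
    change g y * g y = 1
    rw [hy, one_mul]
  intro z hz
  rw [tripleT, ampT_eq (kG z hz) (kG z hz)]
  refine mstar_congr_on hU (fun i k l y hy => cutSymT_eq (kg y hy) (kG y hy) (kg2 y hy) (kg y hy) l)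
    (fun i k l y hy => ?_) i j l hz
  rw [ampT_eq (kG y hy) (kG y hy)]
  exact mstar_congr_on hU (fun i k l y hy => ampT_eq (kG y hy) (kG y hy) _ _)
    (fun i k l y hy => cutSymT_eq (kG y hy) (kg y hy) (kg y hy) (kg2 y hy) l) i k l hy

end Composition

/-! ### Homogeneous extension of diagonalizing germs -/
section Extension
variable {m ν ρ : ℝ} {y₀ : Ph n}

/-- The conic neighbourhood of `y₀` generated by a ball. -/
def coneNhd (y₀ : Ph n) (ρ : ℝ) : Set (Ph n) := {z | z ∈ U0 n ∧ rescale y₀.2 z ∈ ball y₀ ρ}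

/-- The function `χ f`, extended homogeneously. -/
def cutExt (ν : ℝ) (χ : ContDiffBump y₀) (f : Ph n → ℂ) : Ph n → ℂ :=
  homExt ν y₀.2 fun y => ((χ y : ℝ) : ℂ) * f y

variable {χ : ContDiffBump y₀} {f : Ph n → ℂ}

theorem contDiff_bump_mul (hf : ∀ y ∈ closedBall y₀ χ.rOut, ContDiffAt ℝ ∞ f y) :
    ContDiff ℝ ∞ fun y => ((χ y : ℝ) : ℂ) * f y := by
  rw [contDiff_iff_contDiffAt]
  intro y
  by_cases hy : y ∈ tsupport χ
  · exact (Complex.ofRealCLM.contDiff.contDiffAt.comp y χ.contDiffAt).mul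
      (hf y (χ.tsupport_eq ▸ hy))
  · refine (contDiffAt_const (c := (0 : ℂ))).congr_of_eventuallyEq ?_
    filter_upwards [notMem_tsupport_iff_eventuallyEq.1 hy] with z hz
    rw [hz]; simp

theorem hom_cutExt (h0 : y₀.2 ≠ 0) (hf : ∀ y ∈ closedBall y₀ χ.rOut, ContDiffAt ℝ ∞ f y) :
    Hom ν (cutExt ν χ f) := hom_homExt h0 (contDiff_bump_mul hf).contDiffOn

theorem cutExt_zero {z : Ph n} (hz : ‖y₀.1‖ + χ.rOut < ‖z.1‖) : cutExt ν χ f z = 0 := by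
  have : χ (rescale y₀.2 z) = 0 := by
    refine χ.zero_of_le_dist ?_
    refine le_trans ?_ (le_max_left _ _)
    have h1 := norm_sub_norm_le z.1 y₀.1
    change _ ≤ dist z.1 y₀.1
    rw [dist_eq_norm]
    linarith
  simp [cutExt, homExt, this]

theorem cutExt_eq {z : Ph n} (hz : z ∈ coneNhd y₀ χ.rIn) :
    cutExt ν χ f z = (((‖z.2‖ / ‖y₀.2‖) ^ ν : ℝ) : ℂ) * f (rescale y₀.2 z) := by
  rw [cutExt, homExt, χ.one_of_mem_closedBall (Metric.ball_subset_closedBall hz.2)]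
  simp

variable {N : ℕ} {A : Ph n → Matrix (Fin N) (Fin N) ℂ}

theorem eventually_segment_det (hA : GSM A y₀) (h0 : (A y₀).det ≠ 0) :
    ∀ᶠ y in 𝓝 y₀, ∀ t ∈ Icc (0 : ℝ) 1, (A y₀ + (t : ℂ) • (A y - A y₀)).det ≠ 0 := by
  have hc : ContinuousAt A y₀ := continuousAt_pi.2 fun i => continuousAt_pi.2 fun j =>
    (hA i j).continuousAt
  refine isCompact_Icc.eventually_forall_of_forall_eventually fun t _ => ?_
  have h1 : ContinuousAt (fun q : Ph n × ℝ => (A y₀ + (q.2 : ℂ) • (A q.1 - A y₀)).det) (y₀, t) := by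
    have h2 : ContinuousAt (fun q : Ph n × ℝ => A q.1) (y₀, t) :=
      ContinuousAt.comp (f := Prod.fst) (g := A) hc continuousAt_fst
    have h3 : ContinuousAt (fun q : Ph n × ℝ => (q.2 : ℂ)) (y₀, t) :=
      (Complex.continuous_ofReal.comp continuous_snd).continuousAt
    have h4 := (continuous_id.matrix_det (n := Fin N) (R := ℂ)).continuousAt
      (x := A y₀ + (t : ℂ) • (A y₀ - A y₀))
    exact ContinuousAt.comp (f := fun q : Ph n × ℝ => A y₀ + (q.2 : ℂ) • (A q.1 - A y₀))
      (g := fun X => X.det) h4 (continuousAt_const.add (h3.smul (h2.sub continuousAt_const)))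
  exact h1.eventually_ne (by simpa using h0)

/-- The homogeneous extension of the germ `A - A(y₀)`. -/
def matExt (χ : ContDiffBump y₀) (A : Ph n → Matrix (Fin N) (Fin N) ℂ) (z : Ph n) :
    Matrix (Fin N) (Fin N) ℂ := Matrix.of fun i j => cutExt 0 χ (fun y => A y i j - A y₀ i j) z

theorem matExt_eq {z : Ph n} (hz : z ∈ coneNhd y₀ χ.rIn) :
    A y₀ + matExt χ A z = A (rescale y₀.2 z) := by
  ext i j
  simp [matExt, cutExt_eq hz]

theorem det_matExt (h : ∀ y ∈ ball y₀ χ.rOut, ∀ t ∈ Icc (0 : ℝ) 1,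
      (A y₀ + (t : ℂ) • (A y - A y₀)).det ≠ 0) (z : Ph n) {t : ℝ} (ht : t ∈ Icc (0 : ℝ) 1) :
    (A y₀ + (t : ℂ) • matExt χ A z).det ≠ 0 := by
  have h1 : (t : ℂ) • matExt χ A z = ((t * χ (rescale y₀.2 z) : ℝ) : ℂ) •
      (A (rescale y₀.2 z) - A y₀) := by
    ext i j
    simp [matExt, cutExt, homExt, mul_assoc]
  rw [h1]
  by_cases hz : rescale y₀.2 z ∈ ball y₀ χ.rOut
  · exact h _ hz _ ⟨mul_nonneg ht.1 χ.nonneg, mul_le_one₀ ht.2 χ.nonneg χ.le_one⟩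
  · have h2 := h y₀ (mem_ball_self χ.rOut_pos) 0 ⟨le_rfl, zero_le_one⟩
    rw [χ.zero_of_le_dist (not_lt.1 hz)]
    simpa using h2

variable {K L : ℕ} {a b : Ph n → Matrix (Fin N) (Fin N) ℂ} {l : Ph n → ℂ}
  {r : Ph n → Matrix (Fin L) (Fin L) ℂ}

/-- The terms of the symbol `A(y₀) + a` for an expansion `a`. -/
def shiftSeq (A₀ : Matrix (Fin N) (Fin N) ℂ) (a : MSeq n (Fin N)) : MSeq n (Fin N) :=
  fun i k s z => (if s = 0 then A₀ i k else 0) + a i k s z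

/-- The sequence of terms with the leading term replaced by `X`. -/
def headSeq (X : Ph n → Matrix (Fin N) (Fin N) ℂ) (S : MSeq n (Fin N)) : MSeq n (Fin N) :=
  fun i j s z => if s = 0 then X z i j else S i j s z

theorem homSeq_headSeq {X : Ph n → Matrix (Fin N) (Fin N) ℂ} {S : MSeq n (Fin N)}
    (hX : ∀ i j, Hom m (fun z => X z i j)) (hS : HomSeq m S) : HomSeq m (headSeq X S) :=
  fun i j s => by
  unfold headSeq
  by_cases hs : s = 0
  · subst hs; simpa using hX i j
  · simpa [hs] using hS i j s

theorem shiftSeq_headSeq {A₀ : Matrix (Fin N) (Fin N) ℂ} {X : Ph n → Matrix (Fin N) (Fin N) ℂ}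
    {S : MSeq n (Fin N)} (h : ∀ z, S.at 0 z = A₀ + X z) : shiftSeq A₀ (headSeq X S) = S := by
  funext i j s z
  by_cases hs : s = 0
  · subst hs
    simpa [shiftSeq, headSeq, MSeq.at] using (congrFun (congrFun (h z) i) j).symm
  · simp [shiftSeq, headSeq, hs]

theorem diagBlock_off (g : Fin K ⊕ Fin L ≃ Fin N) (l : ℂ) (r : Matrix (Fin L) (Fin L) ℂ)
    {i j : Fin N} (hij : (g.symm i).isLeft ↔ ¬ (g.symm j).isLeft) : diagBlock g l r i j = 0 := by
  rw [diagBlock, reindex_apply, Matrix.submatrix_apply]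
  generalize g.symm i = x, g.symm j = y at hij
  rcases x with x | x <;> rcases y with y | y <;> simp at hij ⊢

theorem diagBlock_inv (g : Fin K ⊕ Fin L ≃ Fin N) (l : ℂ) {r : Matrix (Fin L) (Fin L) ℂ}
    (hr : r.det ≠ 0) : diagBlock g 0 r⁻¹ * diagBlock g l r =
      1 - blockProj (fun i => (g.symm i).isLeft) ∧
    diagBlock g l r * diagBlock g 0 r⁻¹ = 1 - blockProj (fun i => (g.symm i).isLeft) := by
  have hu : IsUnit r.det := isUnit_iff_ne_zero.2 hr
  have h1 : (1 : Matrix (Fin N) (Fin N) ℂ) - blockProj (fun i => (g.symm i).isLeft) =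
      reindex g g (fromBlocks (0 : Matrix (Fin K) (Fin K) ℂ) 0 0 1) := by
    ext i j
    obtain ⟨x, rfl⟩ := g.surjective i
    obtain ⟨y, rfl⟩ := g.surjective j
    rcases x with x | x <;> rcases y with y | y <;>
      simp [blockProj, Matrix.one_apply, Matrix.diagonal_apply]
  rw [h1, diagBlock, diagBlock, reindex_apply, reindex_apply, reindex_apply,
    Matrix.submatrix_mul_equiv, Matrix.submatrix_mul_equiv, Matrix.fromBlocks_multiply,
    Matrix.fromBlocks_multiply]
  simp [Matrix.nonsing_inv_mul _ hu, Matrix.mul_nonsing_inv _ hu]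

theorem exists_expansions (g : Fin K ⊕ Fin L ≃ Fin N) {p : MSeq n (Fin N)} (hp : HomSeq m p)
    (h0 : y₀.2 ≠ 0) (hD : Diag g (p.at 0) y₀ a b l r) {W : Set (Ph n)} (hW : W ∈ 𝓝 y₀) :
    ∃ ρ : ℝ, 0 < ρ ∧ ∃ (aT bT : MSeq n (Fin N)) (R : ℝ), ball y₀ ρ ⊆ W ∧
      (∀ y ∈ ball y₀ ρ, ContDiffAt ℝ ∞ l y ∧ (r y).det ≠ 0) ∧
      HomSeq 0 aT ∧ HomSeq 0 bT ∧
      (∀ i j s (z : Ph n), R < ‖z.1‖ → aT i j s z = 0 ∧ bT i j s z = 0) ∧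
      (∀ z, ∀ t ∈ Icc (0 : ℝ) 1, (a y₀ + (t : ℂ) • aT.at 0 z).det ≠ 0 ∧
        (b y₀ + (t : ℂ) • bT.at 0 z).det ≠ 0) ∧
      ∀ z ∈ coneNhd y₀ ρ, (mstar (shiftSeq (a y₀) aT) (mstar p (shiftSeq (b y₀) bT))).at 0 z =
          (((‖z.2‖ / ‖y₀.2‖) ^ m : ℝ) : ℂ) • diagBlock g (l (rescale y₀.2 z)) (r (rescale y₀.2 z)) ∧
        ∀ s i j, ((g.symm i).isLeft ↔ ¬ (g.symm j).isLeft) →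
          mstar (shiftSeq (a y₀) aT) (mstar p (shiftSeq (b y₀) bT)) i j s z = 0 := by
  have hM : ∀ {y}, Diag g (p.at 0) y a b l r → ∀ i j,
      ContDiffAt ℝ ∞ (fun y => diagBlock g 0 (r y)⁻¹ i j) y := fun h i j =>
    (GSM.fromBlocks (GSM.const _) (GSM.const _) (GSM.const _) (h.hr.inv h.hr0) (g.symm i)
      (g.symm j)).self_of_nhds
  have key := (eventually_mem_set.2 hW).and (hD.eventually.and
    ((eventually_segment_det hD.ha hD.ha0).and (eventually_segment_det hD.hb hD.hb0)))
  obtain ⟨δ, hδ, hball⟩ := Metric.eventually_nhds_iff_ball.1 key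
  set χ : ContDiffBump y₀ := ⟨δ / 3, δ / 2, by positivity, by linarith⟩ with hχ
  have hcl : closedBall y₀ χ.rOut ⊆ ball y₀ δ :=
    Metric.closedBall_subset_ball (by change δ / 2 < δ; linarith)
  have hop : ball y₀ χ.rOut ⊆ ball y₀ δ := Metric.ball_subset_closedBall.trans hcl
  have hin : ball y₀ χ.rIn ⊆ ball y₀ δ := Metric.ball_subset_ball (by change δ / 3 ≤ δ; linarith)
  have hA : ∀ i j, Hom 0 (fun z => matExt χ a z i j) := fun i j => hom_cutExt h0 fun y hy =>
    ((hball y (hcl hy)).2.1.ha i j).self_of_nhds.sub contDiffAt_const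
  have hB : ∀ i j, Hom 0 (fun z => matExt χ b z i j) := fun i j => hom_cutExt h0 fun y hy =>
    ((hball y (hcl hy)).2.1.hb i j).self_of_nhds.sub contDiffAt_const
  have hc : ∀ c : ℂ, Hom 0 (fun _ : Ph n => c) := fun c => Hom.of_fst (c := fun _ => c)
    contDiff_const
  have hadd : ∀ {f : Ph n → ℂ} (c : ℂ), Hom 0 f → Hom 0 (fun z => c + f z) := fun c hf =>
    ⟨contDiffOn_const.add hf.smooth, fun z t hz ht => by rw [hf.hom z t hz ht]; simp⟩
  obtain ⟨aS, bS, hAS, hBS, ha00, hb00, hz, hstar⟩ := exists_block_sequences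
    (c := fun i => (g.symm i).isLeft) (R := ‖y₀.1‖ + χ.rOut) hp
    (a₀ := fun z => a y₀ + matExt χ a z) (b₀ := fun z => b y₀ + matExt χ b z)
    (M := fun z => Matrix.of fun i j => cutExt (-m) χ (fun y => diagBlock g 0 (r y)⁻¹ i j) z)
    (fun i j => hadd _ (hA i j)) (fun i j => hadd _ (hB i j))
    (fun i j => hom_cutExt h0 fun y hy => hM (hball y (hcl hy)).2.1 i j)
    (fun z hz => by
      ext i j
      change cutExt (-m) χ (fun y => diagBlock g 0 (r y)⁻¹ i j) z = 0
      exact cutExt_zero hz)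
  refine ⟨χ.rIn, χ.rIn_pos, headSeq (matExt χ a) aS, headSeq (matExt χ b) bS, ‖y₀.1‖ + χ.rOut,
    fun y hy => (hball y (hin hy)).1,
    fun y hy => ⟨(hball y (hin hy)).2.1.hl.self_of_nhds, (hball y (hin hy)).2.1.hr0⟩, homSeq_headSeq hA hAS,
    homSeq_headSeq hB hBS, fun i j s z hR => ?_, fun z t ht => ⟨?_, ?_⟩, ?_⟩
  · by_cases hs : s = 0
    · simp only [headSeq, hs, if_true, matExt, of_apply]
      exact ⟨cutExt_zero hR, cutExt_zero hR⟩
    · simp only [headSeq, hs, if_false]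
      exact ⟨congrFun (congrFun (hz s hs z hR).1 i) j, congrFun (congrFun (hz s hs z hR).2 i) j⟩
  · exact det_matExt (fun y hy => (hball y (hop hy)).2.2.1) z ht
  · exact det_matExt (fun y hy => (hball y (hop hy)).2.2.2) z ht
  · rw [shiftSeq_headSeq ha00, shiftSeq_headSeq hb00]
    intro z hzc
    have hy := hball _ (hin hzc.2)
    have hpos : 0 < ‖z.2‖ / ‖y₀.2‖ := div_pos (norm_pos_iff.2 hzc.1) (norm_pos_iff.2 h0)
    have hp0 : p.at 0 z = (((‖z.2‖ / ‖y₀.2‖) ^ m : ℝ) : ℂ) • p.at 0 (rescale y₀.2 z) := by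
      ext i j
      have := (hp i j 0).homExt_eq h0 hzc.1
      simp only [Nat.cast_zero, sub_zero] at this
      exact this.symm
    have h1 : (a y₀ + matExt χ a z) * p.at 0 z * (b y₀ + matExt χ b z) =
        (((‖z.2‖ / ‖y₀.2‖) ^ m : ℝ) : ℂ) •
          diagBlock g (l (rescale y₀.2 z)) (r (rescale y₀.2 z)) := by
      rw [matExt_eq hzc, matExt_eq hzc, hp0, Matrix.mul_smul, Matrix.smul_mul, hy.2.1.diag.self_of_nhds]
    have h2 : (Matrix.of fun i j => cutExt (-m) χ (fun y => diagBlock g 0 (r y)⁻¹ i j) z) =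
        (((‖z.2‖ / ‖y₀.2‖) ^ (-m) : ℝ) : ℂ) • diagBlock g 0 (r (rescale y₀.2 z))⁻¹ := by
      ext i j
      simp [cutExt_eq hzc]
    have h3 := diagBlock_inv g (l (rescale y₀.2 z)) hy.2.1.hr0
    have h4 : (((‖z.2‖ / ‖y₀.2‖) ^ (-m) : ℝ) : ℂ) * (((‖z.2‖ / ‖y₀.2‖) ^ m : ℝ) : ℂ) = 1 := by
      rw [← Complex.ofReal_mul, ← Real.rpow_add hpos]; simp
    have h5 : (mstar aS (mstar p bS)).at 0 z = (((‖z.2‖ / ‖y₀.2‖) ^ m : ℝ) : ℂ) •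
          diagBlock g (l (rescale y₀.2 z)) (r (rescale y₀.2 z)) := by
      rw [mstar_at_zero, mstar_at_zero, ha00, hb00, ← Matrix.mul_assoc, h1]
    refine ⟨h5, fun s i j hij => ?_⟩
    by_cases hs : s = 0
    · subst hs
      have := congrFun (congrFun h5 i) j
      rw [Matrix.smul_apply, diagBlock_off g _ _ hij, smul_zero] at this
      exact this
    · refine hstar z ?_ ?_ s hs i j hij
      · rw [h1, h2, Matrix.smul_mul, Matrix.mul_smul, smul_smul, h4, one_smul]
        convert h3.1
      · rw [h1, h2, Matrix.smul_mul, Matrix.mul_smul, smul_smul, mul_comm, h4, one_smul]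
        convert h3.2

end Extension

/-! ### The hypotheses in coordinates on the cotangent bundle -/
section Homogeneous
variable {N K L : ℕ} {m : ℝ} {η₀ : Rn n} {z : Ph n} {P a b : Ph n → Matrix (Fin N) (Fin N) ℂ}
  {l : Ph n → ℂ} {r : Ph n → Matrix (Fin L) (Fin L) ℂ}

theorem GS.comp_rescale {f : Ph n → ℂ} (hz : z ∈ U0 n) (hf : GS f (rescale η₀ z)) :
    GS (fun z => f (rescale η₀ z)) z := by
  have h1 := ((contDiffOn_rescale η₀).contDiffAt (isOpen_U0.mem_nhds hz)).continuousAt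
  filter_upwards [h1.eventually hf, isOpen_U0.mem_nhds hz] with y hy hy0
  exact ContDiffAt.comp y hy ((contDiffOn_rescale η₀).contDiffAt (isOpen_U0.mem_nhds hy0))

theorem GS.homExt {f : Ph n → ℂ} (h0 : η₀ ≠ 0) (hz : z ∈ U0 n) (hf : GS f (rescale η₀ z)) :
    GS (homExt m η₀ f) z := by
  have h1 : GS (PsiDO.homExt m η₀ fun _ : Ph n => 1) z := by
    filter_upwards [isOpen_U0.mem_nhds hz] with y hy
    exact (hom_homExt h0 contDiffOn_const).smooth.contDiffAt (isOpen_U0.mem_nhds hy)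
  have h2 := h1.mul (hf.comp_rescale hz)
  simp only [PsiDO.homExt, mul_one] at h2
  exact h2

theorem GSM.of_hom (hP : ∀ i j, Hom m (fun z => P z i j)) (hz : z ∈ U0 n) : GSM P z :=
  fun i j => by
    filter_upwards [isOpen_U0.mem_nhds hz] with y hy
    exact (hP i j).smooth.contDiffAt (isOpen_U0.mem_nhds hy)

theorem matrix_hom (hP : ∀ i j, Hom m (fun z => P z i j)) {t : ℝ} (ht : 0 < t) (hz : z ∈ U0 n) :
    P (z.1, t • z.2) = ((t ^ m : ℝ) : ℂ) • P z := by
  ext i j; exact (hP i j).hom z t hz ht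

theorem dM_dilate (hP : ∀ i j, Hom m (fun z => P z i j)) {t : ℝ} (ht : 0 < t) (hz : z ∈ U0 n)
    (v : Ph n) : dM (dilate n t v) P (z.1, t • z.2) = ((t ^ m : ℝ) : ℂ) • dM v P z := by
  ext i j; exact (hP i j).dd_dilate hz ht v

theorem PT.smul {p q : Matrix (Fin N) (Fin N) ℂ} (h : PT p q) {c : ℂ} (hc : c ≠ 0) :
    PT (c • p) (c • q) := by
  rintro u hu ⟨w, hw⟩
  rw [Matrix.smul_mulVec, smul_eq_zero_iff_right hc] at hu
  rw [Matrix.smul_mulVec, Matrix.smul_mulVec] at hw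
  exact h u hu ⟨w, smul_right_injective _ hc hw⟩

theorem fderiv_homExt_ne_zero (hK : 0 < K) (g : Fin K ⊕ Fin L ≃ Fin N) (h0 : η₀ ≠ 0)
    (hP : ∀ i j, Hom m (fun z => P z i j)) (hz : z ∈ U0 n)
    (hD : Diag g P (rescale η₀ z) a b l r) {v : Ph n}
    (hpt : PT (P (rescale η₀ z)) (dM v P (rescale η₀ z))) (hl0 : homExt m η₀ l z = 0) :
    fderiv ℝ (homExt m η₀ l) z ≠ 0 := by
  have hr := (contDiffOn_rescale η₀).contDiffAt (isOpen_U0.mem_nhds hz)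
  set t := ‖z.2‖ / ‖η₀‖ with ht
  have hn : 0 < ‖η₀‖ := norm_pos_iff.2 h0
  have hzn : 0 < ‖z.2‖ := norm_pos_iff.2 hz
  have htp : 0 < t := div_pos hzn hn
  have hzt : (((rescale η₀ z).1, t • (rescale η₀ z).2) : Ph n) = z := by
    refine Prod.ext rfl ?_
    change t • (‖η₀‖ / ‖z.2‖) • z.2 = z.2
    rw [smul_smul, ht]
    have : ‖z.2‖ / ‖η₀‖ * (‖η₀‖ / ‖z.2‖) = 1 := by field_simp
    rw [this, one_smul]
  have hpt' : PT (P z) (dM (dilate n t v) P z) := by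
    have e1 := matrix_hom hP htp (rescale_mem h0 hz)
    have e2 := dM_dilate hP htp (rescale_mem h0 hz) v
    rw [hzt] at e1 e2
    rw [e1, e2]
    exact hpt.smul (Complex.ofReal_ne_zero.2 (Real.rpow_pos_of_pos htp m).ne')
  intro hd
  refine fderiv_ne_zero_of_diag hK g (GSM.of_hom hP hz)
    (a := fun z => a (rescale η₀ z)) (b := fun z => b (rescale η₀ z))
    (fun i j => (hD.ha i j).comp_rescale hz) (fun i j => (hD.hb i j).comp_rescale hz)
    (hD.hl.homExt (m := m) h0 hz) hD.ha0 hD.hb0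
    (r := fun z => (((‖z.2‖ / ‖η₀‖) ^ m : ℝ) : ℂ) • r (rescale η₀ z)) ?_ hpt' hl0
    (by rw [hd]; rfl)
  filter_upwards [hr.continuousAt.eventually hD.diag, isOpen_U0.mem_nhds hz] with y hy hy0
  have e1 : P y = (((‖y.2‖ / ‖η₀‖) ^ m : ℝ) : ℂ) • P (rescale η₀ y) := by
    ext i j; exact ((hP i j).homExt_eq h0 hy0).symm
  rw [e1, Matrix.mul_smul, Matrix.smul_mul, hy, diagBlock, ← Matrix.reindexLinearEquiv_apply ℂ ℂ,
    ← map_smul, Matrix.fromBlocks_smul, smul_zero, smul_zero, Matrix.reindexLinearEquiv_apply]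
  congr 2
  ext i j
  by_cases hij : i = j
  · subst hij; simp [homExt]
  · simp [hij]

end Homogeneous

section Transfer
variable {N : ℕ}
  {p : Cotangent n M → Matrix (Fin N) (Fin N) ℂ} {P : Ph n → Matrix (Fin N) (Fin N) ℂ}
  {w : Cotangent n M}

theorem exists_pt_of_principalType (hκ : IsChart κ)
    (hw : w.1 ∈ κ.source) (hp : ∀ᶠ w' in 𝓝 w, p w' = P (cotCoord κ w'))
    (hP : GSM P (cotCoord κ w)) (h : IsPrincipalTypeAt p w) :
    ∃ v : Ph n, PT (P (cotCoord κ w)) (dM v P (cotCoord κ w)) := by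
  obtain ⟨v, hv⟩ := h
  set v' : Ph n := mfderiv (cotModel n) 𝓘(ℝ, Ph n) (cotCoord κ) w v with hv'
  have hd : dirDeriv p w v = dM v' P (cotCoord κ w) := by
    ext i j
    have h1 : (fun w' => p w' i j) =ᶠ[𝓝 w] (fun z => P z i j) ∘ cotCoord κ := by
      filter_upwards [hp] with w' hw' using by rw [hw']; rfl
    have h2 : MDifferentiableAt 𝓘(ℝ, Ph n) 𝓘(ℝ, ℂ) (fun z => P z i j) (cotCoord κ w) :=
      (hP i j).diffAt.mdifferentiableAt
    have h3 := mfderiv_comp w h2 ((contMDiffAt_cotCoord hκ hw).mdifferentiableAt (by simp))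
    change mfderiv (cotModel n) 𝓘(ℝ, ℂ) (fun w' => p w' i j) w v =
      fderiv ℝ (fun y => P y i j) (cotCoord κ w) v'
    rw [h1.mfderiv_eq, h3, mfderiv_eq_fderiv]
    rfl
  refine ⟨v', ?_⟩
  rw [← hd, ← hp.self_of_nhds]
  rintro u hu ⟨x, hx⟩
  have h1 := @hv.1 ⟨u, by rwa [LinearMap.mem_ker, Matrix.toLin'_apply]⟩ 0 (by
    rw [map_zero]
    simp only [LinearMap.comp_apply, Submodule.subtype_apply]
    exact (Submodule.Quotient.mk_eq_zero _).2 ⟨x, by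
      rw [Matrix.toLin'_apply, Matrix.toLin'_apply, hx]⟩)
  exact congrArg Subtype.val h1

theorem tendsto_cotPoint (hκ : IsChart κ) (hw : w.1 ∈ κ.source) :
    Tendsto (cotPoint (M := M) κ) (𝓝 (cotCoord κ w)) (𝓝 w) := by
  have := (contMDiffAt_cotPoint hκ (z := cotCoord κ w) (κ.map_source hw)).continuousAt
  rwa [ContinuousAt, cotPoint_cotCoord hκ hw] at this

theorem exists_eigenvalue_gap (A : Matrix (Fin N) (Fin N) ℂ) :
    ∃ ε : ℝ, 0 < ε ∧ ∀ μ : ℂ, ‖μ‖ < ε → (A - scalar (Fin N) μ).det = 0 → μ = 0 := by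
  have hf : ({μ : ℂ | A.charpoly.IsRoot μ} \ {0}).Finite :=
    (Polynomial.finite_setOf_isRoot A.charpoly_monic.ne_zero).subset Set.diff_subset
  obtain ⟨ε, hε, h⟩ := Metric.mem_nhds_iff.1 (hf.isClosed.isOpen_compl.mem_nhds
    (show (0 : ℂ) ∈ _ from fun h => h.2 rfl))
  refine ⟨ε, hε, fun μ hμ hd => ?_⟩
  by_contra h0
  refine h (show μ ∈ ball (0 : ℂ) ε by simpa using hμ) ⟨?_, h0⟩
  change A.charpoly.eval μ = 0
  rw [Matrix.eval_charpoly, ← neg_sub, Matrix.det_neg, hd, mul_zero]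

theorem multiplicities_of_constantCharacteristics (hκ : IsChart κ) (hw : w.1 ∈ κ.source)
    (hp : ∀ᶠ w' in 𝓝 w, p w' = P (cotCoord κ w')) (hd : (p w).det = 0)
    (h : HasConstantCharacteristicsNear p w) :
    ∃ ε : ℝ, 0 < ε ∧ ∀ᶠ y in 𝓝 (cotCoord κ w), ∀ μ : ℂ, ‖μ‖ < ε → (P y - scalar (Fin N) μ).det = 0 →
        algMult (P y) μ = algMult (P (cotCoord κ w)) 0 ∧
        geomMult (P y) μ = geomMult (P (cotCoord κ w)) 0 := by
  obtain ⟨ε, hε, U, hU, hc⟩ := h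
  obtain ⟨ε', hε', hgap⟩ := exists_eigenvalue_gap (p w)
  have ht : (cotCoord κ w).1 ∈ κ.target := κ.map_source hw
  refine ⟨min ε ε', lt_min hε hε', ?_⟩
  filter_upwards [(tendsto_cotPoint hκ hw).eventually (hp.and hU),
    (κ.open_target.preimage continuous_fst).mem_nhds ht] with y ⟨hy, hyU⟩ hyt μ hμ hdet
  rw [cotCoord_cotPoint hκ hyt] at hy
  rw [← hy] at hdet ⊢
  rw [← hp.self_of_nhds]
  by_cases hyw : y = cotCoord κ w
  · rw [hyw, cotPoint_cotCoord hκ hw] at hdet ⊢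
    rw [hgap μ (hμ.trans_le (min_le_right _ _)) hdet]
    exact ⟨rfl, rfl⟩
  have hne : ‖y - cotCoord κ w‖ ≠ 0 := norm_ne_zero_iff.2 (sub_ne_zero.2 hyw)
  set l : Cotangent n M → ℂ := fun w' =>
    ((‖cotCoord κ w' - cotCoord κ w‖ / ‖y - cotCoord κ w‖ : ℝ) : ℂ) * μ with hl
  have hl0 : l w = 0 := by simp [hl]
  have hl1 : l (cotPoint κ y) = μ := by
    simp only [hl, cotCoord_cotPoint hκ hyt, div_self hne, Complex.ofReal_one, one_mul]
  have hlc : ∀ w' : Cotangent n M, w'.1 ∈ κ.source → ContinuousAt l w' := fun w' hw' =>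
    (Complex.continuous_ofReal.continuousAt.comp ((((contMDiffAt_cotCoord hκ hw').continuousAt.sub
      continuousAt_const).norm).div_const _)).mul continuousAt_const
  have key := hc {cotPoint κ y, w} l (by rintro _ (rfl | rfl); exacts [hyU, mem_of_mem_nhds hU])
    ⟨by rintro _ (rfl | rfl)
        exacts [(hlc _ (κ.map_target hyt)).continuousWithinAt, (hlc _ hw).continuousWithinAt],
      by rintro _ (rfl | rfl)
         exacts [by rw [hl1]; exact hdet, by rw [hl0]; simpa using hd]⟩
    (by rintro _ (rfl | rfl)
        exacts [by rw [hl1]; exact hμ.trans_le (min_le_left _ _), by rw [hl0]; simpa using hε])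
    (cotPoint κ y) (Or.inl rfl) w (Or.inr rfl)
  rwa [hl0, hl1] at key

theorem mfderiv_comp_cotCoord_ne_zero (hκ : IsChart κ)
    (hw : w.1 ∈ κ.source) {f : Ph n → ℂ} (hf : DifferentiableAt ℝ f (cotCoord κ w))
    (h : fderiv ℝ f (cotCoord κ w) ≠ 0) :
    mfderiv (cotModel n) 𝓘(ℝ, ℂ) (fun w' => f (cotCoord κ w')) w ≠ 0 := by
  intro h0
  apply h
  have ht : (cotCoord κ w).1 ∈ κ.target := κ.map_source hw
  have hz := cotPoint_cotCoord hκ hw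
  have h1 : f =ᶠ[𝓝 (cotCoord κ w)] (fun w' => f (cotCoord κ w')) ∘ cotPoint (M := M) κ := by
    filter_upwards [(κ.open_target.preimage continuous_fst).mem_nhds ht] with y hy
    change _ = f (cotCoord κ (cotPoint κ y))
    rw [cotCoord_cotPoint hκ hy]
  have h2 : MDifferentiableAt (cotModel n) 𝓘(ℝ, ℂ) (fun w' => f (cotCoord κ w'))
      (cotPoint κ (cotCoord κ w)) := by
    rw [hz]
    exact MDifferentiableAt.comp w hf.mdifferentiableAt
      ((contMDiffAt_cotCoord hκ hw).mdifferentiableAt (by simp))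
  have h3 := mfderiv_comp (cotCoord κ w) h2
    ((contMDiffAt_cotPoint hκ ht).mdifferentiableAt (by simp))
  rw [← mfderiv_eq_fderiv, h1.mfderiv_eq, h3, hz, h0]
  rfl

end Transfer

/-! ### Microlocal equality and the germs that diagonalize the principal symbol -/
section Microlocal
open scoped SchwartzMap

theorem exists_cut {z₀ : Rn n} {r R : ℝ} (hr : 0 < r) (hR : r < R)
    (h : closedBall z₀ R ⊆ κ.target) : ∃ g : Cut κ, (∀ z ∈ closedBall z₀ r, g z = 1) ∧
      (∀ z ∉ ball z₀ R, g z = 0) ∧ ∀ z, ∃ t ∈ Icc (0 : ℝ) 1, g z = (t : ℂ) := by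
  set χ : ContDiffBump z₀ := ⟨r, R, hr, hR⟩
  have hs : tsupport (fun z => ((χ z : ℝ) : ℂ)) ⊆ closedBall z₀ R := by
    refine closure_minimal (fun z hz => ?_) Metric.isClosed_closedBall
    by_contra h'
    refine hz ?_
    simp only [χ.zero_of_le_dist (not_le.1 h').le, Complex.ofReal_zero]
  refine ⟨⟨fun z => ((χ z : ℝ) : ℂ), Complex.ofRealCLM.contDiff.comp χ.contDiff,
    (isCompact_closedBall z₀ R).of_isClosed_subset (isClosed_tsupport _) hs, hs.trans h⟩,
    fun z hz => ?_, fun z hz => ?_, fun z => ⟨χ z, ⟨χ.nonneg, χ.le_one⟩, rfl⟩⟩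
  · change ((χ z : ℝ) : ℂ) = 1
    rw [χ.one_of_mem_closedBall hz, Complex.ofReal_one]
  · change ((χ z : ℝ) : ℂ) = 0
    rw [χ.zero_of_le_dist (not_lt.1 hz), Complex.ofReal_zero]

theorem exists_cuts {z₀ : Rn n} (hz : z₀ ∈ κ.target) :
    ∃ (g₀ g G : Cut κ) (V : Set (Rn n)), IsOpen V ∧ z₀ ∈ V ∧ V ⊆ κ.target ∧
      (∀ z, g₀ z * g z = g₀ z) ∧ (∀ z, g z * G z = g z) ∧ EqOn g₀ (fun _ => 1) V ∧
      EqOn g (fun _ => 1) V ∧ EqOn G (fun _ => 1) V ∧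
      ∀ z, ∃ t ∈ Icc (0 : ℝ) 1, g z * g z = (t : ℂ) := by
  obtain ⟨r, hr, hb⟩ := Metric.isOpen_iff.1 κ.open_target z₀ hz
  have hsub : ∀ s < r, closedBall z₀ s ⊆ κ.target := fun s hs =>
    (Metric.closedBall_subset_ball hs).trans hb
  obtain ⟨g₀, h1, h2, -⟩ := exists_cut (z₀ := z₀) (r := r / 5) (R := 2 * r / 5) (by linarith)
    (by linarith) (hsub _ (by linarith))
  obtain ⟨g, h3, h4, h5⟩ := exists_cut (z₀ := z₀) (r := 2 * r / 5) (R := 3 * r / 5) (by linarith)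
    (by linarith) (hsub _ (by linarith))
  obtain ⟨G, h6, -, -⟩ := exists_cut (z₀ := z₀) (r := 3 * r / 5) (R := 4 * r / 5) (by linarith)
    (by linarith) (hsub _ (by linarith))
  have hm : ∀ {f f' : Cut κ} {s : ℝ}, (∀ z ∉ ball z₀ s, f z = 0) →
      (∀ z ∈ closedBall z₀ s, f' z = 1) → ∀ z, f z * f' z = f z := fun {_ _ s} hf hf' z => by
    by_cases h : z ∈ ball z₀ s
    · rw [hf' z (Metric.ball_subset_closedBall h), mul_one]
    · rw [hf z h, zero_mul]
  have hV : ∀ {s : ℝ}, r / 5 ≤ s → ball z₀ (r / 5) ⊆ closedBall z₀ s := fun hs =>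
    Metric.ball_subset_closedBall.trans (Metric.closedBall_subset_closedBall hs)
  refine ⟨g₀, g, G, ball z₀ (r / 5), Metric.isOpen_ball,
    mem_ball_self (by linarith), (hV le_rfl).trans (hsub _ (by linarith)), hm h2 h3,
    hm h4 h6, fun z hz => h1 z (hV le_rfl hz), fun z hz => h3 z (hV (by linarith) hz),
    fun z hz => h6 z (hV (by linarith) hz), fun z => ?_⟩
  obtain ⟨t, ht, h⟩ := h5 z
  exact ⟨t * t, ⟨mul_nonneg ht.1 ht.1, mul_le_one₀ ht.2 ht.1 ht.2⟩, by rw [h]; push_cast; rfl⟩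

theorem notMemWF_of_local [T2Space M] (hκ : IsChart κ)
    (g₀ : Cut κ) {R : Op n M} {m : ℝ} {q : Ph n → ℂ} {b : ℕ → Ph n → ℂ}
    (hq : IsClassicalSymbol m q b) {w : Cotangent n M} (hw : w.1 ∈ κ.source) {V C : Set (Rn n)}
    (hV : IsOpen V) (hVw : κ w.1 ∈ V) (hg : EqOn g₀ (fun _ => 1) V) (hC : IsOpen C)
    (hCw : (cotCoord κ w).2 ∈ C) (hcone : ∀ η ∈ C, ∀ t : ℝ, 0 < t → t • η ∈ C)
    (hb : ∀ l (z : Ph n), z.1 ∈ V → z.2 ∈ C → b l z = 0)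
    (hR : ∀ (u : 𝓢(Rn n, ℂ)) z, g₀ z * (R (g₀.lift hκ u) : M → ℂ) (κ.symm z) =
      g₀ z * weylOp q (g₀.mul u (u.smooth ⊤)).schwartz z) : NotMemWF R w := by
  have hcl := hq.ampS g₀.isCut g₀.isCut
  have hev : ∀ᶠ x in 𝓝 w.1, (g₀.test hκ : M → ℂ) x = 1 := by
    filter_upwards [κ.open_source.mem_nhds hw, (κ.continuousAt hw).eventually (hV.mem_nhds hVw)]
      with x hx hxV
    rw [Cut.test_apply, push_of_mem hx, hg hxV]
  refine ⟨κ, hκ, g₀.test hκ, g₀.test hκ, g₀.test_supp hκ, m, ampS g₀ g₀ q, (cotCoord κ w).2, V, C,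
    hw, g₀.test_supp hκ, hev.and hev, hcl.isSymbol, fun u z => ?_, covector_cotCoord hκ hw,
    hV, hVw, hC, hCw, hcone, fun ν => ?_⟩
  · rw [weylOp_ampS g₀.isCut g₀.isCut hq.contDiff hq.symOn u
      (g₀.mul u (u.smooth ⊤)).schwartz (fun y => rfl) z, ← hR]
    by_cases hz : z ∈ κ.target
    · rw [indicator_of_mem hz, Cut.test_apply, push_symm hz]; rfl
    · rw [indicator_of_notMem hz, g₀.eq_zero hz, zero_mul]
  · obtain ⟨k, hk⟩ := exists_nat_ge (m - ν)
    set U : Set (Ph n) := {z | z.1 ∈ V ∧ z.2 ∈ C} ∩ U0 n with hU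
    have hUo : IsOpen U := ((hV.preimage continuous_fst).inter (hC.preimage continuous_snd)).inter
      isOpen_U0
    have hs : {z : Ph n | z.1 ∈ V ∧ z.2 ∈ C ∧ 1 ≤ ‖z.2‖} ⊆ U := fun z hz =>
      ⟨⟨hz.1, hz.2.1⟩, S1_subset hz.2.2⟩
    refine (symbolBoundOn_iff hUo hs hcl.contDiff.contDiffOn).2 ?_
    have h1 := (((hcl.rem k).sym.mono_order (μ' := ν) (by linarith)).mono_set
      (t := {z : Ph n | z.1 ∈ V ∧ z.2 ∈ C ∧ 1 ≤ ‖z.2‖}) fun z hz => hz.2.2)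
    refine h1.congr hUo hs fun z hz => ?_
    have hgz := hg.eventuallyEq_of_mem (hV.mem_nhds hz.1.1)
    have hs0 : ∑ j ∈ range k, ampT g₀ g₀ b j z = 0 := sum_eq_zero fun l _ => by
      rw [ampT_eq hgz hgz, hb l z hz.1.1 hz.1.2]
    simp only [hs0, sub_zero]

theorem isOpen_cotCoord_preimage (hκ : IsChart κ) {S : Set (Ph n)} (hS : IsOpen S) :
    IsOpen {w : Cotangent n M | w.1 ∈ κ.source ∧ cotCoord κ w ∈ S} := by
  have h1 : IsOpen {w : Cotangent n M | w.1 ∈ κ.source} :=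
    κ.open_source.preimage (FiberBundle.continuous_proj _ _)
  exact ContinuousOn.isOpen_inter_preimage (f := cotCoord κ)
    (fun w hw => (contMDiffAt_cotCoord hκ hw).continuousAt.continuousWithinAt) h1 hS

theorem isOpen_coneNhd (y₀ : Ph n) (ρ : ℝ) : IsOpen (coneNhd y₀ ρ) :=
  (contDiffOn_rescale y₀.2).continuousOn.isOpen_inter_preimage isOpen_U0 Metric.isOpen_ball

variable {N K L : ℕ} {m : ℝ} {p : Cotangent n M → Matrix (Fin N) (Fin N) ℂ} {w₀ : Cotangent n M}
  {P : Ph n → Matrix (Fin N) (Fin N) ℂ} {V : Set (Rn n)}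

/-- The germs given by `exists_diagonalizers`, at the base point `y₀`. -/
structure Diagonalizers (m : ℝ) (P : Ph n → Matrix (Fin N) (Fin N) ℂ)
    (e : Fin K ⊕ Fin L ≃ Fin N) (y₀ : Ph n) (a b : Ph n → Matrix (Fin N) (Fin N) ℂ)
    (l : Ph n → ℂ) (r : Ph n → Matrix (Fin L) (Fin L) ℂ) : Prop extends Diag e P y₀ a b l r where
  zero : 0 < K → l y₀ = 0
  eigen : ∀ᶠ y in 𝓝 y₀, (0 < K → (P y - scalar (Fin N) (l y)).det = 0) ∧
    ∀ z ∈ U0 n, rescale y₀.2 z = y → homExt m y₀.2 l z = 0 → fderiv ℝ (homExt m y₀.2 l) z ≠ 0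

theorem Diagonalizers.of_isEmpty {e : Fin K ⊕ Fin L ≃ Fin N} {y₀ : Ph n}
    {a b : Ph n → Matrix (Fin N) (Fin N) ℂ} {l : Ph n → ℂ} {r : Ph n → Matrix (Fin L) (Fin L) ℂ}
    (hK : K = 0) (h0 : y₀.2 ≠ 0) (hD : Diag e P y₀ a b l r) :
    Diagonalizers m P e y₀ a b (fun _ => 1) r := by
  subst hK
  refine ⟨{ hD with hl := GS.const _, diag := ?_ }, fun h => absurd h (lt_irrefl _),
    of_forall fun y => ⟨fun h => absurd h (lt_irrefl _), fun z hz _ h1 => ?_⟩⟩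
  · filter_upwards [hD.diag] with y hy
    rw [hy, diagBlock, diagBlock, Subsingleton.elim (scalar (Fin 0) (l y))]
  · have : 0 < (‖z.2‖ / ‖y₀.2‖) ^ m :=
      Real.rpow_pos_of_pos (div_pos (norm_pos_iff.2 hz) (norm_pos_iff.2 h0)) m
    exact absurd h1 (by simp [homExt, this.ne'])

theorem exists_diagonalizers_coord (hκ : IsChart κ)
    (hw₀ : w₀.2 ≠ 0) (hx₀ : w₀.1 ∈ κ.source) (hV : IsOpen V) (hxV : κ w₀.1 ∈ V)
    (hP : ∀ i j, Hom m (fun z => P z i j))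
    (hPp : ∀ w : Cotangent n M, w.1 ∈ κ.source → κ w.1 ∈ V → w.2 ≠ 0 → p w = P (cotCoord κ w))
    (hpt : ∀ᶠ w in 𝓝 w₀, IsPrincipalTypeAt p w) (hcc : HasConstantCharacteristicsNear p w₀)
    (hK : K = finrank ℂ (ker (toLin' (p w₀))))
    (e : Fin K ⊕ Fin L ≃ Fin N) :
    ∃ a b l r, Diagonalizers m P e (cotCoord κ w₀) a b l r := by
  set y₀ := cotCoord κ w₀ with hy₀
  have h0 : y₀.2 ≠ 0 := (cotCoord_snd_ne_zero hκ hx₀).2 hw₀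
  have hnear : ∀ {w : Cotangent n M}, w.1 ∈ κ.source → κ w.1 ∈ V → (cotCoord κ w).2 ≠ 0 →
      ∀ᶠ w' in 𝓝 w, p w' = P (cotCoord κ w') := fun {w} h1 h2 h3 => by
    filter_upwards [(isOpen_cotCoord_preimage hκ ((hV.preimage continuous_fst).inter
      isOpen_U0)).mem_nhds ⟨h1, h2, h3⟩] with w' hw'
    exact hPp w' hw'.1 hw'.2.1 ((cotCoord_snd_ne_zero hκ hw'.1).1 hw'.2.2)
  have hp0 := hnear hx₀ hxV h0
  have hGP : ∀ y ∈ U0 n, GSM P y := fun y hy => GSM.of_hom hP hy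
  obtain ⟨v, hv⟩ := exists_pt_of_principalType hκ hx₀ hp0 (hGP _ h0) hpt.self_of_nhds
  have hK' : K = finrank ℂ (ker (toLin' (P y₀))) := by rw [← hp0.self_of_nhds, hK]
  obtain ⟨ε, hε, hε'⟩ : ∃ ε : ℝ, 0 < ε ∧ (0 < K → ∀ᶠ y in 𝓝 y₀, ∀ μ : ℂ, ‖μ‖ < ε →
      (P y - scalar (Fin N) μ).det = 0 →
        algMult (P y) μ = algMult (P y₀) 0 ∧ geomMult (P y) μ = geomMult (P y₀) 0) := by
    by_cases h : 0 < K
    · have hd : (p w₀).det = 0 := by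
        by_contra hd
        rw [hK, finrank_ker_toLin'_of_det hd] at h
        exact lt_irrefl _ h
      obtain ⟨ε, hε, h'⟩ := multiplicities_of_constantCharacteristics hκ hx₀ hp0 hd hcc
      exact ⟨ε, hε, fun _ => h'⟩
    · exact ⟨1, one_pos, fun h' => absurd h' h⟩
  obtain ⟨a, b, l, r, hD, hl0⟩ := exists_diagonalizers (hGP _ h0) hK' e hv hε hε'
  rcases Nat.eq_zero_or_pos K with hK0 | hK0
  · exact ⟨a, b, _, r, Diagonalizers.of_isEmpty hK0 h0 hD⟩
  refine ⟨a, b, l, r, hD, fun h => (hl0 h).1, ?_⟩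
  have ht : y₀.1 ∈ κ.target := κ.map_source hx₀
  filter_upwards [(hl0 hK0).2, hD.eventually, (tendsto_cotPoint hκ hx₀).eventually hpt,
    (κ.open_target.preimage continuous_fst).mem_nhds ht,
    (hV.preimage continuous_fst).mem_nhds hxV, isOpen_U0.mem_nhds h0]
    with y h1 h2 h8 h9 h10 h11
  refine ⟨fun _ => h1, fun z hz hzy hz0 => ?_⟩
  have hc : cotCoord κ (cotPoint (M := M) κ y) = y := cotCoord_cotPoint hκ h9
  have hs : (cotPoint (M := M) κ y).1 ∈ κ.source := κ.map_target h9
  have hn := hnear (w := cotPoint (M := M) κ y) hs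
    (by have := congrArg Prod.fst hc; change κ _ = _ at this; rw [this]; exact h10)
    (by rw [hc]; exact h11)
  obtain ⟨v', hv'⟩ := exists_pt_of_principalType hκ hs hn (by rw [hc]; exact hGP y h11) h8
  rw [hc] at hv'
  subst hzy
  exact fderiv_homExt_ne_zero hK0 e h0 hP hz h2 hv' hz0

end Microlocal

/-! ### Block diagonalization in a chart -/
section Block
open scoped SchwartzMap
variable [T2Space M] {N K L : ℕ} {m : ℝ}

theorem isElliptic_locSymb {g : Rn n → ℂ} (hg : ∀ z, ∃ t ∈ Icc (0 : ℝ) 1, g z * g z = (t : ℂ))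
    {A₀ : Matrix (Fin N) (Fin N) ℂ} {aT : MSeq n (Fin N)}
    (h : ∀ z, ∀ t ∈ Icc (0 : ℝ) 1, (A₀ + (t : ℂ) • aT.at 0 z).det ≠ 0) :
    IsEllipticOn (fun w : Cotangent n M => Matrix.of fun i j => A₀ i j + locSymb κ g (aT i j 0) w)
      univ := fun w _ _ => by
  by_cases hw : w.1 ∈ κ.source
  · obtain ⟨t, ht, hgt⟩ := hg (κ w.1)
    convert h (cotCoord κ w) t ht using 2
    ext i j
    change A₀ i j + locSymb κ g (aT i j 0) w = _
    rw [locSymb_of_mem hw, hgt]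
    rfl
  · convert h (cotCoord κ w) 0 ⟨le_rfl, zero_le_one⟩ using 2
    ext i j
    change A₀ i j + locSymb κ g (aT i j 0) w = _
    rw [locSymb_of_notMem hw]
    simp

variable {g₀ g : Cut κ}

/-- The operator `g q^w g` on test functions. -/
def blockOp (hκ : IsChart κ) (g : Cut κ) {q : Ph n → ℂ} (hq : XC m q) : Op n M :=
  locOp hκ g hq ∘ₗ Submodule.inclusion (testFun_le_smoothFun n M)

theorem isClassicalPsiDO_block [Nontrivial (Rn n)] {ι : Type*} (hκ : IsChart κ) (g : Cut κ)
    {q : ι → ι → Ph n → ℂ} {b : ι → ι → ℕ → Ph n → ℂ} (hb : ∀ i j, CS m (q i j) (b i j)) :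
    IsClassicalPsiDO m (fun i j => blockOp hκ g (hb i j).xc)
      fun w => Matrix.of fun i j => locSymb κ g (b i j 0) w := by
  have h := isClassicalPsiDO_of_local hκ g hb (c := fun _ _ => 0) (fun _ _ => Or.inr rfl)
    (R := fun i j => blockOp hκ g (hb i j).xc) fun i j u x => by rw [zero_mul, zero_add]; rfl
  simpa only [zero_add] using h

theorem lift_eq (hκ : IsChart κ) (h : ∀ z, g₀ z * g z = g₀ z) (u : 𝓢(Rn n, ℂ)) :
    g.lift hκ (g₀.mul u (u.smooth ⊤)).schwartz = g₀.lift hκ u := by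
  apply Subtype.ext
  funext x
  by_cases hx : x ∈ κ.source
  · rw [g.lift_of_mem hκ _ hx, g₀.lift_of_mem hκ _ hx]
    change g (κ x) * (g₀ (κ x) * u (κ x)) = _
    rw [← mul_assoc, mul_comm (g (κ x)), h]
  · rw [g.lift_of_notMem hκ _ hx, g₀.lift_of_notMem hκ _ hx]

theorem blockOp_lift (hκ : IsChart κ)
    (h : ∀ z, g₀ z * g z = g₀ z) {q : Ph n → ℂ} (hq : XC m q) (u : 𝓢(Rn n, ℂ)) (z : Rn n) :
    g₀ z * (blockOp hκ g hq (g₀.lift hκ u) : M → ℂ) (κ.symm z) =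
      g₀ z * weylOp q (g₀.mul u (u.smooth ⊤)).schwartz z := by
  by_cases hz : z ∈ κ.target
  · have h1 : (g.pull hκ ⟨g₀.lift hκ u, (g₀.lift hκ u).2.1⟩).schwartz =
        (g₀.mul u (u.smooth ⊤)).schwartz := by
      ext y
      refine (g₀.pull_lift g hκ u y).trans ?_
      change _ = g₀ y * u y
      rw [← mul_assoc, mul_comm (g y), h]
    change g₀ z * push κ (fun z => g z *
      weylOp q (g.pull hκ ⟨g₀.lift hκ u, (g₀.lift hκ u).2.1⟩).schwartz z) (κ.symm z) = _
    rw [push_symm hz, h1, ← mul_assoc, h]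
  · rw [g₀.eq_zero hz, zero_mul, zero_mul]

theorem microlocallyEq_block (hκ : IsChart κ)
    (h : ∀ z, g₀ z * g z = g₀ z) (e : Fin K ⊕ Fin L ≃ Fin N)
    {q : Fin N → Fin N → Ph n → ℂ} {qT : MSeq n (Fin N)}
    (hq : ∀ i j, CS m (q i j) (qT i j)) {R : Matrix (Fin N) (Fin N) (Op n M)}
    (hR : ∀ i j (u : 𝓢(Rn n, ℂ)) z, weylOp (q i j) u z =
      g z * (R i j (g.lift hκ u) : M → ℂ) (κ.symm z))
    {w : Cotangent n M} (hw : w.1 ∈ κ.source) {V C : Set (Rn n)}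
    (hV : IsOpen V) (hVw : κ w.1 ∈ V) (hg : EqOn g₀ (fun _ => 1) V) (hC : IsOpen C)
    (hCw : (cotCoord κ w).2 ∈ C) (hcone : ∀ η ∈ C, ∀ t : ℝ, 0 < t → t • η ∈ C)
    (hoff : ∀ i j, ((e.symm i).isLeft ↔ ¬ (e.symm j).isLeft) → ∀ l (z : Ph n), z.1 ∈ V →
      z.2 ∈ C → qT i j l z = 0) :
    MicrolocallyEq R (reindex e e (fromBlocks
      (fun i j => blockOp hκ g (hq (e (Sum.inl i)) (e (Sum.inl j))).xc) 0 0
      (fun i j => blockOp hκ g (hq (e (Sum.inr i)) (e (Sum.inr j))).xc))) w := by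
  have hR' : ∀ i j (u : 𝓢(Rn n, ℂ)) z, g₀ z * (R i j (g₀.lift hκ u) : M → ℂ) (κ.symm z) =
      g₀ z * weylOp (q i j) (g₀.mul u (u.smooth ⊤)).schwartz z := fun i j u z => by
    rw [hR, lift_eq hκ h, ← mul_assoc, h]
  have hin : ∀ i j, NotMemWF (R i j - blockOp hκ g (hq i j).xc) w := fun i j =>
    notMemWF_of_local hκ g₀ (isClassicalSymbol_const (m := m) (Or.inr rfl)) hw hV hVw hg hC hCw
      hcone (fun l z _ _ => ite_self 0) fun u z => by
        change g₀ z * ((R i j (g₀.lift hκ u) : M → ℂ) (κ.symm z) -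
          (blockOp hκ g (hq i j).xc (g₀.lift hκ u) : M → ℂ) (κ.symm z)) = _
        rw [mul_sub, hR', blockOp_lift hκ h, sub_self, weylOp_zero, mul_zero]
  have hout : ∀ i j, ((e.symm i).isLeft ↔ ¬ (e.symm j).isLeft) → NotMemWF (R i j - 0) w :=
    fun i j hij => notMemWF_of_local hκ g₀ (hq i j).1 hw hV hVw hg hC hCw hcone (hoff i j hij)
      fun u z => by
        change g₀ z * ((R i j (g₀.lift hκ u) : M → ℂ) (κ.symm z) - 0) = _
        rw [sub_zero, hR']
  intro i j
  obtain ⟨x, rfl⟩ := e.surjective i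
  obtain ⟨y, rfl⟩ := e.surjective j
  rw [reindex_apply, Matrix.submatrix_apply, e.symm_apply_apply, e.symm_apply_apply]
  rcases x with x | x <;> rcases y with y | y
  · exact hin _ _
  · exact hout _ _ (by simp)
  · exact hout _ _ (by simp)
  · exact hin _ _

theorem exists_local_symbols (hκ : IsChart κ)
    {P : Matrix (Fin N) (Fin N) (Op n M)} {p : Cotangent n M → Matrix (Fin N) (Fin N) ℂ}
    (hP : ∀ (i j : Fin N) (φ ψ : TestFun n M), tsupport (φ : M → ℂ) ⊆ κ.source →
      ∀ hψ : tsupport (ψ : M → ℂ) ⊆ κ.source, ∃ (a : Rn n × Rn n → ℂ) (b : ℕ → Rn n × Rn n → ℂ),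
        IsClassicalSymbol m a b ∧ LocallyWeyl (P i j) κ hκ φ ψ hψ a ∧
        ∀ x ∈ κ.source, ∀ η : Rn n, η ≠ 0 →
          b 0 (κ x, η) = (φ : M → ℂ) x * (ψ : M → ℂ) x * p (covector κ x η) i j) (G : Cut κ)
    {V : Set (Rn n)} (hG : EqOn G (fun _ => 1) V) :
    ∃ (s : Fin N → Fin N → Ph n → ℂ) (t : MSeq n (Fin N)),
      (∀ i j, IsClassicalSymbol m (s i j) (t i j)) ∧
      (∀ i j, LocallyWeyl (P i j) κ hκ (G.test hκ) (G.test hκ) (G.test_supp hκ) (s i j)) ∧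
      ∀ w : Cotangent n M, w.1 ∈ κ.source → κ w.1 ∈ V → w.2 ≠ 0 → p w = t.at 0 (cotCoord κ w) := by
  choose s t h1 h2 h3 using fun i j => hP i j (G.test hκ) (G.test hκ) (G.test_supp hκ)
    (G.test_supp hκ)
  refine ⟨s, t, h1, h2, fun w hw hwV hw2 => ?_⟩
  ext i j
  have h4 := h3 i j w.1 hw (cotCoord κ w).2 ((cotCoord_snd_ne_zero hκ hw).2 hw2)
  rw [covector_cotCoord hκ hw, Cut.test_apply, push_of_mem hw, hG hwV, one_mul, one_mul] at h4
  exact h4.symm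

theorem cone_slices {y₀ : Ph n} (h0 : y₀.2 ≠ 0) {ρ : ℝ} (hρ : 0 < ρ) :
    ∃ C : Set (Rn n), IsOpen C ∧ y₀.2 ∈ C ∧ (∀ η ∈ C, ∀ t : ℝ, 0 < t → t • η ∈ C) ∧
      ∀ z : Ph n, z ∈ coneNhd y₀ ρ ↔ z.1 ∈ ball y₀.1 ρ ∧ z.2 ∈ C := by
  have h1 : ∀ z : Ph n, z ∈ coneNhd y₀ ρ ↔
      z.1 ∈ ball y₀.1 ρ ∧ (y₀.1, z.2) ∈ coneNhd y₀ ρ := fun z => by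
    simp only [coneNhd, Set.mem_setOf_eq, ← ball_prod_same y₀.1 y₀.2, rescale, Set.mem_prod, U0,
      mem_ball_self hρ, true_and]
    tauto
  refine ⟨{η | (y₀.1, η) ∈ coneNhd y₀ ρ},
    (isOpen_coneNhd y₀ ρ).preimage (Continuous.prodMk_right y₀.1), ?_, fun η hη t ht => ?_, h1⟩
  · refine ⟨h0, ?_⟩
    rw [rescale_self h0]; exact mem_ball_self hρ
  · refine ⟨smul_ne_zero ht.ne' hη.1, ?_⟩
    have := rescale_smul (η₀ := y₀.2) (z := (y₀.1, η)) ht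
    rw [this]; exact hη.2

end Block

section Final
variable {N K L : ℕ} {m ρ : ℝ} {y₀ : Ph n} {l : Ph n → ℂ} {P : Ph n → Matrix (Fin N) (Fin N) ℂ}

theorem isOpenConic_cone (hκ : IsChart κ) :
    IsOpenConic {w : Cotangent n M | w.1 ∈ κ.source ∧ cotCoord κ w ∈ coneNhd y₀ ρ} where
  isOpen := isOpen_cotCoord_preimage hκ (isOpen_coneNhd y₀ ρ)
  ne_zero w hw := (cotCoord_snd_ne_zero hκ hw.1).1 hw.2.1
  conic w hw t ht := by
    refine ⟨hw.1, ?_⟩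
    rw [cotCoord_smul]
    exact ⟨smul_ne_zero ht.ne' hw.2.1, by rw [rescale_smul ht]; exact hw.2.2⟩

theorem gs_on_cone (h0 : y₀.2 ≠ 0) (hl : ∀ y ∈ ball y₀ ρ, ContDiffAt ℝ ∞ l y) {z : Ph n}
    (hz : z ∈ coneNhd y₀ ρ) : GS (homExt m y₀.2 l) z :=
  GS.homExt h0 hz.1 (by filter_upwards [Metric.isOpen_ball.mem_nhds hz.2] with y hy using hl y hy)

theorem contMDiffOn_cone (hκ : IsChart κ) (h0 : y₀.2 ≠ 0)
    (hl : ∀ y ∈ ball y₀ ρ, ContDiffAt ℝ ∞ l y) :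
    ContMDiffOn (cotModel n) 𝓘(ℝ, ℂ) ∞ (fun w : Cotangent n M => homExt m y₀.2 l (cotCoord κ w))
      {w : Cotangent n M | w.1 ∈ κ.source ∧ cotCoord κ w ∈ coneNhd y₀ ρ} := fun w hw =>
  (((gs_on_cone h0 hl hw.2).self_of_nhds.contMDiffAt).comp w
    (contMDiffAt_cotCoord hκ hw.1)).contMDiffWithinAt

theorem det_sub_homExt (h0 : y₀.2 ≠ 0) (hP : ∀ i j, Hom m (fun z => P z i j)) {z : Ph n}
    (hz : z ∈ U0 n)
    (h : (P (rescale y₀.2 z) - scalar (Fin N) (l (rescale y₀.2 z))).det = 0) :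
    (P z - scalar (Fin N) (homExt m y₀.2 l z)).det = 0 := by
  have h1 : P z - scalar (Fin N) (homExt m y₀.2 l z) =
      (((‖z.2‖ / ‖y₀.2‖) ^ m : ℝ) : ℂ) •
        (P (rescale y₀.2 z) - scalar (Fin N) (l (rescale y₀.2 z))) := by
    ext i j
    rw [Matrix.sub_apply, ← (hP i j).homExt_eq h0 hz]
    by_cases hij : i = j
    · subst hij; simp [homExt, mul_sub]
    · simp [homExt, hij]
  rw [h1, Matrix.det_smul, h, mul_zero]

end Final

end PsiDO
end

open scoped Manifold ContDiff Topology
open PsiDO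
theorem proposition4p1 {n N : ℕ} {M : Type*} [TopologicalSpace M] [T2Space M]
    [SecondCountableTopology M] [ChartedSpace (PsiDO.Rn n) M]
    [IsManifold 𝓘(ℝ, PsiDO.Rn n) ∞ M]
    (m : ℝ) (P : Matrix (Fin N) (Fin N) (PsiDO.Op n M))
    (p : PsiDO.Cotangent n M → Matrix (Fin N) (Fin N) ℂ)
    (hP : PsiDO.IsClassicalPsiDO m P p)
    (w₀ : PsiDO.Cotangent n M) (hw₀ : w₀.2 ≠ 0)
    (hpt : ∀ᶠ w in 𝓝 w₀, PsiDO.IsPrincipalTypeAt p w)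
    (hcc : PsiDO.HasConstantCharacteristicsNear p w₀) :
    ∃ (A B : Matrix (Fin N) (Fin N) (PsiDO.ProperOp n M))
      (a b : PsiDO.Cotangent n M → Matrix (Fin N) (Fin N) ℂ),
      PsiDO.IsClassicalPsiDO 0 (A.map PsiDO.ProperOp.toOp) a ∧
      PsiDO.IsEllipticOn a Set.univ ∧
      PsiDO.IsClassicalPsiDO 0 (B.map PsiDO.ProperOp.toOp) b ∧
      PsiDO.IsEllipticOn b Set.univ ∧
      ∃ (K L : ℕ) (hKL : K + L = N)
        (Q₁₁ : Matrix (Fin K) (Fin K) (PsiDO.Op n M))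
        (Q₂₂ : Matrix (Fin L) (Fin L) (PsiDO.Op n M))
        (q₁₁ : PsiDO.Cotangent n M → Matrix (Fin K) (Fin K) ℂ)
        (q₂₂ : PsiDO.Cotangent n M → Matrix (Fin L) (Fin L) ℂ)
        (l : PsiDO.Cotangent n M → ℂ) (Γ : Set (PsiDO.Cotangent n M)),
        K = Module.finrank ℂ (LinearMap.ker (Matrix.toLin' (p w₀))) ∧
        PsiDO.IsClassicalPsiDO m Q₁₁ q₁₁ ∧
        PsiDO.IsClassicalPsiDO m Q₂₂ q₂₂ ∧
        PsiDO.MicrolocallyEq (PsiDO.sysComp A P B)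
          (Matrix.reindex (finSumFinEquiv.trans (finCongr hKL))
            (finSumFinEquiv.trans (finCongr hKL)) (Matrix.fromBlocks Q₁₁ 0 0 Q₂₂)) w₀ ∧
        PsiDO.IsOpenConic Γ ∧ w₀ ∈ Γ ∧
        (∀ w ∈ Γ, q₁₁ w = Matrix.scalar (Fin K) (l w)) ∧
        ContMDiffOn (PsiDO.cotModel n) 𝓘(ℝ, ℂ) ∞ l Γ ∧
        (0 < K → PsiDO.IsEigenvalueSection p l Γ ∧ l w₀ = 0) ∧
        (∀ w ∈ Γ, l w = 0 → mfderiv (PsiDO.cotModel n) 𝓘(ℝ, ℂ) l w ≠ 0) ∧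
        PsiDO.IsEllipticOn q₂₂ Γ := by
  obtain ⟨κ, hκ, hx₀, -, hloc⟩ := hP w₀.1 w₀.1
  have h0 : (cotCoord κ w₀).2 ≠ 0 := (cotCoord_snd_ne_zero hκ hx₀).2 hw₀
  have : Nontrivial (Rn n) := ⟨_, _, h0⟩
  obtain ⟨g₀, g, G, V, hV, hxV, -, hg₀g, hgG, hg₀V, hgV, hGV, hgt⟩ :=
    exists_cuts (κ.map_source hx₀)
  obtain ⟨s, pT, hs, hsW, hp⟩ := exists_local_symbols hκ hloc G hGV
  have hpH : HomSeq m pT := fun i j k => (hs i j).hom k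
  have hpH0 : ∀ i j, Hom m (fun z => pT.at 0 z i j) := fun i j => by
    have := hpH i j 0
    rwa [Nat.cast_zero, sub_zero] at this
  obtain ⟨K, hK⟩ : ∃ K, K = Module.finrank ℂ (LinearMap.ker (Matrix.toLin' (p w₀))) := ⟨_, rfl⟩
  obtain ⟨L, hKL⟩ : ∃ L, K + L = N := by
    refine ⟨N - K, Nat.add_sub_cancel' ?_⟩
    have := Submodule.finrank_le (LinearMap.ker (Matrix.toLin' (p w₀)))
    rwa [Module.finrank_fin_fun, ← hK] at this
  set e := finSumFinEquiv.trans (finCongr hKL)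
  obtain ⟨a, b, l, r, hD⟩ :=
    exists_diagonalizers_coord hκ hw₀ hx₀ hV hxV hpH0 hp hpt hcc hK e
  set y₀ := cotCoord κ w₀ with hy₀
  obtain ⟨ρ, hρ, aT, bT, R, hW, hlr, haH, hbH, hzero, hell, hcone⟩ :=
    exists_expansions e hpH h0 hD.toDiag (Filter.inter_mem hD.eigen ((hV.preimage continuous_fst).mem_nhds hxV))
  have hsub : Metric.ball y₀.1 ρ ⊆ V := fun x hx =>
    (hW (show (x, y₀.2) ∈ Metric.ball y₀ ρ by
      rw [← ball_prod_same y₀.1 y₀.2]; exact ⟨hx, Metric.mem_ball_self hρ⟩)).2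
  choose sa hsa using fun i j => exists_classical (b := aT i j) (haH i j)
    fun k z hz => (hzero i j k z hz).1
  choose sb hsb using fun i j => exists_classical (b := bT i j) (hbH i j)
    fun k z hz => (hzero i j k z hz).2
  set qT : MSeq n (Fin N) := tripleT g G (a y₀) (b y₀) aT pT bT
  have hq := cs_triple (c := a y₀) (c' := b y₀) g G hsa hs hsb
  obtain ⟨C, hC, hyC, hCc, hCz⟩ := cone_slices h0 hρ
  have hqT : ∀ z ∈ coneNhd y₀ ρ, ∀ i j k, qT i j k z = mstar
      (shiftSeq (a y₀) aT) (mstar pT (shiftSeq (b y₀) bT)) i j k z :=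
    fun z hz i j k => tripleT_eq hV hgV hGV aT pT bT i j k (hsub ((hCz z).1 hz).1)
  have hyc : y₀ ∈ coneNhd y₀ ρ := (hCz y₀).2 ⟨Metric.mem_ball_self hρ, hyC⟩
  have hsym : ∀ w : Cotangent n M, w.1 ∈ κ.source →
      cotCoord κ w ∈ coneNhd y₀ ρ → ∀ i j, locSymb κ g (qT i j 0) w =
        (((‖(cotCoord κ w).2‖ / ‖y₀.2‖) ^ m : ℝ) : ℂ) *
          diagBlock e (l (rescale y₀.2 (cotCoord κ w)))
            (r (rescale y₀.2 (cotCoord κ w))) i j := fun w hw hz i j => by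
    have h1 : g (κ w.1) = 1 := hgV (hsub ((hCz _).1 hz).1)
    rw [locSymb_of_mem hw, h1, one_mul, one_mul, hqT _ hz]
    exact congrFun (congrFun (hcone _ hz).1 i) j
  refine ⟨fun i j => constAdd hκ g (hsa i j).xc (a y₀ i j),
    fun i j => constAdd hκ g (hsb i j).xc (b y₀ i j), _, _,
    isClassicalPsiDO_of_local hκ g hsa (c := a y₀) (fun _ _ => Or.inl rfl)
      fun i j u x => rfl,
    isElliptic_locSymb hgt fun z t ht => (hell z t ht).1,
    isClassicalPsiDO_of_local hκ g hsb (c := b y₀) (fun _ _ => Or.inl rfl)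
      fun i j u x => rfl,
    isElliptic_locSymb hgt fun z t ht => (hell z t ht).2,
    K, L, hKL, fun i j => blockOp hκ g (hq (e (Sum.inl i)) (e (Sum.inl j))).xc,
    fun i j => blockOp hκ g (hq (e (Sum.inr i)) (e (Sum.inr j))).xc, _, _,
    fun w => homExt m y₀.2 l (cotCoord κ w),
    {w | w.1 ∈ κ.source ∧ cotCoord κ w ∈ coneNhd y₀ ρ}, hK,
    isClassicalPsiDO_block hκ g (fun i j => hq _ _),
    isClassicalPsiDO_block hκ g (fun i j => hq _ _),
    microlocallyEq_block hκ hg₀g e hq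
      (fun i j u z => weylOp_triple hκ hgG hsa hs hsb hsW i j u z) hx₀
      Metric.isOpen_ball (Metric.mem_ball_self hρ) (hg₀V.mono hsub) hC hyC hCc
      fun i j hij k z hz hzC => ?_,
    isOpenConic_cone hκ, ⟨hx₀, hyc⟩, fun w hw => ?_,
    contMDiffOn_cone hκ h0 fun y hy => (hlr y hy).1,
    fun hK0 => ⟨⟨(contMDiffOn_cone hκ h0 fun y hy => (hlr y hy).1).continuousOn,
      fun w hw => ?_⟩, ?_⟩, fun w hw hl0 => ?_, fun w hw _ => ?_⟩
  · exact (hqT z ((hCz z).2 ⟨hz, hzC⟩) i j k).trans ((hcone z ((hCz z).2 ⟨hz, hzC⟩)).2 k i j hij)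
  · ext i j
    refine (hsym w hw.1 hw.2 _ _).trans ?_
    by_cases hij : i = j
    · subst hij; simp [diagBlock, homExt]
    · simp [diagBlock, hij]
  · rw [hp w hw.1 (hsub ((hCz _).1 hw.2).1) ((cotCoord_snd_ne_zero hκ hw.1).1 hw.2.1)]
    exact det_sub_homExt h0 hpH0 hw.2.1 ((hW hw.2.2).1.1 hK0)
  · change homExt m y₀.2 l y₀ = 0
    rw [homExt, rescale_self h0 y₀.1]
    exact (congrArg _ (hD.zero hK0)).trans (mul_zero _)
  · exact mfderiv_comp_cotCoord_ne_zero hκ hw.1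
      (gs_on_cone h0 (fun y hy => (hlr y hy).1) hw.2).diffAt
      ((hW hw.2.2).1.2 _ hw.2.1 rfl hl0)
  · have hpos : 0 < ‖(cotCoord κ w).2‖ / ‖y₀.2‖ :=
      div_pos (norm_pos_iff.2 hw.2.1) (norm_pos_iff.2 h0)
    have h1 : (Matrix.of fun i j => locSymb κ g (qT (e (Sum.inr i)) (e (Sum.inr j)) 0) w) =
        (((‖(cotCoord κ w).2‖ / ‖y₀.2‖) ^ m : ℝ) : ℂ) •
          r (rescale y₀.2 (cotCoord κ w)) := by
      ext i j
      refine (hsym w hw.1 hw.2 _ _).trans ?_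
      simp [diagBlock]
    change (Matrix.of fun i j =>
      locSymb κ g (qT (e (Sum.inr i)) (e (Sum.inr j)) 0) w).det ≠ 0
    rw [h1, Matrix.det_smul]
    exact mul_ne_zero (pow_ne_zero _ (Complex.ofReal_ne_zero.2
      (Real.rpow_pos_of_pos hpos m).ne')) (hlr _ hw.2.2).2
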